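/- **Conventions.** All lattices are finite, with bottom $\hat 0$, top $\hat 1$ and rank function $\mathrm{rk}$; $\mathcal L$ always denotes a non-trivial geometric lattice (at least two elements). A flat $F\in\mathcal L$ is *proper* if $\hat 0\neq F\neq\hat 1$. An *embedding* of geometric lattices is an injective join-preserving map sending atoms to atoms. An element $F$ is *modular* if $\mathrm{rk}(F\wedge G)+\mathrm{rk}(F\vee G)=\mathrm{rk}F+\mathrm{rk}G$ for all $G$. Cdgas are $\mathbb Z$-graded over $\mathbb Q$ with differential of degree $+1$, and $\otimes$ carries the Koszul signs. A *$\mathcal{GL}$-cooperad* in cdgas is a collection of cdgas $\mathcal C(\mathcal L)$ indexed by non-trivial geometric lattices, contravariantly functorial for isomorphisms of lattices, with cdga morphisms $\Delta_{F}=\Delta_{F,\mathcal L}:\mathcal C(\mathcal L)\to\mathcal C([\hat 0,F])\otimes\mathcal C([F,\hat 1])$ for all proper flats $F$, natural for isomorphisms, such that $(\Delta_{F_1,[\hat 0,F_2]}\otimes\mathrm{Id})\circ\Delta_{F_2,\mathcal L}=(\mathrm{Id}\otimes\Delta_{F_2,[F_1,\hat 1]})\circ\Delta_{F_1,\mathcal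 L}$ for all proper flats $F_1<F_2$. A morphism of $\mathcal{GL}$-cooperads is a collection of cdga morphisms commuting with the isomorphisms and with the $\Delta_F$. **Modular diagrams.** A *modular diagram* of $\mathcal L$ is a triple $\Gamma=(\mathcal E,\imath,J)$ with $\mathcal E$ a geometric lattice, $\imath:\mathcal L\to\mathcal E$ an embedding whose image is an interval $[\hat 0,F_\imath]$ with $F_\imath$ modular in $\mathcal E$, and $J$ a finite word in the atoms of $\mathcal E$. Its degree is $|J|-2(\mathrm{rk}\bigvee J-\mathrm{rk}((\bigvee J)\wedge F_\imath))$. $\mathcal{MD}(\mathcal L)$ is the graded $\mathbb Q$-vector space spanned by the modular diagrams modulo: (1) $(\mathcal E,\imath,J)\sim-(\mathcal E,\imath,J')$ if $J,J'$ differ by a transposition of two letters; (2) $(\mathcal E,\imath,J)\sim(\mathcal E',\varphi\circ\imath,\varphi(J))$ for an embedding $\varphi:\mathcal E\to\mathcal E'$ with $\mathrm{rk}\,\mathcal E=\mathrm{rk}\,\mathcal E'$ (both sides being modular diagrams); (3) $\Gamma\sim0$ if $F_\imath\vee\bigvee J<\hat 1$; (4) $\Gamma\sim 0$ if $\mathcal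 E=\mathcal E_1\times\mathcal E_2$ with $\mathcal E_1,\mathcal E_2$ non-trivial geometric lattices and $F_\imath\in\mathcal E_1\times\{\hat 0\}$; (5) $\Gamma\sim0$ if exactly two letters of $J$ are not below some modular flat $F\ge F_\imath$ of $\mathcal E$. The product is $(\mathcal E_1,\imath_1,J_1)\bullet(\mathcal E_2,\imath_2,J_2)=(\mathcal E_1\cup_{\mathcal L}\mathcal E_2,(\imath_1,\imath_2),J_1J_2)$, where $\mathcal E_1\cup_{\mathcal L}\mathcal E_2=\{(F_1,F_2)\in\mathcal E_1\times\mathcal E_2\mid\imath_1^{-1}(F_1\wedge F_{\imath_1})=\imath_2^{-1}(F_2\wedge F_{\imath_2})\}$, and an atom $H$ of $\mathcal E_1$ is identified with $(H,\imath_2\imath_1^{-1}(H\wedge F_{\imath_1}))$, similarly for $\mathcal E_2$; the unit is $(\mathcal L,\mathrm{Id},\emptyset)$. A letter $H$ of $J$ is *contractible* if $H\not\le F_\imath$ and $H$ is not a bridge, i.e. not the only atom in $J$ which is not below some flat $F\ge F_\imath$. For $J=H_1\cdots H_n$ without repetition, the differential is $\mathrm d\Gamma=\sum_{H_i\text{ contractible}}(-1)^{i+1}\,([H_i,\hat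 1],H_i\vee\imath,H_i\vee(J\setminus H_i))$. An isomorphism $\varphi:\mathcal L\to\mathcal L'$ acts by $(\mathcal E,\imath,J)\mapsto(\mathcal E,\imath\circ\varphi,J)$. **Orlik–Solomon algebras.** $\mathrm{OS}(\mathcal L)$ is the exterior algebra on generators $e_H$ of degree $1$, $H$ an atom of $\mathcal L$, modulo the ideal generated by the $\delta e_C$, $C$ a circuit, where $\delta$ is the derivation with $\delta e_H=1$; its differential is $0$, and $\varphi:\mathcal L\to\mathcal L'$ acts by $e_H\mapsto e_{\varphi^{-1}(H)}$. **Proposition.** 1. The product, unit, differential and isomorphism actions above are well defined, make every $\mathcal{MD}(\mathcal L)$ a cdga, and together with the maps $\Delta_{F}$ given on modular diagrams by $$\Delta_{F}(\mathcal E,\imath,J)=\sum_{\substack{F'\in\mathcal E\\ \imath^{-1}(F'\wedge F_\imath)=F}}\epsilon(J,F')\,([\hat 0,F'],\,\imath,\,J\cap F')\otimes([F',\hat 1],\,F'\vee\imath,\,F'\vee(J\setminus F'))$$ they make $\mathcal{MD}$ a $\mathcal{GL}$-cooperad in cdgas. Here $J\cap F'$ and $J\setminus F'$ are the subwords of letters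 below, resp. not below, $F'$, and $\epsilon(J,F')$ is the signature of the permutation moving $J\cap F'$ before $J\setminus F'$ and keeping the relative orders. 2. The algebras $\mathrm{OS}(\mathcal L)$ form a $\mathcal{GL}$-cooperad in cdgas with $\Delta_F(e_H)=e_H\otimes1$ if $H\le F$ and $\Delta_F(e_H)=1\otimes e_{F\vee H}$ otherwise. 3. The maps $\mathbb I_{\mathcal L}:\mathcal{MD}(\mathcal L)\to\mathrm{OS}(\mathcal L)$ sending $(\mathcal E,\imath,J)$ to $e_{\imath^{-1}(J)}$ if $F_\imath=\hat 1_{\mathcal E}$ (that is, if $\imath$ is an isomorphism), and to $0$ otherwise, are well defined and form a morphism of $\mathcal{GL}$-cooperads in cdgas $\mathbb I:\mathcal{MD}\to\mathrm{OS}$. -/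

import Mathlib

open scoped TensorProduct DirectSum
universe u v w

/-- A commutative differential graded algebra over `ℚ`: `ℤ`-graded, with a differential of
degree `+1`. -/
structure CDGA : Type (v + 1) where
  carrier : Type v
  [ring : Ring carrier]
  [algebra : Algebra ℚ carrier]
  gr : ℤ → Submodule ℚ carrier
  [graded : GradedAlgebra gr]
  d : carrier →ₗ[ℚ] carrier
  d_mem : ∀ (n : ℤ) (a : carrier), a ∈ gr n → d a ∈ gr (n + 1)
  d_d : ∀ a : carrier, d (d a) = 0
  leibniz : ∀ (m : ℤ) (a b : carrier), a ∈ gr m →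
    d (a * b) = d a * b + m.negOnePow • (a * d b)
  comm : ∀ (m n : ℤ) (a b : carrier), a ∈ gr m → b ∈ gr n →
    a * b = (m * n).negOnePow • (b * a)

namespace CDGA

instance : CoeSort CDGA.{v} (Type v) := ⟨CDGA.carrier⟩

attribute [instance] CDGA.ring CDGA.algebra CDGA.graded

/-- Morphisms of cdgas: algebra morphisms of degree `0` commuting with the differentials. -/
structure Hom (A : CDGA.{v}) (B : CDGA.{w}) where
  toAlgHom : A →ₐ[ℚ] B
  map_gr : ∀ (n : ℤ) (a : A), a ∈ A.gr n → toAlgHom a ∈ B.gr n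
  map_d : ∀ a : A, toAlgHom (A.d a) = B.d (toAlgHom a)

instance (A : CDGA.{v}) (B : CDGA.{w}) : CoeFun (Hom A B) (fun _ => A → B) :=
  ⟨fun f => f.toAlgHom⟩

/-- The underlying linear map of a morphism of cdgas. -/
def Hom.lin {A : CDGA.{v}} {B : CDGA.{w}} (f : Hom A B) : A →ₗ[ℚ] B := f.toAlgHom.toLinearMap

section Tensor

variable (A : CDGA.{v}) (B : CDGA.{w})

/-- The linear involution `a ↦ (-1)^{|a|} a`. -/
noncomputable def parity : A →ₗ[ℚ] A :=
  (DirectSum.toModule ℚ ℤ A fun n => ((n.negOnePow : ℤ) : ℚ) • (A.gr n).subtype) ∘ₗ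
    (DirectSum.decomposeLinearEquiv A.gr).toLinearMap

theorem parity_apply {n : ℤ} {a : A} (ha : a ∈ A.gr n) : A.parity a = n.negOnePow • a := by
  have h : DirectSum.decomposeLinearEquiv A.gr a = DirectSum.lof ℚ ℤ (fun i => A.gr i) n ⟨a, ha⟩ :=
    DirectSum.decompose_of_mem A.gr ha
  simp only [parity, LinearMap.comp_apply, LinearEquiv.coe_coe, h, DirectSum.toModule_lof]
  simp [Units.smul_def, ← Int.cast_smul_eq_zsmul ℚ]

/-- The underlying graded algebra of `A ⊗ B`, with `(a ⊗ b)(a' ⊗ b') = (-1)^{|b||a'|} aa' ⊗ bb'`. -/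
abbrev TCarrier : Type (max v w) := GradedTensorProduct ℚ A.gr B.gr

variable {A B} in
/-- The pure tensor `a ⊗ b`. -/
noncomputable abbrev tm (a : A) (b : B) : TCarrier A B := GradedTensorProduct.tmul ℚ a b

/-- The total grading on `A ⊗ B`. -/
noncomputable def tGr (n : ℤ) : Submodule ℚ (TCarrier A B) :=
  Submodule.span ℚ {x | ∃ (i j : ℤ) (a : A) (b : B), a ∈ A.gr i ∧ b ∈ B.gr j ∧ i + j = n ∧
    x = tm a b}

theorem tm_mem_tGr {i j n : ℤ} {a : A} {b : B} (ha : a ∈ A.gr i) (hb : b ∈ B.gr j)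
    (h : i + j = n) : tm a b ∈ tGr A B n :=
  Submodule.subset_span ⟨i, j, a, b, ha, hb, h, rfl⟩

/-- The differential `d ⊗ 1 + 1 ⊗ d` with the Koszul sign. -/
noncomputable def tD : TCarrier A B →ₗ[ℚ] TCarrier A B :=
  (GradedTensorProduct.of ℚ A.gr B.gr).toLinearMap ∘ₗ
    (TensorProduct.map A.d LinearMap.id + TensorProduct.map A.parity B.d) ∘ₗ
    (GradedTensorProduct.of ℚ A.gr B.gr).symm.toLinearMap

theorem tD_tm {i : ℤ} {a : A} (ha : a ∈ A.gr i) (b : B) :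
    tD A B (tm a b) = tm (A.d a) b + i.negOnePow • tm a (B.d b) := by
  have h : tD A B (tm a b) = tm (A.d a) b + tm (A.parity a) (B.d b) := rfl
  rw [h, parity_apply A ha]
  rcases Int.units_eq_one_or i.negOnePow with h | h <;> rw [h]
  · rw [one_smul, one_smul]
  · rw [Units.neg_smul, one_smul, Units.neg_smul, one_smul]
    exact congrArg _ (TensorProduct.neg_tmul a (B.d b))

theorem tm_mul_tm {j k : ℤ} (a : A) {b : B} {a' : A} (b' : B) (hb : b ∈ B.gr j)
    (ha' : a' ∈ A.gr k) :
    tm a b * tm a' b' = (j * k).negOnePow • tm (a * a') (b * b') :=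
  GradedTensorProduct.tmul_coe_mul_coe_tmul (R := ℚ) A.gr B.gr a ⟨b, hb⟩ ⟨a', ha'⟩ b'

/-- Two linear maps out of `A ⊗ B` agree if they agree on tensors of homogeneous elements. -/
theorem tHom_ext {M : Type*} [AddCommGroup M] [Module ℚ M] {f g : TCarrier A B →ₗ[ℚ] M}
    (h : ∀ (i j : ℤ) (a : A) (b : B), a ∈ A.gr i → b ∈ B.gr j → f (tm a b) = g (tm a b)) :
    f = g := by
  apply GradedTensorProduct.hom_ext
  apply TensorProduct.ext
  refine DirectSum.decompose_lhom_ext A.gr fun i => ?_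
  ext a : 1
  refine DirectSum.decompose_lhom_ext B.gr fun j => ?_
  ext b
  exact h i j a b a.2 b.2

/-- The decomposition of `A ⊗ B` into homogeneous components. -/
noncomputable def tDecomp : TCarrier A B →ₗ[ℚ] ⨁ n, tGr A B n :=
  TensorProduct.lift (DirectSum.toModule ℚ ℤ _ fun i => LinearMap.flip
    (DirectSum.toModule ℚ ℤ _ fun j => LinearMap.flip
      (LinearMap.mk₂ ℚ (fun (a : A.gr i) (b : B.gr j) =>
        DirectSum.lof ℚ ℤ (fun n => tGr A B n) (i + j) ⟨tm a.1 b.1, tm_mem_tGr A B a.2 b.2 rfl⟩)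
        (fun a a' b => by
          rw [← map_add]; congr 1; exact Subtype.ext (TensorProduct.add_tmul a.1 a'.1 b.1))
        (fun c a b => by
          rw [← map_smul]; congr 1)
        (fun a b b' => by
          rw [← map_add]; congr 1; exact Subtype.ext (TensorProduct.tmul_add a.1 b.1 b'.1))
        (fun c a b => by
          rw [← map_smul]; congr 1; exact Subtype.ext (TensorProduct.tmul_smul c a.1 b.1))))) ∘ₗ
    (GradedTensorProduct.auxEquiv ℚ A.gr B.gr).toLinearMap

theorem tDecomp_tm {i j n : ℤ} {a : A} {b : B} (ha : a ∈ A.gr i) (hb : b ∈ B.gr j)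
    (h : i + j = n) : tDecomp A B (tm a b) =
      DirectSum.lof ℚ ℤ (fun n => tGr A B n) n ⟨tm a b, tm_mem_tGr A B ha hb h⟩ := by
  subst h
  simp only [tDecomp, LinearMap.comp_apply, LinearEquiv.coe_coe,
    GradedTensorProduct.auxEquiv_tmul, DirectSum.decompose_of_mem A.gr ha,
    DirectSum.decompose_of_mem B.gr hb, TensorProduct.lift.tmul]
  rw [← DirectSum.lof_eq_of ℚ, ← DirectSum.lof_eq_of ℚ, DirectSum.toModule_lof,
    LinearMap.flip_apply, DirectSum.toModule_lof]
  rfl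

theorem tDecomp_mem {n : ℤ} {x : TCarrier A B} (hx : x ∈ tGr A B n) :
    tDecomp A B x = DirectSum.lof ℚ ℤ (fun n => tGr A B n) n ⟨x, hx⟩ := by
  induction hx using Submodule.span_induction with
  | mem x h =>
    obtain ⟨i, j, a, b, ha, hb, hn, rfl⟩ := h
    exact tDecomp_tm A B ha hb hn
  | zero => rw [map_zero]; exact (map_zero _).symm
  | add x y hx hy h1 h2 => rw [map_add, h1, h2, ← map_add]; rfl
  | smul c x hx h1 => rw [map_smul, h1, ← map_smul]; rfl

theorem t_mul_smul (c : ℚ) (x y : TCarrier A B) : x * (c • y) = c • (x * y) :=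
  map_smul (GradedTensorProduct.mulHom A.gr B.gr x) c y

theorem t_mul_usmul (ε : ℤˣ) (x y : TCarrier A B) : x * (ε • y) = ε • (x * y) := by
  rcases Int.units_eq_one_or ε with h | h <;> rw [h]
  · rw [one_smul, one_smul]
  · rw [Units.neg_smul, one_smul, Units.neg_smul, one_smul]
    exact map_neg (GradedTensorProduct.mulHom A.gr B.gr x) y

noncomputable instance tGradedAlgebra : GradedAlgebra (tGr A B) where
  one_mem := tm_mem_tGr A B SetLike.GradedOne.one_mem SetLike.GradedOne.one_mem (add_zero 0)
  mul_mem := by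
    intro m n x y hx hy
    induction hx using Submodule.span_induction with
    | zero => rw [zero_mul]; exact zero_mem _
    | add x x' _ _ h1 h2 => rw [add_mul]; exact add_mem h1 h2
    | smul c x _ h1 => rw [smul_mul_assoc]; exact Submodule.smul_mem _ _ h1
    | mem x h =>
      obtain ⟨i, j, a, b, ha, hb, hn, rfl⟩ := h
      induction hy using Submodule.span_induction with
      | zero => rw [mul_zero]; exact zero_mem _
      | add x x' _ _ h1 h2 => rw [mul_add]; exact add_mem h1 h2
      | smul c x _ h1 => rw [t_mul_smul]; exact Submodule.smul_mem _ _ h1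
      | mem x h =>
        obtain ⟨i', j', a', b', ha', hb', hn', rfl⟩ := h
        rw [tm_mul_tm A B a b' hb ha', Units.smul_def]
        exact zsmul_mem (tm_mem_tGr A B (SetLike.GradedMul.mul_mem ha ha')
          (SetLike.GradedMul.mul_mem hb hb') (by omega)) _
  toDecomposition := DirectSum.Decomposition.ofLinearMap _ (tDecomp A B)
    (tHom_ext A B fun i j a b ha hb => by
      rw [LinearMap.comp_apply, tDecomp_tm A B ha hb rfl, DirectSum.coeLinearMap_lof]; rfl)
    (by
      refine DirectSum.linearMap_ext ℚ fun n => LinearMap.ext fun x => ?_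
      simp only [LinearMap.comp_apply, DirectSum.coeLinearMap_lof, LinearMap.id_apply]
      exact tDecomp_mem A B x.2)

theorem tGr_induction {n : ℤ} {p : TCarrier A B → Prop} (h0 : p 0)
    (hadd : ∀ x y, p x → p y → p (x + y)) (hsmul : ∀ (c : ℚ) (x), p x → p (c • x))
    (htm : ∀ (i j : ℤ) (a : A) (b : B), a ∈ A.gr i → b ∈ B.gr j → i + j = n → p (tm a b))
    {x : TCarrier A B} (hx : x ∈ tGr A B n) : p x := by
  induction hx using Submodule.span_induction with
  | zero => exact h0
  | add x y _ _ h1 h2 => exact hadd _ _ h1 h2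
  | smul c x _ h1 => exact hsmul _ _ h1
  | mem x h =>
    obtain ⟨i, j, a, b, ha, hb, hn, rfl⟩ := h
    exact htm i j a b ha hb hn

theorem t_induction {p : TCarrier A B → Prop} (h0 : p 0)
    (hadd : ∀ x y, p x → p y → p (x + y))
    (htm : ∀ (i j : ℤ) (a : A) (b : B), a ∈ A.gr i → b ∈ B.gr j → p (tm a b))
    (x : TCarrier A B) : p x := by
  classical
  have hx : x = ∑ n ∈ (DirectSum.decompose (tGr A B) x).support,
      (DirectSum.decompose (tGr A B) x n : TCarrier A B) :=
    (DirectSum.sum_support_decompose _ _).symm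
  rw [hx]
  refine Finset.sum_induction _ p hadd h0 fun n _ => ?_
  have : ∀ y ∈ tGr A B n, ∀ c : ℚ, p (c • y) := by
    intro y hy
    refine tGr_induction A B (p := fun y => ∀ c : ℚ, p (c • y)) ?_ ?_ ?_ ?_ hy
    · intro c; rw [smul_zero]; exact h0
    · intro x y hx hy c; rw [smul_add]; exact hadd _ _ (hx c) (hy c)
    · intro c x hx c'; rw [smul_smul]; exact hx _
    · intro i j a b ha hb _ c
      have : c • tm a b = tm (c • a) b := rfl
      rw [this]
      exact htm i j _ b (Submodule.smul_mem _ c ha) hb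
  simpa using this _ (SetLike.coe_mem (DirectSum.decompose (tGr A B) x n)) 1

theorem zsmul_tm (ε : ℤˣ) (a : A) (b : B) : tm (ε • a) b = ε • tm a b := by
  rcases Int.units_eq_one_or ε with h | h <;> rw [h]
  · rw [one_smul, one_smul]
  · rw [Units.neg_smul, one_smul, Units.neg_smul, one_smul]
    exact TensorProduct.neg_tmul a b

theorem tm_zsmul (ε : ℤˣ) (a : A) (b : B) : tm a (ε • b) = ε • tm a b := by
  rcases Int.units_eq_one_or ε with h | h <;> rw [h]
  · rw [one_smul, one_smul]
  · rw [Units.neg_smul, one_smul, Units.neg_smul, one_smul]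
    exact TensorProduct.tmul_neg a b

theorem tm_add (a : A) (b b' : B) : tm a (b + b') = tm a b + tm a b' :=
  TensorProduct.tmul_add a b b'

theorem add_tm (a a' : A) (b : B) : tm (a + a') b = tm a b + tm a' b :=
  TensorProduct.add_tmul a a' b

theorem map_usmul {M N : Type*} [AddCommGroup M] [AddCommGroup N] [Module ℚ M] [Module ℚ N]
    (f : M →ₗ[ℚ] N) (ε : ℤˣ) (x : M) : f (ε • x) = ε • f x := by
  rcases Int.units_eq_one_or ε with h | h <;> rw [h]
  · rw [one_smul, one_smul]
  · rw [Units.neg_smul, one_smul, Units.neg_smul, one_smul, map_neg]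

theorem tD_mem {n : ℤ} {x : TCarrier A B} (hx : x ∈ tGr A B n) : tD A B x ∈ tGr A B (n + 1) := by
  refine tGr_induction A B (p := fun x => tD A B x ∈ tGr A B (n + 1)) ?_ ?_ ?_ ?_ hx
  · rw [map_zero]; exact zero_mem _
  · intro x y hx hy; rw [map_add]; exact add_mem hx hy
  · intro c x hx; rw [map_smul]; exact Submodule.smul_mem _ _ hx
  · intro i j a b ha hb hn
    rw [tD_tm A B ha]
    refine add_mem (tm_mem_tGr A B (A.d_mem i a ha) hb (by omega)) ?_
    rw [Units.smul_def]
    exact zsmul_mem (tm_mem_tGr A B ha (B.d_mem j b hb) (by omega)) _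

theorem tD_tD (x : TCarrier A B) : tD A B (tD A B x) = 0 := by
  refine t_induction A B (p := fun x => tD A B (tD A B x) = 0) ?_ ?_ ?_ x
  · simp
  · intro x y hx hy; rw [map_add, map_add, hx, hy, add_zero]
  · intro i j a b ha hb
    rw [tD_tm A B ha, map_add, tD_tm A B (A.d_mem i a ha), map_usmul, tD_tm A B ha,
      A.d_d, B.d_d, Int.negOnePow_succ]
    have h1 : tm (0 : A) b = 0 := TensorProduct.zero_tmul _ _
    have h2 : tm a (0 : B) = 0 := TensorProduct.tmul_zero _ _
    rw [h1, h2, smul_zero, add_zero, zero_add, Units.neg_smul, neg_add_cancel]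

theorem tD_leibniz {m : ℤ} {x : TCarrier A B} (hx : x ∈ tGr A B m) (y : TCarrier A B) :
    tD A B (x * y) = tD A B x * y + m.negOnePow • (x * tD A B y) := by
  refine tGr_induction A B (p := fun x => tD A B (x * y) = tD A B x * y +
    m.negOnePow • (x * tD A B y)) ?_ ?_ ?_ ?_ hx
  · simp
  · intro x x' h h'
    rw [add_mul, map_add, h, h', map_add, add_mul, add_mul, smul_add]; abel
  · intro c x h
    rw [Algebra.smul_mul_assoc, map_smul, h, map_smul, Algebra.smul_mul_assoc,
      Algebra.smul_mul_assoc, smul_add, smul_comm c m.negOnePow]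
  · intro i j a b ha hb hm
    refine t_induction A B (p := fun y => tD A B (tm a b * y) = tD A B (tm a b) * y +
      m.negOnePow • (tm a b * tD A B y)) ?_ ?_ ?_ y
    · simp
    · intro y y' h h'
      rw [mul_add, map_add, h, h', map_add, mul_add, mul_add, smul_add]; abel
    · intro k l a' b' ha' hb'
      subst hm
      rw [tm_mul_tm A B a b' hb ha', map_usmul, tD_tm A B (SetLike.GradedMul.mul_mem ha ha'),
        A.leibniz i a a' ha, B.leibniz j b b' hb, tD_tm A B ha, tD_tm A B ha', add_mul, mul_add,
        tm_mul_tm A B _ _ hb ha', smul_mul_assoc, tm_mul_tm A B _ _ (B.d_mem j b hb) ha',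
        tm_mul_tm A B _ _ hb (A.d_mem k a' ha'), t_mul_usmul, tm_mul_tm A B _ _ hb ha',
        add_tm, tm_add, zsmul_tm, tm_zsmul]
      simp only [smul_add, smul_smul]
      have e1 : ((j + 1) * k).negOnePow = (j * k).negOnePow * k.negOnePow := by
        rw [← Int.negOnePow_add]; congr 1; ring
      have e2 : (j * (k + 1)).negOnePow = (j * k).negOnePow * j.negOnePow := by
        rw [← Int.negOnePow_add]; congr 1; ring
      rw [e1, e2, Int.negOnePow_add, Int.negOnePow_add]
      have h1 := Int.units_mul_self j.negOnePow
      have h2 := Int.units_mul_self k.negOnePow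
      generalize j.negOnePow = p at *
      generalize k.negOnePow = q at *
      generalize i.negOnePow = r at *
      generalize (j * k).negOnePow = s at *
      have e3 : r * p * (s * p) = s * r := by
        calc r * p * (s * p) = s * r * (p * p) := by ac_rfl
          _ = s * r := by rw [h1, mul_one]
      have e4 : r * p * (q * s) = s * (r * q * p) := by ac_rfl
      have e5 : r * (s * q) = s * (r * q) := by ac_rfl
      rw [e3, e4, e5]
      abel

theorem t_comm {m n : ℤ} {x y : TCarrier A B} (hx : x ∈ tGr A B m) (hy : y ∈ tGr A B n) :
    x * y = (m * n).negOnePow • (y * x) := by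
  refine tGr_induction A B (p := fun x => x * y = (m * n).negOnePow • (y * x)) ?_ ?_ ?_ ?_ hx
  · simp
  · intro x x' h h'
    rw [add_mul, h, h', mul_add, smul_add]
  · intro c x h
    rw [Algebra.smul_mul_assoc, h, t_mul_smul, smul_comm]
  · intro i j a b ha hb hm
    refine tGr_induction A B (p := fun y => tm a b * y = (m * n).negOnePow • (y * tm a b))
      ?_ ?_ ?_ ?_ hy
    · simp
    · intro x x' h h'
      rw [mul_add, h, h', add_mul, smul_add]
    · intro c x h
      rw [t_mul_smul, h, Algebra.smul_mul_assoc, smul_comm]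
    · intro k l a' b' ha' hb' hn
      subst hm hn
      rw [tm_mul_tm A B a b' hb ha', tm_mul_tm A B a' b hb' ha, A.comm i k a a' ha ha',
        B.comm j l b b' hb hb', zsmul_tm, tm_zsmul]
      simp only [smul_smul]
      congr 1
      rw [← Int.negOnePow_add, ← Int.negOnePow_add, ← Int.negOnePow_add, Int.negOnePow_eq_iff]
      exact ⟨-(l * i), by ring⟩

/-- The tensor product of cdgas. -/
noncomputable def tensor (A : CDGA.{v}) (B : CDGA.{w}) : CDGA.{max v w} where
  carrier := TCarrier A B
  gr := tGr A B
  d := tD A B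
  d_mem _ _ h := tD_mem A B h
  d_d := tD_tD A B
  leibniz _ _ y hx := tD_leibniz A B hx y
  comm _ _ _ _ hx hy := t_comm A B hx hy

/-- The pure tensor `a ⊗ b` as an element of the cdga `A ⊗ B`. -/
noncomputable def tmul {A : CDGA.{v}} {B : CDGA.{w}} (a : A) (b : B) : A.tensor B :=
  (tm a b : TCarrier A B)

/-- The tensor product `f ⊗ g` of two linear maps (of degree `0`). -/
noncomputable def tmap {A B : CDGA.{v}} {A' B' : CDGA.{w}} (f : A →ₗ[ℚ] A') (g : B →ₗ[ℚ] B') :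
    A.tensor B →ₗ[ℚ] A'.tensor B' :=
  TensorProduct.map f g

/-- The associativity isomorphism `(A ⊗ B) ⊗ C ≃ A ⊗ (B ⊗ C)`. -/
noncomputable def tassoc (A B C : CDGA.{v}) :
    (A.tensor B).tensor C ≃ₗ[ℚ] A.tensor (B.tensor C) :=
  TensorProduct.assoc ℚ A B C

end Tensor
end CDGA
/-- A non-trivial geometric lattice: a finite lattice with at least two elements which is atomistic
(every element is a join of atoms) and semimodular (if `a` covers `a ∧ b` then `a ∨ b` covers `b`;
for finite lattices this is the same as being ranked with
`rk (a ∧ b) + rk (a ∨ b) ≤ rk a + rk b`). -/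
structure GeomLat : Type (u + 1) where
  carrier : Type u
  [lattice : Lattice carrier]
  [bounded : BoundedOrder carrier]
  [finite : Finite carrier]
  [atomistic : IsAtomistic carrier]
  [semimodular : IsUpperModularLattice carrier]
  [nontrivial : Nontrivial carrier]

namespace GeomLat

instance : CoeSort GeomLat.{u} (Type u) := ⟨GeomLat.carrier⟩

attribute [instance] GeomLat.lattice GeomLat.bounded GeomLat.finite GeomLat.atomistic
  GeomLat.semimodular GeomLat.nontrivial

/-- The rank of a flat `x`: the length of the (maximal) chains from `⊥` to `x`. -/
noncomputable def rk {L : GeomLat.{u}} (x : L) : ℤ := ((Order.height x).toNat : ℤ)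

/-- The interval `[⊥, F]`, for `F ≠ ⊥`. -/
def lower (L : GeomLat.{u}) (F : L) (hF : F ≠ ⊥) : GeomLat.{u} where
  carrier := Set.Iic F
  atomistic := ⟨fun b => by
    obtain ⟨s, hs, ha⟩ := IsAtomistic.isLUB_atoms b.1
    refine ⟨{x | x.1 ∈ s}, ⟨fun x hx => hs.1 hx, fun y hy => hs.2 fun x hx => ?_⟩,
      fun x hx => (ha _ hx).Iic x.2⟩
    exact hy (a := ⟨x, (hs.1 hx).trans b.2⟩) hx⟩
  semimodular := ⟨fun {a b} h => by
    have h' : a.1 ⊓ b.1 ⋖ a.1 := by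
      refine ⟨h.1, fun c h1 h2 => ?_⟩
      exact h.2 (c := ⟨c, h2.le.trans a.2⟩) h1 h2
    have h2 := IsUpperModularLattice.covBy_sup_of_inf_covBy h'
    exact ⟨h2.1, fun c hc hc' => h2.2 (c := c.1) hc hc'⟩⟩
  nontrivial := ⟨⟨⊥, ⊤, fun h => hF (congrArg Subtype.val h).symm⟩⟩

/-- The interval `[F, ⊤]`, for `F ≠ ⊤`. -/
def upper (L : GeomLat.{u}) (F : L) (hF : F ≠ ⊤) : GeomLat.{u} where
  carrier := Set.Ici F
  atomistic := ⟨fun b => by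
    obtain ⟨s, hs, ha⟩ := IsAtomistic.isLUB_atoms b.1
    refine ⟨{x | IsAtom x ∧ x ≤ b}, ⟨fun x hx => hx.2, fun y hy => hs.2 fun x hx => ?_⟩,
      fun x hx => hx.1⟩
    by_cases hxF : x ≤ F
    · exact hxF.trans y.2
    · have h0 : x ⊓ F = ⊥ := ((ha x hx).le_iff.1 inf_le_left).resolve_right
        fun h => hxF (inf_eq_left.1 h)
      have h1 : F ⋖ x ⊔ F := IsUpperModularLattice.covBy_sup_of_inf_covBy
        (h0 ▸ (ha x hx).bot_covBy)
      have h2 : (⟨x ⊔ F, le_sup_right⟩ : Set.Ici F) ≤ y :=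
        hy ⟨Set.Ici.isAtom_iff.2 h1, sup_le (hs.1 hx) b.2⟩
      exact le_sup_left.trans h2⟩
  semimodular := ⟨fun {a b} h => by
    have h' : a.1 ⊓ b.1 ⋖ a.1 := by
      refine ⟨h.1, fun c h1 h2 => ?_⟩
      exact h.2 (c := ⟨c, (le_inf a.2 b.2).trans h1.le⟩) h1 h2
    have h2 := IsUpperModularLattice.covBy_sup_of_inf_covBy h'
    exact ⟨h2.1, fun c hc hc' => h2.2 (c := c.1) hc hc'⟩⟩
  nontrivial := ⟨⟨⊥, ⊤, fun h => hF (congrArg Subtype.val h)⟩⟩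

theorem isAtom_sup {L : GeomLat.{u}} {F H : L} (hH : IsAtom H) (h : ¬ H ≤ F) :
    IsAtom (⟨F ⊔ H, le_sup_left⟩ : Set.Ici F) := by
  have h0 : H ⊓ F = ⊥ := (hH.le_iff.1 inf_le_left).resolve_right fun h' => h (inf_eq_left.1 h')
  have h1 := IsUpperModularLattice.covBy_sup_of_inf_covBy (h0 ▸ hH.bot_covBy)
  rw [sup_comm] at h1
  exact Set.Ici.isAtom_iff.2 h1

section Isos

variable {L M : GeomLat.{u}}

/-- A flat is proper if it is neither `⊥` nor `⊤`. -/
def Proper (F : L) : Prop := F ≠ ⊥ ∧ F ≠ ⊤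

theorem Proper.map (φ : L ≃o M) {F : L} (hF : Proper F) : Proper (φ F) :=
  ⟨fun h => hF.1 (φ.injective (h.trans φ.map_bot.symm)),
    fun h => hF.2 (φ.injective (h.trans φ.map_top.symm))⟩

/-- The restriction of an isomorphism `φ` to `[⊥, F] ≃ [⊥, φ F]`. -/
def lowerIso (φ : L ≃o M) {F : L} (hF : F ≠ ⊥) (hF' : φ F ≠ ⊥) :
    L.lower F hF ≃o M.lower (φ F) hF' where
  toFun x := ⟨φ x.1, φ.monotone x.2⟩
  invFun y := ⟨φ.symm y.1, (φ.symm.monotone y.2).trans_eq (φ.symm_apply_apply F)⟩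
  left_inv x := Subtype.ext (φ.symm_apply_apply x.1)
  right_inv y := Subtype.ext (φ.apply_symm_apply y.1)
  map_rel_iff' {x y} := φ.le_iff_le (x := x.1) (y := y.1)

/-- The restriction of an isomorphism `φ` to `[F, ⊤] ≃ [φ F, ⊤]`. -/
def upperIso (φ : L ≃o M) {F : L} (hF : F ≠ ⊤) (hF' : φ F ≠ ⊤) :
    L.upper F hF ≃o M.upper (φ F) hF' where
  toFun x := ⟨φ x.1, φ.monotone x.2⟩
  invFun y := ⟨φ.symm y.1, (φ.symm_apply_apply F).ge.trans (φ.symm.monotone y.2)⟩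
  left_inv x := Subtype.ext (φ.symm_apply_apply x.1)
  right_inv y := Subtype.ext (φ.apply_symm_apply y.1)
  map_rel_iff' {x y} := φ.le_iff_le (x := x.1) (y := y.1)

variable (L) in
/-- The isomorphism between `L` and the interval `[⊥, ⊤]` of `L`. -/
def upperBotIso : L ≃o L.upper ⊥ bot_ne_top where
  toFun x := ⟨x, bot_le⟩
  invFun y := y.1
  left_inv _ := rfl
  right_inv _ := rfl
  map_rel_iff' := Iff.rfl

variable {F₁ F₂ : L}

/-- `F₁` as a flat of `[⊥, F₂]`. -/
def inLower (h₂ : Proper F₂) (h : F₁ < F₂) : L.lower F₂ h₂.1 := (⟨F₁, h.le⟩ : Set.Iic F₂)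

/-- `F₂` as a flat of `[F₁, ⊤]`. -/
def inUpper (h₁ : Proper F₁) (h : F₁ < F₂) : L.upper F₁ h₁.2 := (⟨F₂, h.le⟩ : Set.Ici F₁)

theorem proper_inLower (h₁ : Proper F₁) (h₂ : Proper F₂) (h : F₁ < F₂) :
    Proper (inLower h₂ h) :=
  ⟨fun e => h₁.1 (congrArg Subtype.val e), fun e => h.ne (congrArg Subtype.val e)⟩

theorem proper_inUpper (h₁ : Proper F₁) (h₂ : Proper F₂) (h : F₁ < F₂) :
    Proper (inUpper h₁ h) :=
  ⟨fun e => h.ne' (congrArg Subtype.val e), fun e => h₂.2 (congrArg Subtype.val e)⟩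

/-- The interval `[⊥, F₁]` of `L` is the interval `[⊥, F₁]` of `[⊥, F₂]`. -/
def lowerLowerIso (h₁ : Proper F₁) (h₂ : Proper F₂) (h : F₁ < F₂) :
    L.lower F₁ h₁.1 ≃o (L.lower F₂ h₂.1).lower (inLower h₂ h) (proper_inLower h₁ h₂ h).1 where
  toFun x := ⟨⟨x.1, x.2.trans h.le⟩, x.2⟩
  invFun y := ⟨y.1.1, y.2⟩
  left_inv _ := rfl
  right_inv _ := rfl
  map_rel_iff' := Iff.rfl

/-- The interval `[F₁, F₂]`, viewed in `[F₁, ⊤]` and in `[⊥, F₂]`. -/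
def middleIso (h₁ : Proper F₁) (h₂ : Proper F₂) (h : F₁ < F₂) :
    (L.upper F₁ h₁.2).lower (inUpper h₁ h) (proper_inUpper h₁ h₂ h).1 ≃o
      (L.lower F₂ h₂.1).upper (inLower h₂ h) (proper_inLower h₁ h₂ h).2 where
  toFun x := ⟨⟨x.1.1, x.2⟩, x.1.2⟩
  invFun y := ⟨⟨y.1.1, y.2⟩, y.1.2⟩
  left_inv _ := rfl
  right_inv _ := rfl
  map_rel_iff' := Iff.rfl

/-- The interval `[F₂, ⊤]` of `L` is the interval `[F₂, ⊤]` of `[F₁, ⊤]`. -/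
def upperUpperIso (h₁ : Proper F₁) (h₂ : Proper F₂) (h : F₁ < F₂) :
    L.upper F₂ h₂.2 ≃o (L.upper F₁ h₁.2).upper (inUpper h₁ h) (proper_inUpper h₁ h₂ h).2 where
  toFun x := ⟨⟨x.1, h.le.trans x.2⟩, x.2⟩
  invFun y := ⟨y.1.1, y.2⟩
  left_inv _ := rfl
  right_inv _ := rfl
  map_rel_iff' := Iff.rfl

end Isos

end GeomLat

open GeomLat

set_option linter.checkUnivs false in
/-- A `GL`-cooperad in the monoidal category of cdgas over `ℚ`. Since an interval of an interval of
`L` is an interval of `L` only up to a canonical isomorphism, the collection is required to be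
(contravariantly) functorial for isomorphisms of lattices and the coproducts to be natural. -/
structure GLCooperad : Type (max (u + 1) (v + 1)) where
  obj : GeomLat.{u} → CDGA.{v}
  map : ∀ {L M : GeomLat.{u}}, (L ≃o M) → CDGA.Hom (obj M) (obj L)
  map_refl : ∀ (L : GeomLat.{u}) (x : obj L), map (OrderIso.refl L) x = x
  map_trans : ∀ {L M N : GeomLat.{u}} (φ : L ≃o M) (ψ : M ≃o N) (x : obj N),
    map (φ.trans ψ) x = map φ (map ψ x)
  Δ : ∀ (L : GeomLat.{u}) (F : L) (hF : Proper F),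
    CDGA.Hom (obj L) ((obj (L.lower F hF.1)).tensor (obj (L.upper F hF.2)))
  Δ_natural : ∀ {L M : GeomLat.{u}} (φ : L ≃o M) (F : L) (hF : Proper F) (x : obj M),
    Δ L F hF (map φ x) =
      CDGA.tmap (map (lowerIso φ hF.1 (hF.map φ).1)).lin (map (upperIso φ hF.2 (hF.map φ).2)).lin
        (Δ M (φ F) (hF.map φ) x)
  coassoc : ∀ (L : GeomLat.{u}) (F₁ F₂ : L) (h₁ : Proper F₁) (h₂ : Proper F₂) (h : F₁ < F₂)
    (x : obj L),
    CDGA.tmap (map (lowerLowerIso h₁ h₂ h)).lin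
        (CDGA.tmap (map (middleIso h₁ h₂ h)).lin LinearMap.id)
      (CDGA.tassoc _ _ _
        (CDGA.tmap (Δ (L.lower F₂ h₂.1) (inLower h₂ h) (proper_inLower h₁ h₂ h)).lin
          LinearMap.id (Δ L F₂ h₂ x))) =
    CDGA.tmap LinearMap.id (CDGA.tmap LinearMap.id (map (upperUpperIso h₁ h₂ h)).lin)
      (CDGA.tmap LinearMap.id
        (Δ (L.upper F₁ h₁.2) (inUpper h₁ h) (proper_inUpper h₁ h₂ h)).lin (Δ L F₁ h₁ x))

/-- A morphism of `GL`-cooperads in cdgas. -/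
structure GLCooperad.Hom (C : GLCooperad.{u, v}) (D : GLCooperad.{u, w}) where
  app : ∀ L : GeomLat.{u}, CDGA.Hom (C.obj L) (D.obj L)
  app_map : ∀ {L M : GeomLat.{u}} (φ : L ≃o M) (x : C.obj M),
    app L (C.map φ x) = D.map φ (app M x)
  app_Δ : ∀ (L : GeomLat.{u}) (F : L) (hF : Proper F) (x : C.obj L),
    D.Δ L F hF (app L x) =
      CDGA.tmap (app (L.lower F hF.1)).lin (app (L.upper F hF.2)).lin (C.Δ L F hF x)

/-! ### Orlik--Solomon algebras -/

namespace OS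

/-- The set of atoms of `L`. -/
abbrev At (L : GeomLat.{u}) : Type u := {a : L // IsAtom a}

/-- The exterior algebra with one generator `e_H` of degree `1` for each atom `H` of `L`. -/
abbrev Ext (L : GeomLat.{u}) : Type u := ExteriorAlgebra ℚ (At L →₀ ℚ)

/-- The product `e_{H₁} ⋯ e_{Hₙ}` in the exterior algebra. -/
noncomputable def extMonomial {L : GeomLat.{u}} (l : List (At L)) : Ext L :=
  (l.map fun H => ExteriorAlgebra.ι ℚ (Finsupp.single H 1)).prod

/-- The (anti)derivation `δ` of the exterior algebra with `δ e_H = 1` for all atoms `H`. -/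
noncomputable def δ (L : GeomLat.{u}) : Ext L →ₗ[ℚ] Ext L :=
  CliffordAlgebra.contractLeft (Finsupp.linearCombination ℚ fun _ : At L => (1 : ℚ))

open scoped Classical in
/-- Circuits: `rk C = #C - 1` and `rk (C \ c) = #C - 1` for all `c ∈ C`. -/
def IsCircuit {L : GeomLat.{u}} (C : Finset (At L)) : Prop :=
  rk (C.sup Subtype.val) = (C.card : ℤ) - 1 ∧
    ∀ c ∈ C, rk ((C.filter (· ≠ c)).sup Subtype.val) = (C.card : ℤ) - 1

/-- An atom `H ≤ F`, as an atom of `[⊥, F]`. -/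
def lowerAtom {L : GeomLat.{u}} {F : L} (hF : F ≠ ⊥) (H : At L) (h : H.1 ≤ F) :
    At (L.lower F hF) :=
  ⟨(⟨H.1, h⟩ : Set.Iic F), H.2.Iic h⟩

/-- For an atom `H` not below `F`, the atom `F ∨ H` of `[F, ⊤]`. -/
def upperAtom {L : GeomLat.{u}} {F : L} (hF : F ≠ ⊤) (H : At L) (h : ¬ H.1 ≤ F) :
    At (L.upper F hF) :=
  ⟨(⟨F ⊔ H.1, le_sup_left⟩ : Set.Ici F), isAtom_sup H.2 h⟩

/-- The relations `δ e_C = 0` for the circuits `C` of `L` (for every ordering of `C`). -/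
inductive Rel (L : GeomLat.{u}) : Ext L → Ext L → Prop
  | circuit (l : List (At L)) (hl : l.Nodup) (C : Finset (At L)) (hC : ∀ H, H ∈ C ↔ H ∈ l)
      (h : IsCircuit C) : Rel L (δ L (extMonomial l)) 0

end OS

/-- The Orlik--Solomon algebra of `L`. -/
abbrev OS (L : GeomLat.{u}) : Type u := RingQuot (OS.Rel L)

namespace OS

/-- The generator `e_H`. -/
noncomputable def e {L : GeomLat.{u}} (H : At L) : OS L :=
  RingQuot.mkAlgHom ℚ (OS.Rel L) (ExteriorAlgebra.ι ℚ (Finsupp.single H 1))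

/-- The monomial `e_{H₁} ⋯ e_{Hₙ}`. -/
noncomputable def monomial {L : GeomLat.{u}} (l : List (At L)) : OS L := (l.map e).prod

end OS

/-! ### Modular diagrams -/

/-- A modular element of a lattice. In a geometric lattice each of the two conditions is equivalent to
`rk (F ∧ G) + rk (F ∨ G) = rk F + rk G` for all `G`. -/
def IsModularElt {α : Type*} [Lattice α] (F : α) : Prop :=
  (∀ A B : α, A ≤ F → F ⊓ (A ⊔ B) = A ⊔ (F ⊓ B)) ∧
    ∀ A B : α, A ≤ B → B ⊓ (A ⊔ F) = A ⊔ (B ⊓ F)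

theorem IsModularElt.sup {α : Type*} [Lattice α] {F : α} (h : IsModularElt F) (G : α) :
    IsModularElt (⟨G ⊔ F, le_sup_left⟩ : Set.Ici G) := by
  refine ⟨fun A B hA => Subtype.ext ?_, fun A B hAB => Subtype.ext ?_⟩
  · have key : ∀ X : α, G ≤ X → (G ⊔ F) ⊓ X = G ⊔ (X ⊓ F) := fun X hX => by
      rw [inf_comm]; exact h.2 G X hX
    have hA' : A.1 = G ⊔ (A.1 ⊓ F) := by
      rw [← key A.1 A.2]; exact congrArg Subtype.val (inf_eq_right.2 hA).symm
    have e1 : A.1 ⊔ B.1 = (A.1 ⊓ F) ⊔ B.1 := by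
      apply le_antisymm
      · refine sup_le ?_ le_sup_right
        rw [hA']
        refine sup_le (B.2.trans le_sup_right) ?_
        rw [← hA']; exact le_sup_left
      · exact sup_le_sup_right inf_le_left _
    change (G ⊔ F) ⊓ (A.1 ⊔ B.1) = A.1 ⊔ ((G ⊔ F) ⊓ B.1)
    rw [key _ (A.2.trans le_sup_left), key _ B.2, e1, inf_comm, h.1 _ _ inf_le_right, ← sup_assoc,
      ← hA', ← sup_assoc, sup_eq_left.2 (show G ≤ A.1 from A.2), inf_comm]
  · change B.1 ⊓ (A.1 ⊔ (G ⊔ F)) = A.1 ⊔ (B.1 ⊓ (G ⊔ F))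
    rw [h.2 G B.1 B.2, ← sup_assoc, ← sup_assoc, sup_eq_left.2 (show G ≤ A.1 from A.2)]
    exact h.2 A.1 B.1 hAB

theorem IsModularElt.inf {α : Type*} [Lattice α] {F : α} (h : IsModularElt F) (G : α) :
    IsModularElt (⟨G ⊓ F, inf_le_left⟩ : Set.Iic G) := by
  refine ⟨fun A B hA => Subtype.ext ?_, fun A B hAB => Subtype.ext ?_⟩
  · change (G ⊓ F) ⊓ (A.1 ⊔ B.1) = A.1 ⊔ ((G ⊓ F) ⊓ B.1)
    have hA' : A.1 ≤ G ⊓ F := hA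
    rw [inf_assoc, h.1 _ _ (hA'.trans inf_le_right), inf_assoc,
      inf_eq_right.2 (show A.1 ⊔ (F ⊓ B.1) ≤ G from sup_le A.2 (inf_le_right.trans B.2)),
      inf_eq_right.2 (show F ⊓ B.1 ≤ G from inf_le_right.trans B.2)]
  · change B.1 ⊓ (A.1 ⊔ (G ⊓ F)) = A.1 ⊔ (B.1 ⊓ (G ⊓ F))
    rw [← h.2 A.1 G A.2, ← inf_assoc, inf_eq_left.2 (show B.1 ≤ G from B.2), ← inf_assoc,
      inf_eq_left.2 (show B.1 ≤ G from B.2)]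
    exact h.2 A.1 B.1 hAB

/-- Embeddings of geometric lattices: injective, compatible with joins, sending atoms to atoms. -/
structure IsEmbedding {L M : GeomLat.{u}} (φ : L → M) : Prop where
  injective : Function.Injective φ
  map_sup : ∀ x y, φ (x ⊔ y) = φ x ⊔ φ y
  map_atom : ∀ a, IsAtom a → IsAtom (φ a)

theorem IsEmbedding.monotone {L M : GeomLat.{u}} {φ : L → M} (h : IsEmbedding φ) :
    Monotone φ := fun x y hxy => by
  rw [← sup_eq_right.2 hxy, h.map_sup]; exact le_sup_left

theorem IsEmbedding.le_iff {L M : GeomLat.{u}} {φ : L → M} (h : IsEmbedding φ) {x y : L} :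
    φ x ≤ φ y ↔ x ≤ y := by
  refine ⟨fun hxy => ?_, fun hxy => h.monotone hxy⟩
  have := h.map_sup x y
  rw [sup_eq_right.2 hxy] at this
  exact sup_eq_right.1 (h.injective this)

/-- A modular diagram `(E, ι, J)` of `L`: a modular extension `ι : L → E` (an embedding whose image
is an interval `[⊥, F_ι]` with `F_ι = ι ⊤` modular in `E`) and a finite word `J` in the atoms
of `E`. -/
structure Diag (L : GeomLat.{u}) : Type (u + 1) where
  E : GeomLat.{u}
  ι : L → E
  emb : IsEmbedding ι
  range_ι : Set.range ι = Set.Iic (ι ⊤)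
  modular : IsModularElt (ι ⊤)
  J : List E
  atoms : ∀ H ∈ J, IsAtom H

namespace Diag

variable {L : GeomLat.{u}}

/-- The flat `F_ι` of `E`. -/
def top (Γ : Diag L) : Γ.E := Γ.ι ⊤

/-- The join of all elements of `J`. -/
def join (Γ : Diag L) : Γ.E := Γ.J.foldr (· ⊔ ·) ⊥

/-- The degree `|J| - 2 (rk (⋁ J) - rk (⋁ J ∧ F_ι))`. -/
noncomputable def deg (Γ : Diag L) : ℤ := (Γ.J.length : ℤ) - 2 * (rk Γ.join - rk (Γ.join ⊓ Γ.top))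

theorem exists_trace (Γ : Diag L) (y : Γ.E) : ∃ x : L, Γ.ι x = y ⊓ Γ.top := by
  have : y ⊓ Γ.top ∈ Set.Iic (Γ.ι ⊤) := inf_le_right
  rwa [← Γ.range_ι] at this

/-- The flat `ι⁻¹(y ∧ F_ι)` of `L`. -/
noncomputable def trace (Γ : Diag L) (y : Γ.E) : L := (Γ.exists_trace y).choose

theorem ι_trace (Γ : Diag L) (y : Γ.E) : Γ.ι (Γ.trace y) = y ⊓ Γ.top :=
  (Γ.exists_trace y).choose_spec

theorem ι_le_top (Γ : Diag L) (x : L) : Γ.ι x ≤ Γ.top := Γ.emb.monotone le_top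

theorem ι_bot (Γ : Diag L) : Γ.ι ⊥ = ⊥ := by
  have : (⊥ : Γ.E) ∈ Set.Iic (Γ.ι ⊤) := bot_le
  rw [← Γ.range_ι] at this
  obtain ⟨x, hx⟩ := this
  exact le_bot_iff.1 ((Γ.emb.monotone bot_le).trans_eq hx)

theorem trace_le_iff (Γ : Diag L) (y : Γ.E) (x : L) : x ≤ Γ.trace y ↔ Γ.ι x ≤ y := by
  rw [← Γ.emb.le_iff, ι_trace, le_inf_iff, and_iff_left (Γ.ι_le_top x)]

/-- The diagram `(L, id, J)`. -/
def ofWord (l : List (OS.At L)) : Diag L where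
  E := L
  ι := id
  emb := ⟨Function.injective_id, fun _ _ => rfl, fun _ h => h⟩
  range_ι := by simp
  modular := ⟨fun A B _ => by simp, fun A B h => by simpa using h⟩
  J := l.map Subtype.val
  atoms := by
    intro H hH
    obtain ⟨a, _, rfl⟩ := List.mem_map.1 hH
    exact a.2

/-- The action of isomorphisms on diagrams: `(E, ι, J) ↦ (E, ι ∘ φ, J)`. -/
def comp {L M : GeomLat.{u}} (Γ : Diag M) (φ : L ≃o M) : Diag L where
  E := Γ.E
  ι x := Γ.ι (φ x)
  emb := ⟨Γ.emb.injective.comp φ.injective, fun x y => by rw [φ.map_sup, Γ.emb.map_sup],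
    fun a ha => Γ.emb.map_atom _ ((φ.isAtom_iff a).2 ha)⟩
  range_ι := by
    rw [φ.map_top, ← Γ.range_ι]
    exact φ.surjective.range_comp Γ.ι
  modular := by rw [φ.map_top]; exact Γ.modular
  J := Γ.J
  atoms := Γ.atoms

open scoped Classical in
/-- The part `J ∩ F'` of the word `J`, as a word in the interval `[⊥, F']`. -/
noncomputable def wordBelow (Γ : Diag L) (F' : Γ.E) : List (Set.Iic F') :=
  Γ.J.filterMap fun H => if h : H ≤ F' then some ⟨H, h⟩ else none

open scoped Classical in
/-- The word `F' ∨ (J \ F')` in the interval `[F', ⊤]`. -/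
noncomputable def wordAbove (Γ : Diag L) (F' : Γ.E) : List (Set.Ici F') :=
  Γ.J.filterMap fun H => if H ≤ F' then none else some ⟨F' ⊔ H, le_sup_left⟩

theorem atom_wordBelow (Γ : Diag L) (F' : Γ.E) : ∀ H ∈ Γ.wordBelow F', IsAtom H := by
  intro H hH
  obtain ⟨K, hK, h⟩ := List.mem_filterMap.1 hH
  split_ifs at h with hle
  cases h
  exact (Γ.atoms K hK).Iic hle

theorem atom_wordAbove (Γ : Diag L) (F' : Γ.E) : ∀ H ∈ Γ.wordAbove F', IsAtom H := by
  intro H hH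
  obtain ⟨K, hK, h⟩ := List.mem_filterMap.1 hH
  split_ifs at h with hle
  cases h
  exact isAtom_sup (Γ.atoms K hK) hle

theorem ι_le_of_trace (Γ : Diag L) {F : L} {F' : Γ.E} (h : Γ.trace F' = F) : Γ.ι F ≤ F' :=
  (Γ.trace_le_iff F' F).1 h.ge

theorem top_inf_sup (Γ : Diag L) {F : L} {F' : Γ.E} (h : Γ.trace F' = F) {x : L} (hx : F ≤ x) :
    Γ.top ⊓ (F' ⊔ Γ.ι x) = Γ.ι x := by
  rw [sup_comm]
  refine (Γ.modular.1 _ _ (Γ.ι_le_top x)).trans ?_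
  have : Γ.ι ⊤ ⊓ F' = Γ.ι F := by rw [← h, ι_trace, inf_comm]; rfl
  rw [this]
  exact sup_eq_left.2 (Γ.emb.monotone hx)

/-- The diagram `Γ_{F'} = ([⊥, F'], ι, J ∩ F')` of `[⊥, F]`, where `ι⁻¹(F' ∧ F_ι) = F`. -/
noncomputable def below (Γ : Diag L) {F : L} (hF : F ≠ ⊥) (F' : Γ.E) (h : Γ.trace F' = F) :
    Diag (L.lower F hF) where
  E := Γ.E.lower F' fun e => hF (by
    apply Γ.emb.injective
    rw [ι_bot, ← le_bot_iff, ← e]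
    exact Γ.ι_le_of_trace h)
  ι x := ⟨Γ.ι x.1, (Γ.emb.monotone x.2).trans (Γ.ι_le_of_trace h)⟩
  emb :=
    { injective := fun x y e => Subtype.ext (Γ.emb.injective (congrArg Subtype.val e))
      map_sup := fun x y => Subtype.ext (Γ.emb.map_sup x.1 y.1)
      map_atom := fun a ha => (Γ.emb.map_atom a.1 ha.of_isAtom_coe_Iic).Iic _ }
  range_ι := by
    refine Set.Subset.antisymm ?_ fun y hy => ?_
    · rintro _ ⟨x, rfl⟩
      exact Γ.emb.monotone (show x.1 ≤ F from x.2)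
    · have hy' : y.1 ≤ Γ.ι F := hy
      have hy2 : y.1 ∈ Set.Iic (Γ.ι ⊤) := hy'.trans (Γ.ι_le_top F)
      rw [← Γ.range_ι] at hy2
      obtain ⟨x, hx⟩ := hy2
      exact ⟨⟨x, Γ.emb.le_iff.1 (hx.trans_le hy')⟩, Subtype.ext hx⟩
  modular := by
    have key := Γ.modular.inf F'
    have e : (⟨F' ⊓ Γ.ι ⊤, inf_le_left⟩ : Set.Iic F') = ⟨Γ.ι F, Γ.ι_le_of_trace h⟩ := by
      apply Subtype.ext
      change F' ⊓ Γ.ι ⊤ = Γ.ι F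
      rw [← h, ι_trace]; rfl
    rw [e] at key
    exact key
  J := Γ.wordBelow F'
  atoms := Γ.atom_wordBelow F'

/-- The diagram `Γ^{F'} = ([F', ⊤], F' ∨ ι, F' ∨ (J \ F'))` of `[F, ⊤]`, where
`ι⁻¹(F' ∧ F_ι) = F`. -/
noncomputable def above (Γ : Diag L) {F : L} (hF : F ≠ ⊤) (F' : Γ.E) (h : Γ.trace F' = F) :
    Diag (L.upper F hF) where
  E := Γ.E.upper F' fun e => hF (by
    rw [← h, e, ← top_le_iff, trace_le_iff]
    exact le_top)
  ι x := ⟨F' ⊔ Γ.ι x.1, le_sup_left⟩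
  emb :=
    { injective := fun x y e => by
        have e' : F' ⊔ Γ.ι x.1 = F' ⊔ Γ.ι y.1 := congrArg Subtype.val e
        apply Subtype.ext
        apply Γ.emb.injective
        rw [← Γ.top_inf_sup h x.2, e', Γ.top_inf_sup h y.2]
      map_sup := fun x y => Subtype.ext (by
        change F' ⊔ Γ.ι (x.1 ⊔ y.1) = (F' ⊔ Γ.ι x.1) ⊔ (F' ⊔ Γ.ι y.1)
        rw [Γ.emb.map_sup, sup_sup_sup_comm, sup_idem])
      map_atom := fun a ha => by
        have e0 : Γ.ι F = F' ⊓ Γ.top := by rw [← ι_trace, h]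
        have ha' : F ⋖ a.1 := Set.Ici.isAtom_iff.1 ha
        have hi : Γ.ι a.1 ⊓ F' = Γ.ι F := by
          rw [e0]
          apply le_antisymm
          · exact le_inf inf_le_right (inf_le_left.trans (Γ.ι_le_top _))
          · refine le_inf ?_ inf_le_left
            rw [← e0]
            exact Γ.emb.monotone a.2
        have hc : Γ.ι a.1 ⊓ F' ⋖ Γ.ι a.1 := by
          rw [hi]
          refine ⟨lt_of_le_of_ne (Γ.emb.monotone a.2) fun e => ha'.1.ne (Γ.emb.injective e),
            fun c h1 h2 => ?_⟩
          have hc : c ∈ Set.Iic (Γ.ι ⊤) := h2.le.trans (Γ.ι_le_top _)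
          rw [← Γ.range_ι] at hc
          obtain ⟨z, rfl⟩ := hc
          exact ha'.2 (lt_of_le_not_ge (Γ.emb.le_iff.1 h1.le) fun k => h1.not_ge (Γ.emb.monotone k))
            (lt_of_le_not_ge (Γ.emb.le_iff.1 h2.le) fun k => h2.not_ge (Γ.emb.monotone k))
        have h1 := IsUpperModularLattice.covBy_sup_of_inf_covBy hc
        rw [sup_comm] at h1
        exact Set.Ici.isAtom_iff.2 h1 }
  range_ι := by
    refine Set.Subset.antisymm ?_ fun y hy => ?_
    · rintro _ ⟨x, rfl⟩
      exact sup_le_sup_left (Γ.ι_le_top x.1) F'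
    · have hy' : y.1 ≤ F' ⊔ Γ.ι ⊤ := hy
      refine ⟨⟨Γ.trace y.1, ?_⟩, Subtype.ext ?_⟩
      · exact (Γ.trace_le_iff _ _).2 ((Γ.ι_le_of_trace h).trans y.2)
      · change F' ⊔ Γ.ι (Γ.trace y.1) = y.1
        rw [ι_trace]
        exact (Γ.modular.2 F' y.1 y.2).symm.trans (inf_eq_left.2 hy')
  modular := Γ.modular.sup F'
  J := Γ.wordAbove F'
  atoms := Γ.atom_wordAbove F'

theorem trace_of_not_le (Γ : Diag L) {H : Γ.E} (hH : IsAtom H) (h : ¬ H ≤ Γ.top) :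
    Γ.trace H = ⊥ := by
  apply Γ.emb.injective
  rw [ι_trace, ι_bot]
  exact (hH.le_iff.1 inf_le_left).resolve_right fun e => h (inf_eq_left.1 e)

/-- The contraction `Γ / H = ([H, ⊤], H ∨ ι, H ∨ (J \ {H}))` of a diagram of `L = [⊥, ⊤]` at an
atom `H` not below `F_ι`. -/
noncomputable def contract (Γ : Diag L) (H : Γ.E) (hH : IsAtom H) (h : ¬ H ≤ Γ.top) : Diag L :=
  (Γ.above bot_ne_top H (Γ.trace_of_not_le hH h)).comp (upperBotIso L)

/-- `H` is a bridge: it is the only atom of `J` not below some flat `F ≥ F_ι`. -/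
def IsBridge (Γ : Diag L) (H : Γ.E) : Prop :=
  ∃ F : Γ.E, Γ.top ≤ F ∧ ¬ H ≤ F ∧ ∀ K ∈ Γ.J, K ≠ H → K ≤ F

/-- `H` is contractible: it is not a bridge and not below `F_ι`. -/
def IsContractible (Γ : Diag L) (H : Γ.E) : Prop := ¬ Γ.IsBridge H ∧ ¬ H ≤ Γ.top

/-- `Γ` is the product of the diagrams `Γ₁` and `Γ₂`: up to an isomorphism `ψ`, its lattice is the
pushout `{(F₁, F₂) ∈ E₁ × E₂ | ι₁⁻¹(F₁ ∧ F_ι₁) = ι₂⁻¹(F₂ ∧ F_ι₂)}` with the componentwise order and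
the embedding `(ι₁, ι₂)` of `L`, and its word is `J₁` followed by `J₂`, where an atom `H` of `E₁` is
identified with `(H, ι₂ ι₁⁻¹(H ∧ F_ι₁))`, and an atom `H` of `E₂` with `(ι₁ ι₂⁻¹(H ∧ F_ι₂), H)`. -/
def IsPushout (Γ₁ Γ₂ Γ : Diag L) : Prop :=
  ∃ ψ : Γ.E → Γ₁.E × Γ₂.E,
    (∀ x y, ψ x ≤ ψ y ↔ x ≤ y) ∧
    Set.range ψ = {p | Γ₁.trace p.1 = Γ₂.trace p.2} ∧
    (∀ x, ψ (Γ.ι x) = (Γ₁.ι x, Γ₂.ι x)) ∧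
    Γ.J.map ψ = Γ₁.J.map (fun H => (H, Γ₂.ι (Γ₁.trace H))) ++
      Γ₂.J.map (fun H => (Γ₁.ι (Γ₂.trace H), H))

end Diag

open scoped Classical in
/-- The signature of the permutation of a word moving the letters satisfying `p` in front of the
others and keeping the relative orders: `-1` to the number of pairs of positions `i < j` such that
the `j`-th letter satisfies `p` and the `i`-th does not. -/
noncomputable def shuffleSign {α : Type*} (p : α → Prop) : List α → ℤ
  | [] => 1
  | a :: l => (if p a then 1 else (-1) ^ (l.countP fun b => decide (p b))) * shuffleSign p l

namespace MD

open scoped Classical in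
/-- The relations between modular diagrams, as a set of elements of the free vector space:
* `Γ ∼ -Γ'` if the words of `Γ` and `Γ'` differ by a transposition;
* `(E, ι, J) ∼ (E', φ ∘ ι, φ J)` for an embedding `φ : E → E'` with `rk E = rk E'`;
* `Γ ∼ 0` if `F_ι ∨ ⋁ J < ⊤`;
* `Γ ∼ 0` if `E` is a product `E₁ × E₂` of non-trivial geometric lattices with `F_ι ∈ E₁ × {⊥}`;
* `Γ ∼ 0` if exactly two letters of `J` are not below some modular flat `F ≥ F_ι`. -/
inductive Rel (L : GeomLat.{u}) : (Diag L →₀ ℚ) → Prop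
  | transposition (Γ : Diag L) (l₁ l₂ l₃ : List Γ.E) (a b : Γ.E)
      (hJ : Γ.J = l₁ ++ a :: l₂ ++ b :: l₃) (h : ∀ H ∈ l₁ ++ b :: l₂ ++ a :: l₃, IsAtom H) :
      Rel L (Finsupp.single Γ 1 +
        Finsupp.single { Γ with J := l₁ ++ b :: l₂ ++ a :: l₃, atoms := h } 1)
  | embedding (Γ Γ' : Diag L) (φ : Γ.E → Γ'.E) (hφ : IsEmbedding φ)
      (hrk : rk (⊤ : Γ.E) = rk (⊤ : Γ'.E)) (hι : ∀ x, Γ'.ι x = φ (Γ.ι x))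
      (hJ : Γ'.J = Γ.J.map φ) : Rel L (Finsupp.single Γ 1 - Finsupp.single Γ' 1)
  | not_spanning (Γ : Diag L) (h : Γ.top ⊔ Γ.join < ⊤) : Rel L (Finsupp.single Γ 1)
  | product (Γ : Diag L) (E₁ E₂ : GeomLat.{u}) (ψ : Γ.E ≃o E₁ × E₂) (h : (ψ Γ.top).2 = ⊥) :
      Rel L (Finsupp.single Γ 1)
  | two_outside (Γ : Diag L) (F : Γ.E) (hF : IsModularElt F) (hle : Γ.top ≤ F)
      (h : (Γ.J.filter fun H => ¬ H ≤ F).length = 2) : Rel L (Finsupp.single Γ 1)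

end MD

/-- The vector space of modular diagrams of `L`. -/
abbrev MD (L : GeomLat.{u}) : Type (u + 1) :=
  (Diag L →₀ ℚ) ⧸ Submodule.span ℚ {x | MD.Rel L x}

/-- The class of a diagram. -/
noncomputable def MD.mk {L : GeomLat.{u}} (Γ : Diag L) : MD L :=
  Submodule.Quotient.mk (Finsupp.single Γ 1)


/-! ### The cooperads `MD` and `OS` and the morphism between them -/

open scoped Classical in
/-- The `GL`-cooperad `C` in cdgas is the one of modular diagrams: its underlying vector spaces are
identified with the spaces `MD L` by `e`, and its structure is given by the following formulas. -/
structure IsMDCooperad (C : GLCooperad.{u, u + 1}) (e : ∀ L : GeomLat.{u}, MD L ≃ₗ[ℚ] C.obj L) :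
    Prop where
  gr_eq : ∀ (L : GeomLat.{u}) (n : ℤ),
    (C.obj L).gr n = Submodule.span ℚ {x | ∃ Γ : Diag L, Γ.deg = n ∧ x = e L (MD.mk Γ)}
  one_eq : ∀ L : GeomLat.{u}, (1 : C.obj L) = e L (MD.mk (Diag.ofWord []))
  exists_pushout : ∀ (L : GeomLat.{u}) (Γ₁ Γ₂ : Diag L), ∃ Γ, Diag.IsPushout Γ₁ Γ₂ Γ
  mul_eq : ∀ (L : GeomLat.{u}) (Γ₁ Γ₂ Γ : Diag L), Diag.IsPushout Γ₁ Γ₂ Γ →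
    e L (MD.mk Γ₁) * e L (MD.mk Γ₂) = e L (MD.mk Γ)
  /-- `d Γ` is the alternating sum of the contractions at the contractible letters. (If `J` has a
  repeated letter, then the class of `Γ` is `0`.) -/
  d_eq : ∀ (L : GeomLat.{u}) (Γ : Diag L), Γ.J.Nodup →
    (C.obj L).d (e L (MD.mk Γ)) = ∑ i : Fin Γ.J.length,
      if h : Γ.IsContractible (Γ.J.get i) then
        (-1 : ℚ) ^ (i : ℕ) •
          e L (MD.mk (Γ.contract (Γ.J.get i) (Γ.atoms _ (List.get_mem Γ.J i)) h.2))
      else 0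
  map_eq : ∀ (L M : GeomLat.{u}) (φ : L ≃o M) (Γ : Diag M),
    C.map φ (e M (MD.mk Γ)) = e L (MD.mk (Γ.comp φ))
  Δ_eq : ∀ (L : GeomLat.{u}) (F : L) (hF : Proper F) (Γ : Diag L),
    C.Δ L F hF (e L (MD.mk Γ)) = ∑ᶠ F' : {F' : Γ.E // Γ.trace F' = F},
      shuffleSign (fun H => H ≤ F'.1) Γ.J •
        CDGA.tmul (e _ (MD.mk (Γ.below hF.1 F'.1 F'.2))) (e _ (MD.mk (Γ.above hF.2 F'.1 F'.2)))

/-- The `GL`-cooperad `D` in cdgas is the one of Orlik--Solomon algebras (with zero differential),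
identified with the algebras `OS L` by `e`. -/
structure IsOSCooperad (D : GLCooperad.{u, u}) (e : ∀ L : GeomLat.{u}, OS L ≃ₐ[ℚ] D.obj L) :
    Prop where
  gr_eq : ∀ (L : GeomLat.{u}) (n : ℤ), (D.obj L).gr n =
    Submodule.span ℚ {x | ∃ l : List (OS.At L), (l.length : ℤ) = n ∧ x = e L (OS.monomial l)}
  d_eq : ∀ (L : GeomLat.{u}) (x : D.obj L), (D.obj L).d x = 0
  map_eq : ∀ (L M : GeomLat.{u}) (φ : L ≃o M) (H : OS.At M),
    D.map φ (e M (OS.e H)) = e L (OS.e ⟨φ.symm H.1, (φ.symm.isAtom_iff H.1).2 H.2⟩)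
  Δ_of_le : ∀ (L : GeomLat.{u}) (F : L) (hF : Proper F) (H : OS.At L) (h : H.1 ≤ F),
    D.Δ L F hF (e L (OS.e H)) = CDGA.tmul (e _ (OS.e (OS.lowerAtom hF.1 H h))) 1
  Δ_of_not_le : ∀ (L : GeomLat.{u}) (F : L) (hF : Proper F) (H : OS.At L) (h : ¬ H.1 ≤ F),
    D.Δ L F hF (e L (OS.e H)) = CDGA.tmul 1 (e _ (OS.e (OS.upperAtom hF.2 H h)))

/-- The maps `I L` are the ones sending a diagram `(E, ι, J)` to `e_{ι⁻¹(J)}` if `ι` is an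
isomorphism onto `E`, and to `0` otherwise. -/
structure IsDiagramIntegral {C : GLCooperad.{u, u + 1}} {D : GLCooperad.{u, u}}
    (eC : ∀ L : GeomLat.{u}, MD L ≃ₗ[ℚ] C.obj L) (eD : ∀ L : GeomLat.{u}, OS L ≃ₐ[ℚ] D.obj L)
    (I : ∀ L : GeomLat.{u}, CDGA.Hom (C.obj L) (D.obj L)) : Prop where
  of_top : ∀ (L : GeomLat.{u}) (Γ : Diag L) (l : List (OS.At L)), Γ.top = ⊤ →
    Γ.J = l.map (fun H => Γ.ι H.1) → I L (eC L (MD.mk Γ)) = eD L (OS.monomial l)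
  of_ne_top : ∀ (L : GeomLat.{u}) (Γ : Diag L), Γ.top ≠ ⊤ → I L (eC L (MD.mk Γ)) = 0

/-! ### Ranks in geometric lattices -/

namespace GeomLat

section Rank

variable {L M : GeomLat.{u}}

/-! For a fixed extension (E, ι) the class of a diagram is an alternating function of its word. A
linear map out of `MD L` is therefore a function of diagrams which satisfies `IsInvariant`, a
convenient form of the five relations, and every structure map is obtained by checking this
condition. The main tool is the trace y ↦ ι⁻¹(y ∧ F_ι): modularity of F_ι gives trace (y ∨ ι t) =
trace y ∨ t and rk y - rk (trace y) = rk (y ∨ F_ι) - rk F_ι.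

Product: the trace identities show that the pushout has the rank function rk x + rk y - rk (trace
x), hence is geometric, and that (F, ⊤) is modular when F ≥ F_ι is. The witnesses of the relations
for one factor extend to the pushout by ⊤ or ⊥ in the other component (`isInvariant_push_left`).

Differential: contracting H and then K is the same as dividing by H ∨ K, which is symmetric
(`contr₂_symm`), while the signs are opposite; so d² = 0. The delicate relation is the fifth. If A
and B are the only letters outside the modular flat F, both contractions become [⊥, F] with the
additional letter F ∧ (A ∨ B), or both vanish, and they cancel (`contr_symm_two_outside`).

Coproduct: a diagram with a bridge vanishes (`wd_bridge`), because it comes from a product with the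
two-element lattice. This kills the terms where a flat F' separates two outer letters.
Coassociativity holds because both sides are sums over chains F₁' ≤ F₂'. For the differential
(`coprod_contr`), contracting a letter H not below F' in the upper factor gives the term of the flat
F' ∨ H in the coproduct of the contraction Γ / H. These flats are exactly the ones where H has
become a bridge of the lower factor, so that no lower contraction accounts for them.

Orlik–Solomon algebras: for every dependent word l both e_l and δ e_l vanish (`dependent`). By
submodularity the part of a dependent word below F or its part above F is dependent
(`rk_lsup_split`), so the coproduct respects the relations.

Integral: as the differential of the target is 0, boundaries must be sent to 0. A contraction
contributes only if F_ι is a hyperplane. The traces of the lines H ∨ K through letters outside this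
hyperplane then satisfy the Arnold relations, and the alternating sum vanishes by induction on the
length of the word (`arnoldSum_eq_zero`). -/

theorem covBy_sup_atom {x a : L} (ha : IsAtom a) (h : ¬ a ≤ x) : x ⋖ x ⊔ a := by
  have h0 : a ⊓ x = ⊥ := (ha.le_iff.1 inf_le_left).resolve_right fun h' => h (inf_eq_left.1 h')
  have h1 := IsUpperModularLattice.covBy_sup_of_inf_covBy (h0 ▸ ha.bot_covBy)
  rwa [sup_comm] at h1

theorem exists_atom_not_le {x y : L} (h : ¬ y ≤ x) : ∃ a, IsAtom a ∧ a ≤ y ∧ ¬ a ≤ x := by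
  obtain ⟨s, hs, ha⟩ := IsAtomistic.isLUB_atoms y
  by_contra hc
  push Not at hc
  exact h (hs.2 fun a has => hc a (ha a has) (hs.1 has))

theorem le_of_atoms {x y : L} (h : ∀ a, IsAtom a → a ≤ y → a ≤ x) : y ≤ x := by
  by_contra hc
  obtain ⟨a, ha, h1, h2⟩ := exists_atom_not_le hc
  exact h2 (h a ha h1)

theorem exists_atom_sup_eq {x y : L} (h : x ⋖ y) : ∃ a, IsAtom a ∧ ¬ a ≤ x ∧ x ⊔ a = y := by
  obtain ⟨a, ha, h1, h2⟩ := exists_atom_not_le h.lt.not_ge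
  refine ⟨a, ha, h2, ?_⟩
  exact (h.eq_or_eq le_sup_left (sup_le h.le h1)).resolve_left
    fun e => h2 (sup_eq_left.1 e)

theorem exists_covBy_le {x y : L} (h : x < y) : ∃ z, x ⋖ z ∧ z ≤ y := by
  obtain ⟨a, ha, h1, h2⟩ := exists_atom_not_le h.not_ge
  exact ⟨x ⊔ a, covBy_sup_atom ha h2, sup_le h.le h1⟩

theorem wf_lt : WellFounded ((· < ·) : L → L → Prop) := wellFounded_lt

theorem wf_gt : WellFounded ((· > ·) : L → L → Prop) := wellFounded_gt

/-- Saturated chains of length `n` from `x` to `y`. -/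
inductive Sat : ℕ → L → L → Prop
  | refl (x : L) : Sat 0 x x
  | step {n : ℕ} {x y z : L} (h : x ⋖ y) (h' : Sat n y z) : Sat (n + 1) x z

theorem Sat.le {n : ℕ} {x y : L} (h : Sat n x y) : x ≤ y := by
  induction h with
  | refl => exact le_rfl
  | step h _ ih => exact h.le.trans ih

theorem Sat.trans {m n : ℕ} {x y z : L} (h : Sat m x y) (h' : Sat n y z) : Sat (m + n) x z := by
  induction h with
  | refl => simpa using h'
  | step h _ ih =>
    rw [Nat.add_right_comm]
    exact Sat.step h (ih h')

theorem Sat.of_covBy {x y : L} (h : x ⋖ y) : Sat 1 x y := .step h (.refl y)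

/-- If z differs from the first step x' of the chain, then by semimodularity z ∨ x' covers both z
and x'. By induction the rest of the chain can be rerouted through z ∨ x', and then started at z.
This is the exchange behind the Jordan–Dedekind property. -/
theorem Sat.shorten {n : ℕ} {x y : L} (h : Sat n x y) :
    ∀ z, x ⋖ z → z ≤ y → ∃ m, n = m + 1 ∧ Sat m z y := by
  induction h with
  | refl x => intro z h1 h2; exact absurd h1.lt h2.not_gt
  | @step n x x' y h h' ih =>
    intro z h1 h2
    refine ⟨n, rfl, ?_⟩
    by_cases e : z = x'
    · exact e ▸ h'
    · have hz : ¬ z ≤ x' := fun hz => e ((h.eq_or_eq h1.le hz).resolve_left h1.lt.ne')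
      have hx' : ¬ x' ≤ z := fun hz => e ((h1.eq_or_eq h.le hz).resolve_left h.lt.ne').symm
      have hi : z ⊓ x' = x := (h1.eq_or_eq (le_inf h1.le h.le) inf_le_left).resolve_right
        fun e => hz (inf_eq_left.1 e)
      have c1 : x' ⋖ z ⊔ x' := IsUpperModularLattice.covBy_sup_of_inf_covBy (hi.symm ▸ h1)
      have c2 : z ⋖ z ⊔ x' := by
        rw [sup_comm]
        exact IsUpperModularLattice.covBy_sup_of_inf_covBy ((inf_comm z x' ▸ hi).symm ▸ h)
      obtain ⟨m, hm, hs⟩ := ih _ c1 (sup_le h2 h'.le)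
      rw [hm]
      exact Sat.step c2 hs

theorem Sat.unique {n : ℕ} {x y : L} (h : Sat n x y) : ∀ {m : ℕ}, Sat m x y → m = n := by
  induction h with
  | refl x =>
    intro m hm
    cases hm with
    | refl => rfl
    | step h h' => exact absurd h.lt h'.le.not_gt
  | @step n x x' y h h' ih =>
    intro m hm
    obtain ⟨k, hk, hs⟩ := hm.shorten x' h h'.le
    rw [hk, ih hs]

theorem exists_sat {x y : L} (h : x ≤ y) : ∃ n, Sat n x y := by
  induction x using wf_gt.induction with
  | _ x ih =>
    rcases h.eq_or_lt with rfl | h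
    · exact ⟨0, .refl x⟩
    · obtain ⟨z, h1, h2⟩ := exists_covBy_le h
      obtain ⟨n, hn⟩ := ih z h1.lt h2
      exact ⟨n + 1, .step h1 hn⟩

theorem Sat.height_add_le {n : ℕ} {x y : L} (h : Sat n x y) :
    Order.height x + n ≤ Order.height y := by
  induction h with
  | refl => simp
  | @step n x x' y h h' ih =>
    refine le_trans ?_ ih
    rw [Nat.cast_add, Nat.cast_one, add_comm (n : ℕ∞) 1, ← add_assoc]
    gcongr
    exact Order.height_add_one_le h.lt

theorem Sat.rk_eq {n : ℕ} {x : L} (h : Sat n ⊥ x) : rk x = n := by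
  have key : Order.height x = n := by
    apply le_antisymm
    -- By uniqueness the length r of a saturated chain from ⊥ is a strictly monotone function, so it
    -- bounds the height.
    · choose r hr using fun x : L => exists_sat (bot_le (a := x))
      have mono : StrictMono r := by
        intro a b hab
        obtain ⟨k, hk⟩ := exists_sat hab.le
        have := (hr b).unique ((hr a).trans hk)
        cases hk with
        | refl => exact absurd rfl hab.ne
        | step => omega
      have := Order.height_le_height_apply_of_strictMono r mono x
      rw [(hr x).unique h]
      simpa using this
    · simpa using h.height_add_le
  simp [rk, key]

theorem rk_bot : rk (⊥ : L) = 0 := by simp [rk]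

theorem Sat.rk_sub {n : ℕ} {x y : L} (h : Sat n x y) : rk y = rk x + n := by
  obtain ⟨m, hm⟩ := exists_sat (bot_le (a := x))
  rw [(hm.trans h).rk_eq, hm.rk_eq]
  push_cast
  ring

theorem rk_covBy {x y : L} (h : x ⋖ y) : rk y = rk x + 1 := by
  simpa using (Sat.of_covBy h).rk_sub

theorem rk_lt {x y : L} (h : x < y) : rk x < rk y := by
  obtain ⟨n, hn⟩ := exists_sat h.le
  rw [hn.rk_sub]
  cases hn with
  | refl => exact absurd rfl h.ne
  | step => push_cast; omega

theorem rk_mono {x y : L} (h : x ≤ y) : rk x ≤ rk y := by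
  rcases h.eq_or_lt with rfl | h
  · exact le_rfl
  · exact (rk_lt h).le

theorem eq_of_le_of_rk_le {x y : L} (h : x ≤ y) (hr : rk y ≤ rk x) : x = y := by
  by_contra hne
  exact (rk_lt (lt_of_le_of_ne h hne)).not_ge hr

theorem rk_nonneg (x : L) : 0 ≤ rk x := by simp [rk]

theorem rk_atom {a : L} (h : IsAtom a) : rk a = 1 := by
  rw [rk_covBy h.bot_covBy, rk_bot, zero_add]

theorem rk_sup_atom_le (x : L) {a : L} (h : IsAtom a) : rk (x ⊔ a) ≤ rk x + 1 := by
  by_cases hx : a ≤ x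
  · rw [sup_eq_left.2 hx]; omega
  · rw [rk_covBy (covBy_sup_atom h hx)]

/-- Induction on flats by adjoining atoms. -/
theorem atom_induction {p : L → Prop} (h0 : p ⊥)
    (h : ∀ x a, IsAtom a → ¬ a ≤ x → p x → p (x ⊔ a)) (x : L) : p x := by
  induction x using wf_lt.induction with
  | _ x ih =>
    by_cases hx : x = ⊥
    · rw [hx]; exact h0
    · obtain ⟨z, hz⟩ := exists_le_covBy_of_lt (bot_lt_iff_ne_bot.2 hx)
      obtain ⟨a, ha, h1, rfl⟩ := exists_atom_sup_eq hz.2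
      exact h z a ha h1 (ih z hz.2.lt)

/-- The rank function is determined by its value at `⊥` and its increments along covers. -/
theorem rk_unique {r : L → ℤ} (h0 : r ⊥ = 0)
    (h : ∀ x a, IsAtom a → ¬ a ≤ x → r (x ⊔ a) = r x + 1) (x : L) : rk x = r x := by
  refine atom_induction (p := fun x => rk x = r x) (by rw [rk_bot, h0]) ?_ x
  intro x a ha hx ih
  rw [h x a ha hx, ← ih, rk_covBy (covBy_sup_atom ha hx)]

theorem sup_atom_induction {x : L} {p : L → Prop} (h0 : p x)
    (h : ∀ y a, x ≤ y → IsAtom a → ¬ a ≤ y → p y → p (y ⊔ a)) {y : L} (hy : x ≤ y) : p y := by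
  induction y using wf_lt.induction with
  | _ y ih =>
    rcases hy.eq_or_lt with rfl | hlt
    · exact h0
    · obtain ⟨z, hxz, hz⟩ := exists_le_covBy_of_lt hlt
      obtain ⟨a, ha, h1, rfl⟩ := exists_atom_sup_eq hz
      exact h z a hxz ha h1 (ih z hz.lt hxz)

/-- Submodularity of the rank. -/
theorem rk_inf_add_rk_sup_le (x y : L) : rk (x ⊓ y) + rk (x ⊔ y) ≤ rk x + rk y := by
  have key : rk (x ⊔ y) - rk x ≤ rk y - rk (x ⊓ y) := by
    refine sup_atom_induction (x := x ⊓ y)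
      (p := fun z => rk (x ⊔ z) - rk x ≤ rk z - rk (x ⊓ y)) ?_ ?_ inf_le_right
    · rw [sup_inf_self]; omega
    · intro z a _ ha hz ih
      have := rk_sup_atom_le (x ⊔ z) ha
      rw [sup_assoc] at this
      rw [rk_covBy (covBy_sup_atom ha hz)]
      omega
  omega

/-- Climb from F ∧ x to F by adding atoms. Each atom strictly enlarges the join with x, since
otherwise it would lie in F ∧ (z ∨ x) = z ∨ (F ∧ x) = z. This gives the inequality opposite to
submodularity. -/
theorem rk_add_of_isModularElt {F : L} (hF : IsModularElt F) (x : L) :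
    rk (F ⊓ x) + rk (F ⊔ x) = rk F + rk x := by
  apply le_antisymm (rk_inf_add_rk_sup_le F x)
  have key : rk F - rk (F ⊓ x) ≤ rk (F ⊔ x) - rk x := by
    refine sup_atom_induction (x := F ⊓ x)
      (p := fun z => z ≤ F → rk z - rk (F ⊓ x) ≤ rk (z ⊔ x) - rk x) ?_ ?_ inf_le_left le_rfl
    · intro _
      rw [sup_eq_right.2 (inf_le_right : F ⊓ x ≤ x)]; omega
    · intro z a hxz ha hz ih hF'
      have h1 := ih (le_sup_left.trans hF')
      have hlt : rk (z ⊔ x) < rk (z ⊔ a ⊔ x) := by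
        apply rk_lt
        refine lt_of_le_of_ne (sup_le_sup_right le_sup_left _) fun e => hz ?_
        have h2 : a ≤ F ⊓ (z ⊔ x) := by
          rw [e]; exact le_inf (le_sup_right.trans hF') (le_sup_right.trans le_sup_left)
        rw [hF.1 z x (le_sup_left.trans hF')] at h2
        exact h2.trans (sup_le le_rfl hxz)
      rw [rk_covBy (covBy_sup_atom ha hz)]
      omega
  omega

theorem isAtom_lower {F : L} (hF : F ≠ ⊥) {x : L.lower F hF} : IsAtom x ↔ IsAtom x.1 :=
  ⟨fun h => h.of_isAtom_coe_Iic, fun h => h.Iic x.2⟩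

theorem rk_lower {F : L} (hF : F ≠ ⊥) (x : L.lower F hF) : rk x = rk x.1 := by
  refine rk_unique (r := fun x : L.lower F hF => rk x.1) rk_bot ?_ x
  intro x a ha hx
  exact rk_covBy (covBy_sup_atom ((isAtom_lower hF).1 ha) hx)

theorem rk_upper {F : L} (hF : F ≠ ⊤) (x : L.upper F hF) : rk x = rk x.1 - rk F := by
  refine rk_unique (r := fun x : L.upper F hF => rk x.1 - rk F) (sub_self _) ?_ x
  intro x a ha hx
  have h : x ⋖ x ⊔ a := covBy_sup_atom ha hx
  have h' : x.1 ⋖ (x ⊔ a).1 :=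
    ⟨h.lt, fun c h1 h2 => h.2 (c := (⟨c, x.2.trans h1.le⟩ : Set.Ici F)) h1 h2⟩
  change rk (x ⊔ a).1 - rk F = rk x.1 - rk F + 1
  rw [rk_covBy h']
  ring

end Rank

end GeomLat

/-! ### Embeddings preserve bottom and ranks. -/

namespace IsEmbedding

variable {L M N : GeomLat.{u}} {φ : L → M}

/-- Injectivity puts φ ⊥ strictly below φ a for any atom a, and φ a is an atom. -/
theorem map_bot (h : IsEmbedding φ) : φ ⊥ = ⊥ := by
  obtain ⟨a, ha, -⟩ := exists_atom_not_le (L := L) (x := ⊥) (y := ⊤) (by simp)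
  have h1 := h.map_atom a ha
  exact h1.2 _ (lt_of_le_of_ne (h.monotone bot_le) fun e => ha.1 (h.injective e).symm)

theorem rk_map (h : IsEmbedding φ) (x : L) : rk (φ x) = rk x := by
  refine (rk_unique (r := fun x => rk (φ x)) (by simp only [h.map_bot, rk_bot]) ?_ x).symm
  intro x a ha hx
  simp only [h.map_sup]
  exact rk_covBy (covBy_sup_atom (h.map_atom a ha) fun e => hx (h.le_iff.1 e))

/-- Turns the equality of ranks in the embedding relation into φ ⊤ = ⊤, the form in which it is
used. -/
theorem map_top_iff (h : IsEmbedding φ) : φ ⊤ = ⊤ ↔ rk (⊤ : L) = rk (⊤ : M) := by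
  constructor
  · intro e; rw [← e, h.rk_map]
  · intro e
    exact eq_of_le_of_rk_le le_top (by rw [h.rk_map, e])

theorem of_orderIso (e : L ≃o M) : IsEmbedding e :=
  ⟨e.injective, e.map_sup, fun a ha => (e.isAtom_iff a).2 ha⟩

end IsEmbedding

/-! ### Alternating functions of words and alternating sums -/

section Words

variable {α : Type*} {β : Type*} {γ : Type*} {M : Type*} {N : Type*} [AddCommGroup M]
  [AddCommGroup N]

/-- Functions of words which change sign when two adjacent letters are exchanged. -/
def IsAlt (f : List α → M) : Prop :=
  ∀ l₁ l₂ a b, f (l₁ ++ a :: b :: l₂) = -f (l₁ ++ b :: a :: l₂)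

namespace IsAlt

variable {f : List α → M}

theorem append_left (hf : IsAlt f) (l : List α) : IsAlt fun l' => f (l ++ l') := by
  intro l₁ l₂ a b
  simp only [← List.append_assoc]
  exact hf _ _ _ _

theorem append_right (hf : IsAlt f) (l : List α) : IsAlt fun l' => f (l' ++ l) := by
  intro l₁ l₂ a b
  simpa only [List.append_assoc, List.cons_append] using hf l₁ (l₂ ++ l) a b

theorem cons (hf : IsAlt f) (a : α) : IsAlt fun l => f (a :: l) := hf.append_left [a]

theorem map (hf : IsAlt f) (g : β → α) : IsAlt fun l => f (l.map g) := by
  intro l₁ l₂ a b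
  simpa using hf (l₁.map g) (l₂.map g) (g a) (g b)

theorem comp_hom (hf : IsAlt f) (φ : M →+ N) : IsAlt fun l => φ (f l) := fun l₁ l₂ a b => by
  simp only [hf l₁ l₂ a b, map_neg]

theorem move (hf : IsAlt f) (l₁ l₂ : List α) (a : α) :
    f (l₁ ++ a :: l₂) = (-1 : ℤ) ^ l₁.length • f (a :: (l₁ ++ l₂)) := by
  induction l₁ generalizing f with
  | nil => simp
  | cons b l ih =>
    have h1 := ih (hf.cons b)
    have h2 := hf [] (l ++ l₂) b a
    simp only [List.nil_append] at h2
    simp only [List.cons_append]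
    rw [h1, h2, List.length_cons, pow_succ, mul_neg_one, neg_smul, smul_neg]

theorem swap (hf : IsAlt f) (l₁ l₂ l₃ : List α) (a b : α) :
    f (l₁ ++ a :: l₂ ++ b :: l₃) = -f (l₁ ++ b :: l₂ ++ a :: l₃) := by
  have h1 := (hf.append_left (l₁ ++ [a])).move l₂ l₃ b
  have h2 := (hf.append_left (l₁ ++ [b])).move l₂ l₃ a
  simp only [List.append_assoc, List.cons_append, List.nil_append] at h1 h2 ⊢
  rw [h1, h2, hf l₁ _ a b, smul_neg]

theorem perm (hf : IsAlt f) {l l' : List α} (h : l.Perm l') : f l = f l' ∨ f l = -f l' := by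
  induction h generalizing f with
  | nil => exact Or.inl rfl
  | cons a _ ih => exact ih (hf.cons a)
  | swap a b l => exact Or.inr (hf [] l b a)
  | trans _ _ ih1 ih2 =>
    rcases ih1 hf with h1 | h1 <;> rcases ih2 hf with h2 | h2 <;> simp [h1, h2]

theorem perm_eq_zero (hf : IsAlt f) {l l' : List α} (h : l.Perm l') (h0 : f l' = 0) : f l = 0 := by
  rcases hf.perm h with h | h <;> simp [h, h0]

/-- Bring two equal letters to the front: exchanging them gives f l = -f l, and there is no
2-torsion over ℚ. -/
theorem of_dup [Module ℚ M] (hf : IsAlt f) {l : List α} (h : ¬ l.Nodup) : f l = 0 := by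
  obtain ⟨a, ha⟩ : ∃ a, List.Sublist [a, a] l := by
    by_contra hc
    push Not at hc
    exact h (List.nodup_iff_sublist.2 hc)
  obtain ⟨l', hl⟩ := ha.exists_perm_append
  refine hf.perm_eq_zero hl ?_
  have := hf [] l' a a
  have hM : IsAddTorsionFree M := .of_module_rat M
  exact self_eq_neg.1 this

theorem append_comm (hf : IsAlt f) (l₁ l₂ : List α) :
    f (l₁ ++ l₂) = (-1 : ℤ) ^ (l₁.length * l₂.length) • f (l₂ ++ l₁) := by
  induction l₁ generalizing f with
  | nil => simp
  | cons a l ih =>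
    have h1 := ih (hf.cons a)
    have h2 := hf.move l₂ l a
    rw [List.cons_append, h1, h2, smul_smul, List.length_cons]
    rw [add_mul, one_mul, pow_add, mul_assoc, ← mul_pow]
    simp

end IsAlt

/-- The alternating sum `∑ i, (-1) ^ i c(l i, l \ l i)`. -/
def altSum : List α → (α → List α → M) → M
  | [], _ => 0
  | a :: l, c => c a l - altSum l fun b l' => c b (a :: l')

/-- Only the rearrangements a :: l' of l have to be tested, so that facts about the letters of l,
such as being atoms, can be used in each term. -/
theorem altSum_congr {l : List α} {c c' : α → List α → M}
    (h : ∀ a l', (a :: l').Perm l → c a l' = c' a l') : altSum l c = altSum l c' := by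
  induction l generalizing c c' with
  | nil => rfl
  | cons a l ih =>
    rw [altSum, altSum, h a l (List.Perm.refl _)]
    congr 1
    exact ih fun b l' hb => h b _ ((List.Perm.swap a b l').trans (hb.cons a))

theorem altSum_zero (l : List α) : altSum l (fun _ _ => (0 : M)) = 0 := by
  induction l with
  | nil => rfl
  | cons a l ih => rw [altSum, ih, sub_zero]

theorem altSum_eq_zero {l : List α} {c : α → List α → M}
    (h : ∀ a l', (a :: l').Perm l → c a l' = 0) : altSum l c = 0 :=
  (altSum_congr h).trans (altSum_zero l)

theorem altSum_add (l : List α) (c c' : α → List α → M) :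
    altSum l (fun a l' => c a l' + c' a l') = altSum l c + altSum l c' := by
  induction l generalizing c c' with
  | nil => simp [altSum]
  | cons a l ih => simp only [altSum, ih]; abel

theorem altSum_hom (φ : M →+ N) (l : List α) (c : α → List α → M) :
    altSum l (fun a l' => φ (c a l')) = φ (altSum l c) := by
  induction l generalizing c with
  | nil => simp [altSum]
  | cons a l ih => simp only [altSum, ih, map_sub]

theorem altSum_neg (l : List α) (c : α → List α → M) :
    altSum l (fun a l' => -c a l') = -altSum l c :=
  altSum_hom (negAddMonoidHom : M →+ M) l c

theorem altSum_smul (n : ℤ) (l : List α) (c : α → List α → M) :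
    altSum l (fun a l' => n • c a l') = n • altSum l c :=
  altSum_hom (zsmulAddGroupHom n : M →+ M) l c

theorem altSum_sum {ι : Type*} (s : Finset ι) (l : List α) (c : ι → α → List α → M) :
    altSum l (fun a l' => ∑ i ∈ s, c i a l') = ∑ i ∈ s, altSum l (c i) := by
  classical
  induction s using Finset.induction_on with
  | empty => simpa using altSum_zero l
  | insert i s hi ih => simp only [Finset.sum_insert hi, altSum_add, ih]

theorem altSum_map (g : β → α) (l : List β) (c : α → List α → M) :
    altSum (l.map g) c = altSum l fun b l' => c (g b) (l'.map g) := by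
  induction l generalizing c with
  | nil => rfl
  | cons a l ih => simp only [List.map_cons, altSum, ih]

theorem altSum_append (l₁ l₂ : List α) (c : α → List α → M) :
    altSum (l₁ ++ l₂) c = altSum l₁ (fun a l => c a (l ++ l₂)) +
      (-1 : ℤ) ^ l₁.length • altSum l₂ fun a l => c a (l₁ ++ l) := by
  induction l₁ generalizing c with
  | nil => simp [altSum]
  | cons a l ih =>
    simp only [List.cons_append, altSum, ih, List.length_cons, pow_succ, mul_neg_one, neg_smul]
    abel

/-- An exchange of adjacent letters a and b exchanges the terms which remove a and b, whose signs
are opposite, and negates every other term. -/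
theorem isAlt_altSum {c : α → List α → M} (h : ∀ a, IsAlt (c a)) :
    IsAlt fun l => altSum l c := by
  intro l₁ l₂ a b
  induction l₁ generalizing c with
  | nil =>
    have : altSum l₂ (fun x l' => c x (a :: b :: l')) =
        -altSum l₂ (fun x l' => c x (b :: a :: l')) := by
      rw [← altSum_neg]
      exact altSum_congr fun x l' _ => h x [] l' a b
    simp only [List.nil_append, altSum, this]
    abel
  | cons x l ih =>
    have := ih (c := fun y l' => c y (x :: l')) fun y => (h y).cons x
    simp only [List.cons_append, altSum, this, h x l l₂ a b]
    abel

/-- The usual reason for d² = 0: removing a and then b comes with the sign opposite to that of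
removing b and then a. -/
theorem altSum_altSum {l : List α} {c : α → α → List α → M}
    (h : ∀ a b l', (a :: b :: l').Perm l → c a b l' = c b a l') :
    altSum l (fun a l' => altSum l' (c a)) = 0 := by
  induction l generalizing c with
  | nil => rfl
  | cons x l ih =>
    have h1 : altSum l (fun a l' => altSum l' fun b l'' => c a b (x :: l'')) = 0 := by
      refine ih fun a b l' hl => h a b _ ?_
      exact (List.perm_middle (l₁ := [a, b])).trans (hl.cons x)
    have h2 : altSum l (fun a l' => c a x l') = altSum l (c x) :=
      altSum_congr fun a l' hl => h a x l' ((List.Perm.swap x a l').trans (hl.cons x))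
    simp only [altSum, sub_eq_add_neg, altSum_add, altSum_neg, h1, h2]
    abel

theorem altSum_eq_sum [Module ℚ M] (l : List α) (c : α → List α → M) :
    altSum l c = ∑ i : Fin l.length, (-1 : ℚ) ^ (i : ℕ) • c (l.get i) (l.eraseIdx i) := by
  induction l generalizing c with
  | nil => simp [altSum]
  | cons a l ih =>
    rw [altSum, ih]
    simp only [List.length_cons]
    rw [Fin.sum_univ_succ, sub_eq_add_neg, ← Finset.sum_neg_distrib]
    simp [pow_succ]

open scoped Classical in
theorem shuffleSign_append (p : α → Prop) (l₁ l₂ : List α) :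
    shuffleSign p (l₁ ++ l₂) = shuffleSign p l₁ * shuffleSign p l₂ *
      (-1) ^ (l₁.countP (fun b => ¬ p b) * l₂.countP (fun b => p b)) := by
  induction l₁ with
  | nil => simp [shuffleSign]
  | cons a l ih =>
    simp only [List.cons_append, shuffleSign, ih, List.countP_append]
    by_cases h : p a
    · simp [h]
    · simp only [h, if_false, not_false_eq_true, decide_true, List.countP_cons_of_pos, add_mul,
        one_mul, pow_add]
      ring

theorem shuffleSign_congr {p q : α → Prop} {l : List α} (h : ∀ a ∈ l, (p a ↔ q a)) :
    shuffleSign p l = shuffleSign q l := by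
  classical
  induction l with
  | nil => rfl
  | cons a l ih =>
    have e : l.countP (fun b => decide (p b)) = l.countP (fun b => decide (q b)) :=
      List.countP_congr fun b hb => by simp [h b (List.mem_cons_of_mem a hb)]
    simp only [shuffleSign, ih fun b hb => h b (List.mem_cons_of_mem a hb)]
    congr 1
    by_cases ha : p a
    · rw [if_pos ha, if_pos ((h a (by simp)).1 ha)]
    · rw [if_neg ha, if_neg fun hq => ha ((h a (by simp)).2 hq)]
      congr 1

theorem shuffleSign_map (p : α → Prop) (g : β → α) (l : List β) :
    shuffleSign p (l.map g) = shuffleSign (fun b => p (g b)) l := by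
  induction l with
  | nil => rfl
  | cons a l ih => simp [shuffleSign, ih, List.countP_map, Function.comp_def]

/-- `g₁` and `g₂` are defined on the letters satisfying, resp. not satisfying, `p`. -/
structure IsSplitting (p : α → Prop) (g₁ : α → Option β) (g₂ : α → Option γ) : Prop where
  pos : ∀ a, p a → (∃ b, g₁ a = some b) ∧ g₂ a = none
  neg : ∀ a, ¬ p a → g₁ a = none ∧ ∃ c, g₂ a = some c

theorem shuffleSign_cons_of_pos {p : α → Prop} {a : α} (ha : p a) (l : List α) :
    shuffleSign p (a :: l) = shuffleSign p l := by
  rw [shuffleSign, if_pos ha, one_mul]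

namespace IsSplitting

variable {p : α → Prop} {g₁ : α → Option β} {g₂ : α → Option γ}

open scoped Classical in
theorem length_filterMap_left (h : IsSplitting p g₁ g₂) (l : List α) :
    (l.filterMap g₁).length = l.countP fun a => p a := by
  induction l with
  | nil => rfl
  | cons a l ih =>
    by_cases ha : p a
    · obtain ⟨⟨b, hb⟩, hc⟩ := h.pos a ha
      simp [hb, ha, ih]
    · simp [(h.neg a ha).1, ha, ih]

open scoped Classical in
theorem length_filterMap_right (h : IsSplitting p g₁ g₂) (l : List α) :
    (l.filterMap g₂).length = l.countP fun a => ¬ p a := by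
  induction l with
  | nil => rfl
  | cons a l ih =>
    by_cases ha : p a
    · simp [(h.pos a ha).2, ha, ih]
    · obtain ⟨hc, b, hb⟩ := h.neg a ha
      simp [hb, ha, ih]

theorem length_add (h : IsSplitting p g₁ g₂) (l : List α) :
    (l.filterMap g₁).length + (l.filterMap g₂).length = l.length := by
  classical
  rw [h.length_filterMap_left, h.length_filterMap_right]
  induction l with
  | nil => rfl
  | cons a l ih => by_cases ha : p a <;> simp [ha] at ih ⊢ <;> omega

theorem shuffleSign_append' (h : IsSplitting p g₁ g₂) (l₁ l₂ : List α) :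
    shuffleSign p (l₁ ++ l₂) = shuffleSign p l₁ * shuffleSign p l₂ *
      (-1) ^ ((l₁.filterMap g₂).length * (l₂.filterMap g₁).length) := by
  classical
  rw [h.length_filterMap_left, h.length_filterMap_right]
  exact shuffleSign_append p l₁ l₂

theorem shuffleSign_cons_of_neg (h : IsSplitting p g₁ g₂) {a : α} (ha : ¬ p a) (l : List α) :
    shuffleSign p (a :: l) = (-1) ^ (l.filterMap g₁).length * shuffleSign p l := by
  classical
  rw [h.length_filterMap_left, shuffleSign, if_neg ha]

/-- Two adjacent letters of the same group are adjacent in their subword and do not affect the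
shuffle sign; two letters of different groups leave both subwords unchanged and flip the shuffle
sign. -/
theorem isAlt (h : IsSplitting p g₁ g₂) {T : List β → List γ → M}
    (h₁ : ∀ l, IsAlt fun l' => T l' l) (h₂ : ∀ l, IsAlt (T l)) :
    IsAlt fun l => shuffleSign p l • T (l.filterMap g₁) (l.filterMap g₂) := by
  intro l₁ l₂ a b
  have e : ∀ a b, ((a :: b :: l₂).filterMap g₁).length = ((b :: a :: l₂).filterMap g₁).length := by
    intro a b
    exact ((List.Perm.swap b a l₂).filterMap g₁).length_eq
  simp only [h.shuffleSign_append' l₁, e a b, List.filterMap_append]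
  -- The prefix l₁ contributes a sign which only involves the number of selected letters behind it,
  -- and this number is the same for both words.
  suffices hs : shuffleSign p (a :: b :: l₂) •
      T (l₁.filterMap g₁ ++ (a :: b :: l₂).filterMap g₁)
        (l₁.filterMap g₂ ++ (a :: b :: l₂).filterMap g₂) =
      -(shuffleSign p (b :: a :: l₂) • T (l₁.filterMap g₁ ++ (b :: a :: l₂).filterMap g₁)
        (l₁.filterMap g₂ ++ (b :: a :: l₂).filterMap g₂)) by
    have := congrArg (fun x => (shuffleSign p l₁ *
      (-1) ^ ((l₁.filterMap g₂).length * ((b :: a :: l₂).filterMap g₁).length)) • x) hs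
    simp only [smul_smul, smul_neg] at this
    convert this using 2 <;> ring_nf
  by_cases ha : p a <;> by_cases hb : p b
  · obtain ⟨⟨a', ha1⟩, ha2⟩ := h.pos a ha
    obtain ⟨⟨b', hb1⟩, hb2⟩ := h.pos b hb
    simp only [shuffleSign, ha, hb, if_true, one_mul, List.filterMap_cons, ha1, ha2, hb1, hb2]
    rw [← smul_neg]
    exact congrArg _ (h₁ _ _ _ a' b')
  · obtain ⟨⟨a', ha1⟩, ha2⟩ := h.pos a ha
    obtain ⟨hb1, b', hb2⟩ := h.neg b hb
    rw [shuffleSign_cons_of_pos ha, h.shuffleSign_cons_of_neg hb, h.shuffleSign_cons_of_neg hb,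
      shuffleSign_cons_of_pos ha]
    simp only [List.filterMap_cons, ha1, ha2, hb1, hb2, List.length_cons, pow_succ, mul_neg_one,
      neg_mul, neg_smul, neg_neg]
  · obtain ⟨ha1, a', ha2⟩ := h.neg a ha
    obtain ⟨⟨b', hb1⟩, hb2⟩ := h.pos b hb
    rw [shuffleSign_cons_of_pos hb, h.shuffleSign_cons_of_neg ha, h.shuffleSign_cons_of_neg ha,
      shuffleSign_cons_of_pos hb]
    simp only [List.filterMap_cons, ha1, ha2, hb1, hb2, List.length_cons, pow_succ, mul_neg_one,
      neg_mul, neg_smul]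
  · obtain ⟨ha1, a', ha2⟩ := h.neg a ha
    obtain ⟨hb1, b', hb2⟩ := h.neg b hb
    rw [h.shuffleSign_cons_of_neg ha, h.shuffleSign_cons_of_neg hb, h.shuffleSign_cons_of_neg hb,
      h.shuffleSign_cons_of_neg ha]
    simp only [List.filterMap_cons, ha1, ha2, hb1, hb2]
    rw [h₂ _ _ _ a' b', smul_neg]

/-- Together with `altSum_right` this is the sign bookkeeping for the differential of a tensor
product: removing a letter from a subword amounts to removing it from the whole word, with the
Koszul sign (-1) to the length of the first subword when the letter belongs to the second one. -/
theorem altSum_left (h : IsSplitting p g₁ g₂) (J : List α) (g : β → List β → List γ → M) :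
    shuffleSign p J • altSum (J.filterMap g₁) (fun H l => g H l (J.filterMap g₂)) =
      altSum J fun H l => (g₁ H).elim 0 fun H' =>
        shuffleSign p l • g H' (l.filterMap g₁) (l.filterMap g₂) := by
  induction J generalizing g with
  | nil => simp [altSum]
  | cons a l ih =>
    by_cases ha : p a
    · obtain ⟨⟨a', ha1⟩, ha2⟩ := h.pos a ha
      simp only [altSum, List.filterMap_cons, ha1, ha2, shuffleSign, ha, if_true, one_mul, smul_sub]
      rw [ih (fun H l₁ l₂ => g H (a' :: l₁) l₂)]
      rfl
    · obtain ⟨ha1, a', ha2⟩ := h.neg a ha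
      rw [h.shuffleSign_cons_of_neg ha]
      simp only [altSum, List.filterMap_cons, ha1, ha2]
      rw [mul_smul, ih (fun H l₁ l₂ => g H l₁ (a' :: l₂)), ← altSum_smul, Option.elim_none,
        zero_sub, ← altSum_neg]
      refine altSum_congr fun H l' hl => ?_
      by_cases hH : p H
      · obtain ⟨⟨H', hH1⟩, hH2⟩ := h.pos H hH
        have e : (l.filterMap g₁).length = (l'.filterMap g₁).length + 1 := by
          rw [← (hl.filterMap g₁).length_eq]; simp [hH1]
        rw [hH1, Option.elim_some, Option.elim_some, h.shuffleSign_cons_of_neg ha, e, smul_smul,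
          pow_succ, ← neg_smul]
        congr 1
        ring
      · simp [(h.neg H hH).1]

theorem altSum_right (h : IsSplitting p g₁ g₂) (J : List α) (g : γ → List β → List γ → M) :
    (shuffleSign p J * (-1) ^ (J.filterMap g₁).length) •
        altSum (J.filterMap g₂) (fun H l => g H (J.filterMap g₁) l) =
      altSum J fun H l => (g₂ H).elim 0 fun H' =>
        shuffleSign p l • g H' (l.filterMap g₁) (l.filterMap g₂) := by
  induction J generalizing g with
  | nil => simp [altSum]
  | cons a l ih =>
    by_cases ha : p a
    · obtain ⟨⟨a', ha1⟩, ha2⟩ := h.pos a ha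
      simp only [altSum, List.filterMap_cons, ha1, ha2, shuffleSign, ha, if_true, one_mul,
        List.length_cons, pow_succ, mul_neg, mul_one, neg_smul]
      rw [ih (fun H l₁ l₂ => g H (a' :: l₁) l₂), Option.elim_none, zero_sub]
    · obtain ⟨ha1, a', ha2⟩ := h.neg a ha
      rw [h.shuffleSign_cons_of_neg ha]
      simp only [altSum, List.filterMap_cons, ha1, ha2, Option.elim_some]
      have e : (-1 : ℤ) ^ (l.filterMap g₁).length * shuffleSign p l *
          (-1) ^ (l.filterMap g₁).length = shuffleSign p l := by
        rw [mul_right_comm, ← mul_pow]; simp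
      rw [e, smul_sub]
      congr 1
      have e' : shuffleSign p l = (-1 : ℤ) ^ (l.filterMap g₁).length *
          (shuffleSign p l * (-1) ^ (l.filterMap g₁).length) := by
        rw [mul_left_comm, ← mul_pow]; simp
      rw [e', mul_smul, ih (fun H l₁ l₂ => g H l₁ (a' :: l₂)), ← altSum_smul]
      refine altSum_congr fun H l' hl => ?_
      by_cases hH : p H
      · simp [(h.pos H hH).2]
      · obtain ⟨hH1, H', hH2⟩ := h.neg H hH
        have e : (l.filterMap g₁).length = (l'.filterMap g₁).length := by
          rw [← (hl.filterMap g₁).length_eq]; simp [hH1]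
        rw [hH2, Option.elim_some, Option.elim_some, h.shuffleSign_cons_of_neg ha, e, smul_smul]

end IsSplitting

/-- Both sides are the sign of sorting the word into three blocks: the letters satisfying p₁, those
satisfying p₂ but not p₁, and the rest. -/
theorem shuffleSign_coassoc {p₁ p₂ : α → Prop} {g₁ : α → Option β} {g₂ : α → Option γ}
    {q₁ : β → Prop} {q₂ : γ → Prop} (hp : ∀ a, p₁ a → p₂ a)
    (h1 : ∀ a, p₂ a → ∃ b, g₁ a = some b ∧ (q₁ b ↔ p₁ a)) (h1' : ∀ a, ¬ p₂ a → g₁ a = none)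
    (h2 : ∀ a, ¬ p₁ a → ∃ c, g₂ a = some c ∧ (q₂ c ↔ p₂ a)) (h2' : ∀ a, p₁ a → g₂ a = none)
    (l : List α) :
    shuffleSign p₂ l * shuffleSign q₁ (l.filterMap g₁) =
      shuffleSign p₁ l * shuffleSign q₂ (l.filterMap g₂) := by
  classical
  have c1 : ∀ l : List α, (l.filterMap g₁).countP (fun b => decide (q₁ b)) =
      l.countP fun a => decide (p₁ a) := by
    intro l
    induction l with
    | nil => rfl
    | cons a l ih =>
      by_cases ha : p₂ a
      · obtain ⟨b, hb, hq⟩ := h1 a ha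
        simp [hb, hq, List.countP_cons, ih]
      · have hn : ¬ p₁ a := fun h => ha (hp a h)
        simp [h1' a ha, hn, ih]
  have c2 : ∀ l : List α, l.countP (fun a => decide (p₂ a)) =
      l.countP (fun a => decide (p₁ a)) + (l.filterMap g₂).countP fun b => decide (q₂ b) := by
    intro l
    induction l with
    | nil => rfl
    | cons a l ih =>
      by_cases ha : p₁ a
      · simp [h2' a ha, ha, hp a ha, ih]; omega
      · obtain ⟨b, hb, hq⟩ := h2 a ha
        simp [hb, hq, ha, List.countP_cons, ih]; omega
  induction l with
  | nil => rfl
  | cons a l ih =>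
    by_cases ha : p₁ a
    · obtain ⟨b, hb, hq⟩ := h1 a (hp a ha)
      simp [shuffleSign, ha, hp a ha, hb, hq, h2' a ha, ih]
    · obtain ⟨c, hc, hq⟩ := h2 a ha
      by_cases ha2 : p₂ a
      · obtain ⟨b, hb, hq1⟩ := h1 a ha2
        simp only [shuffleSign, ha, ha2, hb, hq1, hq, hc, List.filterMap_cons, if_true, if_false,
          one_mul, c1]
        rw [mul_left_comm, ih, mul_assoc]
      · simp only [shuffleSign, ha, ha2, h1' a ha2, hq, hc, List.filterMap_cons, if_false, c2 l,
          pow_add]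
        rw [mul_assoc, ih]
        ring

end Words

/-! ### Modular diagrams and the relations between them -/

theorem isModularElt_top {α : Type*} [Lattice α] [OrderTop α] : IsModularElt (⊤ : α) :=
  ⟨fun A B _ => by simp, fun A B h => by simpa using h⟩

/-- The lattice `α` is the product of `[⊥, a]` and `[⊥, b]`. -/
structure IsSplit {α : Type*} [Lattice α] (a b : α) : Prop where
  le_sup : ∀ x, x ≤ (x ⊓ a) ⊔ (x ⊓ b)
  left : ∀ y z, y ≤ a → z ≤ b → (y ⊔ z) ⊓ a ≤ y
  right : ∀ y z, y ≤ a → z ≤ b → (y ⊔ z) ⊓ b ≤ z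

namespace IsSplit

variable {α : Type*} [Lattice α] {a b : α}

theorem symm (h : IsSplit a b) : IsSplit b a :=
  ⟨fun x => by rw [sup_comm]; exact h.le_sup x,
    fun y z hy hz => by rw [sup_comm]; exact h.right z y hz hy,
    fun y z hy hz => by rw [sup_comm]; exact h.left z y hz hy⟩

theorem eq_sup (h : IsSplit a b) (x : α) : x = (x ⊓ a) ⊔ (x ⊓ b) :=
  le_antisymm (h.le_sup x) (sup_le inf_le_left inf_le_left)

theorem left_eq (h : IsSplit a b) {y z : α} (hy : y ≤ a) (hz : z ≤ b) : (y ⊔ z) ⊓ a = y :=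
  le_antisymm (h.left y z hy hz) (le_inf le_sup_left hy)

theorem right_eq (h : IsSplit a b) {y z : α} (hy : y ≤ a) (hz : z ≤ b) : (y ⊔ z) ⊓ b = z :=
  le_antisymm (h.right y z hy hz) (le_inf le_sup_right hz)

/-- With `IsSplit.upper` this carries a product decomposition to intervals, so that the product
relation passes to contractions and to the factors of coproducts as soon as the two pieces are
nontrivial there. -/
theorem lower (h : IsSplit a b) (F : α) :
    IsSplit (⟨a ⊓ F, inf_le_right⟩ : Set.Iic F) ⟨b ⊓ F, inf_le_right⟩ where
  le_sup x := (h.le_sup x.1).trans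
    (sup_le_sup (le_inf inf_le_left (le_inf inf_le_right (inf_le_left.trans x.2)))
      (le_inf inf_le_left (le_inf inf_le_right (inf_le_left.trans x.2))))
  left y z hy hz := (inf_le_inf_left (y.1 ⊔ z.1) inf_le_left).trans
    (h.left y.1 z.1 (le_trans (show y.1 ≤ a ⊓ F from hy) inf_le_left)
      (le_trans (show z.1 ≤ b ⊓ F from hz) inf_le_left))
  right y z hy hz := (inf_le_inf_left (y.1 ⊔ z.1) inf_le_left).trans
    (h.right y.1 z.1 (le_trans (show y.1 ≤ a ⊓ F from hy) inf_le_left)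
      (le_trans (show z.1 ≤ b ⊓ F from hz) inf_le_left))

theorem upper_left_aux (h : IsSplit a b) (F : α) {y z : α} (hFy : F ≤ y) (hFz : F ≤ z)
    (hy : y ≤ a ⊔ F) (hz : z ≤ b ⊔ F) : (y ⊔ z) ⊓ (a ⊔ F) ≤ y := by
  -- As F = (F ∧ a) ∨ (F ∧ b), one has a ∨ F = a ∨ (F ∧ b), whose component in the direction of b is
  -- F ∧ b.
  have h1 : (a ⊔ F) ⊓ b ≤ F := by
    have e : a ⊔ F = a ⊔ (F ⊓ b) := le_antisymm
      (sup_le le_sup_left ((h.le_sup F).trans (sup_le_sup_right inf_le_right _)))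
      (sup_le_sup_left inf_le_left _)
    rw [e]
    exact (h.right a (F ⊓ b) le_rfl inf_le_right).trans inf_le_left
  have h2 : (b ⊔ F) ⊓ a ≤ F := by
    have e : b ⊔ F = b ⊔ (F ⊓ a) := le_antisymm
      (sup_le le_sup_left ((h.symm.le_sup F).trans (sup_le_sup_right inf_le_right _)))
      (sup_le_sup_left inf_le_left _)
    rw [e]
    exact (h.symm.right b (F ⊓ a) le_rfl inf_le_right).trans inf_le_left
  have h3 : y ⊔ z ≤ (y ⊓ a) ⊔ (z ⊓ b) := by
    refine sup_le ((h.le_sup y).trans (sup_le_sup_left ?_ _))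
      ((h.le_sup z).trans (sup_le ?_ le_sup_right))
    · exact le_inf (((inf_le_inf_right b hy).trans h1).trans hFz) inf_le_right
    · exact (le_inf (((inf_le_inf_right a hz).trans h2).trans hFy) inf_le_right).trans le_sup_left
  refine (h.le_sup _).trans (sup_le ?_ ?_)
  · refine (inf_le_inf_right a (inf_le_left.trans h3)).trans ?_
    exact (h.left _ _ inf_le_right inf_le_right).trans inf_le_left
  · exact ((inf_le_inf_right b inf_le_right).trans h1).trans hFy

theorem upper (h : IsSplit a b) (F : α) :
    IsSplit (⟨a ⊔ F, le_sup_right⟩ : Set.Ici F) ⟨b ⊔ F, le_sup_right⟩ where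
  le_sup x := (h.le_sup x.1).trans
    (sup_le_sup (inf_le_inf_left _ le_sup_left) (inf_le_inf_left _ le_sup_left))
  left y z hy hz := h.upper_left_aux F y.2 z.2 hy hz
  right y z hy hz := by
    change (y.1 ⊔ z.1) ⊓ (b ⊔ F) ≤ z.1
    rw [sup_comm]
    exact h.symm.upper_left_aux F z.2 y.2 hz hy

theorem of_orderIso_prod {β γ : Type*} [Lattice β] [Lattice γ] [BoundedOrder β] [BoundedOrder γ]
    (e : α ≃o β × γ) : IsSplit (e.symm (⊤, ⊥)) (e.symm (⊥, ⊤)) where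
  le_sup x := by
    rw [← e.le_iff_le, e.map_sup, e.map_inf, e.map_inf]
    simp [Prod.le_def]
  left y z hy hz := by
    have hz : e z ≤ (⊥, ⊤) := by rw [← e.symm.le_iff_le]; simpa using hz
    have hy : e y ≤ (⊤, ⊥) := by rw [← e.symm.le_iff_le]; simpa using hy
    rw [← e.le_iff_le, e.map_inf, e.map_sup]
    simp only [Prod.le_def, le_bot_iff, le_top, and_true, true_and] at hy hz
    simp [Prod.le_def, hz]
  right y z hy hz := by
    have hz : e z ≤ (⊥, ⊤) := by rw [← e.symm.le_iff_le]; simpa using hz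
    have hy : e y ≤ (⊤, ⊥) := by rw [← e.symm.le_iff_le]; simpa using hy
    rw [← e.le_iff_le, e.map_inf, e.map_sup]
    simp only [Prod.le_def, le_bot_iff, le_top, and_true, true_and] at hy hz
    simp [Prod.le_def, hy]

/-- The product decomposition defined by a pair of complementary elements. -/
def toOrderIso (h : IsSplit a b) : α ≃o Set.Iic a × Set.Iic b where
  toFun x := (⟨x ⊓ a, inf_le_right⟩, ⟨x ⊓ b, inf_le_right⟩)
  invFun p := p.1.1 ⊔ p.2.1
  left_inv x := (h.eq_sup x).symm
  right_inv p := Prod.ext (Subtype.ext (h.left_eq p.1.2 p.2.2))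
    (Subtype.ext (h.right_eq p.1.2 p.2.2))
  map_rel_iff' {x y} := by
    refine ⟨fun hxy => ?_, fun hxy => ⟨inf_le_inf_right a hxy, inf_le_inf_right b hxy⟩⟩
    rw [h.eq_sup x, h.eq_sup y]
    exact sup_le_sup hxy.1 hxy.2

end IsSplit

namespace GeomLat

/-- The product of `L` and the lattice with two elements. -/
noncomputable def prodTwo (L : GeomLat.{u}) : GeomLat.{u} where
  carrier := L × Bool
  atomistic := ⟨fun b => by
    refine ⟨{x | IsAtom x ∧ x ≤ b}, ⟨fun x hx => hx.2, fun y hy => ⟨?_, ?_⟩⟩, fun x hx => hx.1⟩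
    · refine le_of_atoms fun a ha hab => ?_
      have h1 : IsAtom ((a, false) : L × Bool) := by
        rw [← bot_covBy_iff]
        exact Prod.mk_covBy_mk_iff.2 (Or.inl ⟨ha.bot_covBy, rfl⟩)
      exact (hy (a := (a, false)) ⟨h1, hab, bot_le⟩).1
    · have h1 : IsAtom ((⊥, true) : L × Bool) := by
        rw [← bot_covBy_iff]
        exact Prod.mk_covBy_mk_iff.2 (Or.inr ⟨by
          refine ⟨by decide, ?_⟩
          intro c; revert c; decide, rfl⟩)
      rcases b with ⟨b, i⟩
      cases i
      · exact bot_le (a := y.2)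
      · exact (hy (a := (⊥, true)) ⟨h1, bot_le, le_rfl⟩).2⟩
  semimodular := ⟨fun {a b} h => by
    rcases a with ⟨a, i⟩
    rcases b with ⟨b, j⟩
    rcases Prod.mk_covBy_mk_iff.1 h with ⟨h1, h2⟩ | ⟨h1, h2⟩
    · refine Prod.mk_covBy_mk_iff.2 (Or.inl ⟨IsUpperModularLattice.covBy_sup_of_inf_covBy h1, ?_⟩)
      exact (sup_eq_right.2 (inf_eq_left.1 h2)).symm
    · refine Prod.mk_covBy_mk_iff.2 (Or.inr ⟨IsUpperModularLattice.covBy_sup_of_inf_covBy h1, ?_⟩)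
      exact (sup_eq_right.2 (inf_eq_left.1 h2)).symm⟩

end GeomLat

theorem IsEmbedding.isAtom_iff {L M : GeomLat.{u}} {φ : L → M} (h : IsEmbedding φ) {x : L} :
    IsAtom (φ x) ↔ IsAtom x := by
  refine ⟨fun hx => ⟨fun e => hx.1 (by rw [e, h.map_bot]), fun y hy => ?_⟩, h.map_atom x⟩
  have := hx.2 (φ y) (lt_of_le_not_ge (h.monotone hy.le) fun k => hy.not_ge (h.le_iff.1 k))
  rw [← h.map_bot] at this
  exact h.injective this

/-! ### Traces of flats and functions compatible with the relations. -/

namespace Diag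

variable {L : GeomLat.{u}}

section Trace

variable (Γ : Diag L)

theorem trace_mono {x y : Γ.E} (h : x ≤ y) : Γ.trace x ≤ Γ.trace y :=
  (Γ.trace_le_iff _ _).2 (((Γ.trace_le_iff _ _).1 le_rfl).trans h)

theorem ι_trace_le (x : Γ.E) : Γ.ι (Γ.trace x) ≤ x := (Γ.trace_le_iff _ _).1 le_rfl

theorem trace_ι (x : L) : Γ.trace (Γ.ι x) = x :=
  eq_of_forall_le_iff fun c => by rw [trace_le_iff, Γ.emb.le_iff]

theorem trace_top : Γ.trace ⊤ = ⊤ := top_le_iff.1 ((Γ.trace_le_iff _ _).2 le_top)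

theorem trace_bot : Γ.trace ⊥ = ⊥ := by rw [← Γ.ι_bot, trace_ι]

theorem trace_eq_top_iff {x : Γ.E} : Γ.trace x = ⊤ ↔ Γ.top ≤ x := by
  rw [← top_le_iff, trace_le_iff]; rfl

theorem trace_inf (x y : Γ.E) : Γ.trace (x ⊓ y) = Γ.trace x ⊓ Γ.trace y :=
  eq_of_forall_le_iff fun c => by simp only [trace_le_iff, le_inf_iff]

/-- This is the first modular law of F_ι, read in L through ι. -/
theorem trace_sup_ι (x : Γ.E) (t : L) : Γ.trace (x ⊔ Γ.ι t) = Γ.trace x ⊔ t := by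
  apply Γ.emb.injective
  rw [ι_trace, Γ.emb.map_sup, ι_trace, inf_comm, sup_comm, sup_comm (x ⊓ Γ.top), inf_comm x]
  exact Γ.modular.1 _ _ (Γ.ι_le_top t)

theorem ι_trace_of_le {x : Γ.E} (h : x ≤ Γ.top) : Γ.ι (Γ.trace x) = x := by
  rw [ι_trace, inf_eq_left.2 h]

theorem top_ne_bot : Γ.top ≠ ⊥ := fun h => by
  have := Γ.emb.injective (h.trans Γ.ι_bot.symm)
  exact bot_ne_top this.symm

theorem trace_eq_of_inf_eq {x y : Γ.E} (h : x ⊓ Γ.top = y ⊓ Γ.top) : Γ.trace x = Γ.trace y :=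
  Γ.emb.injective (by rw [ι_trace, ι_trace, h])

/-- Modularity of F_ι rewrites the correction term of the degree as a rank in [F_ι, ⊤], which is
known as soon as the diagram spans. -/
theorem rk_sub_rk_inf_top (x : Γ.E) :
    rk x - rk (x ⊓ Γ.top) = rk (x ⊔ Γ.top) - rk Γ.top := by
  have := rk_add_of_isModularElt Γ.modular x
  rw [inf_comm, sup_comm] at this
  change rk (x ⊓ Γ.top) + rk (x ⊔ Γ.top) = rk Γ.top + rk x at this
  linarith

theorem trace_map {Γ Γ' : Diag L} {φ : Γ.E → Γ'.E} (hφ : IsEmbedding φ)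
    (hι : ∀ x, Γ'.ι x = φ (Γ.ι x)) (x : Γ.E) : Γ'.trace (φ x) = Γ.trace x :=
  eq_of_forall_le_iff fun c => by rw [trace_le_iff, trace_le_iff, hι, hφ.le_iff]

theorem map_top {Γ Γ' : Diag L} {φ : Γ.E → Γ'.E} (hι : ∀ x, Γ'.ι x = φ (Γ.ι x)) :
    Γ'.top = φ Γ.top := hι ⊤

theorem rk_top : rk Γ.top = rk (⊤ : L) := Γ.emb.rk_map ⊤

end Trace

/-- The diagram with the same lattice and embedding, and the word `l`. -/
def withWord (Γ : Diag L) (l : List Γ.E) (h : ∀ H ∈ l, IsAtom H) : Diag L :=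
  { Γ with J := l, atoms := h }

open scoped Classical in
/-- The value of a function of diagrams at the diagram with the same lattice and embedding as `Γ`
and the word `l`, extended by `0` to arbitrary words. -/
noncomputable def onWords {M : Type*} [Zero M] (f : Diag L → M) (Γ : Diag L) (l : List Γ.E) : M :=
  if h : ∀ H ∈ l, IsAtom H then f (Γ.withWord l h) else 0

theorem onWords_J {M : Type*} [Zero M] (f : Diag L → M) (Γ : Diag L) : onWords f Γ Γ.J = f Γ :=
  dif_pos Γ.atoms

theorem onWords_of_atoms {M : Type*} [Zero M] (f : Diag L → M) (Γ : Diag L) {l : List Γ.E}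
    (h : ∀ H ∈ l, IsAtom H) : onWords f Γ l = f (Γ.withWord l h) :=
  dif_pos h

theorem le_join (Γ : Diag L) {H : Γ.E} (h : H ∈ Γ.J) : H ≤ Γ.join := by
  unfold join
  generalize Γ.J = l at h
  induction l with
  | nil => simp at h
  | cons a l ih =>
    rcases List.mem_cons.1 h with rfl | h
    · exact le_sup_left
    · exact (ih h).trans le_sup_right

theorem join_le (Γ : Diag L) {X : Γ.E} (h : ∀ H ∈ Γ.J, H ≤ X) : Γ.join ≤ X := by
  unfold join
  generalize Γ.J = l at h
  induction l with
  | nil => exact bot_le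
  | cons a l ih =>
    exact sup_le (h a (by simp)) (ih fun H hH => h H (List.mem_cons_of_mem a hH))

/-- Functions of diagrams which are compatible with the relations defining `MD L`. -/
structure IsInvariant {M : Type*} [AddCommGroup M] (f : Diag L → M) : Prop where
  swap : ∀ Γ : Diag L, IsAlt (onWords f Γ)
  embedding : ∀ (Γ Γ' : Diag L) (φ : Γ.E → Γ'.E), IsEmbedding φ → φ ⊤ = ⊤ →
    (∀ x, Γ'.ι x = φ (Γ.ι x)) → Γ'.J = Γ.J.map φ → f Γ = f Γ'
  not_spanning : ∀ (Γ : Diag L) (X : Γ.E), X < ⊤ → Γ.top ≤ X → (∀ H ∈ Γ.J, H ≤ X) → f Γ = 0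
  product : ∀ (Γ : Diag L) (a b : Γ.E), IsSplit a b → a ≠ ⊥ → b ≠ ⊥ → Γ.top ≤ a → f Γ = 0
  two_outside : ∀ (Γ : Diag L) (F A B : Γ.E) (l : List Γ.E), IsModularElt F → Γ.top ≤ F →
    ¬ A ≤ F → ¬ B ≤ F → (∀ H ∈ l, H ≤ F) → Γ.J = A :: B :: l → f Γ = 0

end Diag

theorem List.exists_perm_of_length_filter_eq_two {α : Type*} (p : α → Prop) [DecidablePred p]
    (l : List α) (h : (l.filter p).length = 2) :
    ∃ A B l', l.Perm (A :: B :: l') ∧ p A ∧ p B ∧ ∀ x ∈ l', ¬ p x := by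
  obtain ⟨A, B, hAB⟩ := List.length_eq_two.1 h
  refine ⟨A, B, l.filter (fun x => ¬ p x), ?_, ?_, ?_, ?_⟩
  · have := (List.filter_append_perm (fun x => decide (p x)) l).symm
    rw [hAB] at this
    simpa using this
  · have : A ∈ l.filter p := by rw [hAB]; simp
    simpa using (List.mem_filter.1 this).2
  · have : B ∈ l.filter p := by rw [hAB]; simp
    simpa using (List.mem_filter.1 this).2
  · intro x hx
    simpa using (List.mem_filter.1 hx).2

/-! ### Linear maps out of the space of modular diagrams. -/

namespace MD

open Diag

variable {L : GeomLat.{u}} {M : Type*} [AddCommGroup M] [Module ℚ M]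

/-- Each relation is reduced to its form in `IsInvariant`: a transposition is composed of adjacent
ones, a product decomposition is recorded by its two complementary elements, and by alternation the
two letters outside a modular flat can be moved to the front. -/
theorem span_le_ker {f : Diag L → M} (hf : IsInvariant f) :
    Submodule.span ℚ {x | MD.Rel L x} ≤
      LinearMap.ker (Finsupp.lift M ℚ (Diag L) f) := by
  rw [Submodule.span_le]
  intro x hx
  rw [SetLike.mem_coe, LinearMap.mem_ker]
  have hs : ∀ Γ : Diag L, Finsupp.lift M ℚ (Diag L) f (Finsupp.single Γ 1) = f Γ := fun Γ => by
    simp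
  cases hx with
  | transposition Γ l₁ l₂ l₃ a b hJ h =>
    rw [map_add, hs, hs]
    have := (hf.swap Γ).swap l₁ l₂ l₃ a b
    rw [← hJ, onWords_J, onWords_of_atoms _ _ h] at this
    rw [this]
    exact neg_add_cancel _
  | embedding Γ Γ' φ hφ hrk hι hJ =>
    rw [map_sub, hs, hs, hf.embedding Γ Γ' φ hφ (hφ.map_top_iff.2 hrk) hι hJ, sub_self]
  | not_spanning Γ h =>
    rw [hs]
    exact hf.not_spanning Γ _ h le_sup_left fun H hH => (Γ.le_join hH).trans le_sup_right
  | product Γ E₁ E₂ ψ h =>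
    rw [hs]
    refine hf.product Γ _ _ (IsSplit.of_orderIso_prod ψ) ?_ ?_ ?_
    · intro e
      have := congrArg (fun x => (ψ x).1) e
      simp only [OrderIso.apply_symm_apply, ψ.map_bot] at this
      exact bot_ne_top this.symm
    · intro e
      have := congrArg (fun x => (ψ x).2) e
      simp only [OrderIso.apply_symm_apply, ψ.map_bot] at this
      exact bot_ne_top this.symm
    · rw [← ψ.le_iff_le, ψ.apply_symm_apply]
      exact ⟨le_top, h.le⟩
  | two_outside Γ F hF hle h =>
    rw [hs]
    classical
    obtain ⟨A, B, l, hl, hA, hB, hl'⟩ := List.exists_perm_of_length_filter_eq_two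
      (fun H => ¬ H ≤ F) Γ.J (by convert h)
    rw [← onWords_J f Γ]
    refine (hf.swap Γ).perm_eq_zero hl ?_
    have hat : ∀ H ∈ A :: B :: l, IsAtom H := fun H hH => Γ.atoms H (hl.mem_iff.2 hH)
    rw [onWords_of_atoms _ _ hat]
    exact hf.two_outside _ F A B l hF hle hA hB (fun H hH => not_not.1 (hl' H hH)) rfl

/-- The linear map out of `MD L` defined by an invariant function of diagrams. -/
noncomputable def lift (f : Diag L → M) (hf : IsInvariant f) : MD L →ₗ[ℚ] M :=
  Submodule.liftQ _ (Finsupp.lift M ℚ (Diag L) f) (span_le_ker hf)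

@[simp]
theorem lift_mk (f : Diag L → M) (hf : IsInvariant f) (Γ : Diag L) :
    lift f hf (mk Γ) = f Γ := by
  simp [lift, mk]

theorem hom_ext {f g : MD L →ₗ[ℚ] M} (h : ∀ Γ, f (mk Γ) = g (mk Γ)) : f = g := by
  apply Submodule.linearMap_qext
  apply Finsupp.lhom_ext'
  intro Γ
  ext
  exact h Γ

@[elab_as_elim]
theorem induction {p : MD L → Prop} (h0 : p 0) (hadd : ∀ x y, p x → p y → p (x + y))
    (hsmul : ∀ (c : ℚ) (x), p x → p (c • x)) (hmk : ∀ Γ, p (mk Γ)) (x : MD L) : p x := by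
  induction x using Submodule.Quotient.induction_on with
  | _ x =>
    induction x using Finsupp.induction_linear with
    | zero => exact h0
    | add x y hx hy => exact hadd _ _ hx hy
    | single Γ c =>
      have := hsmul c _ (hmk Γ)
      rw [mk, ← Submodule.Quotient.mk_smul, Finsupp.smul_single, smul_eq_mul, mul_one] at this
      exact this

theorem mk_eq_zero_of_rel {Γ : Diag L} (h : Rel L (Finsupp.single Γ 1)) : mk Γ = 0 :=
  (Submodule.Quotient.mk_eq_zero _).2 (Submodule.subset_span h)

theorem isAlt_wd (Γ : Diag L) : IsAlt (onWords mk Γ) := by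
  intro l₁ l₂ a b
  unfold onWords
  have e : (∀ H ∈ l₁ ++ a :: b :: l₂, IsAtom H) ↔ ∀ H ∈ l₁ ++ b :: a :: l₂, IsAtom H := by
    refine forall_congr' fun H => ?_
    simp only [List.mem_append, List.mem_cons]
    tauto
  by_cases h : ∀ H ∈ l₁ ++ a :: b :: l₂, IsAtom H
  · rw [dif_pos h, dif_pos (e.1 h)]
    have e₁ : l₁ ++ a :: b :: l₂ = l₁ ++ a :: [] ++ b :: l₂ := by simp
    have e₂ : l₁ ++ b :: a :: l₂ = l₁ ++ b :: [] ++ a :: l₂ := by simp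
    simp only [e₁, e₂] at h ⊢
    have h' : ∀ H ∈ l₁ ++ b :: [] ++ a :: l₂, IsAtom H := by rw [← e₂]; exact e.1 (by rwa [e₁])
    have := Submodule.subset_span (R := ℚ)
      (Rel.transposition (Γ.withWord _ h) l₁ [] l₂ a b rfl h')
    exact eq_neg_of_add_eq_zero_left ((Submodule.Quotient.mk_eq_zero _).2 this)
  · rw [dif_neg h, dif_neg fun h' => h (e.2 h'), neg_zero]

theorem isInvariant_mk : IsInvariant (mk : Diag L → MD L) where
  swap := isAlt_wd
  embedding Γ Γ' φ hφ htop hι hJ := by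
    have := Submodule.subset_span (R := ℚ)
      (Rel.embedding Γ Γ' φ hφ (hφ.map_top_iff.1 htop) hι hJ)
    exact (Submodule.Quotient.eq _).2 this
  not_spanning Γ X hX htop hJ :=
    mk_eq_zero_of_rel (Rel.not_spanning Γ ((sup_le htop (Γ.join_le hJ)).trans_lt hX))
  product Γ a b h ha hb htop := by
    refine mk_eq_zero_of_rel (Rel.product Γ (Γ.E.lower a ha) (Γ.E.lower b hb) h.toOrderIso ?_)
    apply Subtype.ext
    change Γ.top ⊓ b = ⊥
    have h1 : b ⊓ a = ⊥ := by
      have := h.left ⊥ b bot_le le_rfl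
      rwa [bot_sup_eq, le_bot_iff] at this
    rw [← le_bot_iff, ← h1, inf_comm]
    exact inf_le_inf_left b htop
  two_outside Γ F A B l hF htop hA hB hl hJ := by
    refine mk_eq_zero_of_rel (Rel.two_outside Γ F hF htop ?_)
    rw [hJ, List.filter_cons_of_pos (by simpa using hA), List.filter_cons_of_pos (by simpa using hB),
      List.filter_eq_nil_iff.2 (by simpa using hl)]
    rfl

theorem mk_eq_of_iso {Γ Γ' : Diag L} (e : Γ.E ≃o Γ'.E) (hι : ∀ x, Γ'.ι x = e (Γ.ι x))
    (hJ : Γ'.J = Γ.J.map e) : mk Γ = mk Γ' :=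
  isInvariant_mk.embedding Γ Γ' e (IsEmbedding.of_orderIso e) e.map_top hι hJ

end MD

/-! ### Words over a fixed extension and criteria for their vanishing. -/

namespace Diag

variable {L : GeomLat.{u}}

/-- The class of the diagram with the same lattice and embedding as `Γ` and the word `l`, and `0`
if one of the letters of `l` is not an atom. -/
noncomputable def wd (Γ : Diag L) (l : List Γ.E) : MD L := onWords MD.mk Γ l

theorem wd_J (Γ : Diag L) : Γ.wd Γ.J = MD.mk Γ := onWords_J _ Γ

theorem wd_of_atoms (Γ : Diag L) {l : List Γ.E} (h : ∀ H ∈ l, IsAtom H) :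
    Γ.wd l = MD.mk (Γ.withWord l h) := onWords_of_atoms _ Γ h

theorem wd_of_not_atom (Γ : Diag L) {l : List Γ.E} {H : Γ.E} (h : H ∈ l) (hH : ¬ IsAtom H) :
    Γ.wd l = 0 := dif_neg fun h' => hH (h' H h)

theorem isAlt_wd (Γ : Diag L) : IsAlt Γ.wd := MD.isAlt_wd Γ

theorem mk_of_dup (Γ : Diag L) (h : ¬ Γ.J.Nodup) : MD.mk Γ = 0 := by
  rw [← wd_J]
  exact Γ.isAlt_wd.of_dup h

theorem wd_map {Γ Γ' : Diag L} (φ : Γ.E → Γ'.E) (hφ : IsEmbedding φ) (htop : φ ⊤ = ⊤)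
    (hι : ∀ x, Γ'.ι x = φ (Γ.ι x)) (l : List Γ.E) : Γ'.wd (l.map φ) = Γ.wd l := by
  by_cases h : ∀ H ∈ l, IsAtom H
  · have h' : ∀ H ∈ l.map φ, IsAtom H := by
      intro H hH
      obtain ⟨K, hK, rfl⟩ := List.mem_map.1 hH
      exact hφ.map_atom K (h K hK)
    rw [wd_of_atoms Γ h, wd_of_atoms Γ' h']
    exact (MD.isInvariant_mk.embedding (Γ.withWord l h) (Γ'.withWord _ h') φ hφ htop hι rfl).symm
  · push Not at h
    obtain ⟨H, hH, hH'⟩ := h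
    rw [wd_of_not_atom Γ hH hH', wd_of_not_atom Γ' (List.mem_map_of_mem hH)]
    rwa [hφ.isAtom_iff]

theorem wd_not_spanning (Γ : Diag L) {l : List Γ.E} {X : Γ.E} (hX : X ≠ ⊤) (htop : Γ.top ≤ X)
    (hl : ∀ H ∈ l, H ≤ X) : Γ.wd l = 0 := by
  by_cases h : ∀ H ∈ l, IsAtom H
  · rw [wd_of_atoms Γ h]
    exact MD.isInvariant_mk.not_spanning (Γ.withWord l h) X hX.lt_top htop hl
  · exact dif_neg h

theorem wd_product (Γ : Diag L) {a b : Γ.E} (h : IsSplit a b) (ha : a ≠ ⊥) (hb : b ≠ ⊥)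
    (htop : Γ.top ≤ a) (l : List Γ.E) : Γ.wd l = 0 := by
  by_cases hl : ∀ H ∈ l, IsAtom H
  · rw [wd_of_atoms Γ hl]
    exact MD.isInvariant_mk.product (Γ.withWord l hl) a b h ha hb htop
  · exact dif_neg hl

theorem wd_two_outside (Γ : Diag L) {F A B : Γ.E} {l : List Γ.E} (hF : IsModularElt F)
    (htop : Γ.top ≤ F) (hA : ¬ A ≤ F) (hB : ¬ B ≤ F) (hl : ∀ H ∈ l, H ≤ F) :
    Γ.wd (A :: B :: l) = 0 := by
  by_cases h : ∀ H ∈ A :: B :: l, IsAtom H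
  · rw [wd_of_atoms Γ h]
    exact MD.isInvariant_mk.two_outside (Γ.withWord _ h) F A B l hF htop hA hB hl rfl
  · exact dif_neg h

/-- The restriction of a diagram to an interval `[⊥, F]` with `F_ι ≤ F`. -/
def restrict (Γ : Diag L) (F : Γ.E) (hF : Γ.top ≤ F) : Diag L where
  E := Γ.E.lower F fun e => Γ.top_ne_bot (le_bot_iff.1 (e ▸ hF))
  ι x := ⟨Γ.ι x, (Γ.ι_le_top x).trans hF⟩
  emb :=
    { injective := fun x y e => Γ.emb.injective (congrArg Subtype.val e)
      map_sup := fun x y => Subtype.ext (Γ.emb.map_sup x y)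
      map_atom := fun a ha => (Γ.emb.map_atom a ha).Iic _ }
  range_ι := by
    refine Set.Subset.antisymm ?_ fun y hy => ?_
    · rintro _ ⟨x, rfl⟩
      exact Γ.ι_le_top x
    · exact ⟨Γ.trace y.1, Subtype.ext (Γ.ι_trace_of_le hy)⟩
  modular := by
    have key := Γ.modular.inf F
    have e : (⟨F ⊓ Γ.ι ⊤, inf_le_left⟩ : Set.Iic F) = ⟨Γ.ι ⊤, hF⟩ :=
      Subtype.ext (inf_eq_right.2 hF)
    rw [e] at key
    exact key
  J := []
  atoms := by simp

/-- The product of a diagram with the lattice with two elements. -/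
noncomputable def prodTwo (Γ : Diag L) : Diag L where
  E := Γ.E.prodTwo
  ι x := (Γ.ι x, false)
  emb :=
    { injective := fun x y e => Γ.emb.injective (congrArg Prod.fst e)
      map_sup := fun x y => Prod.ext (Γ.emb.map_sup x y) rfl
      map_atom := fun a ha => (bot_covBy_iff (α := Γ.E × Bool)).1
        (Prod.mk_covBy_mk_iff.2 (Or.inl ⟨(Γ.emb.map_atom a ha).bot_covBy, rfl⟩)) }
  range_ι := by
    refine Set.Subset.antisymm ?_ fun y hy => ?_
    · rintro _ ⟨x, rfl⟩
      exact ⟨Γ.ι_le_top x, le_rfl⟩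
    · exact ⟨Γ.trace y.1, Prod.ext (Γ.ι_trace_of_le hy.1) (le_bot_iff.1 hy.2).symm⟩
  modular := by
    refine ⟨fun A B hA => Prod.ext (Γ.modular.1 A.1 B.1 hA.1) ?_,
      fun A B hAB => Prod.ext (Γ.modular.2 A.1 B.1 hAB.1) ?_⟩
    · have : A.2 = false := le_bot_iff.1 hA.2
      change false ⊓ (A.2 ⊔ B.2) = A.2 ⊔ (false ⊓ B.2)
      rw [this]
      cases B.2 <;> rfl
    · have : A.2 ≤ B.2 := hAB.2
      change B.2 ⊓ (A.2 ⊔ false) = A.2 ⊔ (B.2 ⊓ false)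
      revert this
      cases A.2 <;> cases B.2 <;> decide
  J := []
  atoms := by simp

/-- The meet lies between x and its cover x ∨ H, and it is not x ∨ H because H is not below X. -/
theorem inf_sup_atom_of_covBy {E : GeomLat.{u}} {X H x : E} (hH : IsAtom H) (hHX : ¬ H ≤ X)
    (hx : x ≤ X) : X ⊓ (x ⊔ H) = x := by
  have hc := covBy_sup_atom hH fun h => hHX (h.trans hx)
  refine (hc.eq_or_eq (le_inf hx le_sup_left) inf_le_right).resolve_right fun e => hHX ?_
  exact (le_sup_right.trans e.ge).trans inf_le_left

/-- A diagram with a bridge vanishes. -/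
theorem wd_bridge (Γ : Diag L) {F H : Γ.E} {l : List Γ.E} (htop : Γ.top ≤ F) (hH : ¬ H ≤ F)
    (hl : ∀ K ∈ l, K ≤ F) : Γ.wd (H :: l) = 0 := by
  by_cases hat : IsAtom H
  swap
  · exact wd_of_not_atom Γ (List.mem_cons_self) hat
  by_cases hs : F ⊔ H = ⊤
  swap
  · exact Γ.wd_not_spanning hs (htop.trans le_sup_left) (by
      intro K hK
      rcases List.mem_cons.1 hK with rfl | hK
      · exact le_sup_right
      · exact (hl K hK).trans le_sup_left)
  lift l to List {x // x ≤ F} using hl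
  -- When F ∨ H = ⊤, adjoining H to the flats below F embeds [⊥, F] × {0, 1} into E and sends ⊤ to
  -- ⊤. The word comes from this product, with H as the atom of the two-element factor, and F_ι lies
  -- in the other factor; so the embedding and product relations kill it.
  let φ : (Γ.restrict F htop).prodTwo.E → Γ.E := fun p => if p.2 then p.1.1 ⊔ H else p.1.1
  have e0 : ∀ x : Set.Iic F, φ (x, false) = x.1 := fun x => rfl
  have e1 : ∀ x : Set.Iic F, φ (x, true) = x.1 ⊔ H := fun x => rfl
  have hφ : IsEmbedding φ := by
    refine ⟨?_, ?_, ?_⟩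
    · rintro ⟨⟨x, hx⟩, i⟩ ⟨⟨y, hy⟩, j⟩ h
      have key : ∀ x y : Γ.E, x ≤ F → y ≤ F → x ⊔ H ≠ y := fun x y _ hy h =>
        hH ((le_sup_right.trans h.le).trans hy)
      cases i <;> cases j
      · exact Prod.ext (Subtype.ext h) rfl
      · exact absurd h.symm (key y x hy hx)
      · exact absurd h (key x y hx hy)
      · refine Prod.ext (Subtype.ext ?_) rfl
        have h' : x ⊔ H = y ⊔ H := h
        change x = y
        rw [← inf_sup_atom_of_covBy hat hH hx, h', inf_sup_atom_of_covBy hat hH hy]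
    · rintro ⟨x, i⟩ ⟨y, j⟩
      cases i <;> cases j
      · rfl
      · exact sup_assoc _ _ _
      · change (x.1 ⊔ y.1) ⊔ H = (x.1 ⊔ H) ⊔ y.1
        exact sup_right_comm _ _ _
      · change (x.1 ⊔ y.1) ⊔ H = (x.1 ⊔ H) ⊔ (y.1 ⊔ H)
        rw [sup_sup_sup_comm, sup_idem]
    · rintro ⟨x, i⟩ ha
      rcases Prod.mk_covBy_mk_iff.1 ((bot_covBy_iff (α := Set.Iic F × Bool)).2 ha) with ⟨h1, h2⟩ | ⟨h1, h2⟩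
      · obtain rfl : i = false := h2.symm
        exact (bot_covBy_iff.1 h1).of_isAtom_coe_Iic
      · obtain rfl : i = true := by
          have := h1.lt.ne'
          cases i
          · exact absurd rfl this
          · rfl
        change IsAtom (x.1 ⊔ H)
        rw [← h2]
        exact (bot_sup_eq H).symm ▸ hat
  let l' : List (Set.Iic F × Bool) := (⊥, true) :: l.map fun x => (x, false)
  have e : H :: l.map (↑) = List.map φ l' := by
    refine (List.cons.injEq _ _ _ _).mpr ⟨(bot_sup_eq H).symm, ?_⟩
    exact (List.map_map (f := fun x : Set.Iic F => (x, false)) (g := φ)).symm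
  rw [e]
  refine (wd_map φ hφ hs (fun x => rfl) l').trans ?_
  have hsplit : IsSplit (α := (Γ.restrict F htop).prodTwo.E) (⊤, false) (⊥, true) :=
    IsSplit.of_orderIso_prod (OrderIso.refl (Set.Iic F × Bool))
  have htop' : (Γ.restrict F htop).prodTwo.top ≤ (⊤, false) := ⟨le_top, le_rfl⟩
  refine wd_product _ hsplit (fun e => ?_) (fun e => ?_) htop' _
  · have : F = ⊥ := congrArg (fun p : Set.Iic F × Bool => p.1.1) e
    exact Γ.top_ne_bot (le_bot_iff.1 (this ▸ htop))
  · exact Bool.noConfusion (show true = false from congrArg (fun p : Set.Iic F × Bool => p.2) e)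

end Diag

/-! ### The product of modular diagrams -/

theorem map_append_map {α β γ δ : Type*} (f : γ → δ) (g₁ : α → γ) (g₂ : β → γ) (l₁ : List α)
    (l₂ : List β) :
    (l₁.map g₁ ++ l₂.map g₂).map f = l₁.map (fun x => f (g₁ x)) ++ l₂.map fun x => f (g₂ x) := by
  rw [List.map_append, List.map_map, List.map_map]
  rfl

namespace Diag

variable {L : GeomLat.{u}}

theorem ι_sup (Γ : Diag L) (x y : L) : Γ.ι (x ⊔ y) = Γ.ι x ⊔ Γ.ι y := Γ.emb.map_sup x y

theorem rk_ι (Γ : Diag L) (x : L) : rk (Γ.ι x) = rk x := Γ.emb.rk_map x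

theorem rk_sub_rk_trace (Γ : Diag L) (x : Γ.E) :
    rk x - rk (Γ.trace x) = rk (x ⊔ Γ.top) - rk Γ.top := by
  rw [← rk_sub_rk_inf_top, ← ι_trace, rk_ι]

/-- The rank of a flat is determined by the ranks of its trace and of its join with F_ι, so
comparable flats sharing both are equal. -/
theorem eq_of_trace_eq (Γ : Diag L) {x y : Γ.E} (h : x ≤ y) (h1 : Γ.trace x = Γ.trace y)
    (h2 : y ≤ x ⊔ Γ.top) : x = y := by
  refine eq_of_le_of_rk_le h ?_
  have e1 := Γ.rk_sub_rk_trace x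
  have e2 := Γ.rk_sub_rk_trace y
  have e3 : x ⊔ Γ.top = y ⊔ Γ.top :=
    le_antisymm (sup_le_sup_right h _) (sup_le h2 le_sup_right)
  rw [e3, h1] at e1
  omega

/-- The underlying set of the pushout `E₁ ∪_L E₂`. -/
def PushCarrier (Γ₁ Γ₂ : Diag L) : Type u := {p : Γ₁.E × Γ₂.E // Γ₁.trace p.1 = Γ₂.trace p.2}

namespace PushCarrier

variable {Γ₁ Γ₂ : Diag L}

instance : PartialOrder (PushCarrier Γ₁ Γ₂) := inferInstanceAs (PartialOrder (Subtype _))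

instance : Finite (PushCarrier Γ₁ Γ₂) := inferInstanceAs (Finite (Subtype _))

theorem ext {x y : PushCarrier Γ₁ Γ₂} (h₁ : x.1.1 = y.1.1) (h₂ : x.1.2 = y.1.2) : x = y :=
  Subtype.ext (Prod.ext h₁ h₂)

theorem le_def {x y : PushCarrier Γ₁ Γ₂} : x ≤ y ↔ x.1.1 ≤ y.1.1 ∧ x.1.2 ≤ y.1.2 := Iff.rfl

/-- The element `(x, y)` of the pushout. -/
def mk (x : Γ₁.E) (y : Γ₂.E) (h : Γ₁.trace x = Γ₂.trace y) : PushCarrier Γ₁ Γ₂ := ⟨(x, y), h⟩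

/-- The smallest element of the pushout above a pair. -/
noncomputable def cl (x : Γ₁.E) (y : Γ₂.E) : PushCarrier Γ₁ Γ₂ :=
  ⟨(x ⊔ Γ₁.ι (Γ₁.trace x ⊔ Γ₂.trace y), y ⊔ Γ₂.ι (Γ₁.trace x ⊔ Γ₂.trace y)), by
    simp only [trace_sup_ι]
    rw [← sup_assoc, sup_idem, sup_left_comm, sup_idem]⟩

theorem cl_le {x : Γ₁.E} {y : Γ₂.E} {z : PushCarrier Γ₁ Γ₂} :
    cl x y ≤ z ↔ x ≤ z.1.1 ∧ y ≤ z.1.2 := by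
  refine ⟨fun h => ⟨le_sup_left.trans h.1, le_sup_left.trans h.2⟩, fun h => ?_⟩
  have h3 : Γ₁.trace x ⊔ Γ₂.trace y ≤ Γ₁.trace z.1.1 :=
    sup_le (Γ₁.trace_mono h.1) (z.2 ▸ Γ₂.trace_mono h.2)
  exact ⟨sup_le h.1 ((Γ₁.trace_le_iff _ _).1 h3), sup_le h.2 ((Γ₂.trace_le_iff _ _).1 (z.2 ▸ h3))⟩

noncomputable instance : Lattice (PushCarrier Γ₁ Γ₂) :=
  { (inferInstance : PartialOrder (PushCarrier Γ₁ Γ₂)) with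
    sup := fun x y => cl (x.1.1 ⊔ y.1.1) (x.1.2 ⊔ y.1.2)
    le_sup_left := fun _ _ => ⟨le_sup_left.trans le_sup_left, le_sup_left.trans le_sup_left⟩
    le_sup_right := fun _ _ => ⟨le_sup_right.trans le_sup_left, le_sup_right.trans le_sup_left⟩
    sup_le := fun _ _ _ h h' => cl_le.2 ⟨sup_le h.1 h'.1, sup_le h.2 h'.2⟩
    inf := fun x y => ⟨(x.1.1 ⊓ y.1.1, x.1.2 ⊓ y.1.2), by
      simp only [trace_inf, x.2, y.2]⟩
    inf_le_left := fun _ _ => ⟨inf_le_left, inf_le_left⟩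
    inf_le_right := fun _ _ => ⟨inf_le_right, inf_le_right⟩
    le_inf := fun _ _ _ h h' => ⟨le_inf h.1 h'.1, le_inf h.2 h'.2⟩ }

noncomputable instance : BoundedOrder (PushCarrier Γ₁ Γ₂) where
  top := ⟨(⊤, ⊤), by simp only [trace_top]⟩
  le_top _ := ⟨le_top, le_top⟩
  bot := ⟨(⊥, ⊥), by simp only [trace_bot]⟩
  bot_le _ := ⟨bot_le, bot_le⟩

theorem cl_fst_of_trace_le {x : Γ₁.E} {y : Γ₂.E} (h : Γ₂.trace y ≤ Γ₁.trace x) :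
    (cl x y).1 = (x, y ⊔ Γ₂.ι (Γ₁.trace x)) := by
  refine Prod.ext ?_ ?_
  · change x ⊔ Γ₁.ι (Γ₁.trace x ⊔ Γ₂.trace y) = x
    rw [sup_eq_left.2 h]
    exact sup_eq_left.2 (Γ₁.ι_trace_le x)
  · change y ⊔ Γ₂.ι (Γ₁.trace x ⊔ Γ₂.trace y) = y ⊔ Γ₂.ι (Γ₁.trace x)
    rw [sup_eq_left.2 h]

theorem cl_snd_of_trace_le {x : Γ₁.E} {y : Γ₂.E} (h : Γ₁.trace x ≤ Γ₂.trace y) :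
    (cl x y).1 = (x ⊔ Γ₁.ι (Γ₂.trace y), y) := by
  refine Prod.ext ?_ ?_
  · change x ⊔ Γ₁.ι (Γ₁.trace x ⊔ Γ₂.trace y) = x ⊔ Γ₁.ι (Γ₂.trace y)
    rw [sup_eq_right.2 h]
  · change y ⊔ Γ₂.ι (Γ₁.trace x ⊔ Γ₂.trace y) = y
    rw [sup_eq_right.2 h]
    exact sup_eq_left.2 (Γ₂.ι_trace_le y)

theorem cl_of_trace_eq {x : Γ₁.E} {y : Γ₂.E} (h : Γ₁.trace x = Γ₂.trace y) :
    (cl x y).1 = (x, y) := by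
  rw [cl_fst_of_trace_le h.ge, h, sup_eq_left.2 (Γ₂.ι_trace_le y)]

variable (Γ₁ Γ₂) in
/-- The image in the pushout of an element of the first lattice. -/
noncomputable def inl (H : Γ₁.E) : PushCarrier Γ₁ Γ₂ :=
  ⟨(H, Γ₂.ι (Γ₁.trace H)), by simp only [trace_ι]⟩

variable (Γ₁ Γ₂) in
/-- The image in the pushout of an element of the second lattice. -/
noncomputable def inr (H : Γ₂.E) : PushCarrier Γ₁ Γ₂ :=
  ⟨(Γ₁.ι (Γ₂.trace H), H), by simp only [trace_ι]⟩

theorem inl_le {H : Γ₁.E} {x : PushCarrier Γ₁ Γ₂} : inl Γ₁ Γ₂ H ≤ x ↔ H ≤ x.1.1 :=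
  ⟨fun h => h.1, fun h => ⟨h, (Γ₂.trace_le_iff _ _).1 (x.2 ▸ Γ₁.trace_mono h)⟩⟩

theorem inr_le {H : Γ₂.E} {x : PushCarrier Γ₁ Γ₂} : inr Γ₁ Γ₂ H ≤ x ↔ H ≤ x.1.2 :=
  ⟨fun h => h.2, fun h => ⟨(Γ₁.trace_le_iff _ _).1 (x.2 ▸ Γ₂.trace_mono h), h⟩⟩

theorem isAtom_inl {H : Γ₁.E} (hH : IsAtom H) : IsAtom (inl Γ₁ Γ₂ H) := by
  refine ⟨fun h => hH.1 (congrArg (fun x : PushCarrier Γ₁ Γ₂ => x.1.1) h), fun x hx => ?_⟩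
  have h1 : x.1.1 ≠ H := fun h => hx.not_ge (inl_le.2 h.ge)
  have h2 : x.1.1 = ⊥ := (hH.le_iff.1 hx.le.1).resolve_right h1
  have h3 : Γ₂.trace x.1.2 = ⊥ := by rw [← x.2, h2, trace_bot]
  refine ext h2 ?_
  have h4 : x.1.2 ≤ Γ₂.top := hx.le.2.trans (Γ₂.ι_le_top _)
  have h5 := Γ₂.ι_trace_of_le h4
  rw [h3, ι_bot] at h5
  exact h5.symm

theorem isAtom_inr {H : Γ₂.E} (hH : IsAtom H) : IsAtom (inr Γ₁ Γ₂ H) := by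
  refine ⟨fun h => hH.1 (congrArg (fun x : PushCarrier Γ₁ Γ₂ => x.1.2) h), fun x hx => ?_⟩
  have h1 : x.1.2 ≠ H := fun h => hx.not_ge (inr_le.2 h.ge)
  have h2 : x.1.2 = ⊥ := (hH.le_iff.1 hx.le.2).resolve_right h1
  have h3 : Γ₁.trace x.1.1 = ⊥ := by rw [x.2, h2, trace_bot]
  refine ext ?_ h2
  have h4 : x.1.1 ≤ Γ₁.top := hx.le.1.trans (Γ₁.ι_le_top _)
  have h5 := Γ₁.ι_trace_of_le h4
  rw [h3, ι_bot] at h5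
  exact h5.symm

/-- The images of the atoms of the two lattices take over the role of atoms until the pushout is
known to be a geometric lattice. -/
theorem exists_generator {x y : PushCarrier Γ₁ Γ₂} (h : ¬ y ≤ x) :
    ∃ a, ((∃ H, IsAtom H ∧ a = inl Γ₁ Γ₂ H) ∨ ∃ H, IsAtom H ∧ a = inr Γ₁ Γ₂ H) ∧
      a ≤ y ∧ ¬ a ≤ x := by
  rw [le_def, not_and_or] at h
  rcases h with h | h
  · obtain ⟨H, h1, h2, h3⟩ := exists_atom_not_le h
    exact ⟨inl Γ₁ Γ₂ H, Or.inl ⟨H, h1, rfl⟩, inl_le.2 h2, fun h => h3 (inl_le.1 h)⟩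
  · obtain ⟨H, h1, h2, h3⟩ := exists_atom_not_le h
    exact ⟨inr Γ₁ Γ₂ H, Or.inr ⟨H, h1, rfl⟩, inr_le.2 h2, fun h => h3 (inr_le.1 h)⟩

/-- The rank function of the pushout. -/
noncomputable def rank (x : PushCarrier Γ₁ Γ₂) : ℤ := rk x.1.1 + rk x.1.2 - rk (Γ₁.trace x.1.1)

/-- A sum of three monotone terms: ranks in [F_ι₁, ⊤] and [F_ι₂, ⊤], and the rank of the trace. If
none of them grows along x ≤ y then x = y, which is how `rank_lt` obtains strict monotonicity. -/
theorem rank_eq (x : PushCarrier Γ₁ Γ₂) : x.rank = rk (x.1.1 ⊔ Γ₁.top) - rk Γ₁.top +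
    (rk (x.1.2 ⊔ Γ₂.top) - rk Γ₂.top) + rk (Γ₁.trace x.1.1) := by
  rw [← rk_sub_rk_trace, ← rk_sub_rk_trace, ← x.2, rank]
  ring

theorem rank_lt {x y : PushCarrier Γ₁ Γ₂} (h : x < y) : x.rank < y.rank := by
  by_contra hc
  rw [rank_eq, rank_eq] at hc
  have h1 := rk_mono (sup_le_sup_right h.le.1 Γ₁.top)
  have h2 := rk_mono (sup_le_sup_right h.le.2 Γ₂.top)
  have h3 := rk_mono (Γ₁.trace_mono h.le.1)
  have e1 := eq_of_le_of_rk_le (sup_le_sup_right h.le.1 Γ₁.top) (by omega)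
  have e2 := eq_of_le_of_rk_le (sup_le_sup_right h.le.2 Γ₂.top) (by omega)
  have e3 := eq_of_le_of_rk_le (Γ₁.trace_mono h.le.1) (by omega)
  refine h.ne (ext ?_ ?_)
  · exact Γ₁.eq_of_trace_eq h.le.1 e3 (le_sup_left.trans e1.ge)
  · exact Γ₂.eq_of_trace_eq h.le.2 (by rw [← x.2, ← y.2, e3]) (le_sup_left.trans e2.ge)

/-- Enlarging y to a flat with the trace of x does not change rk y - rk (trace y), because this
difference only depends on y ∨ F_ι₂. -/
theorem rank_cl_left {x : Γ₁.E} {y : Γ₂.E} (h : Γ₂.trace y ≤ Γ₁.trace x) :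
    (cl x y).rank = rk x + (rk y - rk (Γ₂.trace y)) := by
  have e := Γ₂.rk_sub_rk_trace (y ⊔ Γ₂.ι (Γ₁.trace x))
  rw [trace_sup_ι, sup_eq_right.2 h, sup_assoc, sup_eq_right.2 (Γ₂.ι_le_top _),
    ← rk_sub_rk_trace] at e
  rw [rank, cl_fst_of_trace_le h, ← e]
  ring

theorem rank_cl_right {x : Γ₁.E} {y : Γ₂.E} (h : Γ₁.trace x ≤ Γ₂.trace y) :
    (cl x y).rank = rk y + (rk x - rk (Γ₁.trace x)) := by
  have e := Γ₁.rk_sub_rk_trace (x ⊔ Γ₁.ι (Γ₂.trace y))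
  rw [trace_sup_ι, sup_eq_right.2 h, sup_assoc, sup_eq_right.2 (Γ₁.ι_le_top _),
    ← rk_sub_rk_trace] at e
  rw [rank, (cl x y).2, cl_snd_of_trace_le h, ← e]
  ring

theorem sup_inl (x : PushCarrier Γ₁ Γ₂) (H : Γ₁.E) :
    x ⊔ inl Γ₁ Γ₂ H = cl (x.1.1 ⊔ H) x.1.2 := by
  refine eq_of_forall_ge_iff fun z => ?_
  rw [sup_le_iff, inl_le, cl_le, sup_le_iff, le_def]
  tauto

theorem sup_inr (x : PushCarrier Γ₁ Γ₂) (H : Γ₂.E) :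
    x ⊔ inr Γ₁ Γ₂ H = cl x.1.1 (x.1.2 ⊔ H) := by
  refine eq_of_forall_ge_iff fun z => ?_
  rw [sup_le_iff, inr_le, cl_le, sup_le_iff, le_def]
  tauto

theorem rank_sup_generator_le (x : PushCarrier Γ₁ Γ₂) {a : PushCarrier Γ₁ Γ₂}
    (ha : (∃ H, IsAtom H ∧ a = inl Γ₁ Γ₂ H) ∨ ∃ H, IsAtom H ∧ a = inr Γ₁ Γ₂ H) :
    (x ⊔ a).rank ≤ x.rank + 1 := by
  rcases ha with ⟨H, hH, rfl⟩ | ⟨H, hH, rfl⟩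
  · rw [sup_inl, rank_cl_left (x.2 ▸ Γ₁.trace_mono le_sup_left), rank, x.2]
    have := rk_sup_atom_le x.1.1 hH
    omega
  · rw [sup_inr, rank_cl_right (x.2 ▸ Γ₂.trace_mono le_sup_left), rank]
    have := rk_sup_atom_le x.1.2 hH
    omega

/-- The rank is strictly monotone and integer valued, and it grows by at most one; there is no room
for an intermediate element. -/
theorem covBy_sup_generator {x a : PushCarrier Γ₁ Γ₂} (h : ¬ a ≤ x)
    (ha : (∃ H, IsAtom H ∧ a = inl Γ₁ Γ₂ H) ∨ ∃ H, IsAtom H ∧ a = inr Γ₁ Γ₂ H) : x ⋖ x ⊔ a := by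
  refine ⟨lt_of_le_of_ne le_sup_left fun e => h (le_sup_right.trans e.ge), fun c h1 h2 => ?_⟩
  have := rank_lt h1
  have := rank_lt h2
  have := rank_sup_generator_le x ha
  omega

end PushCarrier

open PushCarrier

/-- The pushout `E₁ ∪_L E₂`. -/
noncomputable def pushLat (Γ₁ Γ₂ : Diag L) : GeomLat.{u} where
  carrier := PushCarrier Γ₁ Γ₂
  atomistic := ⟨fun b => by
    refine ⟨{x | IsAtom x ∧ x ≤ b}, ⟨fun x hx => hx.2, fun y hy => ?_⟩, fun x hx => hx.1⟩
    by_contra hc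
    obtain ⟨a, ha, h1, h2⟩ := exists_generator hc
    refine h2 (hy ⟨?_, h1⟩)
    rcases ha with ⟨H, hH, rfl⟩ | ⟨H, hH, rfl⟩
    · exact isAtom_inl hH
    · exact isAtom_inr hH⟩
  semimodular := ⟨fun {a b} h => by
    -- A generator g below a but not below b satisfies a = (a ∧ b) ∨ g, hence a ∨ b = b ∨ g, which
    -- covers b.
    obtain ⟨g, hg, h1, h2⟩ := exists_generator (fun h' => h.lt.ne (inf_eq_left.2 h'))
    have e1 : (a ⊓ b) ⊔ g = a := (h.eq_or_eq le_sup_left (sup_le inf_le_left h1)).resolve_left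
      fun e => h2 ((sup_eq_left.1 e).trans inf_le_right)
    have e2 : a ⊔ b = b ⊔ g := by
      refine le_antisymm (sup_le ?_ le_sup_left) (sup_le le_sup_right (h1.trans le_sup_left))
      rw [← e1]
      exact sup_le (inf_le_right.trans le_sup_left) le_sup_right
    rw [e2]
    exact covBy_sup_generator h2 hg⟩
  nontrivial := ⟨⟨⊥, ⊤, fun h => bot_ne_top (congrArg (fun x : PushCarrier Γ₁ Γ₂ => x.1.1) h)⟩⟩

theorem rk_pushLat {Γ₁ Γ₂ : Diag L} (x : pushLat Γ₁ Γ₂) : rk x = PushCarrier.rank x := by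
  refine rk_unique (r := fun x : pushLat Γ₁ Γ₂ => PushCarrier.rank x) ?_ ?_ x
  · change rk (⊥ : Γ₁.E) + rk (⊥ : Γ₂.E) - rk (Γ₁.trace ⊥) = 0
    simp only [trace_bot, rk_bot]
    omega
  · intro x a ha hx
    have hlt : x < x ⊔ a := (covBy_sup_atom ha hx).lt
    have h1 := rank_lt hlt
    obtain ⟨g, hg, h2, h3⟩ := exists_generator (fun h' => ha.1 (le_bot_iff.1 h'))
    have e : g = a := (ha.le_iff.1 h2).resolve_left fun e => h3 e.le
    have h4 := rank_sup_generator_le x (e ▸ hg)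
    exact le_antisymm h4 h1

/-- Since F₁ and F₂ contain the images of L, meeting with them does not change traces. In the first
law the joins on both sides are therefore corrected by the same ι t, and in the second law no
correction is needed; both reduce to the laws for F₁ and F₂ in the components. -/
theorem isModularElt_push {Γ₁ Γ₂ : Diag L} {F₁ : Γ₁.E} {F₂ : Γ₂.E} (h₁ : IsModularElt F₁)
    (h₂ : IsModularElt F₂) (hF₁ : Γ₁.top ≤ F₁) (hF₂ : Γ₂.top ≤ F₂)
    (h : Γ₁.trace F₁ = Γ₂.trace F₂) :
    IsModularElt (PushCarrier.mk F₁ F₂ h) := by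
  have t1 : Γ₁.trace F₁ = ⊤ := Γ₁.trace_eq_top_iff.2 hF₁
  have t2 : Γ₂.trace F₂ = ⊤ := Γ₂.trace_eq_top_iff.2 hF₂
  refine ⟨fun A B hA => ?_, fun A B hAB => ?_⟩
  · have e1 : Γ₁.trace (A.1.1 ⊔ (F₁ ⊓ B.1.1)) = Γ₁.trace (A.1.1 ⊔ B.1.1) := by
      rw [← h₁.1 _ _ hA.1, trace_inf, t1, top_inf_eq]
    have e2 : Γ₂.trace (A.1.2 ⊔ (F₂ ⊓ B.1.2)) = Γ₂.trace (A.1.2 ⊔ B.1.2) := by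
      rw [← h₂.1 _ _ hA.2, trace_inf, t2, top_inf_eq]
    have key : ∀ {Γ : Diag L} {F a b : Γ.E} (t : L), IsModularElt F → Γ.top ≤ F → a ≤ F →
        F ⊓ (a ⊔ b ⊔ Γ.ι t) = a ⊔ (F ⊓ b) ⊔ Γ.ι t := by
      intro Γ F a b t hF htop ha
      rw [sup_right_comm, hF.1 _ _ (sup_le ha ((Γ.ι_le_top t).trans htop)), sup_right_comm]
    refine ext ?_ ?_
    · change F₁ ⊓ (A.1.1 ⊔ B.1.1 ⊔ Γ₁.ι (Γ₁.trace (A.1.1 ⊔ B.1.1) ⊔ Γ₂.trace (A.1.2 ⊔ B.1.2))) =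
        A.1.1 ⊔ (F₁ ⊓ B.1.1) ⊔ Γ₁.ι (Γ₁.trace (A.1.1 ⊔ (F₁ ⊓ B.1.1)) ⊔
          Γ₂.trace (A.1.2 ⊔ (F₂ ⊓ B.1.2)))
      rw [e1, e2, key _ h₁ hF₁ hA.1]
    · change F₂ ⊓ (A.1.2 ⊔ B.1.2 ⊔ Γ₂.ι (Γ₁.trace (A.1.1 ⊔ B.1.1) ⊔ Γ₂.trace (A.1.2 ⊔ B.1.2))) =
        A.1.2 ⊔ (F₂ ⊓ B.1.2) ⊔ Γ₂.ι (Γ₁.trace (A.1.1 ⊔ (F₁ ⊓ B.1.1)) ⊔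
          Γ₂.trace (A.1.2 ⊔ (F₂ ⊓ B.1.2)))
      rw [e1, e2, key _ h₂ hF₂ hA.2]
  · have hs : (A ⊔ (PushCarrier.mk F₁ F₂ h)).1 = (A.1.1 ⊔ F₁, A.1.2 ⊔ F₂) := by
      refine cl_of_trace_eq ?_
      change Γ₁.trace (A.1.1 ⊔ F₁) = Γ₂.trace (A.1.2 ⊔ F₂)
      rw [Γ₁.trace_eq_top_iff.2 (hF₁.trans le_sup_right),
        Γ₂.trace_eq_top_iff.2 (hF₂.trans le_sup_right)]
    have e1 := h₁.2 _ _ hAB.1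
    have e2 := h₂.2 _ _ hAB.2
    have hr : (A ⊔ (B ⊓ (PushCarrier.mk F₁ F₂ h))).1 =
        (A.1.1 ⊔ (B.1.1 ⊓ F₁), A.1.2 ⊔ (B.1.2 ⊓ F₂)) := by
      refine cl_of_trace_eq ?_
      change Γ₁.trace (A.1.1 ⊔ (B.1.1 ⊓ F₁)) = Γ₂.trace (A.1.2 ⊔ (B.1.2 ⊓ F₂))
      rw [← e1, ← e2, trace_inf, trace_inf, Γ₁.trace_eq_top_iff.2 (hF₁.trans le_sup_right),
        Γ₂.trace_eq_top_iff.2 (hF₂.trans le_sup_right), B.2]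
    refine Subtype.ext ?_
    rw [hr, ← e1, ← e2]
    refine Prod.ext ?_ ?_
    · exact congrArg (fun p => B.1.1 ⊓ p.1) hs
    · exact congrArg (fun p => B.1.2 ⊓ p.2) hs

/-- The product of two modular diagrams. -/
noncomputable def push (Γ₁ Γ₂ : Diag L) : Diag L where
  E := pushLat Γ₁ Γ₂
  ι x := ⟨(Γ₁.ι x, Γ₂.ι x), by simp only [trace_ι]⟩
  emb :=
    { injective := fun x y e =>
        Γ₁.emb.injective (congrArg (fun x : PushCarrier Γ₁ Γ₂ => x.1.1) e)
      map_sup := fun x y => by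
        refine Subtype.ext ?_
        refine Eq.trans ?_ (cl_of_trace_eq ?_).symm
        · exact Prod.ext (Γ₁.ι_sup x y) (Γ₂.ι_sup x y)
        · change Γ₁.trace (Γ₁.ι x ⊔ Γ₁.ι y) = Γ₂.trace (Γ₂.ι x ⊔ Γ₂.ι y)
          rw [← ι_sup, ← ι_sup, trace_ι, trace_ι]
      map_atom := fun a ha => by
        have := isAtom_inl (Γ₂ := Γ₂) (Γ₁.emb.map_atom a ha)
        simp only [inl, trace_ι] at this
        exact this }
  range_ι := by
    refine Set.Subset.antisymm ?_ fun y hy => ?_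
    · rintro _ ⟨x, rfl⟩
      exact ⟨Γ₁.ι_le_top x, Γ₂.ι_le_top x⟩
    · refine ⟨Γ₁.trace y.1.1, PushCarrier.ext (Γ₁.ι_trace_of_le hy.1) ?_⟩
      change Γ₂.ι (Γ₁.trace y.1.1) = y.1.2
      rw [y.2]
      exact Γ₂.ι_trace_of_le hy.2
  modular := isModularElt_push Γ₁.modular Γ₂.modular le_rfl le_rfl _
  J := Γ₁.J.map (inl Γ₁ Γ₂) ++ Γ₂.J.map (inr Γ₁ Γ₂)
  atoms H hH := by
    rcases List.mem_append.1 hH with hH | hH <;> obtain ⟨K, hK, rfl⟩ := List.mem_map.1 hH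
    · exact isAtom_inl (Γ₁.atoms K hK)
    · exact isAtom_inr (Γ₂.atoms K hK)

theorem push_trace (Γ₁ Γ₂ : Diag L) (x : (push Γ₁ Γ₂).E) :
    (push Γ₁ Γ₂).trace x = Γ₁.trace x.1.1 := by
  refine eq_of_forall_le_iff fun c => ?_
  rw [trace_le_iff]
  refine Iff.trans (b := Γ₁.ι c ≤ x.1.1 ∧ Γ₂.ι c ≤ x.1.2) Iff.rfl ?_
  rw [← trace_le_iff, ← trace_le_iff, ← x.2, and_self]

theorem isPushout_push (Γ₁ Γ₂ : Diag L) : IsPushout Γ₁ Γ₂ (push Γ₁ Γ₂) := by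
  refine ⟨fun x => x.1, fun x y => Iff.rfl, Subtype.range_coe, fun x => rfl, ?_⟩
  exact map_append_map Subtype.val (inl Γ₁ Γ₂) (inr Γ₁ Γ₂) Γ₁.J Γ₂.J

/-- Pushouts are unique up to isomorphism and isomorphic diagrams have the same class, so the
product does not depend on the chosen model. -/
theorem IsPushout.mk_eq {Γ₁ Γ₂ Γ : Diag L} (h : IsPushout Γ₁ Γ₂ Γ) :
    MD.mk Γ = MD.mk (push Γ₁ Γ₂) := by
  obtain ⟨ψ, h1, h2, h3, h4⟩ := h
  have hinj : Function.Injective ψ := fun x y e => le_antisymm ((h1 x y).1 e.le) ((h1 y x).1 e.ge)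
  have hmem : ∀ x, Γ₁.trace (ψ x).1 = Γ₂.trace (ψ x).2 := fun x => by
    have : ψ x ∈ Set.range ψ := ⟨x, rfl⟩
    rwa [h2] at this
  let e : Γ.E ≃o PushCarrier Γ₁ Γ₂ :=
    { toEquiv := Equiv.ofBijective (fun x => (⟨ψ x, hmem x⟩ : PushCarrier Γ₁ Γ₂))
        ⟨fun x y h => hinj (congrArg Subtype.val h), fun y => by
          have : y.1 ∈ Set.range ψ := by rw [h2]; exact y.2
          obtain ⟨x, hx⟩ := this
          exact ⟨x, Subtype.ext hx⟩⟩
      map_rel_iff' := fun {x y} => h1 x y }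
  refine MD.mk_eq_of_iso (Γ' := push Γ₁ Γ₂) e (fun x => Subtype.ext (h3 x).symm) ?_
  have hval : Function.Injective (fun x : PushCarrier Γ₁ Γ₂ => x.1) := Subtype.val_injective
  refine List.map_injective_iff.2 hval ?_
  refine (map_append_map _ (inl Γ₁ Γ₂) (inr Γ₁ Γ₂) Γ₁.J Γ₂.J).trans ?_
  exact h4.symm.trans (List.map_map (f := e) (g := fun x : PushCarrier Γ₁ Γ₂ => x.1)).symm

theorem push_word_left (Γ₁ Γ₂ : Diag L) {l : List Γ₁.E} (h : ∀ H ∈ l, IsAtom H) :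
    MD.mk (push (Γ₁.withWord l h) Γ₂) =
      (push Γ₁ Γ₂).wd (l.map (inl Γ₁ Γ₂) ++ Γ₂.J.map (inr Γ₁ Γ₂)) :=
  (wd_J (push (Γ₁.withWord l h) Γ₂)).symm

theorem isAlt_onWords {M : Type*} [AddCommGroup M] {f : Diag L → M} {Γ : Diag L}
    {g : List Γ.E → M} (hg : IsAlt g) (h : ∀ l (hl : ∀ H ∈ l, IsAtom H), f (Γ.withWord l hl) = g l) :
    IsAlt (onWords f Γ) := by
  intro l₁ l₂ a b
  have e : (∀ H ∈ l₁ ++ a :: b :: l₂, IsAtom H) ↔ ∀ H ∈ l₁ ++ b :: a :: l₂, IsAtom H := by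
    refine forall_congr' fun H => ?_
    simp only [List.mem_append, List.mem_cons]
    tauto
  by_cases hl : ∀ H ∈ l₁ ++ a :: b :: l₂, IsAtom H
  · rw [onWords_of_atoms _ _ hl, onWords_of_atoms _ _ (e.1 hl), h, h, hg]
  · rw [onWords, onWords, dif_neg hl, dif_neg fun h' => hl (e.2 h'), neg_zero]

/-- Witnesses of the relations extend to the pushout: X becomes (X, ⊤), a modular flat F becomes (F,
⊤), and a splitting a, b becomes (a, ⊤), (b, ⊥), which makes sense because flats below b have trace
⊥ when F_ι ≤ a. Letters coming from Γ₂ lie below every element with second component ⊤. -/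
theorem isInvariant_push_left (Γ₂ : Diag L) :
    IsInvariant fun Γ₁ : Diag L => MD.mk (push Γ₁ Γ₂) where
  swap Γ := isAlt_onWords (((push Γ Γ₂).isAlt_wd.append_right (Γ₂.J.map (inr Γ Γ₂))).map
    (inl Γ Γ₂)) fun l hl => push_word_left Γ Γ₂ hl
  embedding Γ Γ' φ hφ htop hι hJ := by
    have htr := trace_map hφ hι
    let φ' : (push Γ Γ₂).E → (push Γ' Γ₂).E := fun x => ⟨(φ x.1.1, x.1.2), by rw [htr, x.2]⟩
    have hφ' : IsEmbedding φ' := by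
      refine ⟨fun x y e => PushCarrier.ext ?_ ?_, fun x y => PushCarrier.ext ?_ ?_, ?_⟩
      · exact hφ.injective (congrArg (fun x : PushCarrier Γ' Γ₂ => x.1.1) e)
      · exact congrArg (fun x : PushCarrier Γ' Γ₂ => x.1.2) e
      · change φ (x.1.1 ⊔ y.1.1 ⊔ Γ.ι (Γ.trace (x.1.1 ⊔ y.1.1) ⊔ Γ₂.trace (x.1.2 ⊔ y.1.2))) =
          φ x.1.1 ⊔ φ y.1.1 ⊔ Γ'.ι (Γ'.trace (φ x.1.1 ⊔ φ y.1.1) ⊔ Γ₂.trace (x.1.2 ⊔ y.1.2))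
        rw [← hφ.map_sup, htr, hι, ← hφ.map_sup]
      · change x.1.2 ⊔ y.1.2 ⊔ Γ₂.ι (Γ.trace (x.1.1 ⊔ y.1.1) ⊔ Γ₂.trace (x.1.2 ⊔ y.1.2)) =
          x.1.2 ⊔ y.1.2 ⊔ Γ₂.ι (Γ'.trace (φ x.1.1 ⊔ φ y.1.1) ⊔ Γ₂.trace (x.1.2 ⊔ y.1.2))
        rw [← hφ.map_sup, htr]
      · intro a ha
        obtain ⟨g, hg, h1, h2⟩ := exists_generator (fun h' => ha.1 (le_bot_iff.1 h'))
        have e : g = a := (ha.le_iff.1 h1).resolve_left fun e => h2 e.le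
        subst e
        rcases hg with ⟨H, hH, rfl⟩ | ⟨H, hH, rfl⟩
        · have := isAtom_inl (Γ₂ := Γ₂) (hφ.map_atom H hH)
          simp only [inl, htr] at this
          exact this
        · have := isAtom_inr (Γ₁ := Γ') hH
          simp only [inr, hι] at this
          exact this
    refine MD.isInvariant_mk.embedding _ _ φ' hφ' (PushCarrier.ext htop rfl)
      (fun x => PushCarrier.ext (hι x) rfl) ?_
    refine Eq.trans ?_ (map_append_map φ' (inl Γ Γ₂) (inr Γ Γ₂) Γ.J Γ₂.J).symm
    change Γ'.J.map (inl Γ' Γ₂) ++ Γ₂.J.map (inr Γ' Γ₂) = _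
    rw [hJ, List.map_map]
    congr 1
    · refine List.map_congr_left fun H _ => PushCarrier.ext rfl ?_
      change Γ₂.ι (Γ'.trace (φ H)) = Γ₂.ι (Γ.trace H)
      rw [htr]
    · exact List.map_congr_left fun H _ => PushCarrier.ext (hι _) rfl
  not_spanning Γ X hX htop hJ := by
    have t : Γ.trace X = Γ₂.trace ⊤ := by rw [trace_top, trace_eq_top_iff]; exact htop
    refine MD.isInvariant_mk.not_spanning (push Γ Γ₂) (PushCarrier.mk X ⊤ t) ?_
      ⟨htop, le_top⟩ ?_
    · exact lt_of_le_of_ne le_top fun e => hX.ne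
        (congrArg (fun x : PushCarrier Γ Γ₂ => x.1.1) e)
    · intro H hH
      rcases List.mem_append.1 hH with hH | hH <;> obtain ⟨K, hK, rfl⟩ := List.mem_map.1 hH
      · exact inl_le.2 (hJ K hK)
      · exact inr_le.2 le_top
  product Γ a b h ha hb htop := by
    have t : Γ.trace a = Γ₂.trace ⊤ := by rw [trace_top, trace_eq_top_iff]; exact htop
    have hab : b ⊓ a = ⊥ := by
      have := h.left ⊥ b bot_le le_rfl
      rwa [bot_sup_eq, le_bot_iff] at this
    have tb : ∀ z ≤ b, Γ.trace z = ⊥ := fun z hz => by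
      apply Γ.emb.injective
      rw [ι_trace, ι_bot, ← le_bot_iff, ← hab]
      exact inf_le_inf hz htop
    have t' : Γ.trace b = Γ₂.trace ⊥ := by rw [trace_bot, tb b le_rfl]
    have hs : IsSplit (PushCarrier.mk a ⊤ t) (PushCarrier.mk b ⊥ t') := by
      have key : ∀ y z : PushCarrier Γ Γ₂, y ≤ .mk a ⊤ t → z ≤ .mk b ⊥ t' →
          (y ⊔ z).1 = (y.1.1 ⊔ z.1.1, y.1.2) := by
        intro y z hy hz
        have hz2 : z.1.2 = ⊥ := le_bot_iff.1 hz.2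
        have : (y ⊔ z).1 = (y.1.1 ⊔ z.1.1, y.1.2 ⊔ z.1.2) := by
          refine cl_of_trace_eq ?_
          rw [hz2, sup_bot_eq, ← y.2]
          apply Γ.trace_eq_of_inf_eq
          refine le_antisymm (le_inf ?_ inf_le_right) (inf_le_inf_right _ le_sup_left)
          exact (inf_le_inf_left _ htop).trans (h.left _ _ hy.1 hz.1)
        rw [this, hz2, sup_bot_eq]
      refine ⟨fun x => ?_, fun y z hy hz => ?_, fun y z hy hz => ?_⟩
      · refine le_def.2 ⟨(h.le_sup x.1.1).trans le_sup_left, ?_⟩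
        exact (le_inf le_rfl le_top).trans (le_sup_left.trans le_sup_left)
      · refine le_def.2 ⟨?_, ?_⟩
        · change (y ⊔ z).1.1 ⊓ a ≤ _
          rw [key y z hy hz]
          exact h.left _ _ hy.1 hz.1
        · change (y ⊔ z).1.2 ⊓ ⊤ ≤ _
          rw [key y z hy hz]
          exact inf_le_left
      · refine le_def.2 ⟨?_, ?_⟩
        · change (y ⊔ z).1.1 ⊓ b ≤ _
          rw [key y z hy hz]
          exact h.right _ _ hy.1 hz.1
        · exact inf_le_right.trans bot_le
    refine MD.isInvariant_mk.product (push Γ Γ₂) _ _ hs ?_ ?_ ⟨htop, le_top⟩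
    · exact fun e => ha (congrArg (fun x : PushCarrier Γ Γ₂ => x.1.1) e)
    · exact fun e => hb (congrArg (fun x : PushCarrier Γ Γ₂ => x.1.1) e)
  two_outside Γ F A B l hF htop hA hB hl hJ := by
    have t : Γ.trace F = Γ₂.trace ⊤ := by rw [trace_top, trace_eq_top_iff]; exact htop
    refine MD.isInvariant_mk.two_outside (push Γ Γ₂) (PushCarrier.mk F ⊤ t)
      (inl Γ Γ₂ A) (inl Γ Γ₂ B) (l.map (inl Γ Γ₂) ++ Γ₂.J.map (inr Γ Γ₂))
      (isModularElt_push hF isModularElt_top htop le_top t) ⟨htop, le_top⟩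
      (fun h => hA (inl_le.1 h)) (fun h => hB (inl_le.1 h)) ?_ ?_
    · intro H hH
      rcases List.mem_append.1 hH with hH | hH <;> obtain ⟨K, hK, rfl⟩ := List.mem_map.1 hH
      · exact inl_le.2 (hl K hK)
      · exact inr_le.2 le_top
    · change Γ.J.map (inl Γ Γ₂) ++ Γ₂.J.map (inr Γ Γ₂) = _
      rw [hJ]
      rfl

end Diag

/-! ### The graded algebra structure of `MD L` -/

theorem negOnePow_smul {M : Type*} [AddCommGroup M] (n : ℕ) (x : M) :
    (n : ℤ).negOnePow • x = (-1 : ℤ) ^ n • x := by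
  rw [Units.smul_def, Int.negOnePow_def]
  simp

namespace Diag

variable {L : GeomLat.{u}}

open PushCarrier

theorem mk_push_comm (Γ₁ Γ₂ : Diag L) : MD.mk (push Γ₁ Γ₂) =
    (-1 : ℤ) ^ (Γ₁.J.length * Γ₂.J.length) • MD.mk (push Γ₂ Γ₁) := by
  let e : PushCarrier Γ₁ Γ₂ ≃o PushCarrier Γ₂ Γ₁ :=
    { toFun := fun x => .mk x.1.2 x.1.1 x.2.symm
      invFun := fun x => .mk x.1.2 x.1.1 x.2.symm
      left_inv := fun _ => rfl
      right_inv := fun _ => rfl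
      map_rel_iff' := fun {x y} => and_comm }
  have h1 := (push Γ₁ Γ₂).isAlt_wd.append_comm (Γ₁.J.map (inl Γ₁ Γ₂)) (Γ₂.J.map (inr Γ₁ Γ₂))
  have h2 : (push Γ₁ Γ₂).wd (Γ₁.J.map (inl Γ₁ Γ₂) ++ Γ₂.J.map (inr Γ₁ Γ₂)) =
      MD.mk (push Γ₁ Γ₂) := wd_J _
  have h3 : (push Γ₁ Γ₂).wd (Γ₂.J.map (inr Γ₁ Γ₂) ++ Γ₁.J.map (inl Γ₁ Γ₂)) =
      MD.mk (push Γ₂ Γ₁) := by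
    refine (wd_map (Γ := push Γ₁ Γ₂) (Γ' := push Γ₂ Γ₁) e (IsEmbedding.of_orderIso
      (L := pushLat Γ₁ Γ₂) (M := pushLat Γ₂ Γ₁) e) e.map_top (fun x => rfl) _).symm.trans ?_
    refine Eq.trans ?_ (wd_J (push Γ₂ Γ₁))
    exact congrArg _ (map_append_map e (inr Γ₁ Γ₂) (inl Γ₁ Γ₂) Γ₂.J Γ₁.J)
  have hl : (Γ₁.J.map (inl Γ₁ Γ₂)).length * (Γ₂.J.map (inr Γ₁ Γ₂)).length =
      Γ₁.J.length * Γ₂.J.length := by rw [List.length_map, List.length_map]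
  exact h2.symm.trans (h1.trans (congrArg₂ (fun (n : ℕ) (y : MD L) => (-1 : ℤ) ^ n • y) hl h3))

theorem IsInvariant.smul_pow {M : Type*} [AddCommGroup M] {f : Diag L → M} (hf : IsInvariant f)
    (n : ℕ) : IsInvariant fun Γ => (-1 : ℤ) ^ (n * Γ.J.length) • f Γ where
  swap Γ := by
    refine isAlt_onWords (g := fun l => (-1 : ℤ) ^ (n * l.length) • onWords f Γ l) ?_ ?_
    · intro l₁ l₂ a b
      simp only [hf.swap Γ l₁ l₂ a b, List.length_append, List.length_cons, smul_neg]
    · intro l hl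
      rw [onWords_of_atoms f Γ hl]
      rfl
  embedding Γ Γ' φ hφ htop hι hJ := by
    rw [hf.embedding Γ Γ' φ hφ htop hι hJ, hJ, List.length_map]
  not_spanning Γ X hX htop hJ := by rw [hf.not_spanning Γ X hX htop hJ, smul_zero]
  product Γ a b h ha hb htop := by rw [hf.product Γ a b h ha hb htop, smul_zero]
  two_outside Γ F A B l hF htop hA hB hl hJ := by
    rw [hf.two_outside Γ F A B l hF htop hA hB hl hJ, smul_zero]

/-- Graded commutativity reduces this to the other factor; the sign only depends on the length of
the word and does not disturb invariance. -/
theorem isInvariant_push_right (Γ₁ : Diag L) :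
    IsInvariant fun Γ₂ : Diag L => MD.mk (push Γ₁ Γ₂) := by
  have := (isInvariant_push_left Γ₁).smul_pow Γ₁.J.length
  convert this using 2
  exact mk_push_comm _ _

end Diag

namespace MD

open Diag

variable {L L' : GeomLat.{u}} {M : Type*} [AddCommGroup M] [Module ℚ M]

/-- The bilinear map defined by a function of two diagrams. -/
noncomputable def lift₂ (f : Diag L → Diag L' → M) (h₁ : ∀ Γ₂, IsInvariant fun Γ₁ => f Γ₁ Γ₂)
    (h₂ : ∀ Γ₁, IsInvariant (f Γ₁)) : MD L →ₗ[ℚ] MD L' →ₗ[ℚ] M :=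
  lift (fun Γ₁ => lift (f Γ₁) (h₂ Γ₁))
    { swap := fun Γ l₁ l₂ a b => hom_ext fun Γ₂ => by
        have key : ∀ l, (onWords (fun Γ₁ => lift (f Γ₁) (h₂ Γ₁)) Γ l) (mk Γ₂) =
            onWords (fun Γ₁ => f Γ₁ Γ₂) Γ l := by
          intro l
          unfold onWords
          split_ifs
          · exact lift_mk _ _ _
          · rfl
        rw [LinearMap.neg_apply, key, key]
        exact (h₁ Γ₂).swap Γ l₁ l₂ a b
      embedding := fun Γ Γ' φ hφ htop hι hJ => hom_ext fun Γ₂ => by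
        rw [lift_mk, lift_mk]
        exact (h₁ Γ₂).embedding Γ Γ' φ hφ htop hι hJ
      not_spanning := fun Γ X hX htop hJ => hom_ext fun Γ₂ => by
        rw [lift_mk]
        exact (h₁ Γ₂).not_spanning Γ X hX htop hJ
      product := fun Γ a b h ha hb htop => hom_ext fun Γ₂ => by
        rw [lift_mk]
        exact (h₁ Γ₂).product Γ a b h ha hb htop
      two_outside := fun Γ F A B l hF htop hA hB hl hJ => hom_ext fun Γ₂ => by
        rw [lift_mk]
        exact (h₁ Γ₂).two_outside Γ F A B l hF htop hA hB hl hJ }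

@[simp]
theorem lift₂_mk (f : Diag L → Diag L' → M) (h₁ : ∀ Γ₂, IsInvariant fun Γ₁ => f Γ₁ Γ₂)
    (h₂ : ∀ Γ₁, IsInvariant (f Γ₁)) (Γ₁ : Diag L) (Γ₂ : Diag L') :
    lift₂ f h₁ h₂ (mk Γ₁) (mk Γ₂) = f Γ₁ Γ₂ := by
  rw [lift₂, lift_mk, lift_mk]

/-- The product of `MD L`. -/
noncomputable def mulHom : MD L →ₗ[ℚ] MD L →ₗ[ℚ] MD L :=
  lift₂ (fun Γ₁ Γ₂ => mk (push Γ₁ Γ₂)) isInvariant_push_left isInvariant_push_right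

noncomputable instance : Mul (MD L) := ⟨fun x y => mulHom x y⟩

noncomputable instance : One (MD L) := ⟨mk (ofWord [])⟩

theorem mk_mul_mk (Γ₁ Γ₂ : Diag L) : mk Γ₁ * mk Γ₂ = mk (push Γ₁ Γ₂) :=
  lift₂_mk _ _ _ _ _

theorem mk_mul_mk_of_isPushout {Γ₁ Γ₂ Γ : Diag L} (h : IsPushout Γ₁ Γ₂ Γ) :
    mk Γ₁ * mk Γ₂ = mk Γ := by rw [mk_mul_mk, h.mk_eq]

theorem one_def : (1 : MD L) = mk (ofWord []) := rfl

theorem ofWord_trace (l : List (OS.At L)) (y : L) : (ofWord l).trace y = y :=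
  eq_of_forall_le_iff fun _ => (ofWord l).trace_le_iff _ _

theorem push_one_mk (Γ : Diag L) : mk (push (ofWord []) Γ) = mk Γ := by
  refine (IsPushout.mk_eq (Γ := Γ) ⟨fun y => (Γ.trace y, y), fun x y => ?_, ?_, ?_, ?_⟩).symm
  · exact ⟨fun h => h.2, fun h => ⟨Γ.trace_mono h, h⟩⟩
  · ext ⟨x, y⟩
    constructor
    · rintro ⟨z, hz⟩
      cases hz
      exact ofWord_trace _ _
    · intro h
      have h' : x = Γ.trace y := (ofWord_trace [] x).symm.trans h
      exact ⟨y, Prod.ext h'.symm rfl⟩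
  · intro x
    exact Prod.ext (Γ.trace_ι x) rfl
  · rfl

theorem lin_ext₃ {f g : MD L →ₗ[ℚ] MD L →ₗ[ℚ] MD L →ₗ[ℚ] M}
    (h : ∀ Γ₁ Γ₂ Γ₃, f (mk Γ₁) (mk Γ₂) (mk Γ₃) = g (mk Γ₁) (mk Γ₂) (mk Γ₃)) : f = g :=
  hom_ext fun Γ₁ => hom_ext fun Γ₂ => hom_ext fun Γ₃ => h Γ₁ Γ₂ Γ₃

theorem mk_push_assoc (Γ₁ Γ₂ Γ₃ : Diag L) :
    mk (push (push Γ₁ Γ₂) Γ₃) = mk (push Γ₁ (push Γ₂ Γ₃)) := by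
  let e : PushCarrier (push Γ₁ Γ₂) Γ₃ ≃o PushCarrier Γ₁ (push Γ₂ Γ₃) :=
    { toFun := fun x => .mk x.1.1.1.1
        (.mk x.1.1.1.2 x.1.2 (x.1.1.2.symm.trans ((push_trace Γ₁ Γ₂ x.1.1).symm.trans x.2)))
        (x.1.1.2.trans (push_trace Γ₂ Γ₃ (.mk x.1.1.1.2 x.1.2
          (x.1.1.2.symm.trans ((push_trace Γ₁ Γ₂ x.1.1).symm.trans x.2)))).symm)
      invFun := fun x => .mk (.mk x.1.1 x.1.2.1.1 (x.2.trans (push_trace Γ₂ Γ₃ _))) x.1.2.1.2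
        ((push_trace Γ₁ Γ₂ _).trans (x.2.trans ((push_trace Γ₂ Γ₃ _).trans x.1.2.2)))
      left_inv := fun _ => rfl
      right_inv := fun _ => rfl
      map_rel_iff' := fun {x y} => ⟨fun h => ⟨⟨h.1, h.2.1⟩, h.2.2⟩,
        fun h => ⟨h.1.1, h.1.2, h.2⟩⟩ }
  refine mk_eq_of_iso (Γ := push (push Γ₁ Γ₂) Γ₃) (Γ' := push Γ₁ (push Γ₂ Γ₃)) e
    (fun x => rfl) ?_
  refine Eq.trans ?_ (map_append_map e (PushCarrier.inl (push Γ₁ Γ₂) Γ₃)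
    (PushCarrier.inr (push Γ₁ Γ₂) Γ₃) (push Γ₁ Γ₂).J Γ₃.J).symm
  change Γ₁.J.map _ ++ List.map (PushCarrier.inr Γ₁ (push Γ₂ Γ₃))
    (Γ₂.J.map (PushCarrier.inl Γ₂ Γ₃) ++ Γ₃.J.map (PushCarrier.inr Γ₂ Γ₃)) =
    List.map _ (Γ₁.J.map (PushCarrier.inl Γ₁ Γ₂) ++ Γ₂.J.map (PushCarrier.inr Γ₁ Γ₂)) ++ _
  refine (congrArg (fun l => Γ₁.J.map _ ++ l) (map_append_map _ _ _ _ _)).trans ?_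
  refine Eq.trans ?_ (congrArg (fun l => l ++ Γ₃.J.map _) (map_append_map _ _ _ _ _)).symm
  rw [List.append_assoc]
  refine congrArg₂ (fun l l' => l ++ l') ?_ (congrArg₂ (fun l l' => l ++ l') ?_ ?_)
  · refine List.map_congr_left fun H _ => PushCarrier.ext rfl (PushCarrier.ext rfl ?_)
    change Γ₃.ι (Γ₁.trace H) = Γ₃.ι ((push Γ₁ Γ₂).trace _)
    exact congrArg Γ₃.ι (push_trace Γ₁ Γ₂ (PushCarrier.inl Γ₁ Γ₂ H)).symm
  · refine List.map_congr_left fun H _ => PushCarrier.ext ?_ (PushCarrier.ext rfl ?_)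
    · change Γ₁.ι ((push Γ₂ Γ₃).trace _) = Γ₁.ι (Γ₂.trace H)
      exact congrArg Γ₁.ι (push_trace Γ₂ Γ₃ (PushCarrier.inl Γ₂ Γ₃ H))
    · change Γ₃.ι (Γ₂.trace H) = Γ₃.ι ((push Γ₁ Γ₂).trace _)
      exact congrArg Γ₃.ι ((push_trace Γ₁ Γ₂ (PushCarrier.inr Γ₁ Γ₂ H)).trans (Γ₁.trace_ι _)).symm
  · refine List.map_congr_left fun H _ => PushCarrier.ext ?_ (PushCarrier.ext rfl rfl)
    change Γ₁.ι ((push Γ₂ Γ₃).trace _) = Γ₁.ι (Γ₃.trace H)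
    exact congrArg Γ₁.ι ((push_trace Γ₂ Γ₃ (PushCarrier.inr Γ₂ Γ₃ H)).trans (Γ₂.trace_ι _))

theorem mul_mk_mk_comm (Γ₁ Γ₂ : Diag L) :
    mk Γ₁ * mk Γ₂ = (-1 : ℤ) ^ (Γ₁.J.length * Γ₂.J.length) • (mk Γ₂ * mk Γ₁) := by
  rw [mk_mul_mk, mk_mul_mk, mk_push_comm]

theorem add_mul' (x y z : MD L) : (x + y) * z = x * z + y * z :=
  LinearMap.congr_fun (map_add mulHom x y) z

theorem mul_add' (x y z : MD L) : x * (y + z) = x * y + x * z := map_add (mulHom x) y z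

theorem smul_mul' (c : ℚ) (x y : MD L) : (c • x) * y = c • (x * y) :=
  LinearMap.congr_fun (map_smul mulHom c x) y

theorem mul_smul' (c : ℚ) (x y : MD L) : x * (c • y) = c • (x * y) := map_smul (mulHom x) c y

noncomputable instance : Ring (MD L) :=
  { (inferInstance : AddCommGroup (MD L)) with
    mul := fun x y => x * y
    one := 1
    left_distrib := mul_add'
    right_distrib := add_mul'
    zero_mul := fun y => LinearMap.congr_fun (map_zero mulHom) y
    mul_zero := fun x => map_zero (mulHom x)
    one_mul := fun x => by
      induction x using MD.induction with
      | h0 => exact map_zero (mulHom 1)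
      | hadd x y hx hy => rw [mul_add', hx, hy]
      | hsmul c x hx => rw [mul_smul', hx]
      | hmk Γ => rw [one_def, mk_mul_mk, push_one_mk]
    mul_one := fun x => by
      induction x using MD.induction with
      | h0 => exact LinearMap.congr_fun (map_zero mulHom) 1
      | hadd x y hx hy => rw [add_mul', hx, hy]
      | hsmul c x hx => rw [smul_mul', hx]
      | hmk Γ =>
        rw [one_def, mul_mk_mk_comm, mk_mul_mk, push_one_mk]
        change (-1 : ℤ) ^ (Γ.J.length * 0) • mk Γ = mk Γ
        simp
    -- Associativity is an equality of two trilinear maps, which may be tested on classes of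
    -- diagrams.
    mul_assoc := fun x y z => by
      let f : MD L →ₗ[ℚ] MD L →ₗ[ℚ] MD L →ₗ[ℚ] MD L :=
        (LinearMap.llcomp ℚ (MD L) (MD L) (MD L →ₗ[ℚ] MD L) mulHom) ∘ₗ mulHom
      let g : MD L →ₗ[ℚ] MD L →ₗ[ℚ] MD L →ₗ[ℚ] MD L :=
        ((LinearMap.llcomp ℚ (MD L) (MD L →ₗ[ℚ] MD L) (MD L →ₗ[ℚ] MD L)).flip mulHom) ∘ₗ
          (LinearMap.llcomp ℚ (MD L) (MD L) (MD L)) ∘ₗ mulHom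
      have hfg : f = g := lin_ext₃ fun Γ₁ Γ₂ Γ₃ => by
        change mk Γ₁ * mk Γ₂ * mk Γ₃ = mk Γ₁ * (mk Γ₂ * mk Γ₃)
        simp only [mk_mul_mk, mk_push_assoc]
      exact LinearMap.congr_fun (LinearMap.congr_fun (LinearMap.congr_fun hfg x) y) z }

noncomputable instance : Algebra ℚ (MD L) := Algebra.ofModule smul_mul' mul_smul'

/-- The homogeneous components of `MD L`. -/
noncomputable def gr (L : GeomLat.{u}) (n : ℤ) : Submodule ℚ (MD L) :=
  Submodule.span ℚ {x | ∃ Γ : Diag L, Γ.deg = n ∧ x = mk Γ}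

theorem mk_mem_gr (Γ : Diag L) : mk Γ ∈ gr L Γ.deg := Submodule.subset_span ⟨Γ, rfl, rfl⟩

end MD

namespace Diag

variable {L : GeomLat.{u}}

/-- The degree of a diagram `Γ` with `F_ι ∨ ⋁ J = ⊤`. -/
noncomputable def deg' (Γ : Diag L) : ℤ := (Γ.J.length : ℤ) - 2 * (rk (⊤ : Γ.E) - rk (⊤ : L))

/-- If the join of the letters and F_ι is ⊤, modularity of F_ι turns the degree into `deg'`, which
only sees the length of the word and the ranks of the lattices; otherwise the class is 0. All later
degree computations use `deg'`. -/
theorem deg_eq (Γ : Diag L) : Γ.deg = Γ.deg' ∨ MD.mk Γ = 0 := by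
  by_cases h : Γ.join ⊔ Γ.top = ⊤
  · left
    rw [deg, rk_sub_rk_inf_top, h, rk_top]
    rfl
  · right
    exact MD.isInvariant_mk.not_spanning Γ _ (lt_top_iff_ne_top.2 h) le_sup_right
      fun H hH => (Γ.le_join hH).trans le_sup_left

theorem mk_mem_gr' (Γ : Diag L) : MD.mk Γ ∈ MD.gr L Γ.deg' := by
  rcases Γ.deg_eq with h | h
  · rw [← h]; exact MD.mk_mem_gr Γ
  · rw [h]; exact zero_mem _

theorem deg'_push (Γ₁ Γ₂ : Diag L) : (push Γ₁ Γ₂).deg' = Γ₁.deg' + Γ₂.deg' := by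
  have h1 : rk (⊤ : (push Γ₁ Γ₂).E) = rk (⊤ : Γ₁.E) + rk (⊤ : Γ₂.E) - rk (⊤ : L) := by
    refine (rk_pushLat (Γ₁ := Γ₁) (Γ₂ := Γ₂) ⊤).trans ?_
    change rk (⊤ : Γ₁.E) + rk (⊤ : Γ₂.E) - rk (Γ₁.trace ⊤) = _
    rw [trace_top]
  have h2 : (push Γ₁ Γ₂).J.length = Γ₁.J.length + Γ₂.J.length := by
    change (List.map _ _ ++ List.map _ _).length = _
    exact List.length_append.trans
      (congrArg₂ (fun m n => m + n) (List.length_map _) (List.length_map _))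
  rw [deg', h1, h2, deg', deg']
  push_cast
  ring

/-- The rank correction is even, so Koszul signs can be computed from lengths of words. -/
theorem deg'_negOnePow (Γ : Diag L) : Γ.deg'.negOnePow = (Γ.J.length : ℤ).negOnePow := by
  rw [Int.negOnePow_eq_iff]
  exact ⟨-(rk (⊤ : Γ.E) - rk (⊤ : L)), by rw [deg']; ring⟩

theorem deg'_mul_negOnePow {L' : GeomLat.{u}} (Γ₁ : Diag L) (Γ₂ : Diag L') :
    (Γ₁.deg' * Γ₂.deg').negOnePow = ((Γ₁.J.length * Γ₂.J.length : ℕ) : ℤ).negOnePow := by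
  rw [Int.negOnePow_eq_iff]
  obtain ⟨a, ha⟩ := (Int.negOnePow_eq_iff _ _).1 Γ₁.deg'_negOnePow
  obtain ⟨b, hb⟩ := (Int.negOnePow_eq_iff _ _).1 Γ₂.deg'_negOnePow
  refine ⟨a * Γ₂.deg' + Γ₁.J.length * b, ?_⟩
  push_cast
  linear_combination Γ₂.deg' * ha + (Γ₁.J.length : ℤ) * hb

end Diag

namespace MD

open Diag

variable {L : GeomLat.{u}}

theorem gr_induction {n : ℤ} {p : MD L → Prop} (h0 : p 0)
    (hadd : ∀ x y, p x → p y → p (x + y)) (hsmul : ∀ (c : ℚ) (x), p x → p (c • x))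
    (hmk : ∀ Γ : Diag L, Γ.deg' = n → p (mk Γ)) {x : MD L} (hx : x ∈ gr L n) : p x := by
  induction hx using Submodule.span_induction with
  | zero => exact h0
  | add x y _ _ hx hy => exact hadd x y hx hy
  | smul c x _ hx => exact hsmul c x hx
  | mem x hx =>
    obtain ⟨Γ, h, rfl⟩ := hx
    rcases Γ.deg_eq with h' | h'
    · exact hmk Γ (h'.symm.trans h)
    · rw [h']; exact h0

/-- The relations are homogeneous for `deg'`. As the components live in types indexed by the degree,
equality of degrees and equality of classes are applied together through `key`. -/
theorem isInvariant_decompose : IsInvariant fun Γ : Diag L =>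
    DirectSum.lof ℚ ℤ (fun n => gr L n) Γ.deg' ⟨mk Γ, Γ.mk_mem_gr'⟩ := by
  have key : ∀ {m n : ℤ} (h : m = n) (x y : MD L) (hx : x ∈ gr L m) (hy : y ∈ gr L n), x = y →
      DirectSum.lof ℚ ℤ (fun n => gr L n) m ⟨x, hx⟩ =
        DirectSum.lof ℚ ℤ (fun n => gr L n) n ⟨y, hy⟩ := by
    rintro m _ rfl x _ hx hy rfl
    rfl
  have key0 : ∀ Γ : Diag L, mk Γ = 0 →
      DirectSum.lof ℚ ℤ (fun n => gr L n) Γ.deg' ⟨mk Γ, Γ.mk_mem_gr'⟩ = 0 := fun Γ h => by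
    rw [key (n := Γ.deg') rfl (mk Γ) 0 Γ.mk_mem_gr' (zero_mem _) h]
    exact map_zero _
  refine ⟨fun Γ => ?_, fun Γ Γ' φ hφ htop hι hJ => ?_, fun Γ X hX htop hJ => ?_,
    fun Γ a b h ha hb htop => ?_, fun Γ F A B l hF htop hA hB hl hJ => ?_⟩
  · intro l₁ l₂ a b
    have hw := Γ.isAlt_wd l₁ l₂ a b
    have e : (∀ H ∈ l₁ ++ a :: b :: l₂, IsAtom H) ↔ ∀ H ∈ l₁ ++ b :: a :: l₂, IsAtom H := by
      refine forall_congr' fun H => ?_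
      simp only [List.mem_append, List.mem_cons]
      tauto
    by_cases hl : ∀ H ∈ l₁ ++ a :: b :: l₂, IsAtom H
    · rw [onWords_of_atoms _ _ hl, onWords_of_atoms _ _ (e.1 hl), ← map_neg]
      rw [wd_of_atoms _ hl, wd_of_atoms _ (e.1 hl)] at hw
      refine key ?_ _ (-mk _) _ (neg_mem (mk_mem_gr' _)) hw
      simp only [deg', withWord, List.length_append, List.length_cons]
      rfl
    · rw [onWords, onWords, dif_neg hl, dif_neg fun h' => hl (e.2 h'), neg_zero]
  · refine key ?_ _ _ _ _ (isInvariant_mk.embedding Γ Γ' φ hφ htop hι hJ)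
    rw [deg', deg', hφ.map_top_iff.1 htop, hJ, List.length_map]
  · exact key0 Γ (isInvariant_mk.not_spanning Γ X hX htop hJ)
  · exact key0 Γ (isInvariant_mk.product Γ a b h ha hb htop)
  · exact key0 Γ (isInvariant_mk.two_outside Γ F A B l hF htop hA hB hl hJ)

/-- The decomposition of an element of `MD L` into homogeneous components. -/
noncomputable def decompose : MD L →ₗ[ℚ] ⨁ n, gr L n := lift _ isInvariant_decompose

theorem decompose_mem {n : ℤ} {x : MD L} (hx : x ∈ gr L n) :
    decompose x = DirectSum.lof ℚ ℤ (fun n => gr L n) n ⟨x, hx⟩ := by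
  have : ∃ hx : x ∈ gr L n, decompose x = DirectSum.lof ℚ ℤ (fun n => gr L n) n ⟨x, hx⟩ := by
    refine gr_induction (p := fun x => ∃ hx : x ∈ gr L n,
      decompose x = DirectSum.lof ℚ ℤ (fun n => gr L n) n ⟨x, hx⟩) ?_ ?_ ?_ ?_ hx
    · exact ⟨zero_mem _, by rw [map_zero]; exact (map_zero _).symm⟩
    · rintro x y ⟨hx, ex⟩ ⟨hy, ey⟩
      exact ⟨add_mem hx hy, by rw [map_add, ex, ey, ← map_add]; rfl⟩
    · rintro c x ⟨hx, ex⟩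
      exact ⟨Submodule.smul_mem _ _ hx, by rw [map_smul, ex, ← map_smul]; rfl⟩
    · rintro Γ rfl
      exact ⟨Γ.mk_mem_gr', lift_mk _ _ _⟩
  exact this.2

noncomputable instance : GradedAlgebra (gr L) where
  one_mem := by
    have h := mk_mem_gr' (ofWord ([] : List (OS.At L)))
    have e : (ofWord ([] : List (OS.At L))).deg' = 0 := by
      change ((0 : ℕ) : ℤ) - 2 * (rk (⊤ : L) - rk (⊤ : L)) = 0
      simp
    rwa [e] at h
  mul_mem m n x y hx hy := by
    refine gr_induction (p := fun x => x * y ∈ gr L (m + n)) ?_ ?_ ?_ ?_ hx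
    · rw [zero_mul]; exact zero_mem _
    · intro x x' h h'; rw [add_mul]; exact add_mem h h'
    · intro c x h; rw [smul_mul_assoc]; exact Submodule.smul_mem _ _ h
    · rintro Γ₁ rfl
      refine gr_induction (p := fun y => mk Γ₁ * y ∈ gr L (Γ₁.deg' + n)) ?_ ?_ ?_ ?_ hy
      · rw [mul_zero]; exact zero_mem _
      · intro x x' h h'; rw [mul_add]; exact add_mem h h'
      · intro c x h; rw [mul_smul_comm]; exact Submodule.smul_mem _ _ h
      · rintro Γ₂ rfl
        rw [mk_mul_mk, ← deg'_push]
        exact mk_mem_gr' _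
  toDecomposition := DirectSum.Decomposition.ofLinearMap _ decompose
    (hom_ext fun Γ => by
      rw [LinearMap.comp_apply, decompose_mem Γ.mk_mem_gr', DirectSum.coeLinearMap_lof]
      rfl)
    (by
      refine DirectSum.linearMap_ext ℚ fun n => LinearMap.ext fun x => ?_
      simp only [LinearMap.comp_apply, DirectSum.coeLinearMap_lof, LinearMap.id_apply]
      exact decompose_mem x.2)

theorem mul_comm_of_mem {m n : ℤ} {x y : MD L} (hx : x ∈ gr L m) (hy : y ∈ gr L n) :
    x * y = (m * n).negOnePow • (y * x) := by
  refine gr_induction (p := fun x => x * y = (m * n).negOnePow • (y * x)) ?_ ?_ ?_ ?_ hx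
  · simp
  · intro x x' h h'; rw [add_mul, h, h', mul_add, smul_add]
  · intro c x h; rw [smul_mul_assoc, h, mul_smul_comm, smul_comm]
  · rintro Γ₁ rfl
    refine gr_induction (p := fun y => mk Γ₁ * y = (Γ₁.deg' * n).negOnePow • (y * mk Γ₁))
      ?_ ?_ ?_ ?_ hy
    · simp
    · intro x x' h h'; rw [mul_add, h, h', add_mul, smul_add]
    · intro c x h; rw [smul_mul_assoc, mul_smul_comm, h, smul_comm]
    · rintro Γ₂ rfl
      rw [deg'_mul_negOnePow, negOnePow_smul, mul_mk_mk_comm]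

end MD

/-! ### The differential of `MD L` -/

/-- The elements sent below y are closed under joins, so a maximal one is the greatest. This right
adjoint pulls flats of the larger lattice back to the smaller one. -/
theorem IsEmbedding.exists_adjoint {L M : GeomLat.{u}} {φ : L → M} (h : IsEmbedding φ) (y : M) :
    ∃ x, ∀ z, z ≤ x ↔ φ z ≤ y := by
  obtain ⟨x, hx⟩ := (Set.toFinite {z | φ z ≤ y}).exists_maximal
    ⟨⊥, show φ ⊥ ≤ y by rw [h.map_bot]; exact bot_le⟩
  refine ⟨x, fun z => ⟨fun hz => (h.monotone hz).trans hx.1, fun hz => ?_⟩⟩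
  have : x ⊔ z ≤ x := hx.2 (show φ (x ⊔ z) ≤ y by rw [h.map_sup]; exact sup_le hx.1 hz) le_sup_left
  exact le_sup_right.trans this

theorem IsEmbedding.upper {L M : GeomLat.{u}} {φ : L → M} (h : IsEmbedding φ) {F : L} (hF : F ≠ ⊤)
    {F' : M} (hF' : F' ≠ ⊤) (e : F' = φ F) : IsEmbedding (L := L.upper F hF) (M := M.upper F' hF')
      (fun x => (⟨φ x.1, e.trans_le (h.monotone x.2)⟩ : Set.Ici F')) := by
  refine ⟨fun _ _ hxy => Subtype.ext (h.injective (congrArg Subtype.val hxy)),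
    fun x y => Subtype.ext (h.map_sup x.1 y.1), fun x hx => ?_⟩
  obtain ⟨a, ha, h1, h2⟩ := exists_atom_sup_eq (Set.Ici.isAtom_iff.1 hx)
  have h3 := isAtom_sup (h.map_atom a ha) (F := φ F) fun h' => h1 (h.le_iff.1 h')
  subst e
  have h4 : (⟨φ F ⊔ φ a, le_sup_left⟩ : Set.Ici (φ F)) = ⟨φ x.1, h.monotone x.2⟩ :=
    Subtype.ext ((h.map_sup F a).symm.trans (congrArg φ h2))
  exact h4 ▸ h3

theorem IsEmbedding.lower {L M : GeomLat.{u}} {φ : L → M} (h : IsEmbedding φ) {F : L} (hF : F ≠ ⊥)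
    {F' : M} (hF' : F' ≠ ⊥) (e : φ F ≤ F') : IsEmbedding (L := L.lower F hF) (M := M.lower F' hF')
      (fun x => (⟨φ x.1, (h.monotone x.2).trans e⟩ : Set.Iic F')) :=
  ⟨fun _ _ hxy => Subtype.ext (h.injective (congrArg Subtype.val hxy)),
    fun x y => Subtype.ext (h.map_sup x.1 y.1),
    fun x hx => IsAtom.Iic (h.map_atom x.1 hx.of_isAtom_coe_Iic) _⟩

/-- The element `G ∨ K` of `[G, ⊤]`. -/
def up {E : Type*} [Lattice E] (G K : E) : Set.Ici G := ⟨G ⊔ K, le_sup_left⟩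

/-- An interval `[G', ⊤]` of an interval `[G, ⊤]`. -/
def iciIci {E : Type*} [Lattice E] {G G' : E} (h : G ≤ G') :
    Set.Ici G' ≃o Set.Ici (⟨G', h⟩ : Set.Ici G) where
  toFun x := ⟨⟨x.1, h.trans x.2⟩, x.2⟩
  invFun x := ⟨x.1.1, x.2⟩
  left_inv _ := rfl
  right_inv _ := rfl
  map_rel_iff' := Iff.rfl

theorem iciIci_up {E : Type*} [Lattice E] {G G' : E} (h : G ≤ G') (K : E) :
    iciIci h (up G' K) = up (⟨G', h⟩ : Set.Ici G) (up G K) := by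
  refine Subtype.ext (Subtype.ext ?_)
  change G' ⊔ K = G' ⊔ (G ⊔ K)
  rw [← sup_assoc, sup_eq_left.2 h]

theorem map_up_iciIci {E : Type*} [Lattice E] {G G' : E} (h : G ≤ G') (l : List E) :
    (l.map (up G')).map (iciIci h) = (l.map (up G)).map (up (⟨G', h⟩ : Set.Ici G)) := by
  rw [List.map_map, List.map_map]
  exact List.map_congr_left fun K _ => iciIci_up h K

/-- A letter equal to the contracted one becomes ⊥ in [H, ⊤]. Since `wd` is 0 on words containing a
non-atom, contracting a repeated letter gives 0, as it must. -/
theorem not_isAtom_up_self {E : GeomLat.{u}} (H : E) : ¬ IsAtom (up H H) := fun h =>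
  h.1 (Subtype.ext (sup_idem H))

namespace Diag

variable {L : GeomLat.{u}}

theorem wd_mem (Γ : Diag L) (l : List Γ.E) :
    Γ.wd l ∈ MD.gr L ((l.length : ℤ) - 2 * (rk (⊤ : Γ.E) - rk (⊤ : L))) := by
  by_cases h : ∀ H ∈ l, IsAtom H
  · rw [wd_of_atoms Γ h]
    exact (Γ.withWord l h).mk_mem_gr'
  · rw [wd, onWords, dif_neg h]
    exact zero_mem _

theorem wd_iso {Γ Γ' : Diag L} (e : Γ.E ≃o Γ'.E) (hι : ∀ x, Γ'.ι x = e (Γ.ι x)) (l : List Γ.E) :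
    Γ'.wd (l.map e) = Γ.wd l :=
  wd_map e (IsEmbedding.of_orderIso e) e.map_top hι l

/-- The atom raises the rank of X ∨ F_ι by one and that of X by at most one, which leaves nothing
for the rank of the trace. -/
theorem trace_sup_atom (Γ : Diag L) {X H : Γ.E} (hH : IsAtom H) (h : ¬ H ≤ X ⊔ Γ.top) :
    Γ.trace (X ⊔ H) = Γ.trace X := by
  refine (eq_of_le_of_rk_le (Γ.trace_mono le_sup_left) ?_).symm
  have e1 := Γ.rk_sub_rk_trace (X ⊔ H)
  have e2 := Γ.rk_sub_rk_trace X
  have e3 := rk_covBy (covBy_sup_atom hH h)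
  rw [sup_right_comm] at e3
  have e4 := rk_sup_atom_le X hH
  omega

theorem ne_top_of_trace (Γ : Diag L) {F : L} (hF : F ≠ ⊤) {F' : Γ.E} (h : Γ.trace F' = F) :
    F' ≠ ⊤ := fun e => hF (by rw [← h, e, trace_top])

theorem ne_bot_of_trace (Γ : Diag L) {F : L} (hF : F ≠ ⊥) {F' : Γ.E} (h : Γ.trace F' = F) :
    F' ≠ ⊥ := fun e => hF (by rw [← h, e, trace_bot])

/-- The quotient of a diagram of `L = [⊥, ⊤]` by a flat `G` with `G ∧ F_ι = ⊥`. -/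
noncomputable def quot (Γ : Diag L) (G : Γ.E) (h : Γ.trace G = ⊥) : Diag L :=
  (Γ.above bot_ne_top G h).comp (upperBotIso L)

theorem quot_top_le (Γ : Diag L) {G : Γ.E} {h : Γ.trace G = ⊥} {x : Set.Ici G} :
    (Γ.quot G h).top ≤ x ↔ Γ.top ≤ x.1 :=
  ⟨fun h' => le_sup_right.trans (show G ⊔ Γ.top ≤ x.1 from h'),
    fun h' => show G ⊔ Γ.top ≤ x.1 from sup_le x.2 h'⟩

theorem up_le_iff {E : Type*} [Lattice E] {G K : E} {x : Set.Ici G} : up G K ≤ x ↔ K ≤ x.1 :=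
  ⟨fun h => le_sup_right.trans (show G ⊔ K ≤ x.1 from h),
    fun h => show G ⊔ K ≤ x.1 from sup_le x.2 h⟩

theorem trace_quot (Γ : Diag L) {G : Γ.E} {h : Γ.trace G = ⊥} (x : Set.Ici G) :
    (Γ.quot G h).trace x = Γ.trace x.1 :=
  eq_of_forall_le_iff fun c => by
    refine ((Γ.quot G h).trace_le_iff x c).trans (Iff.trans ?_ (Γ.trace_le_iff x.1 c).symm)
    exact up_le_iff

theorem quot_congr (Γ : Diag L) {G G' : Γ.E} (e : G = G') (h : Γ.trace G = ⊥)
    (h' : Γ.trace G' = ⊥) (l : List Γ.E) :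
    (Γ.quot G h).wd (l.map (up G)) = (Γ.quot G' h').wd (l.map (up G')) := by
  subst e; rfl

theorem quot_quot (Γ : Diag L) {G G' : Γ.E} (hG : G ≤ G') (h : Γ.trace G = ⊥)
    (h' : (Γ.quot G h).trace (⟨G', hG⟩ : Set.Ici G) = ⊥) (h'' : Γ.trace G' = ⊥) (l : List Γ.E) :
    ((Γ.quot G h).quot (⟨G', hG⟩ : Set.Ici G) h').wd
      ((l.map (up G)).map (up (⟨G', hG⟩ : Set.Ici G))) = (Γ.quot G' h'').wd (l.map (up G')) := by
  refine (congrArg _ (map_up_iciIci hG l).symm).trans ?_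
  refine wd_iso (Γ := Γ.quot G' h'') (Γ' := (Γ.quot G h).quot (⟨G', hG⟩ : Set.Ici G) h')
    (iciIci hG) (fun x => ?_) _
  exact (iciIci_up hG (Γ.ι x)).symm

/-- The quotient by an atom outside of a hyperplane. -/
theorem quot_eq_restrict (Γ : Diag L) {X H : Γ.E} (hH : IsAtom H) (htop : Γ.top ≤ X)
    (hX : ¬ H ≤ X) (hs : H ⊔ X = ⊤) (h : Γ.trace H = ⊥) (l : List (Set.Iic X)) :
    (Γ.quot H h).wd (l.map fun x => up H x.1) = (Γ.restrict X htop).wd l := by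
  refine wd_map (Γ := Γ.restrict X htop) (Γ' := Γ.quot H h) (fun x : Set.Iic X => up H x.1) ?_
    (Subtype.ext hs) (fun x => rfl) l
  refine ⟨fun x y hxy => Subtype.ext ?_, fun x y => Subtype.ext ?_, fun a ha => ?_⟩
  · have h' : H ⊔ x.1 = H ⊔ y.1 := congrArg Subtype.val hxy
    rw [← inf_sup_atom_of_covBy hH hX x.2, sup_comm, h', sup_comm, inf_sup_atom_of_covBy hH hX y.2]
  · change H ⊔ (x.1 ⊔ y.1) = (H ⊔ x.1) ⊔ (H ⊔ y.1)
    rw [sup_sup_sup_comm, sup_idem]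
  · have ha' : IsAtom a.1 := IsAtom.of_isAtom_coe_Iic ha
    refine isAtom_sup ha' fun h' => hX ?_
    have := (hH.le_iff.1 h').resolve_left ha'.1
    exact this ▸ a.2

/-- `H` is contractible in the word consisting of `H` and `l`. -/
def Contractible (Γ : Diag L) (H : Γ.E) (l : List Γ.E) : Prop :=
  IsAtom H ∧ ¬ H ≤ Γ.top ∧ ∀ F, Γ.top ≤ F → (∀ K ∈ l, K ≤ F) → H ≤ F

open scoped Classical in
/-- The term of the differential which corresponds to the letter `H`. -/
noncomputable def contr (Γ : Diag L) (H : Γ.E) (l : List Γ.E) : MD L :=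
  if h : Γ.Contractible H l then
    (Γ.quot H (Γ.trace_of_not_le h.1 h.2.1)).wd (l.map (up H)) else 0

theorem contr_of_pos (Γ : Diag L) {H : Γ.E} {l : List Γ.E} (h : Γ.Contractible H l)
    (h' : Γ.trace H = ⊥) : Γ.contr H l = (Γ.quot H h').wd (l.map (up H)) := dif_pos h

theorem contr_of_neg (Γ : Diag L) {H : Γ.E} {l : List Γ.E} (h : ¬ Γ.Contractible H l) :
    Γ.contr H l = 0 := dif_neg h

theorem contr_self_mem (Γ : Diag L) {H : Γ.E} {l : List Γ.E} (h : H ∈ l) : Γ.contr H l = 0 := by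
  by_cases hc : Γ.Contractible H l
  · rw [Γ.contr_of_pos hc (Γ.trace_of_not_le hc.1 hc.2.1)]
    exact wd_of_not_atom _ (H := up H H) (List.mem_map_of_mem h) (not_isAtom_up_self H)
  · exact Γ.contr_of_neg hc

theorem Contractible.congr {Γ : Diag L} {H : Γ.E} {l l' : List Γ.E} (e : ∀ K, K ∈ l ↔ K ∈ l') :
    Γ.Contractible H l ↔ Γ.Contractible H l' := by
  simp only [Contractible, e]

theorem isAlt_contr (Γ : Diag L) (H : Γ.E) : IsAlt (Γ.contr H) := by
  intro l₁ l₂ a b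
  have e : Γ.Contractible H (l₁ ++ a :: b :: l₂) ↔ Γ.Contractible H (l₁ ++ b :: a :: l₂) :=
    Contractible.congr fun K => by
      simp only [List.mem_append, List.mem_cons]
      tauto
  by_cases h : Γ.Contractible H (l₁ ++ a :: b :: l₂)
  · have h0 := Γ.trace_of_not_le h.1 h.2.1
    rw [Γ.contr_of_pos h h0, Γ.contr_of_pos (e.1 h) h0]
    exact (Γ.quot H h0).isAlt_wd.map (up H) l₁ l₂ a b
  · rw [Γ.contr_of_neg h, Γ.contr_of_neg fun h' => h (e.2 h'), neg_zero]

/-- For contractibility, a flat of E is tested through its image and a flat of E' through the right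
adjoint of φ. The map φ then induces an embedding of [H, ⊤] into [φ H, ⊤] preserving ⊤. -/
theorem contr_map {Γ Γ' : Diag L} {φ : Γ.E → Γ'.E} (hφ : IsEmbedding φ) (htop : φ ⊤ = ⊤)
    (hι : ∀ x, Γ'.ι x = φ (Γ.ι x)) (H : Γ.E) (l : List Γ.E) :
    Γ'.contr (φ H) (l.map φ) = Γ.contr H l := by
  have ht : Γ'.top = φ Γ.top := map_top hι
  have e : Γ'.Contractible (φ H) (l.map φ) ↔ Γ.Contractible H l := by
    refine and_congr hφ.isAtom_iff (and_congr (not_congr ?_) ⟨fun h F h1 h2 => ?_,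
      fun h F h1 h2 => ?_⟩)
    · rw [ht, hφ.le_iff]
    · refine hφ.le_iff.1 (h (φ F) (by rw [ht]; exact hφ.monotone h1) fun K hK => ?_)
      obtain ⟨K, hK', rfl⟩ := List.mem_map.1 hK
      exact hφ.monotone (h2 K hK')
    · obtain ⟨x, hx⟩ := hφ.exists_adjoint F
      refine (hx H).1 (h x ((hx _).2 (ht ▸ h1)) fun K hK => (hx K).2 (h2 _ ?_))
      exact List.mem_map_of_mem hK
  by_cases h : Γ.Contractible H l
  · have h0 := Γ.trace_of_not_le h.1 h.2.1
    have h0' := Γ'.trace_of_not_le (e.2 h).1 (e.2 h).2.1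
    rw [Γ'.contr_of_pos (e.2 h) h0', Γ.contr_of_pos h h0]
    have hw := wd_map (Γ := Γ.quot H h0) (Γ' := Γ'.quot (φ H) h0')
      (fun x : Set.Ici H => (⟨φ x.1, hφ.monotone x.2⟩ : Set.Ici (φ H)))
      (hφ.upper (Γ.ne_top_of_trace bot_ne_top h0) (Γ'.ne_top_of_trace bot_ne_top h0') rfl) (Subtype.ext htop)
      (fun x => Subtype.ext (by
        change φ H ⊔ Γ'.ι x = φ (H ⊔ Γ.ι x)
        rw [hφ.map_sup, hι])) (l.map (up H))
    refine Eq.trans (congrArg _ ?_) hw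
    refine Eq.trans ?_ List.map_map.symm
    refine List.map_map.trans (List.map_congr_left fun K _ => Subtype.ext ?_)
    exact (hφ.map_sup H K).symm
  · rw [Γ'.contr_of_neg fun h' => h (e.1 h'), Γ.contr_of_neg h]

/-- Both contractions are identified with [⊥, F], where the other letter becomes F ∧ (A ∨ B):
modularity of F gives A ∨ (F ∧ (A ∨ B)) = A ∨ B, and likewise for B. In the differential of a
diagram with exactly two letters outside F these terms have opposite signs and cancel. -/
theorem contr_symm_two_outside (Γ : Diag L) {F A B : Γ.E} {l : List Γ.E} (hF : IsModularElt F)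
    (htop : Γ.top ≤ F) (hA : ¬ A ≤ F) (hB : ¬ B ≤ F) (hl : ∀ H ∈ l, H ≤ F) (hA' : IsAtom A)
    (hB' : IsAtom B) : Γ.contr A (B :: l) = Γ.contr B (A :: l) := by
  -- If B were not below Z, then A, being below Z and below (Z ∧ F) ∨ B, would be below their meet Z
  -- ∧ F, although A is not below F.
  have exch : ∀ {A B : Γ.E}, IsAtom A → IsAtom B → ¬ A ≤ F → Γ.Contractible A (B :: l) →
      ∀ Z, Γ.top ≤ Z → (∀ K ∈ l, K ≤ Z) → A ≤ Z → B ≤ Z := by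
    intro A B hA' hB' hA h Z h1 h2 h3
    by_contra hZ
    have h4 : A ≤ (Z ⊓ F) ⊔ B := h.2.2 _ ((le_inf h1 htop).trans le_sup_left) fun K hK => by
      rcases List.mem_cons.1 hK with rfl | hK
      · exact le_sup_right
      · exact (le_inf (h2 K hK) (hl K hK)).trans le_sup_left
    have h5 : ¬ B ≤ Z ⊓ F := fun h => hZ (h.trans inf_le_left)
    have h6 : A ≤ Z ⊓ ((Z ⊓ F) ⊔ B) := le_inf h3 h4
    rw [inf_sup_atom_of_covBy hB' hZ inf_le_left] at h6
    exact hA (h6.trans inf_le_right)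
  have symm : ∀ {A B : Γ.E}, IsAtom A → IsAtom B → ¬ A ≤ F → ¬ B ≤ F →
      Γ.Contractible A (B :: l) → Γ.Contractible B (A :: l) := by
    intro A B hA' hB' hA hB h
    exact ⟨hB', fun h' => hB (h'.trans htop), fun Z h1 h2 => exch hA' hB' hA h Z h1
      (fun K hK => h2 K (List.mem_cons_of_mem _ hK)) (h2 A List.mem_cons_self)⟩
  by_cases h : Γ.Contractible A (B :: l)
  swap
  · rw [Γ.contr_of_neg h, Γ.contr_of_neg fun h' => h (symm hB' hA' hB hA h')]
  have h' := symm hA' hB' hA hB h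
  have tA := Γ.trace_of_not_le h.1 h.2.1
  have tB := Γ.trace_of_not_le h'.1 h'.2.1
  rw [Γ.contr_of_pos h tA, Γ.contr_of_pos h' tB]
  have hBA : B ≤ A ⊔ F := h'.2.2 _ (htop.trans le_sup_right) fun K hK => by
    rcases List.mem_cons.1 hK with rfl | hK
    · exact le_sup_left
    · exact (hl K hK).trans le_sup_right
  have hAB : A ≤ B ⊔ F := h.2.2 _ (htop.trans le_sup_right) fun K hK => by
    rcases List.mem_cons.1 hK with rfl | hK
    · exact le_sup_left
    · exact (hl K hK).trans le_sup_right
  have hs : A ⊔ F = B ⊔ F := le_antisymm (sup_le hAB le_sup_right) (sup_le hBA le_sup_right)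
  -- If A ∨ F = B ∨ F is not ⊤, neither contraction spans and both are 0.
  by_cases hsp : A ⊔ F = ⊤
  · lift l to List {x // x ≤ F} using hl
    let C : Set.Iic F := ⟨F ⊓ (A ⊔ B), inf_le_left⟩
    have key : ∀ (A B : Γ.E) (D : Set.Iic F), D.1 = F ⊓ (A ⊔ B) → IsAtom A → ¬ A ≤ F → B ≤ A ⊔ F →
        A ⊔ F = ⊤ → ∀ t : Γ.trace A = ⊥, (Γ.quot A t).wd ((B :: l.map (↑)).map (up A)) =
          (Γ.restrict F htop).wd (D :: l) := by
      intro A B D hD hA' hA hBA hs t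
      refine Eq.trans ?_ (Γ.quot_eq_restrict hA' htop hA hs t (D :: l))
      refine congrArg _ ((List.cons.injEq _ _ _ _).mpr ⟨Subtype.ext ?_, ?_⟩)
      · change A ⊔ B = A ⊔ D.1
        have := hF.2 A (A ⊔ B) le_sup_left
        rw [inf_eq_left.2 (sup_le le_sup_left hBA)] at this
        rw [hD, inf_comm]
        exact this
      · exact List.map_map
    rw [key A B C rfl hA' hA hBA hsp tA,
      key B A C (congrArg _ (sup_comm A B)) hB' hB hAB (hs ▸ hsp) tB]
  · have key : ∀ (A B : Γ.E) (t : Γ.trace A = ⊥), A ⊔ F ≠ ⊤ → B ≤ A ⊔ F →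
        (Γ.quot A t).wd ((B :: l).map (up A)) = 0 := by
      intro A B t hs hBA
      refine wd_not_spanning _ (X := up A F) (fun e => hs (congrArg Subtype.val e))
        (Γ.quot_top_le.2 (htop.trans le_sup_right)) fun K hK => ?_
      obtain ⟨K, hK', rfl⟩ := List.mem_map.1 hK
      refine up_le_iff.2 ?_
      rcases List.mem_cons.1 hK' with rfl | hK
      · exact hBA
      · exact (hl K hK).trans le_sup_right
    rw [key A B tA hsp hBA, key B A tB (hs ▸ hsp) hAB]

/-- The non-spanning and product relations pass to each single contraction. For the fifth relation
the contractions at the two outer letters cancel, and any other contraction still has exactly two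
letters outside the modular flat H ∨ F. -/
theorem isInvariant_d : IsInvariant fun Γ : Diag L => altSum Γ.J Γ.contr where
  swap Γ := isAlt_onWords (g := fun l => altSum l Γ.contr) (isAlt_altSum Γ.isAlt_contr)
    fun l hl => rfl
  embedding Γ Γ' φ hφ htop hι hJ := by
    rw [hJ, altSum_map]
    exact altSum_congr fun H l _ => (contr_map hφ htop hι H l).symm
  not_spanning Γ X hX htop hJ := altSum_eq_zero fun H l hl => by
    by_cases h : Γ.Contractible H l
    swap
    · exact Γ.contr_of_neg h
    have hH : H ≤ X := hJ H (hl.mem_iff.1 List.mem_cons_self)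
    rw [Γ.contr_of_pos h (Γ.trace_of_not_le h.1 h.2.1)]
    refine wd_not_spanning _ (X := (⟨X, hH⟩ : Set.Ici H)) (fun e => hX.ne (congrArg Subtype.val e))
      (Γ.quot_top_le.2 htop) fun K hK => ?_
    obtain ⟨K, hK', rfl⟩ := List.mem_map.1 hK
    exact up_le_iff.2 (hJ K (hl.mem_iff.1 (List.mem_cons_of_mem _ hK')))
  product Γ a b hs ha hb htop := altSum_eq_zero fun H l hl => by
    by_cases h : Γ.Contractible H l
    swap
    · exact Γ.contr_of_neg h
    by_cases hHl : H ∈ l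
    · exact Γ.contr_self_mem hHl
    have hab : b ⊓ a = ⊥ := by
      have := hs.left ⊥ b bot_le le_rfl
      rwa [bot_sup_eq, le_bot_iff] at this
    rw [Γ.contr_of_pos h (Γ.trace_of_not_le h.1 h.2.1)]
    refine wd_product _ (hs.upper H) (fun e => ?_) (fun e => ?_)
      (Γ.quot_top_le.2 (htop.trans le_sup_left)) _
    · have h1 : a ⊔ H = H := congrArg Subtype.val e
      have h2 : Γ.top ≤ H := htop.trans (sup_eq_right.1 h1)
      exact h.2.1 ((h.1.le_iff.1 h2).resolve_left Γ.top_ne_bot).ge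
    -- If b collapses in the quotient then b = H. No other letter meets b, so they all lie below a,
    -- and H would be a bridge.
    · have h1 : b ⊔ H = H := congrArg Subtype.val e
      have h2 : b = H := (h.1.le_iff.1 (sup_eq_right.1 h1)).resolve_left hb
      have h3 : H ≤ a := h.2.2 a htop fun K hK => by
        have hK' : IsAtom K := Γ.atoms K (hl.mem_iff.1 (List.mem_cons_of_mem _ hK))
        have h4 : K ⊓ b = ⊥ := by
          by_contra hne
          have h5 : K ⊓ b = K := (hK'.le_iff.1 inf_le_left).resolve_left hne
          have h6 : K ≤ H := h2 ▸ inf_eq_left.1 h5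
          exact hHl ((h.1.le_iff.1 h6).resolve_left hK'.1 ▸ hK)
        have h7 := hs.le_sup K
        rw [h4, sup_bot_eq] at h7
        exact h7.trans inf_le_right
      rw [h2, inf_eq_left.2 h3] at hab
      exact h.1.1 hab
  two_outside Γ F A B l hF htop hA hB hl hJ := by
    have hat : ∀ H ∈ A :: B :: l, IsAtom H := hJ ▸ Γ.atoms
    rw [hJ, altSum, altSum, Γ.contr_symm_two_outside hF htop hA hB hl (hat A (by simp))
      (hat B (by simp))]
    rw [altSum_eq_zero (l := l), sub_zero, sub_self]
    intro H l' hl'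
    by_cases h : Γ.Contractible H (A :: B :: l')
    swap
    · exact Γ.contr_of_neg h
    have hH : H ≤ F := hl H (hl'.mem_iff.1 List.mem_cons_self)
    rw [Γ.contr_of_pos h (Γ.trace_of_not_le h.1 h.2.1)]
    refine wd_two_outside _ (F := (⟨H ⊔ F, le_sup_left⟩ : Set.Ici H)) (hF.sup H)
      (Γ.quot_top_le.2 (htop.trans le_sup_right)) (fun h' => hA ?_) (fun h' => hB ?_)
      fun K hK => ?_
    · exact (up_le_iff.1 h').trans (sup_le hH le_rfl)
    · exact (up_le_iff.1 h').trans (sup_le hH le_rfl)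
    · obtain ⟨K, hK', rfl⟩ := List.mem_map.1 hK
      exact up_le_iff.2 ((hl K (hl'.mem_iff.1 (List.mem_cons_of_mem _ hK'))).trans le_sup_right)

end Diag

namespace MD

open Diag

variable {L : GeomLat.{u}}

/-- The differential of `MD L`. -/
noncomputable def d : MD L →ₗ[ℚ] MD L := lift _ isInvariant_d

theorem d_mk (Γ : Diag L) : d (mk Γ) = altSum Γ.J Γ.contr := lift_mk _ _ _

theorem d_wd (Γ : Diag L) {l : List Γ.E} (h : ∀ H ∈ l, IsAtom H) :
    d (Γ.wd l) = altSum l Γ.contr := by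
  rw [wd_of_atoms Γ h, d_mk]
  rfl

end MD

/-! ### The square of the differential and the Leibniz rule. -/

namespace Diag

variable {L : GeomLat.{u}}

theorem rk_top_quot (Γ : Diag L) {H : Γ.E} (hH : IsAtom H) (h : Γ.trace H = ⊥) :
    rk (⊤ : (Γ.quot H h).E) = rk (⊤ : Γ.E) - 1 := by
  refine (rk_upper (L := Γ.E) (Γ.ne_top_of_trace bot_ne_top h) ⊤).trans ?_
  rw [rk_atom hH]
  rfl

theorem contr_mem (Γ : Diag L) (H : Γ.E) (l : List Γ.E) :
    Γ.contr H l ∈ MD.gr L ((l.length : ℤ) - 2 * (rk (⊤ : Γ.E) - rk (⊤ : L)) + 2) := by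
  by_cases h : Γ.Contractible H l
  · have h0 := Γ.trace_of_not_le h.1 h.2.1
    rw [Γ.contr_of_pos h h0]
    have := (Γ.quot H h0).wd_mem (l.map (up H))
    rw [rk_top_quot Γ h.1] at this
    have e : ((l.map (up H)).length : ℤ) = l.length := by rw [List.length_map]
    refine Eq.mp (congrArg (fun n : ℤ => (Γ.quot H h0).wd (l.map (up H)) ∈ MD.gr L n) ?_) this
    refine (congrArg (fun n : ℤ => n - 2 * (rk (⊤ : Γ.E) - 1 - rk (⊤ : L))) e).trans ?_
    ring
  · rw [Γ.contr_of_neg h]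
    exact zero_mem _

theorem altSum_mem {α M : Type*} [AddCommGroup M] [Module ℚ M] (S : Submodule ℚ M) {l : List α}
    {c : α → List α → M} (h : ∀ a l', (a :: l').Perm l → c a l' ∈ S) : altSum l c ∈ S := by
  induction l generalizing c with
  | nil => exact zero_mem _
  | cons a l ih =>
    exact sub_mem (h a l (List.Perm.refl _)) (ih fun b l' hb =>
      h b _ ((List.Perm.swap a b l').trans (hb.cons a)))

open scoped Classical in
/-- The term of the square of the differential which corresponds to two letters. -/
noncomputable def contr₂ (Γ : Diag L) (H K : Γ.E) (l : List Γ.E) : MD L :=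
  if h : Γ.Contractible H (K :: l) then
    (Γ.quot H (Γ.trace_of_not_le h.1 h.2.1)).contr (up H K) (l.map (up H)) else 0

theorem contr₂_of_pos (Γ : Diag L) {H K : Γ.E} {l : List Γ.E} (h : Γ.Contractible H (K :: l))
    (h0 : Γ.trace H = ⊥) :
    Γ.contr₂ H K l = (Γ.quot H h0).contr (up H K) (l.map (up H)) := dif_pos h

/-- Exchange: as H is not below X ∨ K, the meet of X ∨ K and X ∨ H is X, and K below X ∨ H would lie
in it. -/
theorem not_le_sup_symm {E : GeomLat.{u}} {X H K : E} (hH : IsAtom H) (h1 : ¬ K ≤ X)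
    (h2 : ¬ H ≤ X ⊔ K) : ¬ K ≤ X ⊔ H := fun h3 => by
  have hH' : ¬ H ≤ X := fun h => h2 (h.trans le_sup_left)
  have h5 : (X ⊔ K) ⊓ (X ⊔ H) = X := inf_sup_atom_of_covBy hH h2 le_sup_left
  exact h1 ((le_inf le_sup_right h3).trans h5.le)

theorem contr_of_contr₂ (Γ : Diag L) {H K : Γ.E} {l : List Γ.E} (hK : IsAtom K)
    (h : Γ.Contractible H (K :: l)) (h0 : Γ.trace H = ⊥) (h0' : Γ.trace (H ⊔ K) = ⊥)
    (h1 : ¬ K ≤ Γ.top ⊔ H) (h2 : Γ.Contractible K (H :: l)) :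
    (Γ.quot H h0).contr (up H K) (l.map (up H)) =
      (Γ.quot (H ⊔ K) h0').wd (l.map (up (H ⊔ K))) := by
  have hc : (Γ.quot H h0).Contractible (up H K) (l.map (up H)) := by
    refine ⟨isAtom_sup hK fun h => h1 (h.trans le_sup_right), fun h' => h1 ?_, fun F hF hl => ?_⟩
    · have : H ⊔ K ≤ H ⊔ Γ.top := h'
      exact (le_sup_right.trans this).trans_eq (sup_comm _ _)
    · refine up_le_iff.2 (h2.2.2 F.1 (Γ.quot_top_le.1 hF) fun Z hZ => ?_)
      rcases List.mem_cons.1 hZ with rfl | hZ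
      · exact F.2
      · exact up_le_iff.1 (hl (up H Z) (List.mem_map_of_mem hZ))
  have h3 : (Γ.quot H h0).trace (up H K) = ⊥ := (trace_quot Γ _).trans h0'
  refine (contr_of_pos _ hc h3).trans ?_
  exact Γ.quot_quot (le_sup_left : H ≤ H ⊔ K) h0 h3 h0' l

/-- A nonzero double contraction forces conditions which turn out to be symmetric: each letter is
contractible in the presence of the other, and they are independent over F_ι. Under these conditions
`contr_of_contr₂` identifies both orders of contraction with the quotient by H ∨ K. -/
theorem contr₂_cases (Γ : Diag L) {H K : Γ.E} {l : List Γ.E} (h : Γ.contr₂ H K l ≠ 0)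
    (hK : IsAtom K) :
    Γ.Contractible H (K :: l) ∧ Γ.Contractible K (H :: l) ∧ ¬ K ≤ Γ.top ⊔ H := by
  by_cases h' : Γ.Contractible H (K :: l)
  swap
  · exact absurd (dif_neg h') h
  have h0 := Γ.trace_of_not_le h'.1 h'.2.1
  have e := Γ.contr₂_of_pos h' h0
  by_cases hc : (Γ.quot H h0).Contractible (up H K) (l.map (up H))
  swap
  · exact absurd (e.trans (contr_of_neg _ hc)) h
  have h1 : ¬ K ≤ Γ.top ⊔ H := fun h1 => hc.2.1 (by
    change H ⊔ K ≤ H ⊔ Γ.top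
    exact sup_le le_sup_left (h1.trans_eq (sup_comm _ _)))
  refine ⟨h', ⟨hK, fun h2 => h1 (h2.trans le_sup_left), fun F hF hl => ?_⟩, h1⟩
  have hHF : H ≤ F := hl H List.mem_cons_self
  exact up_le_iff.1 (hc.2.2 (⟨F, hHF⟩ : Set.Ici H) (Γ.quot_top_le.2 hF) fun Z hZ => by
    obtain ⟨Z, hZ', rfl⟩ := List.mem_map.1 hZ
    exact up_le_iff.2 (hl Z (List.mem_cons_of_mem _ hZ')))

theorem contr₂_symm (Γ : Diag L) {H K : Γ.E} (hH : IsAtom H) (hK : IsAtom K) (l : List Γ.E) :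
    Γ.contr₂ H K l = Γ.contr₂ K H l := by
  have key : ∀ {H K : Γ.E}, IsAtom H → IsAtom K → Γ.contr₂ H K l ≠ 0 →
      Γ.contr₂ H K l = Γ.contr₂ K H l := by
    intro H K hH hK h
    obtain ⟨h1, h2, h3⟩ := Γ.contr₂_cases h hK
    have h4 : ¬ H ≤ Γ.top ⊔ K := not_le_sup_symm hK h1.2.1 h3
    have tH := Γ.trace_of_not_le h1.1 h1.2.1
    have tK := Γ.trace_of_not_le h2.1 h2.2.1
    have t1 : Γ.trace (H ⊔ K) = ⊥ := by
      rw [Γ.trace_sup_atom hK (by rwa [sup_comm]), tH]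
    have t2 : Γ.trace (K ⊔ H) = ⊥ := by rwa [sup_comm]
    refine (dif_pos h1).trans (Eq.trans ?_ (dif_pos h2).symm)
    rw [Γ.contr_of_contr₂ hK h1 tH t1 h3 h2, Γ.contr_of_contr₂ hH h2 tK t2 h4 h1]
    exact Γ.quot_congr (sup_comm H K) t1 t2 l
  by_cases h : Γ.contr₂ H K l = 0
  · by_cases h' : Γ.contr₂ K H l = 0
    · rw [h, h']
    · exact (key hK hH h').symm
  · exact key hH hK h

theorem isAtom_up {E : GeomLat.{u}} {H K : E} (hH : IsAtom H) (hK : IsAtom K) (h : K ≠ H) :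
    IsAtom (up H K) :=
  isAtom_sup hK fun h' => h ((hH.le_iff.1 h').resolve_left hK.1)

theorem isAtom_of_inl {Γ₁ Γ₂ : Diag L} {H : Γ₁.E} (h : IsAtom (PushCarrier.inl Γ₁ Γ₂ H)) :
    IsAtom H := by
  refine ⟨fun e => h.1 (PushCarrier.ext e ?_), fun x hx => ?_⟩
  · change Γ₂.ι (Γ₁.trace H) = ⊥
    rw [e, trace_bot, ι_bot]
  · have := h.2 (PushCarrier.inl Γ₁ Γ₂ x) (lt_of_le_not_ge (PushCarrier.inl_le.2 hx.le)
      fun h' => hx.not_ge (PushCarrier.inl_le.1 h'))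
    exact congrArg (fun x : PushCarrier Γ₁ Γ₂ => x.1.1) this

theorem wd_mul_mk (Γ₁ Γ₂ : Diag L) (l : List Γ₁.E) : Γ₁.wd l * MD.mk Γ₂ =
    (push Γ₁ Γ₂).wd (l.map (PushCarrier.inl Γ₁ Γ₂) ++ Γ₂.J.map (PushCarrier.inr Γ₁ Γ₂)) := by
  by_cases h : ∀ H ∈ l, IsAtom H
  · rw [wd_of_atoms Γ₁ h, MD.mk_mul_mk]
    exact push_word_left Γ₁ Γ₂ h
  · have h0 : Γ₁.wd l = 0 := dif_neg h
    push Not at h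
    obtain ⟨H, hH, hH'⟩ := h
    rw [h0, zero_mul]
    exact (wd_of_not_atom (push Γ₁ Γ₂) (H := PushCarrier.inl Γ₁ Γ₂ H)
      (List.mem_append_left _ (List.mem_map_of_mem hH)) fun h => hH' (isAtom_of_inl h)).symm

/-- Contractibility in the pushout is tested on the flats (F, ⊤), which contain all letters of Γ₂,
so it only depends on Γ₁. As H has trace ⊥, it becomes (H, ⊥), and the interval above it is the
pushout of [H, ⊤] and the lattice of Γ₂. -/
theorem contr_push_left (Γ₁ Γ₂ : Diag L) (H : Γ₁.E) (l : List Γ₁.E) :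
    (push Γ₁ Γ₂).contr (PushCarrier.inl Γ₁ Γ₂ H)
      (l.map (PushCarrier.inl Γ₁ Γ₂) ++ Γ₂.J.map (PushCarrier.inr Γ₁ Γ₂)) =
      Γ₁.contr H l * MD.mk Γ₂ := by
  have e : (push Γ₁ Γ₂).Contractible (PushCarrier.inl Γ₁ Γ₂ H)
      (l.map (PushCarrier.inl Γ₁ Γ₂) ++ Γ₂.J.map (PushCarrier.inr Γ₁ Γ₂)) ↔
      Γ₁.Contractible H l := by
    refine and_congr ⟨isAtom_of_inl, PushCarrier.isAtom_inl⟩ (and_congr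
      (not_congr PushCarrier.inl_le) ⟨fun h F h1 h2 => ?_, fun h Z h1 h2 => ?_⟩)
    · have t : Γ₁.trace F = Γ₂.trace ⊤ := by rw [trace_top, trace_eq_top_iff]; exact h1
      refine PushCarrier.inl_le.1 (h (PushCarrier.mk F ⊤ t) ⟨h1, le_top⟩ fun K hK => ?_)
      rcases List.mem_append.1 hK with hK | hK <;> obtain ⟨K, hK', rfl⟩ := List.mem_map.1 hK
      · exact PushCarrier.inl_le.2 (h2 K hK')
      · exact PushCarrier.inr_le.2 le_top
    · exact PushCarrier.inl_le.2 (h Z.1.1 h1.1 fun K hK => PushCarrier.inl_le.1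
        (h2 _ (List.mem_append_left _ (List.mem_map_of_mem hK))))
  by_cases h : Γ₁.Contractible H l
  swap
  · rw [contr_of_neg _ fun h' => h (e.1 h'), contr_of_neg _ h, zero_mul]
  have h0 := Γ₁.trace_of_not_le h.1 h.2.1
  have h0' : (push Γ₁ Γ₂).trace (PushCarrier.inl Γ₁ Γ₂ H) = ⊥ := (push_trace Γ₁ Γ₂ _).trans h0
  rw [contr_of_pos _ (e.2 h) h0', contr_of_pos _ h h0, wd_mul_mk]
  let ψ : PushCarrier (Γ₁.quot H h0) Γ₂ ≃o Set.Ici (PushCarrier.inl Γ₁ Γ₂ H) :=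
    { toFun := fun x => ⟨.mk x.1.1.1 x.1.2 ((trace_quot Γ₁ x.1.1).symm.trans x.2),
        PushCarrier.inl_le.2 x.1.1.2⟩
      invFun := fun y => .mk (⟨y.1.1.1, PushCarrier.inl_le.1 y.2⟩ : Set.Ici H) y.1.1.2
        ((trace_quot Γ₁ _).trans y.1.2)
      left_inv := fun _ => rfl
      right_inv := fun _ => rfl
      map_rel_iff' := Iff.rfl }
  have tH : Γ₁.trace H = Γ₂.trace ⊥ := by rw [h0, trace_bot]
  have hH : PushCarrier.inl Γ₁ Γ₂ H = PushCarrier.mk H ⊥ tH := PushCarrier.ext rfl (by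
    change Γ₂.ι (Γ₁.trace H) = ⊥
    rw [h0, ι_bot])
  -- Joins in a pushout involve the closure `cl`; comparing upper bounds avoids computing it.
  have hl : ∀ K, ψ (PushCarrier.inl (Γ₁.quot H h0) Γ₂ (up H K)) =
      up (PushCarrier.inl Γ₁ Γ₂ H) (PushCarrier.inl Γ₁ Γ₂ K) := fun K => by
    refine eq_of_forall_ge_iff fun z => ?_
    refine Iff.trans ?_ up_le_iff.symm
    refine (ψ.le_symm_apply).symm.trans (PushCarrier.inl_le.trans ?_)
    exact up_le_iff.trans PushCarrier.inl_le.symm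
  have hr : ∀ K, ψ (PushCarrier.inr (Γ₁.quot H h0) Γ₂ K) =
      up (PushCarrier.inl Γ₁ Γ₂ H) (PushCarrier.inr Γ₁ Γ₂ K) := fun K => by
    refine eq_of_forall_ge_iff fun z => ?_
    refine Iff.trans ?_ up_le_iff.symm
    refine (ψ.le_symm_apply).symm.trans (PushCarrier.inr_le.trans ?_)
    exact (PushCarrier.inr_le (x := z.1)).symm
  refine Eq.trans ?_ (wd_iso (Γ := push (Γ₁.quot H h0) Γ₂)
    (Γ' := (push Γ₁ Γ₂).quot (PushCarrier.inl Γ₁ Γ₂ H) h0') ψ (fun x => ?_) _)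
  · refine congrArg _ ?_
    refine (map_append_map (up (PushCarrier.inl Γ₁ Γ₂ H)) (PushCarrier.inl Γ₁ Γ₂)
      (PushCarrier.inr Γ₁ Γ₂) l Γ₂.J).trans ?_
    refine Eq.trans ?_ (map_append_map ψ (PushCarrier.inl (Γ₁.quot H h0) Γ₂)
      (PushCarrier.inr (Γ₁.quot H h0) Γ₂) (l.map (up H)) Γ₂.J).symm
    refine congrArg₂ (fun l l' => l ++ l') ?_ ?_
    · refine Eq.trans ?_ List.map_map.symm
      exact List.map_congr_left fun K _ => (hl K).symm
    · exact List.map_congr_left fun K _ => (hr K).symm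
  · refine eq_of_forall_ge_iff fun z => ?_
    change PushCarrier.inl Γ₁ Γ₂ H ⊔ (push Γ₁ Γ₂).ι x ≤ z.1 ↔ ψ ((push (Γ₁.quot H h0) Γ₂).ι x) ≤ z
    refine sup_le_iff.trans (Iff.trans (and_iff_right z.2) ?_)
    refine Iff.trans ?_ (ψ.le_symm_apply)
    exact and_congr (up_le_iff (G := H) (K := Γ₁.ι x) (x := (ψ.symm z).1.1)).symm Iff.rfl

theorem mk_mul_wd (Γ₁ Γ₂ : Diag L) (l : List Γ₂.E) :
    MD.mk Γ₁ * Γ₂.wd l = (-1 : ℤ) ^ (Γ₁.J.length * l.length) • (Γ₂.wd l * MD.mk Γ₁) := by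
  by_cases h : ∀ H ∈ l, IsAtom H
  · rw [wd_of_atoms Γ₂ h, MD.mul_mk_mk_comm]
    rfl
  · have h0 : Γ₂.wd l = 0 := dif_neg h
    rw [h0, mul_zero, zero_mul, smul_zero]

theorem mk_mul_contr (Γ₁ Γ₂ : Diag L) (H : Γ₂.E) (l : List Γ₂.E) :
    MD.mk Γ₁ * Γ₂.contr H l =
      (-1 : ℤ) ^ (Γ₁.J.length * l.length) • (Γ₂.contr H l * MD.mk Γ₁) := by
  by_cases h : Γ₂.Contractible H l
  · have h0 := Γ₂.trace_of_not_le h.1 h.2.1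
    rw [contr_of_pos _ h h0]
    exact (mk_mul_wd Γ₁ (Γ₂.quot H h0) _).trans (congrArg (fun n : ℕ =>
      (-1 : ℤ) ^ (Γ₁.J.length * n) • ((Γ₂.quot H h0).wd (l.map (up H)) * MD.mk Γ₁))
      (List.length_map _))
  · rw [contr_of_neg _ h, mul_zero, zero_mul, smul_zero]

/-- The commutativity of the pushout. -/
def pushSwap (Γ₁ Γ₂ : Diag L) : PushCarrier Γ₁ Γ₂ ≃o PushCarrier Γ₂ Γ₁ where
  toFun x := .mk x.1.2 x.1.1 x.2.symm
  invFun x := .mk x.1.2 x.1.1 x.2.symm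
  left_inv _ := rfl
  right_inv _ := rfl
  map_rel_iff' {_ _} := and_comm

theorem contr_push_right (Γ₁ Γ₂ : Diag L) (H : Γ₂.E) (l : List Γ₂.E) :
    (push Γ₁ Γ₂).contr (PushCarrier.inr Γ₁ Γ₂ H)
      (Γ₁.J.map (PushCarrier.inl Γ₁ Γ₂) ++ l.map (PushCarrier.inr Γ₁ Γ₂)) =
      MD.mk Γ₁ * Γ₂.contr H l := by
  rw [mk_mul_contr, ← contr_push_left]
  have h1 := ((push Γ₂ Γ₁).isAlt_contr (PushCarrier.inl Γ₂ Γ₁ H)).append_comm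
    (Γ₁.J.map (PushCarrier.inr Γ₂ Γ₁)) (l.map (PushCarrier.inl Γ₂ Γ₁))
  have hl : (Γ₁.J.map (PushCarrier.inr Γ₂ Γ₁)).length * (l.map (PushCarrier.inl Γ₂ Γ₁)).length =
      Γ₁.J.length * l.length := by rw [List.length_map, List.length_map]
  refine Eq.trans ?_ (h1.trans (congrArg (fun n : ℕ => (-1 : ℤ) ^ n • (push Γ₂ Γ₁).contr
    (PushCarrier.inl Γ₂ Γ₁ H) (l.map (PushCarrier.inl Γ₂ Γ₁) ++
      Γ₁.J.map (PushCarrier.inr Γ₂ Γ₁))) hl))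
  refine (contr_map (Γ := push Γ₁ Γ₂) (Γ' := push Γ₂ Γ₁) (φ := pushSwap Γ₁ Γ₂) (IsEmbedding.of_orderIso
    (L := pushLat Γ₁ Γ₂) (M := pushLat Γ₂ Γ₁) (pushSwap Γ₁ Γ₂)) (pushSwap Γ₁ Γ₂).map_top
    (fun x => rfl) _ _).symm.trans ?_
  exact congrArg _ (map_append_map (pushSwap Γ₁ Γ₂) (PushCarrier.inl Γ₁ Γ₂)
    (PushCarrier.inr Γ₁ Γ₂) Γ₁.J l)

theorem d_push (Γ₁ Γ₂ : Diag L) : MD.d (MD.mk Γ₁ * MD.mk Γ₂) =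
    MD.d (MD.mk Γ₁) * MD.mk Γ₂ + (-1 : ℤ) ^ Γ₁.J.length • (MD.mk Γ₁ * MD.d (MD.mk Γ₂)) := by
  rw [MD.mk_mul_mk, MD.d_mk, MD.d_mk, MD.d_mk]
  refine (altSum_append (Γ₁.J.map (PushCarrier.inl Γ₁ Γ₂)) (Γ₂.J.map (PushCarrier.inr Γ₁ Γ₂))
    (push Γ₁ Γ₂).contr).trans ?_
  rw [List.length_map, altSum_map, altSum_map]
  refine congrArg₂ (fun x y => x + (-1 : ℤ) ^ Γ₁.J.length • y) ?_ ?_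
  · refine Eq.trans ?_ (altSum_hom (AddMonoidHom.mulRight (MD.mk Γ₂)) Γ₁.J Γ₁.contr)
    exact altSum_congr fun H l _ => contr_push_left Γ₁ Γ₂ H l
  · refine Eq.trans ?_ (altSum_hom (AddMonoidHom.mulLeft (MD.mk Γ₁)) Γ₂.J Γ₂.contr)
    exact altSum_congr fun H l _ => contr_push_right Γ₁ Γ₂ H l

end Diag

namespace MD

open Diag

variable {L : GeomLat.{u}}

theorem d_mem {n : ℤ} {x : MD L} (hx : x ∈ gr L n) : d x ∈ gr L (n + 1) := by
  refine gr_induction (p := fun x => d x ∈ gr L (n + 1)) ?_ ?_ ?_ ?_ hx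
  · rw [map_zero]; exact zero_mem _
  · intro x y hx hy; rw [map_add]; exact add_mem hx hy
  · intro c x hx; rw [map_smul]; exact Submodule.smul_mem _ _ hx
  · rintro Γ rfl
    rw [d_mk]
    refine altSum_mem _ fun H l hl => ?_
    have := Γ.contr_mem H l
    have e : ((l.length : ℤ) - 2 * (rk (⊤ : Γ.E) - rk (⊤ : L)) + 2) = Γ.deg' + 1 := by
      rw [deg', ← hl.length_eq, List.length_cons]
      push_cast
      ring
    rwa [e] at this

theorem d_d (x : MD L) : d (d x) = 0 := by
  suffices h : d ∘ₗ d = (0 : MD L →ₗ[ℚ] MD L) from LinearMap.congr_fun h x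
  refine hom_ext fun Γ => ?_
  rw [LinearMap.comp_apply, LinearMap.zero_apply]
  -- A word with a repeated letter has class 0. Without repetitions every letter K ≠ H gives an atom
  -- H ∨ K of [H, ⊤], so that `d_wd` applies to the contraction.
  by_cases hn : Γ.J.Nodup
  swap
  · rw [Γ.mk_of_dup hn, map_zero, map_zero]
  rw [d_mk]
  refine (altSum_hom (d : MD L →ₗ[ℚ] MD L).toAddMonoidHom Γ.J Γ.contr).symm.trans ?_
  have hat : ∀ {H l}, (H :: l).Perm Γ.J → IsAtom H ∧ ∀ K ∈ l, IsAtom K := fun h =>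
    ⟨Γ.atoms _ (h.mem_iff.1 List.mem_cons_self),
      fun K hK => Γ.atoms K (h.mem_iff.1 (List.mem_cons_of_mem _ hK))⟩
  rw [← altSum_altSum (l := Γ.J) (c := Γ.contr₂) fun a b l h => Γ.contr₂_symm (hat h).1
    ((hat h).2 b List.mem_cons_self) l]
  refine altSum_congr fun H l hl => ?_
  change d (Γ.contr H l) = _
  have hn' := (hl.nodup_iff.2 hn)
  by_cases hc : Γ.Contractible H l
  · have h0 := Γ.trace_of_not_le hc.1 hc.2.1
    rw [contr_of_pos _ hc h0]
    refine (d_wd (Γ.quot H h0) fun K hK => ?_).trans ((altSum_map (up H) l _).trans ?_)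
    · obtain ⟨K, hK', rfl⟩ := List.mem_map.1 hK
      exact isAtom_up hc.1 ((hat hl).2 K hK') fun e => (List.nodup_cons.1 hn').1 (e ▸ hK')
    · refine altSum_congr fun K l' hl' => ?_
      have hc' : Γ.Contractible H (K :: l') := (Contractible.congr fun _ => hl'.mem_iff).2 hc
      exact (Γ.contr₂_of_pos hc' h0).symm
  · rw [contr_of_neg _ hc, map_zero]
    refine (altSum_eq_zero fun K l' hl' => ?_).symm
    have hc' : ¬ Γ.Contractible H (K :: l') := fun h =>
      hc ((Contractible.congr fun _ => hl'.mem_iff).1 h)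
    exact dif_neg hc'

theorem leibniz {m : ℤ} {x : MD L} (hx : x ∈ gr L m) (y : MD L) :
    d (x * y) = d x * y + m.negOnePow • (x * d y) := by
  refine gr_induction (p := fun x => d (x * y) = d x * y + m.negOnePow • (x * d y)) ?_ ?_ ?_ ?_ hx
  · simp
  · intro x x' h h'
    rw [add_mul, map_add, h, h', map_add, add_mul, add_mul, smul_add]; abel
  · intro c x h
    rw [smul_mul_assoc, map_smul, h, map_smul, smul_mul_assoc, smul_mul_assoc, smul_add,
      smul_comm c m.negOnePow]
  · rintro Γ rfl
    rw [deg'_negOnePow, negOnePow_smul]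
    induction y using MD.induction with
    | h0 => simp
    | hadd y y' h h' => rw [mul_add, map_add, h, h', map_add, mul_add, mul_add, smul_add]; abel
    | hsmul c y h => rw [mul_smul_comm, map_smul, h, map_smul, mul_smul_comm, mul_smul_comm,
        smul_add, smul_comm c]
    | hmk Γ' => exact d_push Γ Γ'

end MD

/-! ### Comparison with the explicit formula for the differential. -/

namespace Diag

variable {L : GeomLat.{u}}

/-- One notion refers to the remaining word, the other to the letters different from H; they agree
because H occurs only once. -/
theorem contractible_iff (Γ : Diag L) {H : Γ.E} {l : List Γ.E} (hl : (H :: l).Perm Γ.J)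
    (hn : Γ.J.Nodup) : Γ.IsContractible H ↔ Γ.Contractible H l := by
  have hn' := List.nodup_cons.1 (hl.nodup_iff.2 hn)
  have hm : ∀ K, (K ∈ Γ.J ∧ K ≠ H) ↔ K ∈ l := fun K => by
    rw [← hl.mem_iff, List.mem_cons]
    constructor
    · rintro ⟨h1 | h1, h2⟩
      · exact absurd h1 h2
      · exact h1
    · exact fun h => ⟨Or.inr h, fun e => hn'.1 (e ▸ h)⟩
  constructor
  · rintro ⟨h1, h2⟩
    refine ⟨Γ.atoms H (hl.mem_iff.1 List.mem_cons_self), h2, fun F hF hK => ?_⟩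
    by_contra hH
    exact h1 ⟨F, hF, hH, fun K hK1 hK2 => hK K ((hm K).1 ⟨hK1, hK2⟩)⟩
  · rintro ⟨_, h2, h3⟩
    refine ⟨fun ⟨F, hF, hH, hK⟩ => hH (h3 F hF fun K hK' => ?_), h2⟩
    obtain ⟨h4, h5⟩ := (hm K).2 hK'
    exact hK K h4 h5

/-- The hypothesis `e` expresses that l is the word J with H deleted, order included: no partial map
undefined at H distinguishes them. It is applied to the partial map K ↦ H ∨ K which defines
`wordAbove`. -/
theorem mk_contract (Γ : Diag L) {H : Γ.E} {l : List Γ.E} (hl : (H :: l).Perm Γ.J)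
    (hn : Γ.J.Nodup) (hH : IsAtom H) (h : ¬ H ≤ Γ.top)
    (e : ∀ f : Γ.E → Option (Set.Ici H), f H = none → Γ.J.filterMap f = l.filterMap f) :
    MD.mk (Γ.contract H hH h) = (Γ.quot H (Γ.trace_of_not_le hH h)).wd (l.map (up H)) := by
  refine (wd_J (Γ.contract H hH h)).symm.trans ?_
  refine congrArg (Γ.quot H (Γ.trace_of_not_le hH h)).wd ?_
  have hn' := List.nodup_cons.1 (hl.nodup_iff.2 hn)
  change Γ.wordAbove H = _
  rw [wordAbove, e _ (if_pos le_rfl)]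
  refine Eq.trans ?_ (congrFun (List.filterMap_eq_map (f := up H)) l)
  refine List.filterMap_congr fun K hK => ?_
  have hK' : IsAtom K := Γ.atoms K (hl.mem_iff.1 (List.mem_cons_of_mem _ hK))
  refine if_neg fun hle => hn'.1 ?_
  exact (hH.le_iff.1 hle).resolve_left hK'.1 ▸ hK

end Diag

namespace MD

open Diag

variable {L : GeomLat.{u}}

theorem perm_eraseIdx {α : Type*} (l : List α) (i : Fin l.length) :
    (l.get i :: l.eraseIdx i).Perm l := by
  exact (List.getElem_cons_eraseIdx_perm i.2)

theorem filterMap_eraseIdx {α β : Type*} (l : List α) (i : Fin l.length) (f : α → Option β)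
    (h : f (l.get i) = none) : l.filterMap f = (l.eraseIdx i).filterMap f := by
  obtain ⟨i, hi⟩ := i
  induction l generalizing i with
  | nil => simp at hi
  | cons a l ih =>
    cases i with
    | zero => exact List.filterMap_cons_none h
    | succ i =>
      have := ih i (by simpa using hi) h
      simp only [List.eraseIdx_cons_succ, List.filterMap_cons, this]

open scoped Classical in
theorem d_mk_of_nodup (Γ : Diag L) (hn : Γ.J.Nodup) : d (mk Γ) = ∑ i : Fin Γ.J.length,
    if h : Γ.IsContractible (Γ.J.get i) then
      (-1 : ℚ) ^ (i : ℕ) • mk (Γ.contract (Γ.J.get i) (Γ.atoms _ (List.get_mem Γ.J i)) h.2)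
    else 0 := by
  rw [d_mk, altSum_eq_sum]
  refine Finset.sum_congr rfl fun i _ => ?_
  have hp := perm_eraseIdx Γ.J i
  have e := Γ.contractible_iff hp hn
  split_ifs with h
  · have h' := e.1 h
    rw [contr_of_pos _ h' (Γ.trace_of_not_le h'.1 h'.2.1), Γ.mk_contract hp hn h'.1 h'.2.1
      fun f => filterMap_eraseIdx Γ.J i f]
  · rw [contr_of_neg _ fun h' => h (e.2 h'), smul_zero]

/-- The cdga `MD L`. -/
noncomputable def cdga (L : GeomLat.{u}) : CDGA.{u + 1} where
  carrier := MD L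
  gr := gr L
  d := d
  d_mem _ _ h := d_mem h
  d_d := d_d
  leibniz _ _ y hx := leibniz hx y
  comm _ _ _ _ hx hy := mul_comm_of_mem hx hy

end MD

/-! ### The coproducts of `MD` -/

open scoped Classical in
/-- A letter below `F'`, as a letter of `[⊥, F']`. -/
noncomputable def toLower {E : Type*} [Lattice E] (F' K : E) : Option (Set.Iic F') :=
  if h : K ≤ F' then some ⟨K, h⟩ else none

open scoped Classical in
/-- A letter not below `F'`, as a letter of `[F', ⊤]`. -/
noncomputable def toUpper {E : Type*} [Lattice E] (F' K : E) : Option (Set.Ici F') :=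
  if K ≤ F' then none else some (up F' K)

section Letters

variable {E : Type*} [Lattice E] {F' K : E}

theorem toLower_of_le (h : K ≤ F') : toLower F' K = some ⟨K, h⟩ := dif_pos h

theorem toLower_of_not_le (h : ¬ K ≤ F') : toLower F' K = none := dif_neg h

theorem toUpper_of_le (h : K ≤ F') : toUpper F' K = none := if_pos h

theorem toUpper_of_not_le (h : ¬ K ≤ F') : toUpper F' K = some (up F' K) := if_neg h

theorem mem_toLower {l : List E} {x : Set.Iic F'} :
    x ∈ l.filterMap (toLower F') ↔ x.1 ∈ l := by
  rw [List.mem_filterMap]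
  constructor
  · rintro ⟨K, hK, h⟩
    by_cases hle : K ≤ F'
    · rw [toLower_of_le hle] at h
      cases h
      exact hK
    · rw [toLower_of_not_le hle] at h
      cases h
  · exact fun h => ⟨x.1, h, toLower_of_le x.2⟩

theorem mem_toUpper {l : List E} {x : Set.Ici F'} :
    x ∈ l.filterMap (toUpper F') ↔ ∃ K ∈ l, ¬ K ≤ F' ∧ up F' K = x := by
  rw [List.mem_filterMap]
  refine exists_congr fun K => and_congr_right fun _ => ?_
  by_cases hle : K ≤ F'
  · simp [toUpper_of_le hle, hle]
  · simp [toUpper_of_not_le hle, hle]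

variable (F') in
theorem isSplitting_toLower : IsSplitting (· ≤ F') (toLower F') (toUpper F') where
  pos _ h := ⟨⟨_, toLower_of_le h⟩, toUpper_of_le h⟩
  neg _ h := ⟨toLower_of_not_le h, ⟨_, toUpper_of_not_le h⟩⟩

end Letters

namespace MD

/-- The tensor product `MD A ⊗ MD B`. -/
abbrev T (A B : GeomLat.{u}) : Type (u + 1) := CDGA.TCarrier (MD.cdga A) (MD.cdga B)

/-- The pure tensors, as a bilinear map. -/
noncomputable def tm (A B : GeomLat.{u}) : MD A →ₗ[ℚ] MD B →ₗ[ℚ] T A B :=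
  TensorProduct.mk ℚ (MD A) (MD B)

end MD

namespace Diag

variable {L : GeomLat.{u}} {F : L}

/-- The flats `F'` such that `ι⁻¹(F' ∧ F_ι) = F`. -/
abbrev Fiber (Γ : Diag L) (F : L) : Type u := {F' : Γ.E // Γ.trace F' = F}

noncomputable instance (Γ : Diag L) (F : L) : Fintype (Γ.Fiber F) := Fintype.ofFinite _

/-- The class of the part of a word in `[⊥, F']`. -/
noncomputable def lowerWd (Γ : Diag L) (hF : F ≠ ⊥) (x : Γ.Fiber F) (l : List Γ.E) :
    MD (L.lower F hF) := (Γ.below hF x.1 x.2).wd (l.filterMap (toLower x.1))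

/-- The class of the part of a word in `[F', ⊤]`. -/
noncomputable def upperWd (Γ : Diag L) (hF : F ≠ ⊤) (x : Γ.Fiber F) (l : List Γ.E) :
    MD (L.upper F hF) := (Γ.above hF x.1 x.2).wd (l.filterMap (toUpper x.1))

theorem lowerWd_J (Γ : Diag L) (hF : F ≠ ⊥) (x : Γ.Fiber F) :
    Γ.lowerWd hF x Γ.J = MD.mk (Γ.below hF x.1 x.2) := wd_J (Γ.below hF x.1 x.2)

theorem upperWd_J (Γ : Diag L) (hF : F ≠ ⊤) (x : Γ.Fiber F) :
    Γ.upperWd hF x Γ.J = MD.mk (Γ.above hF x.1 x.2) := wd_J (Γ.above hF x.1 x.2)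

/-- The term of the coproduct which corresponds to the flat `F'`. -/
noncomputable def coterm (Γ : Diag L) (hF : Proper F) (x : Γ.Fiber F) (l : List Γ.E) :
    MD.T (L.lower F hF.1) (L.upper F hF.2) :=
  shuffleSign (· ≤ x.1) l • MD.tm _ _ (Γ.lowerWd hF.1 x l) (Γ.upperWd hF.2 x l)

theorem isAlt_coterm (Γ : Diag L) (hF : Proper F) (x : Γ.Fiber F) : IsAlt (Γ.coterm hF x) := by
  refine (isSplitting_toLower x.1).isAlt (T := fun l l' => MD.tm _ _
    ((Γ.below hF.1 x.1 x.2).wd l) ((Γ.above hF.2 x.1 x.2).wd l')) (fun l => ?_) fun l => ?_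
  · exact (Γ.below hF.1 x.1 x.2).isAlt_wd.comp_hom
      ((MD.tm (L.lower F hF.1) (L.upper F hF.2)).flip _).toAddMonoidHom
  · exact (Γ.above hF.2 x.1 x.2).isAlt_wd.comp_hom
      (MD.tm (L.lower F hF.1) (L.upper F hF.2) _).toAddMonoidHom

theorem coterm_of_lower (Γ : Diag L) (hF : Proper F) {x : Γ.Fiber F} {l : List Γ.E}
    (h : Γ.lowerWd hF.1 x l = 0) : Γ.coterm hF x l = 0 := by
  rw [coterm, h, map_zero, LinearMap.zero_apply, smul_zero]

theorem coterm_of_upper (Γ : Diag L) (hF : Proper F) {x : Γ.Fiber F} {l : List Γ.E}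
    (h : Γ.upperWd hF.2 x l = 0) : Γ.coterm hF x l = 0 := by
  rw [coterm, h, map_zero, smul_zero]

/-- The flat X ∧ F' of [⊥, F'] is not the top and contains ι F and all the letters, so the lower
factor does not span. This is the main source of vanishing terms in coproducts. -/
theorem lowerWd_eq_zero (Γ : Diag L) (hF : F ≠ ⊥) {x : Γ.Fiber F} {l : List Γ.E} (X : Γ.E)
    (hX : ¬ x.1 ≤ X) (hι : Γ.ι F ≤ X) (hl : ∀ K ∈ l, K ≤ x.1 → K ≤ X) :
    Γ.lowerWd hF x l = 0 := by
  refine wd_not_spanning _ (X := (⟨X ⊓ x.1, inf_le_right⟩ : Set.Iic x.1)) (fun e => hX ?_)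
    (le_inf hι (Γ.ι_le_of_trace x.2)) fun K hK => ?_
  · exact inf_eq_right.1 (congrArg Subtype.val e)
  · exact le_inf (hl K.1 (mem_toLower.1 hK) K.2) K.2

theorem upperWd_eq_zero (Γ : Diag L) (hF : F ≠ ⊤) {x : Γ.Fiber F} {l : List Γ.E} (X : Γ.E)
    (hX : X ≠ ⊤) (htop : Γ.top ≤ X) (hx : x.1 ≤ X) (hl : ∀ K ∈ l, K ≤ X) :
    Γ.upperWd hF x l = 0 := by
  refine wd_not_spanning _ (X := (⟨X, hx⟩ : Set.Ici x.1)) (fun e => hX (congrArg Subtype.val e))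
    (show x.1 ⊔ Γ.top ≤ X from sup_le hx htop) fun K hK => ?_
  obtain ⟨K, hK', -, rfl⟩ := mem_toUpper.1 hK
  exact up_le_iff.2 (hl K hK')

theorem coterm_map {Γ Γ' : Diag L} {φ : Γ.E → Γ'.E} (hφ : IsEmbedding φ) (htop : φ ⊤ = ⊤)
    (hι : ∀ x, Γ'.ι x = φ (Γ.ι x)) (hF : Proper F) (x : Γ.Fiber F) (y : Γ'.Fiber F)
    (hy : y.1 = φ x.1) (l : List Γ.E) :
    Γ'.coterm hF y (l.map φ) = Γ.coterm hF x l := by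
  obtain ⟨y, hy'⟩ := y
  change y = _ at hy
  subst hy
  have e1 : Γ'.lowerWd hF.1 ⟨φ x.1, hy'⟩ (l.map φ) = Γ.lowerWd hF.1 x l := by
    refine Eq.trans ?_ (wd_map (Γ := Γ.below hF.1 x.1 x.2) (Γ' := Γ'.below hF.1 (φ x.1) hy')
      (fun z : Set.Iic x.1 => (⟨φ z.1, hφ.monotone z.2⟩ : Set.Iic (φ x.1)))
      (hφ.lower (Γ.ne_bot_of_trace hF.1 x.2) (Γ'.ne_bot_of_trace hF.1 hy') le_rfl)
      rfl (fun z => Subtype.ext (hι z.1)) _)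
    refine congrArg (Γ'.below hF.1 (φ x.1) hy').wd ?_
    refine List.filterMap_map.trans (Eq.trans ?_ (List.map_filterMap (l := l)).symm)
    refine List.filterMap_congr fun K _ => ?_
    change toLower (φ x.1) (φ K) = (toLower x.1 K).map _
    by_cases h : K ≤ x.1
    · rw [toLower_of_le h, toLower_of_le (hφ.monotone h)]
      rfl
    · rw [toLower_of_not_le h, toLower_of_not_le fun h' => h (hφ.le_iff.1 h')]
      rfl
  have e2 : Γ'.upperWd hF.2 ⟨φ x.1, hy'⟩ (l.map φ) = Γ.upperWd hF.2 x l := by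
    refine Eq.trans ?_ (wd_map (Γ := Γ.above hF.2 x.1 x.2) (Γ' := Γ'.above hF.2 (φ x.1) hy')
      (fun z : Set.Ici x.1 => (⟨φ z.1, hφ.monotone z.2⟩ : Set.Ici (φ x.1)))
      (hφ.upper (Γ.ne_top_of_trace hF.2 x.2) (Γ'.ne_top_of_trace hF.2 hy') rfl)
      (Subtype.ext htop) (fun z => Subtype.ext ?_) _)
    · refine congrArg (Γ'.above hF.2 (φ x.1) hy').wd ?_
      refine List.filterMap_map.trans (Eq.trans ?_ (List.map_filterMap (l := l)).symm)
      refine List.filterMap_congr fun K _ => ?_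
      change toUpper (φ x.1) (φ K) = (toUpper x.1 K).map _
      by_cases h : K ≤ x.1
      · rw [toUpper_of_le h, toUpper_of_le (hφ.monotone h)]
        rfl
      · rw [toUpper_of_not_le h, toUpper_of_not_le fun h' => h (hφ.le_iff.1 h')]
        exact congrArg some (Subtype.ext (hφ.map_sup x.1 K).symm)
    · change φ x.1 ⊔ Γ'.ι z.1 = φ (x.1 ⊔ Γ.ι z.1)
      rw [hφ.map_sup, hι]
  rw [coterm, coterm, e1, e2, shuffleSign_map]
  congr 1
  exact shuffleSign_congr fun K _ => hφ.le_iff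

/-- If A and B are both below F', the modular flat F' ∧ M kills the lower factor; if only one of
them is, it is a bridge of the lower factor. If neither is, then either F' ≤ M and the modular flat
F' ∨ M kills the upper factor, or F' is not below M and the lower factor, whose letters are all
below M, does not span. -/
theorem coterm_two_outside (Γ : Diag L) (hF : Proper F) (x : Γ.Fiber F) {M A B : Γ.E}
    {l : List Γ.E} (hM : IsModularElt M) (htop : Γ.top ≤ M) (hA : ¬ A ≤ M) (hB : ¬ B ≤ M)
    (hl : ∀ K ∈ l, K ≤ M) : Γ.coterm hF x (A :: B :: l) = 0 := by
  have hι : Γ.ι F ≤ x.1 ⊓ M := le_inf (Γ.ι_le_of_trace x.2) ((Γ.ι_le_top F).trans htop)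
  have hl' : ∀ K ∈ l.filterMap (toLower x.1), K ≤ (⟨x.1 ⊓ M, inf_le_left⟩ : Set.Iic x.1) :=
    fun K hK => le_inf K.2 (hl _ (mem_toLower.1 hK))
  have hn : ∀ {K : Γ.E} (h : K ≤ x.1), ¬ K ≤ M →
      ¬ (⟨K, h⟩ : Set.Iic x.1) ≤ ⟨x.1 ⊓ M, inf_le_left⟩ := fun h hK h' =>
    hK (le_trans (show _ ≤ x.1 ⊓ M from h') inf_le_right)
  by_cases hAx : A ≤ x.1 <;> by_cases hBx : B ≤ x.1
  · refine Γ.coterm_of_lower hF ?_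
    refine (congrArg (Γ.below hF.1 x.1 x.2).wd ((List.filterMap_cons_some (toLower_of_le hAx)).trans
      (congrArg (List.cons _) (List.filterMap_cons_some (toLower_of_le hBx))))).trans ?_
    exact wd_two_outside _ (F := (⟨x.1 ⊓ M, inf_le_left⟩ : Set.Iic x.1)) (hM.inf x.1) hι
      (hn hAx hA) (hn hBx hB) fun K hK => hl' K hK
  · refine Γ.coterm_of_lower hF ?_
    refine (congrArg (Γ.below hF.1 x.1 x.2).wd ((List.filterMap_cons_some (toLower_of_le hAx)).trans
      (congrArg (List.cons _) (List.filterMap_cons_none (toLower_of_not_le hBx))))).trans ?_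
    exact wd_bridge _ (F := (⟨x.1 ⊓ M, inf_le_left⟩ : Set.Iic x.1)) hι (hn hAx hA)
      fun K hK => hl' K hK
  · refine Γ.coterm_of_lower hF ?_
    refine (congrArg (Γ.below hF.1 x.1 x.2).wd ((List.filterMap_cons_none (toLower_of_not_le hAx)).trans
      (List.filterMap_cons_some (toLower_of_le hBx)))).trans ?_
    exact wd_bridge _ (F := (⟨x.1 ⊓ M, inf_le_left⟩ : Set.Iic x.1)) hι (hn hBx hB)
      fun K hK => hl' K hK
  · by_cases hx : x.1 ≤ M
    · refine Γ.coterm_of_upper hF ?_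
      refine (congrArg (Γ.above hF.2 x.1 x.2).wd ((List.filterMap_cons_some (toUpper_of_not_le hAx)).trans
        (congrArg (List.cons _) (List.filterMap_cons_some (toUpper_of_not_le hBx))))).trans ?_
      have hle : x.1 ⊔ M ≤ M := sup_le hx le_rfl
      refine wd_two_outside _ (F := (⟨x.1 ⊔ M, le_sup_left⟩ : Set.Ici x.1)) (hM.sup x.1)
        (show x.1 ⊔ Γ.top ≤ x.1 ⊔ M from sup_le_sup_left htop _)
        (fun h => hA ((up_le_iff.1 h).trans hle)) (fun h => hB ((up_le_iff.1 h).trans hle))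
        fun K hK => ?_
      obtain ⟨K, hK', -, rfl⟩ := mem_toUpper.1 hK
      exact up_le_iff.2 ((hl K hK').trans le_sup_right)
    · refine Γ.coterm_of_lower hF (Γ.lowerWd_eq_zero hF.1 M hx ((Γ.ι_le_top F).trans htop) ?_)
      intro K hK hKx
      rcases List.mem_cons.1 hK with rfl | hK
      · exact absurd hKx hAx
      rcases List.mem_cons.1 hK with rfl | hK
      · exact absurd hKx hBx
      · exact hl K hK

/-- For the embedding relation, a flat y of E' which is not in the image of φ contributes 0: the
letters below y all lie below φ z < y, where z is the right adjoint of φ at y. For the product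
relation, the upper interval splits if b ∧ F' = ⊥ and the lower one splits otherwise. -/
theorem isInvariant_coprod (hF : Proper F) :
    IsInvariant fun Γ : Diag L => ∑ x : Γ.Fiber F, Γ.coterm hF x Γ.J where
  swap Γ := isAlt_onWords (g := fun l => ∑ x : Γ.Fiber F, Γ.coterm hF x l)
    (fun l₁ l₂ a b => by
      rw [← Finset.sum_neg_distrib]
      exact Finset.sum_congr rfl fun x _ => Γ.isAlt_coterm hF x l₁ l₂ a b) fun l hl => rfl
  embedding Γ Γ' φ hφ htop hι hJ := by
    refine Finset.sum_of_injOn (fun x : Γ.Fiber F =>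
      (⟨φ x.1, (trace_map hφ hι x.1).trans x.2⟩ : Γ'.Fiber F)) ?_ ?_ ?_ ?_
    · exact fun x _ y _ h => Subtype.ext (hφ.injective (congrArg Subtype.val h))
    · exact fun x _ => Finset.mem_coe.2 (Finset.mem_univ _)
    · intro y _ hy
      refine Γ'.coterm_of_lower hF ?_
      obtain ⟨z, hz⟩ := hφ.exists_adjoint y.1
      refine Γ'.lowerWd_eq_zero hF.1 (φ z) (fun hle => hy ?_) ?_ ?_
      · have e : φ z = y.1 := le_antisymm ((hz z).1 le_rfl) hle
        refine ⟨⟨z, ?_⟩, Finset.mem_coe.2 (Finset.mem_univ _), Subtype.ext e⟩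
        rw [← trace_map hφ hι, e, y.2]
      · have := Γ'.ι_le_of_trace y.2
        rw [hι] at this ⊢
        exact hφ.monotone ((hz _).2 this)
      · intro K hK hKy
        rw [hJ] at hK
        obtain ⟨K, hK, rfl⟩ := List.mem_map.1 hK
        exact hφ.monotone ((hz _).2 hKy)
    · intro x _
      rw [hJ]
      exact (coterm_map hφ htop hι hF x _ rfl Γ.J).symm
  not_spanning Γ X hX htop hJ := Finset.sum_eq_zero fun x _ => by
    by_cases hx : x.1 ≤ X
    · exact Γ.coterm_of_upper hF (Γ.upperWd_eq_zero hF.2 X hX.ne htop hx hJ)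
    · exact Γ.coterm_of_lower hF (Γ.lowerWd_eq_zero hF.1 X hx ((Γ.ι_le_top F).trans htop)
        fun K hK _ => hJ K hK)
  product Γ a b hs ha hb htop := Finset.sum_eq_zero fun x _ => by
    by_cases hbx : b ⊓ x.1 = ⊥
    · refine Γ.coterm_of_upper hF (wd_product _ (hs.upper x.1) (fun e => ?_) (fun e => ?_)
        (show x.1 ⊔ Γ.top ≤ a ⊔ x.1 from sup_le le_sup_right (htop.trans le_sup_left)) _)
      · have h1 : a ⊔ x.1 = x.1 := congrArg Subtype.val e
        have h2 : Γ.top ≤ x.1 := htop.trans (sup_eq_right.1 h1)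
        exact hF.2 (x.2.symm.trans (Γ.trace_eq_top_iff.2 h2))
      · have h1 : b ⊔ x.1 = x.1 := congrArg Subtype.val e
        rw [inf_eq_left.2 (sup_eq_right.1 h1)] at hbx
        exact hb hbx
    · have hι : Γ.ι F ≤ a ⊓ x.1 := le_inf ((Γ.ι_le_top F).trans htop) (Γ.ι_le_of_trace x.2)
      refine Γ.coterm_of_lower hF (wd_product _ (hs.lower x.1) (fun e => ?_) (fun e => ?_) hι _)
      · have h1 : a ⊓ x.1 = ⊥ := congrArg Subtype.val e
        rw [h1, le_bot_iff, ← Γ.ι_bot] at hι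
        exact hF.1 (Γ.emb.injective hι)
      · exact hbx (congrArg Subtype.val e)
  two_outside Γ M A B l hM htop hA hB hl hJ := Finset.sum_eq_zero fun x _ => by
    rw [hJ]
    exact Γ.coterm_two_outside hF x hM htop hA hB hl

end Diag

namespace MD

open Diag

variable {L : GeomLat.{u}} {F : L}

/-- The coproduct of `MD`, as a linear map. -/
noncomputable def coprod (hF : Proper F) : MD L →ₗ[ℚ] T (L.lower F hF.1) (L.upper F hF.2) :=
  lift _ (isInvariant_coprod hF)

theorem coprod_mk (hF : Proper F) (Γ : Diag L) :
    coprod hF (mk Γ) = ∑ x : Γ.Fiber F, Γ.coterm hF x Γ.J := lift_mk _ _ _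

end MD

/-! ### Multiplicativity and degree of the coproducts. -/

theorem MD.zsmul_mul_zsmul {A B : GeomLat.{u}} (m n : ℤ) (x y : MD.T A B) :
    (m • x) * (n • y) = (m * n) • (x * y) := by
  rw [← Int.cast_smul_eq_zsmul ℚ m, ← Int.cast_smul_eq_zsmul ℚ n, ← Int.cast_smul_eq_zsmul ℚ (m * n),
    smul_mul_assoc, CDGA.t_mul_smul, smul_smul, Int.cast_mul]

namespace Diag

variable {L : GeomLat.{u}} {F : L}

theorem trace_below (Γ : Diag L) (hF : F ≠ ⊥) {F' : Γ.E} (h : Γ.trace F' = F) (y : Set.Iic F') :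
    Subtype.val (p := (· ∈ Set.Iic F)) ((Γ.below hF F' h).trace y) = Γ.trace y.1 := by
  refine le_antisymm ((Γ.trace_le_iff _ _).2 ((Γ.below hF F' h).ι_trace_le y)) ?_
  have h1 : Γ.trace y.1 ≤ F := h ▸ Γ.trace_mono y.2
  exact ((Γ.below hF F' h).trace_le_iff y (⟨_, h1⟩ : Set.Iic F)).2 (Γ.ι_trace_le y.1)

theorem trace_above (Γ : Diag L) (hF : F ≠ ⊤) {F' : Γ.E} (h : Γ.trace F' = F) (y : Set.Ici F') :
    Subtype.val (p := (· ∈ Set.Ici F)) ((Γ.above hF F' h).trace y) = Γ.trace y.1 := by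
  refine le_antisymm ((Γ.trace_le_iff _ _).2
    (le_sup_right.trans ((Γ.above hF F' h).ι_trace_le y))) ?_
  have h1 : F ≤ Γ.trace y.1 := h ▸ Γ.trace_mono y.2
  exact ((Γ.above hF F' h).trace_le_iff y (⟨_, h1⟩ : Set.Ici F)).2
    (show F' ⊔ _ ≤ y.1 from sup_le y.2 (Γ.ι_trace_le y.1))

/-- The flats of a pushout in a fiber. -/
def pushFiber {Γ₁ Γ₂ : Diag L} (x : Γ₁.Fiber F) (y : Γ₂.Fiber F) : (push Γ₁ Γ₂).Fiber F :=
  ⟨PushCarrier.mk x.1 y.1 (x.2.trans y.2.symm), (push_trace Γ₁ Γ₂ _).trans x.2⟩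

theorem map_filterMap_append {α β γ δ α' β' : Type*} (f : α' → Option γ) (i₁ : α → α')
    (i₂ : β → α') (g₁ : α → Option δ) (g₂ : β → Option β') (j₁ : δ → γ) (j₂ : β' → γ) (l₁ : List α)
    (l₂ : List β) (h₁ : ∀ a, f (i₁ a) = (g₁ a).map j₁) (h₂ : ∀ b, f (i₂ b) = (g₂ b).map j₂) :
    (l₁.map i₁ ++ l₂.map i₂).filterMap f =
      (l₁.filterMap g₁).map j₁ ++ (l₂.filterMap g₂).map j₂ := by
  rw [List.filterMap_append, List.filterMap_map, List.filterMap_map, List.map_filterMap,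
    List.map_filterMap]
  congr 1
  · exact List.filterMap_congr fun a _ => h₁ a
  · exact List.filterMap_congr fun b _ => h₂ b

/-- With `mk_above_push`: intervals of a pushout are pushouts of intervals, and a letter of one
factor lies below (x, y) exactly when it lies below the corresponding component. -/
theorem mk_below_push (hF : F ≠ ⊥) {Γ₁ Γ₂ : Diag L} (x : Γ₁.Fiber F) (y : Γ₂.Fiber F) :
    MD.mk ((push Γ₁ Γ₂).below hF (pushFiber x y).1 (pushFiber x y).2) =
      MD.mk (Γ₁.below hF x.1 x.2) * MD.mk (Γ₂.below hF y.1 y.2) := by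
  rw [MD.mk_mul_mk]
  let B₁ := Γ₁.below hF x.1 x.2
  let B₂ := Γ₂.below hF y.1 y.2
  let ψ : PushCarrier B₁ B₂ ≃o Set.Iic (PushCarrier.mk x.1 y.1 (x.2.trans y.2.symm)) :=
    { toFun := fun z => ⟨.mk z.1.1.1 z.1.2.1 ((trace_below Γ₁ hF x.2 z.1.1).symm.trans
        ((congrArg Subtype.val z.2).trans (trace_below Γ₂ hF y.2 z.1.2))), ⟨z.1.1.2, z.1.2.2⟩⟩
      invFun := fun w => .mk (⟨w.1.1.1, w.2.1⟩ : Set.Iic x.1) (⟨w.1.1.2, w.2.2⟩ : Set.Iic y.1)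
        (Subtype.ext ((trace_below Γ₁ hF x.2 ⟨w.1.1.1, w.2.1⟩).trans
          (w.1.2.trans (trace_below Γ₂ hF y.2 ⟨w.1.1.2, w.2.2⟩).symm)))
      left_inv := fun _ => rfl
      right_inv := fun _ => rfl
      map_rel_iff' := Iff.rfl }
  refine (MD.mk_eq_of_iso (Γ := push B₁ B₂) (Γ' := (push Γ₁ Γ₂).below hF (pushFiber x y).1
    (pushFiber x y).2) ψ (fun z => rfl) ?_).symm
  refine Eq.trans ?_ (map_append_map ψ (PushCarrier.inl B₁ B₂) (PushCarrier.inr B₁ B₂)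
    (Γ₁.J.filterMap (toLower x.1)) (Γ₂.J.filterMap (toLower y.1))).symm
  refine map_filterMap_append (toLower (pushFiber x y).1) (PushCarrier.inl Γ₁ Γ₂)
    (PushCarrier.inr Γ₁ Γ₂) (toLower x.1) (toLower y.1) _ _ Γ₁.J Γ₂.J (fun K => ?_) fun K => ?_
  · by_cases h : K ≤ x.1
    · rw [toLower_of_le h]
      refine (toLower_of_le (PushCarrier.inl_le.2 h)).trans (congrArg some (Subtype.ext
        (PushCarrier.ext rfl ?_)))
      exact congrArg Γ₂.ι (trace_below Γ₁ hF x.2 ⟨K, h⟩).symm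
    · rw [toLower_of_not_le h]
      exact toLower_of_not_le fun h' => h (PushCarrier.inl_le.1 h')
  · by_cases h : K ≤ y.1
    · rw [toLower_of_le h]
      refine (toLower_of_le (PushCarrier.inr_le.2 h)).trans (congrArg some (Subtype.ext
        (PushCarrier.ext ?_ rfl)))
      exact congrArg Γ₁.ι (trace_below Γ₂ hF y.2 ⟨K, h⟩).symm
    · rw [toLower_of_not_le h]
      exact toLower_of_not_le fun h' => h (PushCarrier.inr_le.1 h')

theorem mk_above_push (hF : F ≠ ⊤) {Γ₁ Γ₂ : Diag L} (x : Γ₁.Fiber F) (y : Γ₂.Fiber F) :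
    MD.mk ((push Γ₁ Γ₂).above hF (pushFiber x y).1 (pushFiber x y).2) =
      MD.mk (Γ₁.above hF x.1 x.2) * MD.mk (Γ₂.above hF y.1 y.2) := by
  rw [MD.mk_mul_mk]
  let A₁ := Γ₁.above hF x.1 x.2
  let A₂ := Γ₂.above hF y.1 y.2
  let ψ : PushCarrier A₁ A₂ ≃o Set.Ici (PushCarrier.mk x.1 y.1 (x.2.trans y.2.symm)) :=
    { toFun := fun z => ⟨.mk z.1.1.1 z.1.2.1 ((trace_above Γ₁ hF x.2 z.1.1).symm.trans
        ((congrArg Subtype.val z.2).trans (trace_above Γ₂ hF y.2 z.1.2))), ⟨z.1.1.2, z.1.2.2⟩⟩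
      invFun := fun w => .mk (⟨w.1.1.1, w.2.1⟩ : Set.Ici x.1) (⟨w.1.1.2, w.2.2⟩ : Set.Ici y.1)
        (Subtype.ext ((trace_above Γ₁ hF x.2 ⟨w.1.1.1, w.2.1⟩).trans
          (w.1.2.trans (trace_above Γ₂ hF y.2 ⟨w.1.1.2, w.2.2⟩).symm)))
      left_inv := fun _ => rfl
      right_inv := fun _ => rfl
      map_rel_iff' := Iff.rfl }
  refine (MD.mk_eq_of_iso (Γ := push A₁ A₂) (Γ' := (push Γ₁ Γ₂).above hF (pushFiber x y).1
    (pushFiber x y).2) ψ (fun z => ?_) ?_).symm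
  · refine eq_of_forall_ge_iff fun w => ?_
    refine (up_le_iff (G := (pushFiber x y).1) (K := (push Γ₁ Γ₂).ι z.1) (x := w)).trans ?_
    refine Iff.trans ?_ ψ.le_symm_apply
    exact and_congr (up_le_iff (G := x.1) (K := Γ₁.ι z.1) (x := (ψ.symm w).1.1)).symm
      (up_le_iff (G := y.1) (K := Γ₂.ι z.1) (x := (ψ.symm w).1.2)).symm
  refine Eq.trans ?_ (map_append_map ψ (PushCarrier.inl A₁ A₂) (PushCarrier.inr A₁ A₂)
    (Γ₁.J.filterMap (toUpper x.1)) (Γ₂.J.filterMap (toUpper y.1))).symm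
  refine map_filterMap_append (toUpper (pushFiber x y).1) (PushCarrier.inl Γ₁ Γ₂)
    (PushCarrier.inr Γ₁ Γ₂) (toUpper x.1) (toUpper y.1) _ _ Γ₁.J Γ₂.J (fun K => ?_) fun K => ?_
  · by_cases h : K ≤ x.1
    · rw [toUpper_of_le h]
      exact toUpper_of_le (PushCarrier.inl_le.2 h)
    · rw [toUpper_of_not_le h]
      refine (toUpper_of_not_le fun h' => h (PushCarrier.inl_le.1 h')).trans (congrArg some
        (eq_of_forall_ge_iff fun w => ?_))
      refine up_le_iff.trans (Iff.trans ?_ ψ.le_symm_apply)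
      refine (PushCarrier.inl_le (x := w.1)).trans (Iff.trans ?_ PushCarrier.inl_le.symm)
      exact (up_le_iff (G := x.1) (K := K) (x := (ψ.symm w).1.1)).symm
  · by_cases h : K ≤ y.1
    · rw [toUpper_of_le h]
      exact toUpper_of_le (PushCarrier.inr_le.2 h)
    · rw [toUpper_of_not_le h]
      refine (toUpper_of_not_le fun h' => h (PushCarrier.inr_le.1 h')).trans (congrArg some
        (eq_of_forall_ge_iff fun w => ?_))
      refine up_le_iff.trans (Iff.trans ?_ ψ.le_symm_apply)
      refine (PushCarrier.inr_le (x := w.1)).trans (Iff.trans ?_ PushCarrier.inr_le.symm)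
      exact (up_le_iff (G := y.1) (K := K) (x := (ψ.symm w).1.2)).symm

theorem coterm_J (Γ : Diag L) (hF : Proper F) (x : Γ.Fiber F) : Γ.coterm hF x Γ.J =
    shuffleSign (· ≤ x.1) Γ.J •
      MD.tm _ _ (MD.mk (Γ.below hF.1 x.1 x.2)) (MD.mk (Γ.above hF.2 x.1 x.2)) := by
  rw [coterm, lowerWd_J, upperWd_J]

theorem length_below_J (Γ : Diag L) (hF : F ≠ ⊥) (x : Γ.Fiber F) :
    (Γ.below hF x.1 x.2).J.length = (Γ.J.filterMap (toLower x.1)).length := rfl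

theorem length_above_J (Γ : Diag L) (hF : F ≠ ⊤) (x : Γ.Fiber F) :
    (Γ.above hF x.1 x.2).J.length = (Γ.J.filterMap (toUpper x.1)).length := rfl

-- The Koszul sign for moving the upper part of Γ₁ past the lower part of Γ₂ is the cross term in
-- `shuffleSign_append`, because degrees have the parity of the lengths of words.
open scoped Classical in
theorem coterm_push (hF : Proper F) {Γ₁ Γ₂ : Diag L} (x : Γ₁.Fiber F) (y : Γ₂.Fiber F) :
    (push Γ₁ Γ₂).coterm hF (pushFiber x y) (push Γ₁ Γ₂).J =
      Γ₁.coterm hF x Γ₁.J * Γ₂.coterm hF y Γ₂.J := by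
  rw [coterm_J, coterm_J, coterm_J, mk_below_push, mk_above_push, MD.zsmul_mul_zsmul]
  have h1 := CDGA.tm_mul_tm (MD.cdga (L.lower F hF.1)) (MD.cdga (L.upper F hF.2))
    (MD.mk (Γ₁.below hF.1 x.1 x.2)) (MD.mk (Γ₂.above hF.2 y.1 y.2))
    (Γ₁.above hF.2 x.1 x.2).mk_mem_gr' (Γ₂.below hF.1 y.1 y.2).mk_mem_gr'
  rw [deg'_mul_negOnePow, negOnePow_smul] at h1
  refine Eq.trans ?_ (congrArg (fun z => (shuffleSign (· ≤ x.1) Γ₁.J *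
    shuffleSign (· ≤ y.1) Γ₂.J) • z) h1.symm)
  rw [smul_smul]
  refine congrArg (fun n : ℤ => n • MD.tm (L.lower F hF.1) (L.upper F hF.2)
    (MD.mk (Γ₁.below hF.1 x.1 x.2) * MD.mk (Γ₂.below hF.1 y.1 y.2))
    (MD.mk (Γ₁.above hF.2 x.1 x.2) * MD.mk (Γ₂.above hF.2 y.1 y.2))) ?_
  rw [length_below_J, length_above_J, (isSplitting_toLower x.1).length_filterMap_right,
    (isSplitting_toLower y.1).length_filterMap_left]
  refine (shuffleSign_append _ (Γ₁.J.map (PushCarrier.inl Γ₁ Γ₂))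
    (Γ₂.J.map (PushCarrier.inr Γ₁ Γ₂))).trans ?_
  have e1 : ∀ K, PushCarrier.inl Γ₁ Γ₂ K ≤ (pushFiber x y).1 ↔ K ≤ x.1 :=
    fun K => PushCarrier.inl_le
  have e2 : ∀ K, PushCarrier.inr Γ₁ Γ₂ K ≤ (pushFiber x y).1 ↔ K ≤ y.1 :=
    fun K => PushCarrier.inr_le
  refine congrArg₂ (fun a b : ℤ => a * b) (congrArg₂ (fun a b : ℤ => a * b)
    ((shuffleSign_map _ _ _).trans (shuffleSign_congr fun K _ => e1 K))
    ((shuffleSign_map _ _ _).trans (shuffleSign_congr fun K _ => e2 K)))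
    (congrArg (fun n : ℕ => (-1 : ℤ) ^ n) (congrArg₂ (fun a b : ℕ => a * b) ?_ ?_))
  · refine List.countP_map.trans (List.countP_congr fun K _ => ?_)
    exact decide_eq_true_iff.trans ((not_congr (e1 K)).trans decide_eq_true_iff.symm)
  · refine List.countP_map.trans (List.countP_congr fun K _ => ?_)
    exact decide_eq_true_iff.trans ((e2 K).trans decide_eq_true_iff.symm)

/-- The fibers of a pushout. -/
def pushFiberEquiv (Γ₁ Γ₂ : Diag L) (F : L) :
    Γ₁.Fiber F × Γ₂.Fiber F ≃ (push Γ₁ Γ₂).Fiber F where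
  toFun p := pushFiber p.1 p.2
  invFun z := (⟨z.1.1.1, (push_trace Γ₁ Γ₂ z.1).symm.trans z.2⟩,
    ⟨z.1.1.2, z.1.2.symm.trans ((push_trace Γ₁ Γ₂ z.1).symm.trans z.2)⟩)
  left_inv _ := rfl
  right_inv _ := rfl

/-- The lengths of the two subwords add up, and the rank corrections rk F' - rk F and (rk ⊤ - rk F')
- (rk ⊤ - rk F) telescope. -/
theorem coterm_mem (Γ : Diag L) (hF : Proper F) (x : Γ.Fiber F) :
    Γ.coterm hF x Γ.J ∈ CDGA.tGr (MD.cdga (L.lower F hF.1)) (MD.cdga (L.upper F hF.2)) Γ.deg' := by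
  rw [coterm_J]
  refine zsmul_mem (CDGA.tm_mem_tGr _ _ (Γ.below hF.1 x.1 x.2).mk_mem_gr'
    (Γ.above hF.2 x.1 x.2).mk_mem_gr' ?_) _
  have h1 : (Γ.below hF.1 x.1 x.2).deg' = ((Γ.J.filterMap (toLower x.1)).length : ℤ) -
      2 * (rk x.1 - rk F) := by
    have e1 := rk_lower (L := Γ.E) (Γ.ne_bot_of_trace hF.1 x.2) ⊤
    have e2 := rk_lower (L := L) hF.1 ⊤
    exact congrArg₂ (fun a b : ℤ => ((Γ.J.filterMap (toLower x.1)).length : ℤ) - 2 * (a - b)) e1 e2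
  have h2 : (Γ.above hF.2 x.1 x.2).deg' = ((Γ.J.filterMap (toUpper x.1)).length : ℤ) -
      2 * ((rk (⊤ : Γ.E) - rk x.1) - (rk (⊤ : L) - rk F)) := by
    have e1 := rk_upper (L := Γ.E) (Γ.ne_top_of_trace hF.2 x.2) ⊤
    have e2 := rk_upper (L := L) hF.2 ⊤
    exact congrArg₂ (fun a b : ℤ => ((Γ.J.filterMap (toUpper x.1)).length : ℤ) - 2 * (a - b)) e1 e2
  rw [h1, h2, deg', ← (isSplitting_toLower x.1).length_add Γ.J]
  push_cast
  ring

end Diag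

namespace MD

open Diag

variable {L : GeomLat.{u}} {F : L}

theorem coprod_mul (hF : Proper F) (x y : MD L) :
    coprod hF (x * y) = coprod hF x * coprod hF y := by
  induction x using MD.induction with
  | h0 => rw [zero_mul, map_zero, zero_mul]
  | hadd x x' h h' => rw [add_mul, map_add, h, h', map_add, add_mul]
  | hsmul c x h => rw [smul_mul_assoc, map_smul, h, map_smul, smul_mul_assoc]
  | hmk Γ₁ =>
    induction y using MD.induction with
    | h0 => rw [mul_zero, map_zero, mul_zero]
    | hadd y y' h h' => rw [mul_add, map_add, h, h', map_add, mul_add]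
    | hsmul c y h => rw [mul_smul_comm, map_smul, h, map_smul, CDGA.t_mul_smul]
    | hmk Γ₂ =>
      rw [mk_mul_mk, coprod_mk, coprod_mk, coprod_mk, Finset.sum_mul_sum, ← Fintype.sum_prod_type',
        ← (pushFiberEquiv Γ₁ Γ₂ F).sum_comp]
      exact Finset.sum_congr rfl fun p _ => coterm_push hF p.1 p.2

theorem coprod_one (hF : Proper F) : coprod hF (1 : MD L) = 1 := by
  rw [one_def, coprod_mk]
  -- In the unit diagram ι is the identity, so F is the only flat with trace F.
  have hu : ∀ x : (ofWord ([] : List (OS.At L))).Fiber F, x = ⟨F, ofWord_trace [] F⟩ := fun x =>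
    Subtype.ext ((ofWord_trace [] x.1).symm.trans x.2)
  rw [Fintype.sum_eq_single ⟨F, ofWord_trace [] F⟩ fun x hx => absurd (hu x) hx, coterm_J]
  have e1 : mk ((ofWord ([] : List (OS.At L))).below hF.1 F (ofWord_trace [] F)) = 1 := by
    refine (mk_eq_of_iso (Γ := ofWord []) (Γ' := (ofWord ([] : List (OS.At L))).below hF.1 F
      (ofWord_trace [] F)) (OrderIso.refl (Set.Iic F)) (fun x => rfl) rfl).symm
  have e2 : mk ((ofWord ([] : List (OS.At L))).above hF.2 F (ofWord_trace [] F)) = 1 := by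
    refine (mk_eq_of_iso (Γ := ofWord []) (Γ' := (ofWord ([] : List (OS.At L))).above hF.2 F
      (ofWord_trace [] F)) (OrderIso.refl (Set.Ici F)) (fun x => Subtype.ext ?_) rfl).symm
    exact sup_eq_right.2 x.2
  rw [e1, e2]
  exact one_smul ℤ _

theorem coprod_mem (hF : Proper F) {n : ℤ} {x : MD L} (hx : x ∈ gr L n) :
    coprod hF x ∈ CDGA.tGr (MD.cdga (L.lower F hF.1)) (MD.cdga (L.upper F hF.2)) n := by
  refine gr_induction (p := fun x => coprod hF x ∈
    CDGA.tGr (MD.cdga (L.lower F hF.1)) (MD.cdga (L.upper F hF.2)) n) ?_ ?_ ?_ ?_ hx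
  · rw [map_zero]; exact zero_mem _
  · intro x y hx hy; rw [map_add]; exact add_mem hx hy
  · intro c x hx; rw [map_smul]; exact Submodule.smul_mem _ _ hx
  · rintro Γ rfl
    rw [coprod_mk]
    exact sum_mem fun x _ => Γ.coterm_mem hF x

end MD

/-! ### The action of isomorphisms on `MD`, naturality and coassociativity of the coproducts -/

namespace Diag

variable {L M : GeomLat.{u}}

theorem comp_top (Γ : Diag M) (φ : L ≃o M) : (Γ.comp φ).top = Γ.top := congrArg Γ.ι φ.map_top

theorem comp_trace (Γ : Diag M) (φ : L ≃o M) (y : Γ.E) :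
    φ ((Γ.comp φ).trace y) = Γ.trace y := by
  refine eq_of_forall_le_iff fun c => ?_
  rw [← φ.symm_apply_le]
  refine ((Γ.comp φ).trace_le_iff y (φ.symm c)).trans (Iff.trans ?_ (Γ.trace_le_iff y c).symm)
  change Γ.ι (φ (φ.symm c)) ≤ y ↔ _
  rw [φ.apply_symm_apply]

theorem isInvariant_comp (φ : L ≃o M) : IsInvariant fun Γ : Diag M => MD.mk (Γ.comp φ) where
  swap Γ := MD.isInvariant_mk.swap (Γ.comp φ)
  embedding Γ Γ' ψ hψ htop hι hJ :=
    MD.isInvariant_mk.embedding (Γ.comp φ) (Γ'.comp φ) ψ hψ htop (fun x => hι (φ x)) hJ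
  not_spanning Γ X hX htop hJ :=
    MD.isInvariant_mk.not_spanning (Γ.comp φ) X hX ((Γ.comp_top φ).trans_le htop) hJ
  product Γ a b h ha hb htop :=
    MD.isInvariant_mk.product (Γ.comp φ) a b h ha hb ((Γ.comp_top φ).trans_le htop)
  two_outside Γ F A B l hF htop hA hB hl hJ :=
    MD.isInvariant_mk.two_outside (Γ.comp φ) F A B l hF ((Γ.comp_top φ).trans_le htop) hA hB hl hJ

end Diag

namespace MD

open Diag

variable {L M : GeomLat.{u}}

/-- The action of isomorphisms on `MD`. -/
noncomputable def map (φ : L ≃o M) : MD M →ₗ[ℚ] MD L := lift _ (isInvariant_comp φ)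

theorem map_mk (φ : L ≃o M) (Γ : Diag M) : map φ (mk Γ) = mk (Γ.comp φ) := lift_mk _ _ _

theorem map_wd (φ : L ≃o M) (Γ : Diag M) (l : List Γ.E) : map φ (Γ.wd l) = (Γ.comp φ).wd l := by
  by_cases h : ∀ H ∈ l, IsAtom H
  · rw [wd_of_atoms Γ h, map_mk]
    exact (wd_of_atoms (Γ.comp φ) h).symm
  · have h1 : Γ.wd l = 0 := dif_neg h
    have h2 : (Γ.comp φ).wd l = 0 := dif_neg h
    rw [h1, h2, map_zero]

theorem map_mul (φ : L ≃o M) (x y : MD M) : map φ (x * y) = map φ x * map φ y := by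
  induction x using MD.induction with
  | h0 => rw [zero_mul, map_zero, zero_mul]
  | hadd x x' h h' => rw [add_mul, map_add, h, h', map_add, add_mul]
  | hsmul c x h => rw [smul_mul_assoc, map_smul, h, map_smul, smul_mul_assoc]
  | hmk Γ₁ =>
    induction y using MD.induction with
    | h0 => rw [mul_zero, map_zero, mul_zero]
    | hadd y y' h h' => rw [mul_add, map_add, h, h', map_add, mul_add]
    | hsmul c y h => rw [mul_smul_comm, map_smul, h, map_smul, mul_smul_comm]
    | hmk Γ₂ =>
      rw [mk_mul_mk, map_mk, map_mk, map_mk]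
      have htr : ∀ (x : Γ₁.E) (y : Γ₂.E), (Γ₁.comp φ).trace x = (Γ₂.comp φ).trace y ↔
          Γ₁.trace x = Γ₂.trace y := fun x y => by
        rw [← comp_trace Γ₁ φ, ← comp_trace Γ₂ φ, φ.injective.eq_iff]
      refine (mk_mul_mk_of_isPushout (Γ := (push Γ₁ Γ₂).comp φ)
        ⟨fun x : PushCarrier Γ₁ Γ₂ => x.1, fun x y => Iff.rfl, ?_, fun x => rfl, ?_⟩).symm
      · refine Subtype.range_coe.trans ?_
        ext p
        exact (htr p.1 p.2).symm
      · refine (map_append_map Subtype.val (PushCarrier.inl Γ₁ Γ₂) (PushCarrier.inr Γ₁ Γ₂)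
          Γ₁.J Γ₂.J).trans ?_
        refine congrArg₂ (fun l l' => l ++ l') (List.map_congr_left fun K _ => ?_)
          (List.map_congr_left fun K _ => ?_)
        · exact Prod.ext rfl (congrArg Γ₂.ι (comp_trace Γ₁ φ K).symm)
        · exact Prod.ext (congrArg Γ₁.ι (comp_trace Γ₂ φ K).symm) rfl

theorem map_one (φ : L ≃o M) : map φ 1 = 1 := by
  rw [one_def, one_def, map_mk]
  exact (mk_eq_of_iso (Γ := ofWord []) (Γ' := (ofWord ([] : List (OS.At M))).comp φ) φ
    (fun x => rfl) rfl).symm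

theorem map_contr (φ : L ≃o M) (Γ : Diag M) (H : Γ.E) (l : List Γ.E) :
    map φ (Γ.contr H l) = (Γ.comp φ).contr H l := by
  have e : (Γ.comp φ).Contractible H l ↔ Γ.Contractible H l := by
    unfold Contractible
    rw [comp_top]
    exact Iff.rfl
  by_cases h : Γ.Contractible H l
  · have h0 := Γ.trace_of_not_le h.1 h.2.1
    have h0' := (Γ.comp φ).trace_of_not_le (e.2 h).1 (e.2 h).2.1
    rw [contr_of_pos _ h h0]
    refine (map_wd φ (Γ.quot H h0) _).trans (contr_of_pos _ (e.2 h) h0').symm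
  · rw [contr_of_neg _ h, map_zero, contr_of_neg _ fun h' => h (e.1 h')]

theorem map_d (φ : L ≃o M) (x : MD M) : map φ (d x) = d (map φ x) := by
  suffices h : map φ ∘ₗ d = d ∘ₗ map φ from LinearMap.congr_fun h x
  refine hom_ext fun Γ => ?_
  rw [LinearMap.comp_apply, LinearMap.comp_apply, map_mk, d_mk, d_mk]
  refine (altSum_hom (map φ).toAddMonoidHom Γ.J Γ.contr).symm.trans ?_
  exact altSum_congr fun H l _ => map_contr φ Γ H l

theorem map_mem (φ : L ≃o M) {n : ℤ} {x : MD M} (hx : x ∈ gr M n) : map φ x ∈ gr L n := by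
  refine gr_induction (p := fun x => map φ x ∈ gr L n) ?_ ?_ ?_ ?_ hx
  · rw [map_zero]; exact zero_mem _
  · intro x y hx hy; rw [map_add]; exact add_mem hx hy
  · intro c x hx; rw [map_smul]; exact Submodule.smul_mem _ _ hx
  · rintro Γ rfl
    rw [map_mk]
    have e : (Γ.comp φ).deg' = Γ.deg' := by
      have := (IsEmbedding.of_orderIso φ).map_top_iff.1 φ.map_top
      change (Γ.J.length : ℤ) - 2 * (rk (⊤ : Γ.E) - rk (⊤ : L)) = _
      rw [this]
      rfl
    exact e ▸ (Γ.comp φ).mk_mem_gr'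

/-- The morphism of cdgas `MD M → MD L` defined by an isomorphism. -/
noncomputable def mapHom (φ : L ≃o M) : CDGA.Hom (cdga M) (cdga L) where
  toAlgHom := AlgHom.ofLinearMap (map φ) (map_one φ) (map_mul φ)
  map_gr _ _ h := map_mem φ h
  map_d x := map_d φ x

/-- The tensor product of two linear maps. -/
noncomputable def tmap {A B A' B' : GeomLat.{u}} (f : MD A →ₗ[ℚ] MD A') (g : MD B →ₗ[ℚ] MD B') :
    T A B →ₗ[ℚ] T A' B' := TensorProduct.map f g

theorem tmap_tm {A B A' B' : GeomLat.{u}} (f : MD A →ₗ[ℚ] MD A') (g : MD B →ₗ[ℚ] MD B')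
    (a : MD A) (b : MD B) : tmap f g (tm A B a b) = tm A' B' (f a) (g b) := rfl

theorem coprod_natural (φ : L ≃o M) {F : L} (hF : Proper F) (x : MD M) :
    coprod hF (map φ x) = tmap (map (lowerIso φ hF.1 (hF.map φ).1))
      (map (upperIso φ hF.2 (hF.map φ).2)) (coprod (hF.map φ) x) := by
  suffices h : coprod hF ∘ₗ map φ = tmap (map (lowerIso φ hF.1 (hF.map φ).1))
      (map (upperIso φ hF.2 (hF.map φ).2)) ∘ₗ coprod (hF.map φ) from LinearMap.congr_fun h x
  refine hom_ext fun Γ => ?_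
  rw [LinearMap.comp_apply, LinearMap.comp_apply, map_mk, coprod_mk, coprod_mk, map_sum]
  have htr : ∀ y : Γ.E, (Γ.comp φ).trace y = F ↔ Γ.trace y = φ F := fun y => by
    rw [← comp_trace Γ φ, φ.injective.eq_iff]
  let e : (Γ.comp φ).Fiber F ≃ Γ.Fiber (φ F) := Equiv.subtypeEquivRight htr
  rw [← e.sum_comp]
  refine Finset.sum_congr rfl fun y _ => ?_
  rw [coterm_J, coterm_J, map_zsmul, tmap_tm, map_mk, map_mk]
  rfl

/-! ### Coassociativity of the coproducts of modular diagrams. -/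

section Coassoc

/-- The tensor product of three of the spaces. -/
def T₃ (A B C : GeomLat.{u}) : Type (u + 1) := MD A ⊗[ℚ] (MD B ⊗[ℚ] MD C)

noncomputable instance (A B C : GeomLat.{u}) : AddCommGroup (T₃ A B C) :=
  inferInstanceAs (AddCommGroup (MD A ⊗[ℚ] (MD B ⊗[ℚ] MD C)))

noncomputable instance (A B C : GeomLat.{u}) : Module ℚ (T₃ A B C) :=
  inferInstanceAs (Module ℚ (MD A ⊗[ℚ] (MD B ⊗[ℚ] MD C)))

/-- The pure tensors, as a trilinear map. -/
noncomputable def tm₃ (A B C : GeomLat.{u}) : MD A →ₗ[ℚ] MD B →ₗ[ℚ] MD C →ₗ[ℚ] T₃ A B C :=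
  (LinearMap.llcomp ℚ (MD B) (MD C →ₗ[ℚ] MD B ⊗[ℚ] MD C) (MD C →ₗ[ℚ] T₃ A B C)).flip
      (TensorProduct.mk ℚ (MD B) (MD C)) ∘ₗ
    (LinearMap.llcomp ℚ (MD C) (MD B ⊗[ℚ] MD C) (T₃ A B C)) ∘ₗ
      (TensorProduct.mk ℚ (MD A) (MD B ⊗[ℚ] MD C) : MD A →ₗ[ℚ] MD B ⊗[ℚ] MD C →ₗ[ℚ] T₃ A B C)

variable {A A' B B' C : GeomLat.{u}}

/-- The map `(a ⊗ b) ⊗ c ↦ f a ⊗ (g b ⊗ c)`. -/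
noncomputable def leftTriple (f : MD A →ₗ[ℚ] MD A') (g : MD B →ₗ[ℚ] MD B') :
    T A B →ₗ[ℚ] MD C →ₗ[ℚ] T₃ A' B' C :=
  LinearMap.compr₂ (TensorProduct.mk ℚ (MD A ⊗[ℚ] MD B) (MD C))
    (TensorProduct.map f (TensorProduct.map g LinearMap.id) ∘ₗ
      (TensorProduct.assoc ℚ (MD A) (MD B) (MD C)).toLinearMap)

theorem leftTriple_tm (f : MD A →ₗ[ℚ] MD A') (g : MD B →ₗ[ℚ] MD B') (a : MD A) (b : MD B)
    (c : MD C) : leftTriple f g (tm A B a b) c = tm₃ A' B' C (f a) (g b) c := rfl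

/-- The map `a ⊗ (b ⊗ c) ↦ a ⊗ (b ⊗ g c)`. -/
noncomputable def rightTriple (g : MD B →ₗ[ℚ] MD B') :
    MD A →ₗ[ℚ] T C B →ₗ[ℚ] T₃ A C B' :=
  LinearMap.compr₂ (TensorProduct.mk ℚ (MD A) (MD C ⊗[ℚ] MD B))
    (TensorProduct.map LinearMap.id (TensorProduct.map LinearMap.id g))

theorem rightTriple_tm (g : MD B →ₗ[ℚ] MD B') (a : MD A) (b : MD B) (c : MD C) :
    rightTriple g a (tm C B c b) = tm₃ A C B' a c (g b) := rfl

/-- The map `a ⊗ c ↦ (f ⊗ g) (Δ a) ⊗ c`. -/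
noncomputable def coassocLeft (Δ : MD C →ₗ[ℚ] T A B) (f : MD A →ₗ[ℚ] MD A')
    (g : MD B →ₗ[ℚ] MD B') {D : GeomLat.{u}} : T C D →ₗ[ℚ] T₃ A' B' D :=
  TensorProduct.map f (TensorProduct.map g LinearMap.id) ∘ₗ
      (TensorProduct.assoc ℚ (MD A) (MD B) (MD D)).toLinearMap ∘ₗ
    TensorProduct.map (Δ : MD C →ₗ[ℚ] MD A ⊗[ℚ] MD B) LinearMap.id

theorem coassocLeft_tm (Δ : MD C →ₗ[ℚ] T A B) (f : MD A →ₗ[ℚ] MD A')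
    (g : MD B →ₗ[ℚ] MD B') {D : GeomLat.{u}} (c : MD C) (x : MD D) :
    coassocLeft Δ f g (tm C D c x) = leftTriple f g (Δ c) x := rfl

/-- The map `a ⊗ c ↦ a ⊗ (1 ⊗ g) (Δ c)`. -/
noncomputable def coassocRight (Δ : MD C →ₗ[ℚ] T A B) (g : MD B →ₗ[ℚ] MD B') {D : GeomLat.{u}} :
    T D C →ₗ[ℚ] T₃ D A B' :=
  TensorProduct.map LinearMap.id (TensorProduct.map LinearMap.id g) ∘ₗ
    TensorProduct.map LinearMap.id (Δ : MD C →ₗ[ℚ] MD A ⊗[ℚ] MD B)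

theorem coassocRight_tm (Δ : MD C →ₗ[ℚ] T A B) (g : MD B →ₗ[ℚ] MD B') {D : GeomLat.{u}} (c : MD C)
    (x : MD D) : coassocRight Δ g (tm D C x c) = rightTriple g x (Δ c) := rfl

end Coassoc

end MD

namespace Diag

variable {L : GeomLat.{u}} {F₁ F₂ : L}

/-- The chains of flats `F₁' ≤ F₂'` with traces `F₁` and `F₂`. -/
noncomputable def chainEquiv (Γ : Diag L) (h₁ : Proper F₁) (h₂ : Proper F₂) (h : F₁ < F₂) :
    (Σ x : Γ.Fiber F₂, (Γ.below h₂.1 x.1 x.2).Fiber (inLower h₂ h)) ≃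
      Σ x : Γ.Fiber F₁, (Γ.above h₁.2 x.1 x.2).Fiber (inUpper h₁ h) where
  toFun p := ⟨⟨p.2.1.1, (trace_below Γ h₂.1 p.1.2 p.2.1).symm.trans
      (congrArg (Subtype.val (p := (· ∈ Set.Iic F₂))) p.2.2)⟩,
    ⟨(⟨p.1.1, p.2.1.2⟩ : Set.Ici p.2.1.1), Subtype.ext ((trace_above Γ h₁.2 _ _).trans p.1.2)⟩⟩
  invFun p := ⟨⟨p.2.1.1, (trace_above Γ h₁.2 p.1.2 p.2.1).symm.trans
      (congrArg (Subtype.val (p := (· ∈ Set.Ici F₁))) p.2.2)⟩,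
    ⟨(⟨p.1.1, p.2.1.2⟩ : Set.Iic p.2.1.1), Subtype.ext ((trace_below Γ h₂.1 _ _).trans p.1.2)⟩⟩
  left_inv _ := rfl
  right_inv _ := rfl

section Chain

variable {E : Type*} [Lattice E] {X Y : E}

/-- The interval `[⊥, X]` of `[⊥, Y]`. -/
def iicIic (h : X ≤ Y) : Set.Iic X ≃o Set.Iic (⟨X, h⟩ : Set.Iic Y) where
  toFun x := ⟨⟨x.1, le_trans x.2 h⟩, x.2⟩
  invFun x := ⟨x.1.1, x.2⟩
  left_inv _ := rfl
  right_inv _ := rfl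
  map_rel_iff' := Iff.rfl

/-- The interval `[X, Y]`, as an interval of `[⊥, Y]` and of `[X, ⊤]`. -/
def iciIic (h : X ≤ Y) : Set.Ici (⟨X, h⟩ : Set.Iic Y) ≃o Set.Iic (⟨Y, h⟩ : Set.Ici X) where
  toFun x := ⟨⟨x.1.1, x.2⟩, x.1.2⟩
  invFun x := ⟨⟨x.1.1, x.2⟩, x.1.2⟩
  left_inv _ := rfl
  right_inv _ := rfl
  map_rel_iff' := Iff.rfl

theorem toLower_toLower (h : X ≤ Y) (l : List E) :
    (l.filterMap (toLower Y)).filterMap (toLower (⟨X, h⟩ : Set.Iic Y)) =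
      (l.filterMap (toLower X)).map (iicIic h) := by
  rw [List.filterMap_filterMap, List.map_filterMap]
  refine List.filterMap_congr fun K _ => ?_
  by_cases hY : K ≤ Y
  · rw [toLower_of_le hY, Option.bind_some]
    by_cases hX : K ≤ X
    · rw [toLower_of_le hX]
      exact toLower_of_le (F' := (⟨X, h⟩ : Set.Iic Y)) (K := ⟨K, hY⟩) hX
    · rw [toLower_of_not_le hX]
      exact toLower_of_not_le (F' := (⟨X, h⟩ : Set.Iic Y)) (K := ⟨K, hY⟩) hX
  · rw [toLower_of_not_le hY, toLower_of_not_le fun hX => hY (hX.trans h)]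
    rfl

theorem toLower_toUpper (h : X ≤ Y) (l : List E) :
    (l.filterMap (toUpper X)).filterMap (toLower (⟨Y, h⟩ : Set.Ici X)) =
      ((l.filterMap (toLower Y)).filterMap (toUpper (⟨X, h⟩ : Set.Iic Y))).map (iciIic h) := by
  rw [List.filterMap_filterMap, List.filterMap_filterMap, List.map_filterMap]
  refine List.filterMap_congr fun K _ => ?_
  by_cases hX : K ≤ X
  · rw [toUpper_of_le hX, toLower_of_le (hX.trans h), Option.bind_some, Option.bind_none,
      toUpper_of_le (F' := (⟨X, h⟩ : Set.Iic Y)) (K := ⟨K, hX.trans h⟩) hX]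
    rfl
  · rw [toUpper_of_not_le hX, Option.bind_some]
    by_cases hY : K ≤ Y
    · rw [toLower_of_le (F' := (⟨Y, h⟩ : Set.Ici X)) (up_le_iff.2 hY), toLower_of_le hY,
        Option.bind_some, toUpper_of_not_le (F' := (⟨X, h⟩ : Set.Iic Y)) (K := ⟨K, hY⟩) hX]
      rfl
    · rw [toLower_of_not_le (F' := (⟨Y, h⟩ : Set.Ici X)) fun h' => hY (up_le_iff.1 h'),
        toLower_of_not_le hY]
      rfl

theorem toUpper_toUpper (h : X ≤ Y) (l : List E) :
    (l.filterMap (toUpper X)).filterMap (toUpper (⟨Y, h⟩ : Set.Ici X)) =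
      (l.filterMap (toUpper Y)).map (iciIci h) := by
  rw [List.filterMap_filterMap, List.map_filterMap]
  refine List.filterMap_congr fun K _ => ?_
  by_cases hX : K ≤ X
  · rw [toUpper_of_le hX, toUpper_of_le (hX.trans h)]
    rfl
  · rw [toUpper_of_not_le hX, Option.bind_some]
    by_cases hY : K ≤ Y
    · rw [toUpper_of_le hY, toUpper_of_le (F' := (⟨Y, h⟩ : Set.Ici X)) (up_le_iff.2 hY)]
      rfl
    · rw [toUpper_of_not_le hY,
        toUpper_of_not_le (F' := (⟨Y, h⟩ : Set.Ici X)) fun h' => hY (up_le_iff.1 h')]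
      exact congrArg some (iciIci_up h K).symm

theorem shuffleSign_chain (h : X ≤ Y) (l : List E) :
    shuffleSign (· ≤ Y) l * shuffleSign (· ≤ (⟨X, h⟩ : Set.Iic Y)) (l.filterMap (toLower Y)) =
      shuffleSign (· ≤ X) l *
        shuffleSign (· ≤ (⟨Y, h⟩ : Set.Ici X)) (l.filterMap (toUpper X)) :=
  shuffleSign_coassoc (fun _ ha => ha.trans h)
    (fun K hK => ⟨⟨K, hK⟩, toLower_of_le hK, Iff.rfl⟩) (fun _ hK => toLower_of_not_le hK)
    (fun K hK => ⟨up X K, toUpper_of_not_le hK, up_le_iff⟩) (fun _ hK => toUpper_of_le hK) l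

end Chain

theorem mk_below_below (Γ : Diag L) (h₁ : Proper F₁) (h₂ : Proper F₂) (h : F₁ < F₂)
    (p : Σ x : Γ.Fiber F₂, (Γ.below h₂.1 x.1 x.2).Fiber (inLower h₂ h)) :
    MD.map (lowerLowerIso h₁ h₂ h) (MD.mk ((Γ.below h₂.1 p.1.1 p.1.2).below
      (proper_inLower h₁ h₂ h).1 p.2.1 p.2.2)) =
    MD.mk (Γ.below h₁.1 (Γ.chainEquiv h₁ h₂ h p).1.1 (Γ.chainEquiv h₁ h₂ h p).1.2) := by
  have hle : p.2.1.1 ≤ p.1.1 := p.2.1.2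
  rw [MD.map_mk]
  refine (MD.mk_eq_of_iso
    (Γ := Γ.below h₁.1 (Γ.chainEquiv h₁ h₂ h p).1.1 (Γ.chainEquiv h₁ h₂ h p).1.2)
    (Γ' := ((Γ.below h₂.1 p.1.1 p.1.2).below
      (proper_inLower h₁ h₂ h).1 p.2.1 p.2.2).comp (lowerLowerIso h₁ h₂ h))
    (iicIic hle) (fun x => rfl) ?_).symm
  exact toLower_toLower hle Γ.J

theorem mk_above_below (Γ : Diag L) (h₁ : Proper F₁) (h₂ : Proper F₂) (h : F₁ < F₂)
    (p : Σ x : Γ.Fiber F₂, (Γ.below h₂.1 x.1 x.2).Fiber (inLower h₂ h)) :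
    MD.map (middleIso h₁ h₂ h) (MD.mk ((Γ.below h₂.1 p.1.1 p.1.2).above
      (proper_inLower h₁ h₂ h).2 p.2.1 p.2.2)) =
    MD.mk ((Γ.above h₁.2 (Γ.chainEquiv h₁ h₂ h p).1.1 (Γ.chainEquiv h₁ h₂ h p).1.2).below
      (proper_inUpper h₁ h₂ h).1 (Γ.chainEquiv h₁ h₂ h p).2.1 (Γ.chainEquiv h₁ h₂ h p).2.2) := by
  have hle : p.2.1.1 ≤ p.1.1 := p.2.1.2
  rw [MD.map_mk]
  refine MD.mk_eq_of_iso
    (Γ' := (Γ.above h₁.2 (Γ.chainEquiv h₁ h₂ h p).1.1 (Γ.chainEquiv h₁ h₂ h p).1.2).below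
      (proper_inUpper h₁ h₂ h).1 (Γ.chainEquiv h₁ h₂ h p).2.1 (Γ.chainEquiv h₁ h₂ h p).2.2)
    (Γ := ((Γ.below h₂.1 p.1.1 p.1.2).above
      (proper_inLower h₁ h₂ h).2 p.2.1 p.2.2).comp (middleIso h₁ h₂ h))
    (iciIic hle) (fun x => rfl) ?_
  exact toLower_toUpper hle Γ.J

theorem mk_above_above (Γ : Diag L) (h₁ : Proper F₁) (h₂ : Proper F₂) (h : F₁ < F₂)
    (p : Σ x : Γ.Fiber F₂, (Γ.below h₂.1 x.1 x.2).Fiber (inLower h₂ h)) :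
    MD.mk (Γ.above h₂.2 p.1.1 p.1.2) =
    MD.map (upperUpperIso h₁ h₂ h)
      (MD.mk ((Γ.above h₁.2 (Γ.chainEquiv h₁ h₂ h p).1.1 (Γ.chainEquiv h₁ h₂ h p).1.2).above
      (proper_inUpper h₁ h₂ h).2 (Γ.chainEquiv h₁ h₂ h p).2.1 (Γ.chainEquiv h₁ h₂ h p).2.2)) := by
  have hle : p.2.1.1 ≤ p.1.1 := p.2.1.2
  rw [MD.map_mk]
  refine MD.mk_eq_of_iso
    (Γ := Γ.above h₂.2 p.1.1 p.1.2)
    (Γ' := ((Γ.above h₁.2 (Γ.chainEquiv h₁ h₂ h p).1.1 (Γ.chainEquiv h₁ h₂ h p).1.2).above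
      (proper_inUpper h₁ h₂ h).2 (Γ.chainEquiv h₁ h₂ h p).2.1
      (Γ.chainEquiv h₁ h₂ h p).2.2).comp (upperUpperIso h₁ h₂ h))
    (iciIci hle) (fun x => ?_) ?_
  · exact (iciIci_up hle (Γ.ι x.1)).symm
  · exact toUpper_toUpper hle Γ.J

set_option maxHeartbeats 1000000 in
theorem coassocLeft_coprod (Γ : Diag L) (h₁ : Proper F₁) (h₂ : Proper F₂) (h : F₁ < F₂) :
    MD.coassocLeft (MD.coprod (proper_inLower h₁ h₂ h)) (MD.map (lowerLowerIso h₁ h₂ h))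
      (MD.map (middleIso h₁ h₂ h)) (MD.coprod h₂ (MD.mk Γ)) =
    ∑ p : Σ x : Γ.Fiber F₂, (Γ.below h₂.1 x.1 x.2).Fiber (inLower h₂ h),
      (shuffleSign (· ≤ p.1.1) Γ.J *
        shuffleSign (· ≤ p.2.1) (Γ.below h₂.1 p.1.1 p.1.2).J) •
      MD.tm₃ _ _ _
        (MD.map (lowerLowerIso h₁ h₂ h) (MD.mk ((Γ.below h₂.1 p.1.1 p.1.2).below
          (proper_inLower h₁ h₂ h).1 p.2.1 p.2.2)))
        (MD.map (middleIso h₁ h₂ h) (MD.mk ((Γ.below h₂.1 p.1.1 p.1.2).above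
          (proper_inLower h₁ h₂ h).2 p.2.1 p.2.2)))
        (MD.mk (Γ.above h₂.2 p.1.1 p.1.2)) := by
  rw [MD.coprod_mk, map_sum, Fintype.sum_sigma]
  refine Finset.sum_congr rfl fun x _ => ?_
  rw [coterm_J, map_zsmul, MD.coassocLeft_tm, MD.coprod_mk, map_sum, LinearMap.sum_apply,
    Finset.smul_sum]
  refine Finset.sum_congr rfl fun y _ => ?_
  rw [coterm_J, map_zsmul, LinearMap.smul_apply, MD.leftTriple_tm, smul_smul]

theorem coassocRight_coprod (Γ : Diag L) (h₁ : Proper F₁) (h₂ : Proper F₂) (h : F₁ < F₂) :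
    MD.coassocRight (MD.coprod (proper_inUpper h₁ h₂ h)) (MD.map (upperUpperIso h₁ h₂ h))
      (MD.coprod h₁ (MD.mk Γ)) =
    ∑ p : Σ x : Γ.Fiber F₁, (Γ.above h₁.2 x.1 x.2).Fiber (inUpper h₁ h),
      (shuffleSign (· ≤ p.1.1) Γ.J *
        shuffleSign (· ≤ p.2.1) (Γ.above h₁.2 p.1.1 p.1.2).J) •
      MD.tm₃ _ _ _
        (MD.mk (Γ.below h₁.1 p.1.1 p.1.2))
        (MD.mk ((Γ.above h₁.2 p.1.1 p.1.2).below (proper_inUpper h₁ h₂ h).1 p.2.1 p.2.2))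
        (MD.map (upperUpperIso h₁ h₂ h) (MD.mk ((Γ.above h₁.2 p.1.1 p.1.2).above
          (proper_inUpper h₁ h₂ h).2 p.2.1 p.2.2))) := by
  rw [MD.coprod_mk, map_sum, Fintype.sum_sigma]
  refine Finset.sum_congr rfl fun x _ => ?_
  rw [coterm_J, map_zsmul, MD.coassocRight_tm, MD.coprod_mk, map_sum, Finset.smul_sum]
  refine Finset.sum_congr rfl fun y _ => ?_
  rw [coterm_J, map_zsmul, MD.rightTriple_tm, smul_smul]

/-- Both sides are sums over the chains F₁' ≤ F₂' of flats with traces F₁ and F₂. The three tensor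
factors live on the intervals cut out by the chain, and the sign is that of sorting the word into
three blocks. -/
theorem coprod_coassoc (h₁ : Proper F₁) (h₂ : Proper F₂) (h : F₁ < F₂) :
    MD.coassocLeft (MD.coprod (proper_inLower h₁ h₂ h)) (MD.map (lowerLowerIso h₁ h₂ h))
      (MD.map (middleIso h₁ h₂ h)) ∘ₗ MD.coprod h₂ =
    MD.coassocRight (MD.coprod (proper_inUpper h₁ h₂ h)) (MD.map (upperUpperIso h₁ h₂ h)) ∘ₗ
      MD.coprod h₁ := by
  refine MD.hom_ext fun Γ => ?_
  rw [LinearMap.comp_apply, LinearMap.comp_apply, coassocLeft_coprod, coassocRight_coprod,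
    ← (Γ.chainEquiv h₁ h₂ h).sum_comp]
  refine Finset.sum_congr rfl fun p _ => ?_
  rw [mk_below_below, mk_above_below, mk_above_above]
  refine congrArg (fun n : ℤ => n • _) ?_
  exact shuffleSign_chain p.2.1.2 Γ.J

end Diag

/-! ### Compatibility of the coproducts of `MD` with the differentials -/

theorem MD.coprod_wd {L : GeomLat.{u}} {F : L} (hF : Proper F) (Γ : Diag L) {l : List Γ.E}
    (h : ∀ H ∈ l, IsAtom H) :
    MD.coprod hF (Γ.wd l) = ∑ x : Γ.Fiber F, Γ.coterm hF x l := by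
  rw [Diag.wd_of_atoms Γ h, MD.coprod_mk]
  rfl

namespace Diag

variable {L : GeomLat.{u}} {F : L} (Γ : Diag L) (hF : Proper F) (x : Γ.Fiber F) {H : Γ.E}
  {l : List Γ.E}

/-- The contraction of a letter below `F'`, in the corresponding term of the coproduct. -/
noncomputable def lowTerm (H : Γ.E) (l : List Γ.E) : MD.T (L.lower F hF.1) (L.upper F hF.2) :=
  (toLower x.1 H).elim 0 fun H' => shuffleSign (· ≤ x.1) l •
    MD.tm _ _ ((Γ.below hF.1 x.1 x.2).contr H' (l.filterMap (toLower x.1))) (Γ.upperWd hF.2 x l)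

/-- The contraction of a letter not below `F'`, in the corresponding term of the coproduct. -/
noncomputable def upTerm (H : Γ.E) (l : List Γ.E) : MD.T (L.lower F hF.1) (L.upper F hF.2) :=
  (toUpper x.1 H).elim 0 fun H' => shuffleSign (· ≤ x.1) l •
    MD.tm _ _ (Γ.lowerWd hF.1 x l) ((Γ.above hF.2 x.1 x.2).contr H' (l.filterMap (toUpper x.1)))

theorem lowTerm_of_not_le (h : ¬ H ≤ x.1) : Γ.lowTerm hF x H l = 0 := by
  rw [lowTerm, toLower_of_not_le h]
  rfl

theorem lowTerm_of_le (h : H ≤ x.1) : Γ.lowTerm hF x H l = shuffleSign (· ≤ x.1) l •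
    MD.tm _ _ ((Γ.below hF.1 x.1 x.2).contr (⟨H, h⟩ : Set.Iic x.1) (l.filterMap (toLower x.1)))
      (Γ.upperWd hF.2 x l) := by
  rw [lowTerm, toLower_of_le h]
  rfl

theorem upTerm_of_le (h : H ≤ x.1) : Γ.upTerm hF x H l = 0 := by
  rw [upTerm, toUpper_of_le h]
  rfl

theorem upTerm_of_not_le (h : ¬ H ≤ x.1) : Γ.upTerm hF x H l = shuffleSign (· ≤ x.1) l •
    MD.tm _ _ (Γ.lowerWd hF.1 x l)
      ((Γ.above hF.2 x.1 x.2).contr (up x.1 H) (l.filterMap (toUpper x.1))) := by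
  rw [upTerm, toUpper_of_not_le h]
  rfl

theorem lowTerm_eq_zero (h : ∀ h : H ≤ x.1, ¬ (Γ.below hF.1 x.1 x.2).Contractible
    (⟨H, h⟩ : Set.Iic x.1) (l.filterMap (toLower x.1))) : Γ.lowTerm hF x H l = 0 := by
  by_cases hx : H ≤ x.1
  · rw [lowTerm_of_le Γ hF x hx, contr_of_neg _ (h hx), map_zero, LinearMap.zero_apply, smul_zero]
  · exact lowTerm_of_not_le Γ hF x hx

theorem upTerm_eq_zero (h : ¬ (Γ.above hF.2 x.1 x.2).Contractible (up x.1 H)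
    (l.filterMap (toUpper x.1))) : Γ.upTerm hF x H l = 0 := by
  by_cases hx : H ≤ x.1
  · exact upTerm_of_le Γ hF x hx
  · rw [upTerm_of_not_le Γ hF x hx, contr_of_neg _ h, map_zero, smul_zero]

theorem upTerm_eq_zero_of_lower (h : Γ.lowerWd hF.1 x l = 0) : Γ.upTerm hF x H l = 0 := by
  by_cases hx : H ≤ x.1
  · exact upTerm_of_le Γ hF x hx
  · rw [upTerm_of_not_le Γ hF x hx, h, map_zero, LinearMap.zero_apply, smul_zero]

theorem lowTerm_self_mem (h : H ∈ l) : Γ.lowTerm hF x H l = 0 := by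
  by_cases hx : H ≤ x.1
  · have h0 := contr_self_mem (Γ.below hF.1 x.1 x.2) (H := (⟨H, hx⟩ : Set.Iic x.1))
      (l := l.filterMap (toLower x.1)) (mem_toLower.2 h)
    rw [lowTerm_of_le Γ hF x hx, h0, map_zero, LinearMap.zero_apply, smul_zero]
  · exact lowTerm_of_not_le Γ hF x hx

theorem upTerm_self_mem {K : Γ.E} (hK : K ∈ l) (hKx : ¬ K ≤ x.1) (e : up x.1 K = up x.1 H) :
    Γ.upTerm hF x H l = 0 := by
  by_cases hx : H ≤ x.1
  · exact upTerm_of_le Γ hF x hx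
  · have h0 := contr_self_mem (Γ.above hF.2 x.1 x.2) (H := up x.1 H)
      (l := l.filterMap (toUpper x.1)) (mem_toUpper.2 ⟨K, hK, hKx, e⟩)
    rw [upTerm_of_not_le Γ hF x hx, h0, map_zero, smul_zero]

/-- The differential of a term of the coproduct. -/
theorem tD_coterm : CDGA.tD (MD.cdga (L.lower F hF.1)) (MD.cdga (L.upper F hF.2))
    (Γ.coterm hF x Γ.J) =
      altSum Γ.J (fun H l => Γ.lowTerm hF x H l + Γ.upTerm hF x H l) := by
  rw [altSum_add, coterm_J, map_zsmul]
  have h1 := CDGA.tD_tm (MD.cdga (L.lower F hF.1)) (MD.cdga (L.upper F hF.2))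
    (Γ.below hF.1 x.1 x.2).mk_mem_gr' (MD.mk (Γ.above hF.2 x.1 x.2))
  rw [deg'_negOnePow, negOnePow_smul] at h1
  refine (congrArg (fun y => shuffleSign (· ≤ x.1) Γ.J • y) h1).trans ?_
  rw [smul_add, smul_smul]
  refine congrArg₂ (· + ·) ?_ ?_
  · refine Eq.trans ?_ ((isSplitting_toLower x.1).altSum_left Γ.J fun H l l' => MD.tm _ _
      ((Γ.below hF.1 x.1 x.2).contr H l) ((Γ.above hF.2 x.1 x.2).wd l'))
    refine congrArg (fun y => shuffleSign (· ≤ x.1) Γ.J • y) ?_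
    refine Eq.trans ?_ (altSum_hom ((MD.tm (L.lower F hF.1) (L.upper F hF.2)).flip
      (Γ.upperWd hF.2 x Γ.J)).toAddMonoidHom (Γ.J.filterMap (toLower x.1))
      (Γ.below hF.1 x.1 x.2).contr).symm
    rw [upperWd_J]
    exact congrArg (fun y => MD.tm _ _ y (MD.mk (Γ.above hF.2 x.1 x.2)))
      (MD.d_mk (Γ.below hF.1 x.1 x.2))
  · refine Eq.trans ?_ ((isSplitting_toLower x.1).altSum_right Γ.J fun H l l' => MD.tm _ _
      ((Γ.below hF.1 x.1 x.2).wd l) ((Γ.above hF.2 x.1 x.2).contr H l'))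
    refine congrArg₂ (fun (n : ℤ) y => n • y) rfl ?_
    refine Eq.trans ?_ (altSum_hom (MD.tm (L.lower F hF.1) (L.upper F hF.2)
      (Γ.lowerWd hF.1 x Γ.J)).toAddMonoidHom (Γ.J.filterMap (toUpper x.1))
      (Γ.above hF.2 x.1 x.2).contr).symm
    rw [lowerWd_J]
    exact congrArg (fun y => MD.tm _ _ (MD.mk (Γ.below hF.1 x.1 x.2)) y)
      (MD.d_mk (Γ.above hF.2 x.1 x.2))

section NotContractible

/-- A flat X ≥ F_ι which contains the other letters but not H meets F' in a flat with the same
property, so a bridge below F' remains a bridge of the lower factor; and a letter below F' and F_ι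
is below ι F. -/
theorem lowTerm_of_not_contractible (hH : IsAtom H) (h : ¬ Γ.Contractible H l) :
    Γ.lowTerm hF x H l = 0 := by
  refine lowTerm_eq_zero Γ hF x fun hx hc => h ⟨hH, fun ht => hc.2.1 ?_, fun X h1 h2 => ?_⟩
  · have h3 : H ≤ x.1 ⊓ Γ.top := le_inf hx ht
    rw [← ι_trace, x.2] at h3
    exact h3
  · have h3 := hc.2.2 (⟨X ⊓ x.1, inf_le_right⟩ : Set.Iic x.1)
      (le_inf ((Γ.ι_le_top F).trans h1) (Γ.ι_le_of_trace x.2))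
      fun K hK => le_inf (h2 _ (mem_toLower.1 hK)) K.2
    exact le_trans (show H ≤ X ⊓ x.1 from h3) inf_le_left

/-- Let X be a flat which shows that H is a bridge. If F' ≤ X, then H is a bridge of the upper
factor. Otherwise the letters below F' all lie below X and the lower factor does not span. -/
theorem upTerm_of_not_contractible (hH : IsAtom H) (h : ¬ Γ.Contractible H l) :
    Γ.upTerm hF x H l = 0 := by
  by_contra h0
  refine h ⟨hH, fun ht => h0 ?_, fun X h1 h2 => ?_⟩
  · refine upTerm_eq_zero Γ hF x fun hc => hc.2.1 ?_
    exact up_le_iff.2 (ht.trans (show Γ.top ≤ x.1 ⊔ Γ.top from le_sup_right))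
  · by_contra hX
    by_cases hx : x.1 ≤ X
    · refine h0 (upTerm_eq_zero Γ hF x fun hc => hX ?_)
      refine up_le_iff.1 (hc.2.2 (⟨X, hx⟩ : Set.Ici x.1) (show x.1 ⊔ Γ.top ≤ X from sup_le hx h1)
        fun K hK => ?_)
      obtain ⟨K, hK', -, rfl⟩ := mem_toUpper.1 hK
      exact up_le_iff.2 (h2 K hK')
    · exact h0 (upTerm_eq_zero_of_lower Γ hF x (Γ.lowerWd_eq_zero hF.1 X hx
        ((Γ.ι_le_top F).trans h1) fun K hK _ => h2 K hK))

end NotContractible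

/-- A flat above `H` as a flat of the quotient by `H`. -/
def quotFiber (h0 : Γ.trace H = ⊥) (h : H ≤ x.1) : (Γ.quot H h0).Fiber F :=
  ⟨(⟨x.1, h⟩ : Set.Ici H), (Γ.trace_quot (⟨x.1, h⟩ : Set.Ici H)).trans x.2⟩

theorem trace_below_eq_bot (h0 : Γ.trace H = ⊥) (h : H ≤ x.1) :
    (Γ.below hF.1 x.1 x.2).trace (⟨H, h⟩ : Set.Iic x.1) = ⊥ :=
  Subtype.ext ((trace_below Γ hF.1 x.2 (⟨H, h⟩ : Set.Iic x.1)).trans h0)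

theorem upperWd_quotFiber (h0 : Γ.trace H = ⊥) (h : H ≤ x.1) :
    (Γ.quot H h0).upperWd hF.2 (Γ.quotFiber x h0 h) (l.map (up H)) = Γ.upperWd hF.2 x l := by
  refine Eq.trans ?_ (wd_iso (Γ := Γ.above hF.2 x.1 x.2) (Γ' := (Γ.quot H h0).above hF.2
    (Γ.quotFiber x h0 h).1 (Γ.quotFiber x h0 h).2) (iciIci h) (fun y => ?_) _)
  · refine congrArg ((Γ.quot H h0).above hF.2
      (Γ.quotFiber x h0 h).1 (Γ.quotFiber x h0 h).2).wd ?_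
    refine List.filterMap_map.trans (Eq.trans ?_ (List.map_filterMap (l := l)).symm)
    refine List.filterMap_congr fun K _ => ?_
    by_cases hK : K ≤ x.1
    · rw [toUpper_of_le hK]
      exact toUpper_of_le (F' := (⟨x.1, h⟩ : Set.Ici H)) (up_le_iff.2 hK)
    · rw [toUpper_of_not_le hK]
      exact (toUpper_of_not_le (F' := (⟨x.1, h⟩ : Set.Ici H)) fun h' => hK (up_le_iff.1 h')).trans
        (congrArg some (iciIci_up h K).symm)
  · exact (iciIci_up h (Γ.ι y.1)).symm

theorem lowerWd_quotFiber (h0 : Γ.trace H = ⊥) (h : H ≤ x.1) :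
    (Γ.quot H h0).lowerWd hF.1 (Γ.quotFiber x h0 h) (l.map (up H)) =
      ((Γ.below hF.1 x.1 x.2).quot (⟨H, h⟩ : Set.Iic x.1) (Γ.trace_below_eq_bot hF x h0 h)).wd
        ((l.filterMap (toLower x.1)).map (up (⟨H, h⟩ : Set.Iic x.1))) := by
  refine Eq.trans ?_ (wd_iso (Γ := (Γ.below hF.1 x.1 x.2).quot (⟨H, h⟩ : Set.Iic x.1)
    (Γ.trace_below_eq_bot hF x h0 h)) (Γ' := (Γ.quot H h0).below hF.1
    (Γ.quotFiber x h0 h).1 (Γ.quotFiber x h0 h).2) (iciIic h) (fun y => rfl) _)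
  refine congrArg ((Γ.quot H h0).below hF.1
      (Γ.quotFiber x h0 h).1 (Γ.quotFiber x h0 h).2).wd ?_
  refine List.filterMap_map.trans (Eq.trans ?_ ((congrArg (List.map _)
    (List.map_filterMap (l := l))).trans (List.map_filterMap (l := l))).symm)
  refine List.filterMap_congr fun K _ => ?_
  by_cases hK : K ≤ x.1
  · rw [toLower_of_le hK]
    exact toLower_of_le (F' := (⟨x.1, h⟩ : Set.Ici H)) (up_le_iff.2 hK)
  · rw [toLower_of_not_le hK]
    exact toLower_of_not_le (F' := (⟨x.1, h⟩ : Set.Ici H)) fun h' => hK (up_le_iff.1 h')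

theorem coterm_quotFiber (h0 : Γ.trace H = ⊥) (h : H ≤ x.1) :
    (Γ.quot H h0).coterm hF (Γ.quotFiber x h0 h) (l.map (up H)) =
      shuffleSign (· ≤ x.1) l • MD.tm _ _
        (((Γ.below hF.1 x.1 x.2).quot (⟨H, h⟩ : Set.Iic x.1) (Γ.trace_below_eq_bot hF x h0 h)).wd
        ((l.filterMap (toLower x.1)).map (up (⟨H, h⟩ : Set.Iic x.1)))) (Γ.upperWd hF.2 x l) := by
  rw [coterm, Γ.lowerWd_quotFiber hF, Γ.upperWd_quotFiber hF]
  refine congrArg (fun n : ℤ => n • _) ?_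
  refine (shuffleSign_map _ (up H) l).trans (shuffleSign_congr fun K _ => ?_)
  exact up_le_iff (x := (⟨x.1, h⟩ : Set.Ici H))

theorem lowTerm_eq_coterm (h0 : Γ.trace H = ⊥) (h : H ≤ x.1)
    (hc : (Γ.below hF.1 x.1 x.2).Contractible (⟨H, h⟩ : Set.Iic x.1) (l.filterMap (toLower x.1))) :
    Γ.lowTerm hF x H l = (Γ.quot H h0).coterm hF (Γ.quotFiber x h0 h) (l.map (up H)) := by
  rw [coterm_quotFiber, lowTerm_of_le Γ hF x h,
    contr_of_pos _ hc (Γ.trace_below_eq_bot hF x h0 h)]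
  rfl

/-- A term with a contraction of a letter outside of `F'` is equal to a term of the coproduct of the
contraction. -/
theorem upTerm_eq_coterm (hH : IsAtom H) (hc : Γ.Contractible H l) (h0 : Γ.trace H = ⊥)
    (hx : ¬ H ≤ x.1 ⊔ Γ.top) (hl : ∀ K ∈ l, K ≤ x.1 ⊔ H → K ≤ x.1)
    (y : Γ.Fiber F) (hy : y.1 = x.1 ⊔ H) (h : H ≤ y.1) :
    Γ.upTerm hF x H l = (Γ.quot H h0).coterm hF (Γ.quotFiber y h0 h) (l.map (up H)) := by
  obtain ⟨y, hy'⟩ := y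
  change y = _ at hy
  subst hy
  have hxH : ¬ H ≤ x.1 := fun h => hx (h.trans le_sup_left)
  have hle : x.1 ≤ x.1 ⊔ H := le_sup_left
  have hl' : ∀ K ∈ l, K ≤ x.1 ↔ K ≤ x.1 ⊔ H := fun K hK => ⟨fun h => h.trans hle, hl K hK⟩
  rw [coterm_quotFiber, upTerm_of_not_le Γ hF x hxH, shuffleSign_congr hl']
  have hat : IsAtom (up x.1 H) := isAtom_sup hH hxH
  have hc' : (Γ.above hF.2 x.1 x.2).Contractible (up x.1 H) (l.filterMap (toUpper x.1)) := by
    refine ⟨hat, fun h' => hx (up_le_iff.1 h'), fun X h1 h2 => ?_⟩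
    have h1' : x.1 ⊔ Γ.top ≤ X.1 := h1
    refine up_le_iff.2 (hc.2.2 X.1 (le_sup_right.trans h1') fun K hK => ?_)
    by_cases hKx : K ≤ x.1
    · exact hKx.trans X.2
    · exact up_le_iff.1 (h2 _ (mem_toUpper.2 ⟨K, hK, hKx, rfl⟩))
  have ht : (Γ.above hF.2 x.1 x.2).trace (up x.1 H) = ⊥ := trace_of_not_le _ hc'.1 hc'.2.1
  refine congrArg (fun y => shuffleSign (· ≤ x.1 ⊔ H) l • y) ?_
  rw [contr_of_pos _ hc' ht]
  refine congrArg₂ (fun a b => MD.tm _ _ a b) ?_ ?_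
  -- In [⊥, F' ∨ H] the flat F' is a hyperplane which avoids H and contains all the letters of l
  -- that are present. The quotient by H is therefore [⊥, F'] with the same word.
  · have hX : (Γ.below hF.1 (x.1 ⊔ H) hy').top ≤ (⟨x.1, hle⟩ : Set.Iic (x.1 ⊔ H)) :=
      Γ.ι_le_of_trace x.2
    have e := quot_eq_restrict (Γ.below hF.1 (x.1 ⊔ H) hy')
      (X := (⟨x.1, hle⟩ : Set.Iic (x.1 ⊔ H))) (H := (⟨H, h⟩ : Set.Iic (x.1 ⊔ H))) (hH.Iic h) hX
      hxH (Subtype.ext (sup_comm H x.1)) (Γ.trace_below_eq_bot hF ⟨x.1 ⊔ H, hy'⟩ h0 h)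
      ((l.filterMap (toLower x.1)).map (iicIic hle))
    refine Eq.trans ?_ (e.symm.trans (congrArg _ ?_))
    · exact (wd_iso (Γ := Γ.below hF.1 x.1 x.2)
        (Γ' := (Γ.below hF.1 (x.1 ⊔ H) hy').restrict (⟨x.1, hle⟩ : Set.Iic (x.1 ⊔ H)) hX)
        (iicIic hle) (fun y => rfl) _).symm
    · refine ((congrArg (List.map _) (List.map_filterMap (l := l))).trans
        (List.map_filterMap (l := l))).trans (Eq.trans ?_ (List.map_filterMap (l := l)).symm)
      refine List.filterMap_congr fun K hK => ?_
      by_cases hKx : K ≤ x.1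
      · rw [toLower_of_le hKx, toLower_of_le (hKx.trans hle)]
        rfl
      · rw [toLower_of_not_le hKx, toLower_of_not_le fun h' => hKx (hl K hK h')]
        rfl
  -- The quotient of [F', ⊤] by the atom F' ∨ H is [F' ∨ H, ⊤].
  · refine Eq.trans (congrArg _ ?_) (wd_iso (Γ := Γ.above hF.2 (x.1 ⊔ H) hy')
      (Γ' := (Γ.above hF.2 x.1 x.2).quot (up x.1 H) ht) (iciIci hle) (fun y => ?_) _)
    · refine (List.map_filterMap (l := l)).trans (Eq.trans ?_ (List.map_filterMap (l := l)).symm)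
      refine List.filterMap_congr fun K hK => ?_
      by_cases hKx : K ≤ x.1
      · rw [toUpper_of_le hKx, toUpper_of_le (hKx.trans hle)]
        rfl
      · rw [toUpper_of_not_le hKx, toUpper_of_not_le fun h' => hKx (hl K hK h')]
        exact congrArg some (iciIci_up hle K).symm
    · exact (iciIci_up hle (Γ.ι y.1)).symm

-- The key identity for the compatibility with d. The left side runs over the flats y ≥ H of trace
-- F. If H is contractible in [⊥, y], the term at y is the lower contraction. Otherwise some flat Z
-- of [⊥, y] separates H from the other letters; the term at y vanishes unless Z ∨ H = y, and then
-- it is the upper contraction at Z. So x ↦ x ∨ H is a bijection from the flats with nonzero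
-- `upTerm` to the flats where the term of the coproduct differs from `lowTerm`.
open scoped Classical in
theorem coprod_contr (hH : IsAtom H) (hl : ∀ K ∈ l, IsAtom K) :
    MD.coprod hF (Γ.contr H l) =
      ∑ x : Γ.Fiber F, (Γ.lowTerm hF x H l + Γ.upTerm hF x H l) := by
  by_cases hc : Γ.Contractible H l
  swap
  · rw [contr_of_neg _ hc, map_zero]
    refine (Finset.sum_eq_zero fun x _ => ?_).symm
    rw [lowTerm_of_not_contractible Γ hF x hH hc, upTerm_of_not_contractible Γ hF x hH hc, add_zero]
  by_cases hHl : H ∈ l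
  · rw [contr_self_mem _ hHl, map_zero]
    refine (Finset.sum_eq_zero fun x _ => ?_).symm
    rw [lowTerm_self_mem Γ hF x hHl, zero_add]
    by_cases hx : H ≤ x.1
    · exact upTerm_of_le Γ hF x hx
    · exact upTerm_self_mem Γ hF x hHl hx rfl
  have h0 := Γ.trace_of_not_le hc.1 hc.2.1
  have hat : ∀ K ∈ l.map (up H), IsAtom K := fun K hK => by
    obtain ⟨K, hK', rfl⟩ := List.mem_map.1 hK
    exact isAtom_up hH (hl K hK') fun e => hHl (e ▸ hK')
  rw [contr_of_pos _ hc h0]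
  refine (MD.coprod_wd hF (Γ.quot H h0) hat).trans ?_
  -- The terms of the coproduct of Γ / H, extended by 0 to all flats of trace F.
  let S : Γ.Fiber F → MD.T (L.lower F hF.1) (L.upper F hF.2) := fun x =>
    if h : H ≤ x.1 then (Γ.quot H h0).coterm hF (Γ.quotFiber x h0 h) (l.map (up H)) else 0
  have hS : ∀ x : Γ.Fiber F, ∀ h : H ≤ x.1,
      S x = (Γ.quot H h0).coterm hF (Γ.quotFiber x h0 h) (l.map (up H)) := fun x h => dif_pos h
  have hsum : ∑ y : (Γ.quot H h0).Fiber F, (Γ.quot H h0).coterm hF y (l.map (up H)) = ∑ x, S x := by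
    refine Finset.sum_of_injOn (fun y => ⟨Subtype.val (p := (· ∈ Set.Ici H)) y.1,
      (Γ.trace_quot _).symm.trans y.2⟩) ?_ ?_ ?_ ?_
    · exact fun y _ y' _ h => Subtype.ext (Subtype.ext (Subtype.mk.inj h))
    · exact fun x _ => Finset.mem_coe.2 (Finset.mem_univ _)
    · refine fun x _ hx => dif_neg fun h => hx ?_
      exact ⟨Γ.quotFiber x h0 h, Finset.mem_coe.2 (Finset.mem_univ _), rfl⟩
    · exact fun y _ => (hS ⟨Subtype.val (p := (· ∈ Set.Ici H)) y.1,
        (Γ.trace_quot _).symm.trans y.2⟩ y.1.2).symm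
  refine hsum.trans ?_
  rw [Finset.sum_add_distrib, ← sub_eq_iff_eq_add', ← Finset.sum_sub_distrib]
  symm
  -- Three consequences of a nonzero `upTerm` at x: H is not below x ∨ F_ι; a letter of l below x ∨
  -- H is below x, since otherwise it would coincide with H in [x, ⊤]; and x is spanned by ι F and
  -- the letters below it.
  have hne : ∀ x : Γ.Fiber F, Γ.upTerm hF x H l ≠ 0 → ¬ H ≤ x.1 ⊔ Γ.top := fun x hx h =>
    hx (upTerm_eq_zero Γ hF x fun hc => hc.2.1 (up_le_iff.2 h))
  have hle : ∀ x : Γ.Fiber F, Γ.upTerm hF x H l ≠ 0 → ∀ K ∈ l, K ≤ x.1 ⊔ H → K ≤ x.1 := by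
    intro x hx K hK hKx
    by_contra hn
    refine hx (upTerm_self_mem Γ hF x hK hn (Subtype.ext ?_))
    exact ((covBy_sup_atom hH fun h => hne x hx (h.trans le_sup_left)).eq_or_eq le_sup_left
      (sup_le le_sup_left hKx)).resolve_left fun e => hn (sup_eq_left.1 e)
  have hspan : ∀ x : Γ.Fiber F, Γ.upTerm hF x H l ≠ 0 → ∀ X, Γ.ι F ≤ X →
      (∀ K ∈ l, K ≤ x.1 → K ≤ X) → x.1 ≤ X := by
    intro x hx X h1 h2
    by_contra hn
    exact hx (upTerm_eq_zero_of_lower Γ hF x (Γ.lowerWd_eq_zero hF.1 X hn h1 h2))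
  have htr : ∀ x : Γ.Fiber F, ¬ H ≤ x.1 ⊔ Γ.top → Γ.trace (x.1 ⊔ H) = F := fun x hx =>
    (Γ.trace_sup_atom hH hx).trans x.2
  have hval : ∀ (x y : Γ.Fiber F), ¬ H ≤ x.1 ⊔ Γ.top → (∀ K ∈ l, K ≤ x.1 ⊔ H → K ≤ x.1) →
      y.1 = x.1 ⊔ H → Γ.upTerm hF x H l = S y - Γ.lowTerm hF y H l := by
    intro x y hx hlx e
    have hHy : H ≤ y.1 := e ▸ le_sup_right
    rw [hS y hHy, ← upTerm_eq_coterm Γ hF x hH hc h0 hx hlx y e hHy, lowTerm_eq_zero Γ hF y,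
      sub_zero]
    intro h hc'
    have h3 := hc'.2.2 (⟨x.1, e ▸ le_sup_left⟩ : Set.Iic y.1) (Γ.ι_le_of_trace x.2)
      fun K hK => hlx K.1 (mem_toLower.1 hK) (K.2.trans e.le)
    exact hx (le_trans (show H ≤ x.1 from h3) le_sup_left)
  refine Finset.sum_bij_ne_zero (fun x _ hx => ⟨x.1 ⊔ H, htr x (hne x hx)⟩)
    (fun _ _ _ => Finset.mem_univ _) ?_ ?_ ?_
  · intro x _ hx y _ hy e
    have e' : x.1 ⊔ H = y.1 ⊔ H := congrArg Subtype.val e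
    -- The flat x is spanned by ι F and the letters of l below x ∨ H, so it is recovered from x ∨ H.
    refine Subtype.ext (le_antisymm ?_ ?_)
    · exact hspan x hx y.1 (Γ.ι_le_of_trace y.2) fun K hK h => hle y hy K hK
        (h.trans (le_sup_left.trans e'.le))
    · exact hspan y hy x.1 (Γ.ι_le_of_trace x.2) fun K hK h => hle x hx K hK
        (h.trans (le_sup_left.trans e'.ge))
  · intro y _ hy
    have hHy : H ≤ y.1 := by
      by_contra hn
      refine hy ?_
      rw [lowTerm_of_not_le Γ hF y hn, sub_zero]
      exact dif_neg hn
    have hnc : ¬ (Γ.below hF.1 y.1 y.2).Contractible (⟨H, hHy⟩ : Set.Iic y.1)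
        (l.filterMap (toLower y.1)) := fun h' => hy (by
      rw [hS y hHy, lowTerm_eq_coterm Γ hF y h0 hHy h', sub_self])
    obtain ⟨Z, hZ1, hZ2, hZ3⟩ : ∃ Z : Set.Iic y.1, Γ.ι F ≤ Z.1 ∧
        (∀ K ∈ l, K ≤ y.1 → K ≤ Z.1) ∧ ¬ H ≤ Z.1 := by
      by_contra hn
      push Not at hn
      refine hnc ⟨hH.Iic hHy, fun h' => hc.2.1 ?_, fun Z h1 h2 => ?_⟩
      · exact le_trans (show H ≤ Γ.ι F from h') (Γ.ι_le_top F)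
      · exact hn Z h1 fun K hK hKy => h2 (⟨K, hKy⟩ : Set.Iic y.1) (mem_toLower.2 hK)
    -- If Z ∨ H were smaller than y, it would still contain ι F and all the letters below y, so the
    -- lower factor of the contraction would not span.
    have hG : Z.1 ⊔ H = y.1 := by
      by_contra hn
      refine hy ?_
      rw [hS y hHy, lowTerm_eq_zero Γ hF y fun _ => hnc, sub_zero]
      refine coterm_of_lower _ hF (lowerWd_eq_zero (Γ.quot H h0) hF.1 (up H Z.1) (fun h' => hn ?_)
        ?_ ?_)
      · exact le_antisymm (sup_le Z.2 hHy) ((show y.1 ≤ H ⊔ Z.1 from h').trans_eq (sup_comm _ _))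
      · exact sup_le_sup_left hZ1 H
      · intro K hK hKy
        obtain ⟨K, hK', rfl⟩ := List.mem_map.1 hK
        exact up_le_iff.2 ((hZ2 K hK' (up_le_iff.1 hKy)).trans le_sup_right)
    have hZF : Γ.trace Z.1 = F :=
      le_antisymm ((Γ.trace_mono Z.2).trans_eq y.2) ((Γ.trace_le_iff _ _).2 hZ1)
    -- By modularity Z ∨ F_ι meets y in Z ∨ (y ∧ F_ι) = Z ∨ ι F = Z, which does not contain H.
    have hZtop : ¬ H ≤ Z.1 ⊔ Γ.top := fun h' => hZ3 <| by
      have h1 := Γ.modular.2 Z.1 y.1 Z.2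
      have h2 : y.1 ⊓ Γ.ι ⊤ = Γ.ι F := by
        have := Γ.ι_trace y.1
        rw [y.2] at this
        exact this.symm
      rw [h2, sup_eq_left.2 hZ1] at h1
      exact (le_inf hHy h').trans h1.le
    have hlZ : ∀ K ∈ l, K ≤ Z.1 ⊔ H → K ≤ Z.1 := fun K hK h => hZ2 K hK (h.trans hG.le)
    have e := hval ⟨Z.1, hZF⟩ y hZtop hlZ hG.symm
    exact ⟨⟨Z.1, hZF⟩, Finset.mem_univ _, e ▸ hy, Subtype.ext hG⟩
  · exact fun x _ hx => hval x _ (hne x hx) (hle x hx) rfl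

end Diag

theorem MD.coprod_d {L : GeomLat.{u}} {F : L} (hF : Proper F) (x : MD L) :
    MD.coprod hF (MD.d x) =
      CDGA.tD (MD.cdga (L.lower F hF.1)) (MD.cdga (L.upper F hF.2)) (MD.coprod hF x) := by
  suffices h : MD.coprod hF ∘ₗ MD.d = CDGA.tD (MD.cdga (L.lower F hF.1))
      (MD.cdga (L.upper F hF.2)) ∘ₗ MD.coprod hF from LinearMap.congr_fun h x
  refine MD.hom_ext fun Γ => ?_
  rw [LinearMap.comp_apply, LinearMap.comp_apply, MD.d_mk, MD.coprod_mk, map_sum]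
  refine (altSum_hom (MD.coprod hF).toAddMonoidHom Γ.J Γ.contr).symm.trans ?_
  refine Eq.trans ?_ (Finset.sum_congr rfl fun y _ => (Γ.tD_coterm hF y).symm)
  refine Eq.trans ?_ (altSum_sum _ _ _)
  refine altSum_congr fun H l hl => ?_
  have hat : ∀ K ∈ H :: l, IsAtom K := fun K hK => Γ.atoms K (hl.mem_iff.1 hK)
  exact Γ.coprod_contr hF (hat H List.mem_cons_self) fun K hK => hat K (List.mem_cons_of_mem _ hK)

/-! ### Orlik--Solomon algebras -/

namespace OS

variable {L M : GeomLat.{u}}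

theorem mk_extMonomial (l : List (At L)) :
    RingQuot.mkAlgHom ℚ (Rel L) (extMonomial l) = monomial l := by
  rw [extMonomial, map_list_prod, List.map_map]
  rfl

theorem monomial_nil : monomial ([] : List (At L)) = 1 := rfl

theorem monomial_cons (a : At L) (l : List (At L)) : monomial (a :: l) = e a * monomial l := by
  rw [monomial, List.map_cons, List.prod_cons]
  rfl

theorem monomial_append (l l' : List (At L)) : monomial (l ++ l') = monomial l * monomial l' := by
  rw [monomial, List.map_append, List.prod_append]
  rfl

theorem δ_extMonomial (l : List (At L)) :
    δ L (extMonomial l) = altSum l fun _ l' => extMonomial l' := by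
  induction l with
  | nil =>
    exact CliffordAlgebra.contractLeft_one 0 (Finsupp.linearCombination ℚ fun _ : At L => (1 : ℚ))
  | cons a l ih =>
    have h := CliffordAlgebra.contractLeft_ι_mul (Q := (0 : QuadraticForm ℚ (At L →₀ ℚ)))
      (d := (Finsupp.linearCombination ℚ fun _ : At L => (1 : ℚ) : Module.Dual ℚ (At L →₀ ℚ)))
      (Finsupp.single a 1) (extMonomial l)
    rw [Finsupp.linearCombination_single, smul_eq_mul, mul_one, one_smul] at h
    have h' : δ L (extMonomial (a :: l)) =
        extMonomial l - ExteriorAlgebra.ι ℚ (Finsupp.single a 1) * δ L (extMonomial l) := h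
    rw [h', ih, altSum]
    congr 1
    exact (altSum_hom (AddMonoidHom.mulLeft (ExteriorAlgebra.ι ℚ (Finsupp.single a (1 : ℚ)))) l
      fun _ l' => extMonomial l').symm

/-- The element `δ e_l` of the Orlik--Solomon algebra. -/
noncomputable def bd (l : List (At L)) : OS L := altSum l fun _ l' => monomial l'

theorem bd_cons (a : At L) (l : List (At L)) : bd (a :: l) = monomial l - e a * bd l := by
  rw [bd, altSum]
  congr 1
  rw [bd]
  refine Eq.trans ?_ (altSum_hom (AddMonoidHom.mulLeft (e a)) l fun _ l' => monomial l')
  exact altSum_congr fun b l' _ => monomial_cons a l'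

theorem mk_δ_extMonomial (l : List (At L)) :
    RingQuot.mkAlgHom ℚ (Rel L) (δ L (extMonomial l)) = bd l := by
  rw [δ_extMonomial, bd]
  refine (altSum_hom (RingQuot.mkAlgHom ℚ (Rel L)).toLinearMap.toAddMonoidHom l
    fun _ l' => extMonomial l').symm.trans (altSum_congr fun b l' _ => mk_extMonomial l')

theorem e_mul_self (a : At L) : e a * e a = 0 := by
  rw [e, ← map_mul, ExteriorAlgebra.ι_sq_zero, map_zero]

theorem e_mul_e (a b : At L) : e a * e b = -(e b * e a) := by
  have h := congrArg (RingQuot.mkAlgHom ℚ (Rel L)) (eq_neg_of_add_eq_zero_left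
    (ExteriorAlgebra.ι_add_mul_swap (R := ℚ) (Finsupp.single a (1 : ℚ)) (Finsupp.single b 1)))
  rwa [map_mul, map_neg, map_mul] at h

theorem isAlt_prod {α A : Type*} [Ring A] {f : α → A} (hf : ∀ a b, f a * f b = -(f b * f a)) :
    IsAlt fun l => (l.map f).prod := by
  intro l₁ l₂ a b
  simp only [List.map_append, List.map_cons, List.prod_append, List.prod_cons]
  rw [← mul_assoc (f a), hf a b, neg_mul, mul_neg, mul_assoc (f b)]

theorem isAlt_monomial : IsAlt (monomial : List (At L) → OS L) := isAlt_prod e_mul_e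

theorem isAlt_bd : IsAlt (bd : List (At L) → OS L) := isAlt_altSum fun _ => isAlt_monomial

/-- Since e_a squares to 0, multiplying δ (e_a e_l) by e_a recovers the monomial. Hence δ e_C = 0
implies e_C = 0. -/
theorem e_mul_bd (a : At L) (l : List (At L)) : e a * bd (a :: l) = monomial (a :: l) := by
  rw [bd_cons, mul_sub, ← mul_assoc, e_mul_self, zero_mul, sub_zero, monomial_cons]

/-- The join of the atoms of a list. -/
def lsup (l : List (At L)) : L := l.foldr (fun a x => a.1 ⊔ x) ⊥

theorem lsup_cons (a : At L) (l : List (At L)) : lsup (a :: l) = a.1 ⊔ lsup l := rfl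

theorem lsup_le_iff {l : List (At L)} {x : L} : lsup l ≤ x ↔ ∀ a ∈ l, a.1 ≤ x := by
  induction l with
  | nil => simp [lsup]
  | cons a l ih => rw [lsup_cons, sup_le_iff, ih, List.forall_mem_cons]

-- For every letter c, minimality and dependence give length - 1 ≤ rk (l without c) ≤ rk l ≤ length
-- - 1, so all are equalities.
open scoped Classical in
theorem isCircuit_of_minimal {l : List (At L)} (hl : l.Nodup) (h : rk (lsup l) < l.length)
    (hmin : ∀ a l', (a :: l').Perm l → (l'.length : ℤ) ≤ rk (lsup l')) :
    IsCircuit l.toFinset := by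
  have hsup : ∀ (C : Finset (At L)) (l' : List (At L)), (∀ a, a ∈ C ↔ a ∈ l') →
      C.sup Subtype.val = lsup l' := fun C l' hC =>
    eq_of_forall_ge_iff fun x => by simp only [lsup_le_iff, Finset.sup_le_iff, hC]
  have key : ∀ c ∈ l, rk (lsup l) = (l.length : ℤ) - 1 ∧ rk (lsup (l.erase c)) = (l.length : ℤ) - 1 := by
    intro c hc
    have hp := (List.perm_cons_erase hc).symm
    have h1 := hmin c _ hp
    have h2 := List.length_erase_of_mem hc
    have h3 := List.length_pos_of_mem hc
    have h4 : rk (lsup (l.erase c)) ≤ rk (lsup l) := rk_mono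
      (lsup_le_iff.2 fun a ha => lsup_le_iff.1 le_rfl a (List.mem_of_mem_erase ha))
    omega
  obtain ⟨c, hc⟩ : ∃ c, c ∈ l := by
    refine List.exists_mem_of_ne_nil l fun e => ?_
    rw [e] at h
    exact absurd h (not_lt.2 (rk_nonneg _))
  rw [IsCircuit, List.toFinset_card_of_nodup hl]
  refine ⟨(congrArg rk (hsup _ l fun a => List.mem_toFinset)).trans (key c hc).1, fun c hc => ?_⟩
  rw [List.mem_toFinset] at hc
  refine (congrArg rk (hsup _ (l.erase c) fun a => ?_)).trans (key c hc).2
  rw [Finset.mem_filter, List.mem_toFinset, hl.mem_erase_iff, and_comm]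

/-- Induction on the length. Alternation disposes of repeated letters. If every word obtained by
removing a letter is independent, l is a circuit and the defining relation applies. Otherwise move a
letter a with dependent complement l' to the front and use δ (e_a e_l') = e_l' - e_a δ e_l'. In this
form the relations are stable under the operations below. -/
theorem dependent {l : List (At L)} (h : rk (lsup l) < l.length) :
    monomial l = 0 ∧ bd l = 0 := by
  classical
  induction hn : l.length generalizing l with
  | zero =>
    rw [hn] at h
    exact absurd h (not_lt.2 (rk_nonneg _))
  | succ n ih =>
    by_cases hl : l.Nodup
    swap
    · exact ⟨isAlt_monomial.of_dup hl, isAlt_bd.of_dup hl⟩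
    by_cases hmin : ∀ a l', (a :: l').Perm l → (l'.length : ℤ) ≤ rk (lsup l')
    · have h2 : bd l = 0 := by
        rw [← mk_δ_extMonomial, ← map_zero (RingQuot.mkAlgHom ℚ (Rel L))]
        exact RingQuot.mkAlgHom_rel ℚ
          (Rel.circuit l hl l.toFinset (fun _ => List.mem_toFinset) (isCircuit_of_minimal hl h hmin))
      refine ⟨?_, h2⟩
      obtain ⟨a, l', rfl⟩ := List.exists_cons_of_length_eq_add_one hn
      rw [← e_mul_bd, h2, mul_zero]
    · push Not at hmin
      obtain ⟨a, l', hp, hl'⟩ := hmin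
      have hlen := hp.length_eq
      rw [List.length_cons] at hlen
      obtain ⟨h1, h2⟩ := ih hl' (by omega)
      refine ⟨isAlt_monomial.perm_eq_zero hp.symm ?_, isAlt_bd.perm_eq_zero hp.symm ?_⟩
      · rw [monomial_cons, h1, mul_zero]
      · rw [bd_cons, h1, h2, mul_zero, sub_zero]

theorem induction {p : OS L → Prop} (h0 : p 0) (hadd : ∀ x y, p x → p y → p (x + y))
    (hsmul : ∀ (c : ℚ) (x), p x → p (c • x)) (hm : ∀ l, p (monomial l)) (x : OS L) : p x := by
  have hspan : ∀ x : OS L, x ∈ Submodule.span ℚ (Set.range (monomial (L := L))) := by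
    intro x
    obtain ⟨x, rfl⟩ := RingQuot.mkAlgHom_surjective ℚ (Rel L) x
    induction x using ExteriorAlgebra.induction with
    | algebraMap r =>
      rw [AlgHom.commutes, Algebra.algebraMap_eq_smul_one]
      exact Submodule.smul_mem _ _ (Submodule.subset_span ⟨[], rfl⟩)
    | ι x =>
      induction x using Finsupp.induction_linear with
      | zero => rw [map_zero, map_zero]; exact zero_mem _
      | add x y hx hy => rw [map_add, map_add]; exact add_mem hx hy
      | single a r =>
        rw [← mul_one r, ← smul_eq_mul, ← Finsupp.smul_single, map_smul, map_smul]
        exact Submodule.smul_mem _ _ (Submodule.subset_span ⟨[a], by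
          rw [monomial_cons, monomial_nil, mul_one]; rfl⟩)
    | mul x y hx hy =>
      rw [map_mul]
      have := Submodule.mul_mem_mul hx hy
      rw [Submodule.span_mul_span] at this
      refine Submodule.span_mono ?_ this
      rintro _ ⟨_, ⟨l, rfl⟩, _, ⟨l', rfl⟩, rfl⟩
      exact ⟨l ++ l', monomial_append l l'⟩
    | add x y hx hy => rw [map_add]; exact add_mem hx hy
  induction hspan x using Submodule.span_induction with
  | mem x h => obtain ⟨l, rfl⟩ := h; exact hm l
  | zero => exact h0
  | add x y _ _ hx hy => exact hadd x y hx hy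
  | smul c x _ hx => exact hsmul c x hx

theorem hom_ext {N : Type*} [AddCommGroup N] [Module ℚ N] {f g : OS L →ₗ[ℚ] N}
    (h : ∀ l, f (monomial l) = g (monomial l)) : f = g := by
  refine LinearMap.ext fun x => ?_
  refine induction (p := fun x => f x = g x) ?_ ?_ ?_ h x
  · rw [map_zero, map_zero]
  · intro x y hx hy; rw [map_add, hx, hy, map_add]
  · intro c x hx; rw [map_smul, hx, map_smul]

/-! ### Algebra morphisms out of an Orlik–Solomon algebra. -/

section Lift

variable {A : Type*} [Ring A] [Algebra ℚ A] {f : At L → A}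

/-- Anticommutation extends bilinearly, so the square is its own negative, and 2 is invertible. -/
theorem linearCombination_sq (hf : ∀ a b, f a * f b = -(f b * f a)) (x : At L →₀ ℚ) :
    Finsupp.linearCombination ℚ f x * Finsupp.linearCombination ℚ f x = 0 := by
  have key : ∀ x y : At L →₀ ℚ,
      Finsupp.linearCombination ℚ f x * Finsupp.linearCombination ℚ f y =
        -(Finsupp.linearCombination ℚ f y * Finsupp.linearCombination ℚ f x) := by
    intro x y
    induction x using Finsupp.induction_linear with
    | zero => rw [map_zero, zero_mul, mul_zero, neg_zero]
    | add x x' h h' => rw [map_add, add_mul, mul_add, h, h', neg_add]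
    | single a r =>
      induction y using Finsupp.induction_linear with
      | zero => rw [map_zero, zero_mul, mul_zero, neg_zero]
      | add y y' h h' => rw [map_add, add_mul, mul_add, h, h', neg_add]
      | single b s =>
        rw [Finsupp.linearCombination_single, Finsupp.linearCombination_single, smul_mul_smul_comm,
          smul_mul_smul_comm, hf a b, smul_neg, mul_comm r s]
  have h2 := eq_neg_iff_add_eq_zero.1 (key x x)
  rw [← two_smul ℚ] at h2
  exact (smul_eq_zero_iff_right two_ne_zero).1 h2

/-- The algebra morphism from an Orlik--Solomon algebra defined by the images of the generators. -/
noncomputable def lift (f : At L → A) (hf : ∀ a b, f a * f b = -(f b * f a))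
    (hd : ∀ l : List (At L), rk (lsup l) < l.length → altSum l (fun _ l' => (l'.map f).prod) = 0) :
    OS L →ₐ[ℚ] A :=
  RingQuot.liftAlgHom ℚ ⟨ExteriorAlgebra.lift ℚ
    ⟨Finsupp.linearCombination ℚ f, linearCombination_sq hf⟩, by
      rintro _ _ ⟨l, hl, C, hC, h⟩
      have hC' : C.card = l.length := by
        classical
        rw [← List.toFinset_card_of_nodup hl]
        exact congrArg Finset.card (Finset.ext fun a => (hC a).trans List.mem_toFinset.symm)
      have e : C.sup Subtype.val = lsup l :=
        eq_of_forall_ge_iff fun x => by simp only [lsup_le_iff, Finset.sup_le_iff, hC]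
      -- A circuit has rank #C - 1, so every ordering of it is a dependent word.
      have h1 := h.1
      rw [e, hC'] at h1
      rw [map_zero, δ_extMonomial]
      refine ((altSum_hom (ExteriorAlgebra.lift ℚ ⟨Finsupp.linearCombination ℚ f,
        linearCombination_sq hf⟩).toLinearMap.toAddMonoidHom l fun _ l' =>
        extMonomial l').symm.trans (altSum_congr fun b l' _ => ?_)).trans (hd l (by omega))
      change ExteriorAlgebra.lift ℚ ⟨Finsupp.linearCombination ℚ f,
        linearCombination_sq hf⟩ (extMonomial l') = _
      rw [extMonomial, map_list_prod, List.map_map]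
      refine congrArg List.prod (List.map_congr_left fun a _ => ?_)
      rw [Function.comp_apply, ExteriorAlgebra.lift_ι_apply, Finsupp.linearCombination_single,
        one_smul]⟩

theorem lift_e (hf : ∀ a b, f a * f b = -(f b * f a))
    (hd : ∀ l : List (At L), rk (lsup l) < l.length → altSum l (fun _ l' => (l'.map f).prod) = 0)
    (a : At L) : lift f hf hd (e a) = f a := by
  rw [lift, e, RingQuot.liftAlgHom_mkAlgHom_apply, ExteriorAlgebra.lift_ι_apply,
    Finsupp.linearCombination_single, one_smul]

theorem lift_monomial (hf : ∀ a b, f a * f b = -(f b * f a))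
    (hd : ∀ l : List (At L), rk (lsup l) < l.length → altSum l (fun _ l' => (l'.map f).prod) = 0)
    (l : List (At L)) : lift f hf hd (monomial l) = (l.map f).prod := by
  rw [monomial, map_list_prod, List.map_map]
  exact congrArg List.prod (List.map_congr_left fun a _ => lift_e hf hd a)

end Lift

/-! ### The grading of Orlik–Solomon algebras. -/

/-- The homogeneous components of `OS L`. -/
noncomputable def gr (L : GeomLat.{u}) (n : ℤ) : Submodule ℚ (OS L) :=
  Submodule.span ℚ {x | ∃ l : List (At L), (l.length : ℤ) = n ∧ x = monomial l}

theorem monomial_mem (l : List (At L)) : monomial l ∈ gr L l.length :=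
  Submodule.subset_span ⟨l, rfl, rfl⟩

theorem e_mem (a : At L) : e a ∈ gr L 1 := by
  have := monomial_mem [a]
  rwa [monomial_cons, monomial_nil, mul_one] at this

theorem gr_induction {n : ℤ} {p : OS L → Prop} (h0 : p 0)
    (hadd : ∀ x y, p x → p y → p (x + y)) (hsmul : ∀ (c : ℚ) (x), p x → p (c • x))
    (hm : ∀ l : List (At L), (l.length : ℤ) = n → p (monomial l)) {x : OS L} (hx : x ∈ gr L n) :
    p x := by
  induction hx using Submodule.span_induction with
  | mem x h => obtain ⟨l, hl, rfl⟩ := h; exact hm l hl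
  | zero => exact h0
  | add x y _ _ hx hy => exact hadd x y hx hy
  | smul c x _ hx => exact hsmul c x hx

instance : SetLike.GradedMonoid (gr L) where
  one_mem := monomial_mem []
  mul_mem := by
    intro m n x y hx hy
    refine gr_induction (p := fun x => x * y ∈ gr L (m + n)) ?_ ?_ ?_ ?_ hx
    · rw [zero_mul]; exact zero_mem _
    · intro x x' h h'; rw [add_mul]; exact add_mem h h'
    · intro c x h; rw [smul_mul_assoc]; exact Submodule.smul_mem _ _ h
    · intro l hl
      refine gr_induction (p := fun y => monomial l * y ∈ gr L (m + n)) ?_ ?_ ?_ ?_ hy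
      · rw [mul_zero]; exact zero_mem _
      · intro x x' h h'; rw [mul_add]; exact add_mem h h'
      · intro c x h; rw [mul_smul_comm]; exact Submodule.smul_mem _ _ h
      · intro l' hl'
        rw [← monomial_append, ← hl, ← hl', ← Nat.cast_add, ← List.length_append]
        exact monomial_mem _

theorem mul_comm_of_mem {m n : ℤ} {x y : OS L} (hx : x ∈ gr L m) (hy : y ∈ gr L n) :
    x * y = (m * n).negOnePow • (y * x) := by
  refine gr_induction (p := fun x => x * y = (m * n).negOnePow • (y * x)) ?_ ?_ ?_ ?_ hx
  · rw [zero_mul, mul_zero, smul_zero]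
  · intro x x' h h'; rw [add_mul, mul_add, h, h', smul_add]
  · intro c x h; rw [smul_mul_assoc, mul_smul_comm, h, smul_comm]
  · intro l hl
    refine gr_induction (p := fun y => monomial l * y = (m * n).negOnePow • (y * monomial l))
      ?_ ?_ ?_ ?_ hy
    · rw [zero_mul, mul_zero, smul_zero]
    · intro x x' h h'; rw [add_mul, mul_add, h, h', smul_add]
    · intro c x h; rw [smul_mul_assoc, mul_smul_comm, h, smul_comm]
    · intro l' hl'
      rw [← monomial_append, ← monomial_append, ← hl, ← hl', ← Nat.cast_mul, negOnePow_smul]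
      exact isAlt_monomial.append_comm l l'

/-- The image of a generator in the sum of the homogeneous components. -/
noncomputable def homogeneous (a : At L) : ⨁ n, gr L n :=
  DirectSum.of (fun n => gr L n) 1 ⟨e a, e_mem a⟩

theorem of_congr {m n : ℤ} (h : m = n) {x y : OS L} (hx : x ∈ gr L m) (hy : y ∈ gr L n)
    (e : x = y) : DirectSum.of (fun n => gr L n) m ⟨x, hx⟩ = DirectSum.of _ n ⟨y, hy⟩ := by
  subst h; subst e; rfl

theorem prod_homogeneous (l : List (At L)) : (l.map homogeneous).prod =
    DirectSum.of (fun n => gr L n) l.length ⟨monomial l, monomial_mem l⟩ := by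
  induction l with
  | nil => rfl
  | cons a l ih =>
    rw [List.map_cons, List.prod_cons, ih, homogeneous, DirectSum.of_mul_of]
    exact of_congr (by push_cast [List.length_cons]; ring) _ _ (monomial_cons a l).symm

theorem homogeneous_mul (a b : At L) :
    homogeneous a * homogeneous b = -(homogeneous b * homogeneous a) := by
  rw [homogeneous, homogeneous, DirectSum.of_mul_of, DirectSum.of_mul_of, ← map_neg]
  exact congrArg _ (Subtype.ext (e_mul_e a b))

-- All terms lie in the component of degree length - 1, where their sum is δ e_l = 0. The auxiliary
-- w places monomials in this component; its default value 0 is not used for the words which occur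
-- in the sum.
open scoped Classical in
theorem altSum_homogeneous {l : List (At L)} (h : rk (lsup l) < l.length) :
    altSum l (fun _ l' => (l'.map homogeneous).prod) = 0 := by
  let w : List (At L) → gr L ((l.length : ℤ) - 1) := fun l' =>
    if h : monomial l' ∈ gr L ((l.length : ℤ) - 1) then ⟨monomial l', h⟩ else 0
  have hw : ∀ a l', (a :: l').Perm l → ∃ h, w l' = ⟨monomial l', h⟩ := by
    intro a l' hl
    have e : (l'.length : ℤ) = (l.length : ℤ) - 1 := by
      rw [← hl.length_eq, List.length_cons]
      push_cast
      ring
    have h' := e ▸ monomial_mem l'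
    exact ⟨h', dif_pos h'⟩
  have h1 : altSum l (fun _ l' => w l') = 0 := by
    refine Subtype.ext ?_
    refine (altSum_hom (gr L ((l.length : ℤ) - 1)).subtype.toAddMonoidHom l
      fun _ l' => w l').symm.trans (Eq.trans (altSum_congr fun a l' hl => ?_) (dependent h).2)
    obtain ⟨h', e⟩ := hw a l' hl
    exact congrArg Subtype.val e
  have h2 := altSum_hom (N := ⨁ n, gr L n)
    (DirectSum.of (fun n => gr L n) ((l.length : ℤ) - 1)) l fun _ l' => w l'
  rw [h1, map_zero] at h2
  refine Eq.trans (altSum_congr fun a l' hl => ?_) h2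
  obtain ⟨h', e⟩ := hw a l' hl
  rw [e, prod_homogeneous]
  refine of_congr ?_ _ _ rfl
  rw [← hl.length_eq, List.length_cons]
  push_cast
  ring

/-- The decomposition is the algebra morphism which sends each generator to itself placed in degree
1; it exists because the relations are homogeneous. -/
noncomputable instance : GradedAlgebra (gr L) :=
  GradedAlgebra.ofAlgHom (gr L)
    (lift homogeneous homogeneous_mul fun _ h => altSum_homogeneous h)
    (AlgHom.toLinearMap_injective (hom_ext fun l => by
      change DirectSum.coeAlgHom (gr L) (lift homogeneous _ _ (monomial l)) = _
      rw [lift_monomial, prod_homogeneous, DirectSum.coeAlgHom_of]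
      rfl))
    (by
      rintro n ⟨x, hx⟩
      have : ∃ hx : x ∈ gr L n, lift homogeneous homogeneous_mul
          (fun _ h => altSum_homogeneous h) x = DirectSum.of (fun n => gr L n) n ⟨x, hx⟩ := by
        refine gr_induction (p := fun x => ∃ hx : x ∈ gr L n, lift homogeneous homogeneous_mul
          (fun _ h => altSum_homogeneous h) x = DirectSum.of (fun n => gr L n) n ⟨x, hx⟩)
          ?_ ?_ ?_ ?_ hx
        · exact ⟨zero_mem _, (map_zero _).trans (map_zero _).symm⟩
        · rintro x y ⟨hx, ex⟩ ⟨hy, ey⟩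
          exact ⟨add_mem hx hy, by rw [map_add, ex, ey, ← map_add]; rfl⟩
        · rintro c x ⟨hx, ex⟩
          refine ⟨Submodule.smul_mem _ _ hx, ?_⟩
          rw [map_smul, ex]
          exact (map_smul (DirectSum.lof ℚ ℤ (fun n => gr L n) n) c ⟨x, hx⟩).symm
        · rintro l rfl
          exact ⟨monomial_mem l, by rw [lift_monomial, prod_homogeneous]⟩
      exact this.2)

/-- The Orlik--Solomon algebra, as a cdga. -/
noncomputable def cdga (L : GeomLat.{u}) : CDGA.{u} where
  carrier := OS L
  gr := gr L
  d := 0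
  d_mem _ _ _ := zero_mem _
  d_d _ := rfl
  leibniz m a b _ := by
    rw [LinearMap.zero_apply, LinearMap.zero_apply, LinearMap.zero_apply, zero_mul, mul_zero,
      smul_zero, add_zero]
  comm _ _ _ _ ha hb := mul_comm_of_mem ha hb

theorem hom_mem {A : CDGA.{v}} (g : OS L →ₐ[ℚ] A) (h : ∀ a, g (e a) ∈ A.gr 1) (n : ℤ) (x : OS L)
    (hx : x ∈ gr L n) : g x ∈ A.gr n := by
  refine gr_induction (p := fun x => g x ∈ A.gr n) ?_ ?_ ?_ ?_ hx
  · rw [map_zero]; exact zero_mem _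
  · intro x y hx hy; rw [map_add]; exact add_mem hx hy
  · intro c x hx; rw [map_smul]; exact Submodule.smul_mem _ _ hx
  · rintro l rfl
    clear hx
    induction l with
    | nil =>
      rw [monomial_nil, _root_.map_one]
      exact SetLike.GradedOne.one_mem (A := A.gr)
    | cons a l ih =>
      rw [monomial_cons, _root_.map_mul, List.length_cons, Nat.cast_succ, add_comm]
      exact SetLike.GradedMul.mul_mem (h a) ih

theorem anticomm_of_mem {A : CDGA.{v}} {f : At L → A} (hf : ∀ a, f a ∈ A.gr 1) (a b : At L) :
    f a * f b = -(f b * f a) := by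
  rw [A.comm 1 1 _ _ (hf a) (hf b), mul_one, Int.negOnePow_one, Units.neg_smul, one_smul]

/-- The morphism of cdgas defined by the images, of degree `1`, of the generators. -/
noncomputable def homOfGenerators (A : CDGA.{v}) (hA : ∀ x, A.d x = 0) (f : At L → A)
    (hf : ∀ a, f a ∈ A.gr 1)
    (hd : ∀ l : List (At L), rk (lsup l) < l.length → altSum l (fun _ l' => (l'.map f).prod) = 0) :
    CDGA.Hom (cdga L) A where
  toAlgHom := lift f (anticomm_of_mem hf) hd
  map_gr := hom_mem _ fun a => by rw [lift_e]; exact hf a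
  map_d x := by
    rw [hA]
    exact map_zero _

theorem homOfGenerators_e {A : CDGA.{v}} (hA : ∀ x, A.d x = 0) {f : At L → A}
    (hf : ∀ a, f a ∈ A.gr 1)
    (hd : ∀ l : List (At L), rk (lsup l) < l.length → altSum l (fun _ l' => (l'.map f).prod) = 0)
    (a : At L) : (homOfGenerators A hA f hf hd).lin (e a) = f a :=
  lift_e (anticomm_of_mem hf) hd a

theorem homOfGenerators_monomial {A : CDGA.{v}} (hA : ∀ x, A.d x = 0) {f : At L → A}
    (hf : ∀ a, f a ∈ A.gr 1)
    (hd : ∀ l : List (At L), rk (lsup l) < l.length → altSum l (fun _ l' => (l'.map f).prod) = 0)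
    (l : List (At L)) : (homOfGenerators A hA f hf hd).lin (monomial l) = (l.map f).prod :=
  lift_monomial (anticomm_of_mem hf) hd l

end OS

/-! ### The cooperad of Orlik--Solomon algebras -/

namespace OS

variable {L M : GeomLat.{u}}

/-- The atom `φ⁻¹ H`. -/
def mapAtom (φ : L ≃o M) (a : At M) : At L := ⟨φ.symm a.1, (φ.symm.isAtom_iff a.1).2 a.2⟩

theorem rk_lsup_mapAtom (φ : L ≃o M) (l : List (At M)) :
    rk (lsup (l.map (mapAtom φ))) = rk (lsup l) := by
  rw [← (IsEmbedding.of_orderIso φ.symm).rk_map (lsup l)]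
  refine congrArg rk (eq_of_forall_ge_iff fun x => ?_)
  rw [lsup_le_iff, List.forall_mem_map, φ.symm_apply_le, lsup_le_iff]
  exact forall₂_congr fun a _ => φ.symm_apply_le

theorem altSum_mapAtom (φ : L ≃o M) {l : List (At M)} (h : rk (lsup l) < l.length) :
    altSum l (fun _ l' => (l'.map fun a => e (mapAtom φ a)).prod) = 0 := by
  have h1 : rk (lsup (l.map (mapAtom φ))) < (l.map (mapAtom φ)).length := by
    rwa [rk_lsup_mapAtom, List.length_map]
  refine Eq.trans ?_ ((altSum_map (mapAtom φ) l fun _ l' => monomial l').symm.trans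
    (dependent h1).2)
  refine altSum_congr fun a l' _ => ?_
  rw [monomial, List.map_map]
  rfl

/-- The action of isomorphisms on Orlik--Solomon algebras. -/
noncomputable def mapHom (φ : L ≃o M) : CDGA.Hom (cdga M) (cdga L) :=
  homOfGenerators (cdga L) (fun _ => rfl) (fun a => e (mapAtom φ a)) (fun _ => e_mem _)
    fun _ h => altSum_mapAtom φ h

/-- The action of isomorphisms on Orlik--Solomon algebras, as a linear map. -/
noncomputable def map (φ : L ≃o M) : OS M →ₗ[ℚ] OS L := (mapHom φ).lin

theorem map_e (φ : L ≃o M) (a : At M) : map φ (e a) = e (mapAtom φ a) :=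
  homOfGenerators_e _ _ _ a

theorem map_monomial (φ : L ≃o M) (l : List (At M)) :
    map φ (monomial l) = monomial (l.map (mapAtom φ)) := by
  refine (homOfGenerators_monomial (A := cdga L) (fun _ => rfl) (fun _ => e_mem _)
    (fun _ h => altSum_mapAtom φ h) l).trans ?_
  rw [monomial, List.map_map]
  rfl

section Coproduct

variable {F : L}

open scoped Classical in
/-- An atom below `F`, as an atom of `[⊥, F]`. -/
noncomputable def toLower (hF : F ≠ ⊥) (a : At L) : Option (At (L.lower F hF)) :=
  if h : a.1 ≤ F then some (lowerAtom hF a h) else none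

open scoped Classical in
/-- An atom not below `F`, as an atom of `[F, ⊤]`. -/
noncomputable def toUpper (hF : F ≠ ⊤) (a : At L) : Option (At (L.upper F hF)) :=
  if h : a.1 ≤ F then none else some (upperAtom hF a h)

theorem toLower_of_le (hF : F ≠ ⊥) {a : At L} (h : a.1 ≤ F) :
    toLower hF a = some (lowerAtom hF a h) := dif_pos h

theorem toLower_of_not_le (hF : F ≠ ⊥) {a : At L} (h : ¬ a.1 ≤ F) : toLower hF a = none := dif_neg h

theorem toUpper_of_le (hF : F ≠ ⊤) {a : At L} (h : a.1 ≤ F) : toUpper hF a = none := dif_pos h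

theorem toUpper_of_not_le (hF : F ≠ ⊤) {a : At L} (h : ¬ a.1 ≤ F) :
    toUpper hF a = some (upperAtom hF a h) := dif_neg h

theorem isSplitting (hF : Proper F) :
    IsSplitting (fun a : At L => a.1 ≤ F) (toLower hF.1) (toUpper hF.2) where
  pos _ h := ⟨⟨_, toLower_of_le hF.1 h⟩, toUpper_of_le hF.2 h⟩
  neg _ h := ⟨toLower_of_not_le hF.1 h, ⟨_, toUpper_of_not_le hF.2 h⟩⟩

/-- The letters below F span at most F ∧ ⋁ l, and the others span at most F ∨ ⋁ l in [F, ⊤];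
submodularity concludes. As the lengths of the two parts add up, a dependent word has a dependent
part. -/
theorem rk_lsup_split (hF : Proper F) (l : List (At L)) :
    rk (lsup (l.filterMap (toLower hF.1))) + rk (lsup (l.filterMap (toUpper hF.2))) ≤
      rk (lsup l) := by
  have hl : ∀ a ∈ l, a.1 ≤ lsup l := lsup_le_iff.1 le_rfl
  have h1 : lsup (l.filterMap (toLower hF.1)) ≤ (⟨F ⊓ lsup l, inf_le_left⟩ : Set.Iic F) := by
    refine lsup_le_iff.2 fun a ha => ?_
    obtain ⟨b, hb, e⟩ := List.mem_filterMap.1 ha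
    by_cases h : b.1 ≤ F
    · rw [toLower_of_le hF.1 h] at e
      cases e
      exact le_inf h (hl b hb)
    · rw [toLower_of_not_le hF.1 h] at e
      cases e
  have h2 : lsup (l.filterMap (toUpper hF.2)) ≤ (⟨F ⊔ lsup l, le_sup_left⟩ : Set.Ici F) := by
    refine lsup_le_iff.2 fun a ha => ?_
    obtain ⟨b, hb, e⟩ := List.mem_filterMap.1 ha
    by_cases h : b.1 ≤ F
    · rw [toUpper_of_le hF.2 h] at e
      cases e
    · rw [toUpper_of_not_le hF.2 h] at e
      cases e
      exact sup_le_sup_left (hl b hb) F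
  have h3 := (rk_lower hF.1 _).symm.trans_le (rk_mono (L := L.lower F hF.1) h1)
  have h4 := (rk_upper hF.2 _).symm.trans_le (rk_mono (L := L.upper F hF.2) h2)
  have h5 := rk_lower hF.1 (⟨F ⊓ lsup l, inf_le_left⟩ : Set.Iic F)
  have h6 := rk_upper hF.2 (⟨F ⊔ lsup l, le_sup_left⟩ : Set.Ici F)
  have h7 := rk_inf_add_rk_sup_le F (lsup l)
  have h8 := rk_mono (L := L.lower F hF.1) h1
  have h9 := rk_mono (L := L.upper F hF.2) h2
  have h8' := h8.trans_eq h5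
  have h9' := h9.trans_eq h6
  have e1 : rk (Subtype.val (p := (· ∈ Set.Iic F)) (⟨F ⊓ lsup l, inf_le_left⟩ : Set.Iic F)) =
    rk (F ⊓ lsup l) := rfl
  linarith

/-- The pure tensors, as a bilinear map. -/
noncomputable def tm (A B : GeomLat.{u}) : OS A →ₗ[ℚ] OS B →ₗ[ℚ] CDGA.TCarrier (cdga A) (cdga B) :=
  TensorProduct.mk ℚ (OS A) (OS B)

open scoped Classical in
/-- The coproduct of a generator. -/
noncomputable def coprodGen (hF : Proper F) (a : At L) :
    (cdga (L.lower F hF.1)).tensor (cdga (L.upper F hF.2)) :=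
  if h : a.1 ≤ F then tm _ _ (e (lowerAtom hF.1 a h)) 1 else tm _ _ 1 (e (upperAtom hF.2 a h))

theorem coprodGen_of_le (hF : Proper F) {a : At L} (h : a.1 ≤ F) :
    coprodGen hF a = tm _ _ (e (lowerAtom hF.1 a h)) 1 := dif_pos h

theorem coprodGen_of_not_le (hF : Proper F) {a : At L} (h : ¬ a.1 ≤ F) :
    coprodGen hF a = tm _ _ 1 (e (upperAtom hF.2 a h)) := dif_neg h

theorem coprodGen_mem (hF : Proper F) (a : At L) :
    coprodGen hF a ∈ CDGA.tGr (cdga (L.lower F hF.1)) (cdga (L.upper F hF.2)) 1 := by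
  by_cases h : a.1 ≤ F
  · rw [coprodGen_of_le hF h]
    exact CDGA.tm_mem_tGr _ _ (i := 1) (j := 0) (e_mem _) (monomial_mem []) rfl
  · rw [coprodGen_of_not_le hF h]
    exact CDGA.tm_mem_tGr _ _ (i := 0) (j := 1) (monomial_mem []) (e_mem _) rfl

/-- The coproduct of a monomial. -/
noncomputable def coterm (hF : Proper F) (l : List (At L)) :
    CDGA.TCarrier (cdga (L.lower F hF.1)) (cdga (L.upper F hF.2)) :=
  shuffleSign (fun a => a.1 ≤ F) l •
    tm _ _ (monomial (l.filterMap (toLower hF.1))) (monomial (l.filterMap (toUpper hF.2)))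

theorem mul_zsmul_tensor {A B : CDGA.{u}} (n : ℤ) (x y : CDGA.TCarrier A B) :
    x * (n • y) = n • (x * y) := by
  rw [← Int.cast_smul_eq_zsmul ℚ, CDGA.t_mul_smul, Int.cast_smul_eq_zsmul]

/-- The shuffle sign arises as a Koszul sign: each letter not below F is moved past the letters
below F which stand behind it. -/
theorem prod_coprodGen (hF : Proper F) (l : List (At L)) :
    (l.map (coprodGen hF)).prod = coterm hF l := by
  induction l with
  | nil =>
    rw [coterm]
    exact (one_smul ℤ _).symm
  | cons a l ih =>
    rw [List.map_cons, List.prod_cons, ih, coterm, coterm]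
    refine (mul_zsmul_tensor _ _ _).trans ?_
    by_cases h : a.1 ≤ F
    · rw [coprodGen_of_le hF h, shuffleSign_cons_of_pos (p := fun a : At L => a.1 ≤ F) h,
        List.filterMap_cons_some (toLower_of_le hF.1 h),
        List.filterMap_cons_none (toUpper_of_le hF.2 h), monomial_cons]
      refine congrArg _ ((CDGA.tm_mul_tm _ _ (j := 0) (k := ((l.filterMap (toLower hF.1)).length : ℤ))
        _ _ (monomial_mem []) (monomial_mem _)).trans ?_)
      rw [zero_mul, Int.negOnePow_zero, one_smul]
      exact congrArg (tm _ _ _) (one_mul _)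
    · rw [coprodGen_of_not_le hF h, (isSplitting hF).shuffleSign_cons_of_neg h,
        List.filterMap_cons_none (toLower_of_not_le hF.1 h),
        List.filterMap_cons_some (toUpper_of_not_le hF.2 h), monomial_cons]
      refine (congrArg _ (CDGA.tm_mul_tm _ _ (j := 1)
        (k := ((l.filterMap (toLower hF.1)).length : ℤ)) _ _ (e_mem _) (monomial_mem _))).trans ?_
      rw [one_mul, negOnePow_smul, smul_smul, mul_comm]
      exact congrArg (fun y => _ • y) (congrArg (fun x => tm _ _ x _) (one_mul _))

/-- With l' and l'' the parts of l below and not below F, the image of δ e_l is, up to signs, the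
sum of δ e_l' ⊗ e_l'' and e_l' ⊗ δ e_l''. By `rk_lsup_split` one part is dependent; its monomial and
its boundary both vanish, which kills both summands. -/
theorem altSum_coprodGen (hF : Proper F) {l : List (At L)} (h : rk (lsup l) < l.length) :
    altSum l (fun _ l' => (l'.map (coprodGen hF)).prod) = 0 := by
  let X : List (At (L.lower F hF.1)) → List (At (L.upper F hF.2)) →
    CDGA.TCarrier (cdga (L.lower F hF.1)) (cdga (L.upper F hF.2)) := fun l l' =>
      tm _ _ (monomial l) (monomial l')
  have hl := (isSplitting hF).altSum_left l fun _ l₁ l₂ => X l₁ l₂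
  have hr := (isSplitting hF).altSum_right l fun _ l₁ l₂ => X l₁ l₂
  have e1 : altSum (l.filterMap (toLower hF.1)) (fun _ l₁ => X l₁ (l.filterMap (toUpper hF.2))) =
      tm _ _ (bd (l.filterMap (toLower hF.1))) (monomial (l.filterMap (toUpper hF.2))) :=
    altSum_hom ((tm (L.lower F hF.1) (L.upper F hF.2)).flip
      (monomial (l.filterMap (toUpper hF.2)))).toAddMonoidHom _ fun _ l₁ => monomial l₁
  have e2 : altSum (l.filterMap (toUpper hF.2)) (fun _ l₂ => X (l.filterMap (toLower hF.1)) l₂) =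
      tm _ _ (monomial (l.filterMap (toLower hF.1))) (bd (l.filterMap (toUpper hF.2))) :=
    altSum_hom (tm (L.lower F hF.1) (L.upper F hF.2)
      (monomial (l.filterMap (toLower hF.1)))).toAddMonoidHom _ fun _ l₂ => monomial l₂
  rw [e1] at hl
  rw [e2] at hr
  have hsum : altSum l (fun _ l' => (l'.map (coprodGen hF)).prod) =
      altSum l (fun a l' => (toLower hF.1 a).elim 0 fun _ => shuffleSign (fun a => a.1 ≤ F) l' •
        X (l'.filterMap (toLower hF.1)) (l'.filterMap (toUpper hF.2))) +
      altSum l (fun a l' => (toUpper hF.2 a).elim 0 fun _ => shuffleSign (fun a => a.1 ≤ F) l' •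
        X (l'.filterMap (toLower hF.1)) (l'.filterMap (toUpper hF.2))) := by
    refine Eq.trans (altSum_congr fun a l' _ => ?_) (altSum_add _ _ _)
    refine (prod_coprodGen hF l').trans ?_
    by_cases ha : a.1 ≤ F
    · rw [toLower_of_le hF.1 ha, toUpper_of_le hF.2 ha]
      exact (add_zero _).symm
    · rw [toLower_of_not_le hF.1 ha, toUpper_of_not_le hF.2 ha]
      exact (zero_add _).symm
  refine hsum.trans ?_
  rw [← hl, ← hr]
  have h1 := rk_lsup_split hF l
  have h2 := (isSplitting hF).length_add l
  by_cases h3 : rk (lsup (l.filterMap (toLower hF.1))) < (l.filterMap (toLower hF.1)).length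
  · rw [(dependent h3).1, (dependent h3).2, map_zero, LinearMap.zero_apply, LinearMap.zero_apply,
      smul_zero, smul_zero, add_zero]
    rfl
  · have h4 : rk (lsup (l.filterMap (toUpper hF.2))) < (l.filterMap (toUpper hF.2)).length := by
      omega
    rw [(dependent h4).1, (dependent h4).2, map_zero, map_zero, smul_zero, smul_zero, add_zero]
    rfl

theorem tensor_d (A B : GeomLat.{u}) (x : (cdga A).tensor (cdga B)) :
    ((cdga A).tensor (cdga B)).d x = 0 := by
  refine CDGA.t_induction (cdga A) (cdga B) (p := fun x => CDGA.tD (cdga A) (cdga B) x = 0)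
    (map_zero _) (fun x y hx hy => ?_) (fun i j a b ha hb => ?_) x
  · rw [map_add, hx, hy, add_zero]
  · rw [CDGA.tD_tm _ _ ha]
    have h1 : CDGA.tm ((cdga A).d a) b = 0 := TensorProduct.zero_tmul (OS A) (b : OS B)
    have h2 : CDGA.tm a ((cdga B).d b) = 0 := TensorProduct.tmul_zero (OS B) (a : OS A)
    rw [h1, h2, smul_zero, add_zero]

/-- The coproduct of the Orlik--Solomon algebra. -/
noncomputable def coprodHom (hF : Proper F) :
    CDGA.Hom (cdga L) ((cdga (L.lower F hF.1)).tensor (cdga (L.upper F hF.2))) :=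
  homOfGenerators _ (tensor_d _ _) (coprodGen hF) (coprodGen_mem hF) fun _ h => altSum_coprodGen hF h

/-- The coproduct of the Orlik--Solomon algebra, as a linear map. -/
noncomputable def coprod (hF : Proper F) :
    OS L →ₗ[ℚ] OS (L.lower F hF.1) ⊗[ℚ] OS (L.upper F hF.2) := (coprodHom hF).lin

theorem coprod_e (hF : Proper F) (a : At L) : coprod hF (e a) = coprodGen hF a :=
  homOfGenerators_e _ _ _ a

theorem coprod_monomial (hF : Proper F) (l : List (At L)) :
    coprod hF (monomial l) = shuffleSign (fun a => a.1 ≤ F) l •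
      (monomial (l.filterMap (toLower hF.1)) ⊗ₜ[ℚ] monomial (l.filterMap (toUpper hF.2))) :=
  (homOfGenerators_monomial (tensor_d _ _) (coprodGen_mem hF) (fun _ h => altSum_coprodGen hF h)
    l).trans (prod_coprodGen hF l)

theorem coprod_natural (φ : L ≃o M) {F : L} (hF : Proper F) :
    coprod hF ∘ₗ map φ = TensorProduct.map (map (lowerIso φ hF.1 (hF.map φ).1))
      (map (upperIso φ hF.2 (hF.map φ).2)) ∘ₗ coprod (hF.map φ) := by
  refine hom_ext fun l => ?_
  rw [LinearMap.comp_apply, LinearMap.comp_apply, map_monomial, coprod_monomial, coprod_monomial,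
    map_zsmul, TensorProduct.map_tmul, map_monomial, map_monomial]
  have e0 : ∀ a : At M, (mapAtom φ a).1 ≤ F ↔ a.1 ≤ φ F := fun a => φ.symm_apply_le
  have e1 : (l.map (mapAtom φ)).filterMap (toLower hF.1) =
      (l.filterMap (toLower (hF.map φ).1)).map (mapAtom (lowerIso φ hF.1 (hF.map φ).1)) := by
    rw [List.filterMap_map, List.map_filterMap]
    refine List.filterMap_congr fun a _ => ?_
    rw [Function.comp_apply]
    by_cases h : a.1 ≤ φ F
    · rw [toLower_of_le _ h, toLower_of_le _ ((e0 a).2 h)]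
      rfl
    · rw [toLower_of_not_le _ h, toLower_of_not_le _ fun h' => h ((e0 a).1 h')]
      rfl
  have e2 : (l.map (mapAtom φ)).filterMap (toUpper hF.2) =
      (l.filterMap (toUpper (hF.map φ).2)).map (mapAtom (upperIso φ hF.2 (hF.map φ).2)) := by
    rw [List.filterMap_map, List.map_filterMap]
    refine List.filterMap_congr fun a _ => ?_
    rw [Function.comp_apply]
    by_cases h : a.1 ≤ φ F
    · rw [toUpper_of_le _ h, toUpper_of_le _ ((e0 a).2 h)]
      rfl
    · rw [toUpper_of_not_le _ h, toUpper_of_not_le _ fun h' => h ((e0 a).1 h')]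
      refine congrArg some (Subtype.ext (Subtype.ext ?_))
      change F ⊔ φ.symm a.1 = φ.symm (φ F ⊔ a.1)
      rw [φ.symm.map_sup, φ.symm_apply_apply]
  rw [e1, e2, shuffleSign_map, shuffleSign_congr fun a _ => e0 a]

end Coproduct

/-! ### Coassociativity for Orlik–Solomon algebras. -/

section Coassoc

section Tensor

variable {W X Y A B A' B' : CDGA.{u}}

/-- The composition of `Δ` and `δ ⊗ id`, followed by `f ⊗ g ⊗ id`. -/
noncomputable def coassocLeft (Δ : W →ₗ[ℚ] X.tensor Y) (δ : X →ₗ[ℚ] A.tensor B)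
    (f : A →ₗ[ℚ] A') (g : B →ₗ[ℚ] B') : W →ₗ[ℚ] A'.tensor (B'.tensor Y) :=
  CDGA.tmap f (CDGA.tmap g LinearMap.id) ∘ₗ (CDGA.tassoc A B Y).toLinearMap ∘ₗ
    CDGA.tmap δ LinearMap.id ∘ₗ Δ

/-- The composition of `Δ` and `id ⊗ δ`, followed by `id ⊗ id ⊗ g`. -/
noncomputable def coassocRight (Δ : W →ₗ[ℚ] Y.tensor X) (δ : X →ₗ[ℚ] A.tensor B)
    (g : B →ₗ[ℚ] B') : W →ₗ[ℚ] Y.tensor (A.tensor B') :=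
  CDGA.tmap LinearMap.id (CDGA.tmap LinearMap.id g) ∘ₗ CDGA.tmap LinearMap.id δ ∘ₗ Δ

theorem coassocLeft_eq {Δ : W →ₗ[ℚ] X.tensor Y} {δ : X →ₗ[ℚ] A.tensor B} (f : A →ₗ[ℚ] A')
    (g : B →ₗ[ℚ] B') {w : W} {x : X} {y : Y} {a : A} {b : B} {m n : ℤ}
    (hw : Δ w = m • CDGA.tmul x y) (h : δ x = n • CDGA.tmul a b) :
    coassocLeft Δ δ f g w = (m * n) • CDGA.tmul (f a) (CDGA.tmul (g b) y) := by
  have e : CDGA.tmul (n • CDGA.tmul a b) y = n • CDGA.tmul (CDGA.tmul a b) y :=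
    map_zsmul ((TensorProduct.mk ℚ (A.tensor B) Y).flip y) n (CDGA.tmul a b)
  have e1 : CDGA.tmap δ LinearMap.id (CDGA.tmul x y) = n • CDGA.tmul (CDGA.tmul a b) y := by
    rw [← e, ← h]
    rfl
  rw [coassocLeft, LinearMap.comp_apply, LinearMap.comp_apply, LinearMap.comp_apply, hw, map_zsmul,
    e1, map_zsmul, map_zsmul, map_zsmul, map_zsmul, smul_smul]
  rfl

theorem coassocRight_eq {Δ : W →ₗ[ℚ] Y.tensor X} {δ : X →ₗ[ℚ] A.tensor B}
    (g : B →ₗ[ℚ] B') {w : W} {x : X} {y : Y} {a : A} {b : B} {m n : ℤ}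
    (hw : Δ w = m • CDGA.tmul y x) (h : δ x = n • CDGA.tmul a b) :
    coassocRight Δ δ g w = (m * n) • CDGA.tmul y (CDGA.tmul a (g b)) := by
  have e : CDGA.tmul y (n • CDGA.tmul a b) = n • CDGA.tmul y (CDGA.tmul a b) :=
    map_zsmul (TensorProduct.mk ℚ Y (A.tensor B) y) n (CDGA.tmul a b)
  have e1 : CDGA.tmap LinearMap.id δ (CDGA.tmul y x) = n • CDGA.tmul y (CDGA.tmul a b) := by
    rw [← e, ← h]
    rfl
  rw [coassocRight, LinearMap.comp_apply, LinearMap.comp_apply, hw, map_zsmul,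
    e1, map_zsmul, map_zsmul, smul_smul]
  rfl

end Tensor

variable {F₁ F₂ : L} (h₁ : Proper F₁) (h₂ : Proper F₂) (h : F₁ < F₂)

theorem toLower_toLower (l : List (At L)) :
    ((l.filterMap (toLower h₂.1)).filterMap (toLower (proper_inLower h₁ h₂ h).1)).map
      (mapAtom (lowerLowerIso h₁ h₂ h)) = l.filterMap (toLower h₁.1) := by
  rw [List.filterMap_filterMap, List.map_filterMap]
  refine List.filterMap_congr fun a _ => ?_
  by_cases ha : a.1 ≤ F₂
  · rw [toLower_of_le _ ha, Option.bind_some]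
    by_cases ha' : a.1 ≤ F₁
    · rw [toLower_of_le _ ha',
        toLower_of_le (a := lowerAtom h₂.1 a ha) (proper_inLower h₁ h₂ h).1 ha']
      rfl
    · rw [toLower_of_not_le _ ha',
        toLower_of_not_le (a := lowerAtom h₂.1 a ha) (proper_inLower h₁ h₂ h).1 ha']
      rfl
  · rw [toLower_of_not_le _ ha, toLower_of_not_le _ fun h' => ha (h'.trans h.le)]
    rfl

theorem toUpper_toLower (l : List (At L)) :
    ((l.filterMap (toLower h₂.1)).filterMap (toUpper (proper_inLower h₁ h₂ h).2)).map
      (mapAtom (middleIso h₁ h₂ h)) =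
        (l.filterMap (toUpper h₁.2)).filterMap (toLower (proper_inUpper h₁ h₂ h).1) := by
  rw [List.filterMap_filterMap, List.filterMap_filterMap, List.map_filterMap]
  refine List.filterMap_congr fun a _ => ?_
  by_cases ha' : a.1 ≤ F₁
  · have ha : a.1 ≤ F₂ := ha'.trans h.le
    rw [toLower_of_le _ ha, toUpper_of_le _ ha', Option.bind_some, Option.bind_none,
      toUpper_of_le (a := lowerAtom h₂.1 a ha) (proper_inLower h₁ h₂ h).2 ha']
    rfl
  · rw [toUpper_of_not_le _ ha', Option.bind_some]
    by_cases ha : a.1 ≤ F₂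
    · rw [toLower_of_le _ ha, Option.bind_some,
        toUpper_of_not_le (a := lowerAtom h₂.1 a ha) (proper_inLower h₁ h₂ h).2 ha',
        toLower_of_le (a := upperAtom h₁.2 a ha') (proper_inUpper h₁ h₂ h).1
          (show F₁ ⊔ a.1 ≤ F₂ from sup_le h.le ha)]
      rfl
    · rw [toLower_of_not_le _ ha,
        toLower_of_not_le (a := upperAtom h₁.2 a ha') (proper_inUpper h₁ h₂ h).1
          fun h' => ha (le_sup_right.trans (show F₁ ⊔ a.1 ≤ F₂ from h'))]
      rfl

theorem toUpper_toUpper (l : List (At L)) :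
    ((l.filterMap (toUpper h₁.2)).filterMap (toUpper (proper_inUpper h₁ h₂ h).2)).map
      (mapAtom (upperUpperIso h₁ h₂ h)) = l.filterMap (toUpper h₂.2) := by
  rw [List.filterMap_filterMap, List.map_filterMap]
  refine List.filterMap_congr fun a _ => ?_
  by_cases ha' : a.1 ≤ F₁
  · rw [toUpper_of_le _ ha', toUpper_of_le _ (ha'.trans h.le)]
    rfl
  · rw [toUpper_of_not_le _ ha', Option.bind_some]
    by_cases ha : a.1 ≤ F₂
    · rw [toUpper_of_le _ ha, toUpper_of_le (a := upperAtom h₁.2 a ha') (proper_inUpper h₁ h₂ h).2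
          (show F₁ ⊔ a.1 ≤ F₂ from sup_le h.le ha)]
      rfl
    · rw [toUpper_of_not_le _ ha,
        toUpper_of_not_le (a := upperAtom h₁.2 a ha') (proper_inUpper h₁ h₂ h).2
          fun h' => ha (le_sup_right.trans (show F₁ ⊔ a.1 ≤ F₂ from h'))]
      refine congrArg some (Subtype.ext (Subtype.ext ?_))
      change F₂ ⊔ (F₁ ⊔ a.1) = F₂ ⊔ a.1
      rw [← sup_assoc, sup_eq_left.2 h.le]

/-- On a monomial each side is a single signed pure tensor, made of the letters below F₁, those
below F₂ but not F₁, and those not below F₂. -/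
theorem coprod_coassoc :
    coassocLeft (coprodHom h₂).lin (coprodHom (proper_inLower h₁ h₂ h)).lin
      (mapHom (lowerLowerIso h₁ h₂ h)).lin (mapHom (middleIso h₁ h₂ h)).lin =
    coassocRight (coprodHom h₁).lin (coprodHom (proper_inUpper h₁ h₂ h)).lin
      (mapHom (upperUpperIso h₁ h₂ h)).lin := by
  refine hom_ext fun l => ?_
  have e1 := coassocLeft_eq (mapHom (lowerLowerIso h₁ h₂ h)).lin (mapHom (middleIso h₁ h₂ h)).lin
    (Δ := (coprodHom h₂).lin) (δ := (coprodHom (proper_inLower h₁ h₂ h)).lin)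
    (coprod_monomial h₂ l)
    (coprod_monomial (proper_inLower h₁ h₂ h) (l.filterMap (toLower h₂.1)))
  have e2 := coassocRight_eq (mapHom (upperUpperIso h₁ h₂ h)).lin
    (Δ := (coprodHom h₁).lin) (δ := (coprodHom (proper_inUpper h₁ h₂ h)).lin)
    (coprod_monomial h₁ l)
    (coprod_monomial (proper_inUpper h₁ h₂ h) (l.filterMap (toUpper h₁.2)))
  refine e1.trans (Eq.trans ?_ e2.symm)
  have e3 := (map_monomial (lowerLowerIso h₁ h₂ h) _).trans
    (congrArg monomial (toLower_toLower h₁ h₂ h l))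
  have e4 := (map_monomial (middleIso h₁ h₂ h) _).trans
    (congrArg monomial (toUpper_toLower h₁ h₂ h l))
  have e5 := (map_monomial (upperUpperIso h₁ h₂ h) _).trans
    (congrArg monomial (toUpper_toUpper h₁ h₂ h l))
  refine (congrArg₂ (fun x y => (_ : ℤ) • CDGA.tmul x (CDGA.tmul y _)) e3 e4).trans (Eq.trans ?_
    (congrArg (fun x => (_ : ℤ) • CDGA.tmul _ (CDGA.tmul _ x)) e5).symm)
  refine congrArg (fun n : ℤ => n • _) ?_
  exact shuffleSign_coassoc (fun _ ha => ha.trans h.le)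
    (fun a ha => ⟨_, toLower_of_le h₂.1 ha, Iff.rfl⟩) (fun _ ha => toLower_of_not_le h₂.1 ha)
    (fun a ha => ⟨_, toUpper_of_not_le h₁.2 ha, fun h' => le_sup_right.trans
      (show F₁ ⊔ a.1 ≤ F₂ from h'), fun h' => show F₁ ⊔ a.1 ≤ F₂ from sup_le h.le h'⟩)
    (fun _ ha => toUpper_of_le h₁.2 ha) l

end Coassoc

/-- The cooperad of Orlik--Solomon algebras. -/
noncomputable def cooperad : GLCooperad.{u, u} where
  obj := cdga
  map := mapHom
  map_refl L x := by
    have e : map (OrderIso.refl L) = LinearMap.id := hom_ext fun l => by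
      rw [map_monomial]
      exact congrArg monomial (List.map_id l)
    exact LinearMap.congr_fun e x
  map_trans φ ψ x := by
    have e : map (φ.trans ψ) = map φ ∘ₗ map ψ := hom_ext fun l => by
      rw [LinearMap.comp_apply, map_monomial, map_monomial, map_monomial, List.map_map]
      rfl
    exact LinearMap.congr_fun e x
  Δ _ _ hF := coprodHom hF
  Δ_natural φ _ hF x := LinearMap.congr_fun (coprod_natural φ hF) x
  coassoc _ _ _ h₁ h₂ h x := LinearMap.congr_fun (coprod_coassoc h₁ h₂ h) x

theorem isOSCooperad : IsOSCooperad cooperad fun _ => AlgEquiv.refl where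
  gr_eq _ _ := rfl
  d_eq _ _ := rfl
  map_eq _ _ φ H := map_e φ H
  Δ_of_le _ _ hF H h := (coprod_e hF H).trans (coprodGen_of_le hF h)
  Δ_of_not_le _ _ hF H h := (coprod_e hF H).trans (coprodGen_of_not_le hF h)

end OS

/-! ### The cooperad of modular diagrams -/

namespace MD

/-- The coproduct of `MD`, as a morphism of cdgas. -/
noncomputable def coprodHom {L : GeomLat.{u}} {F : L} (hF : Proper F) :
    CDGA.Hom (cdga L) ((cdga (L.lower F hF.1)).tensor (cdga (L.upper F hF.2))) where
  toAlgHom := AlgHom.ofLinearMap (coprod hF) (coprod_one hF) (coprod_mul hF)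
  map_gr _ _ h := coprod_mem hF h
  map_d x := coprod_d hF x

/-- The cooperad of modular diagrams. -/
noncomputable def cooperad : GLCooperad.{u, u + 1} where
  obj := cdga
  map := mapHom
  map_refl L x := by
    have e : map (OrderIso.refl L) = LinearMap.id := hom_ext fun Γ => map_mk _ Γ
    exact LinearMap.congr_fun e x
  map_trans φ ψ x := by
    have e : map (φ.trans ψ) = map φ ∘ₗ map ψ := hom_ext fun Γ => by
      rw [LinearMap.comp_apply, map_mk, map_mk, map_mk]
      rfl
    exact LinearMap.congr_fun e x
  Δ _ _ hF := coprodHom hF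
  Δ_natural φ _ hF x := coprod_natural φ hF x
  coassoc _ _ _ h₁ h₂ h x := LinearMap.congr_fun (Diag.coprod_coassoc h₁ h₂ h) x

theorem isMDCooperad : IsMDCooperad cooperad fun _ => LinearEquiv.refl ℚ _ where
  gr_eq _ _ := rfl
  one_eq _ := one_def
  exists_pushout _ Γ₁ Γ₂ := ⟨Diag.push Γ₁ Γ₂, Diag.isPushout_push Γ₁ Γ₂⟩
  mul_eq _ _ _ _ h := mk_mul_mk_of_isPushout h
  d_eq _ Γ h := d_mk_of_nodup Γ h
  map_eq _ _ φ Γ := map_mk φ Γ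
  Δ_eq _ F hF Γ := by
    refine (coprod_mk hF Γ).trans (Eq.trans ?_ (finsum_eq_sum_of_fintype _).symm)
    exact Finset.sum_congr rfl fun x _ => Γ.coterm_J hF x

end MD

/-! ### The morphism from the modular diagrams to the Orlik--Solomon algebras -/

section Arnold

variable {α R : Type*} [Ring R]

open scoped Classical in
/-- The alternating sum of the products `∏ g H K` over the letters `H` satisfying `p`. -/
noncomputable def arnoldSum (p : α → Prop) (g : α → α → R) (l : List α) : R :=
  altSum l fun H l' => if p H then (l'.map (g H)).prod else 0

theorem isAlt_arnoldSum {p : α → Prop} {g : α → α → R}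
    (h : ∀ a b c, g a b * g a c = -(g a c * g a b)) : IsAlt (arnoldSum p g) := by
  refine isAlt_altSum fun H => ?_
  by_cases hH : p H
  · simp only [if_pos hH]
    exact OS.isAlt_prod (h H)
  · simp only [if_neg hH]
    exact fun _ _ _ _ => neg_zero.symm

/-- The relation `harn` extracts the factor g a b from the term of every letter c of l; the terms of
a and b already contain it, by symmetry of g. -/
theorem arnoldSum_cons_cons {p : α → Prop} {g : α → α → R} {a b : α} (ha : p a) (hb : p b)
    (l : List α) (hsymm : ∀ a b, g a b = g b a)
    (harn : ∀ c, p c → g c a * g c b = g a b * (g c b - g c a)) :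
    arnoldSum p g (a :: b :: l) = g a b * (arnoldSum p g (a :: l) - arnoldSum p g (b :: l)) := by
  classical
  have e1 : altSum l (fun c l' => if p c then ((a :: b :: l').map (g c)).prod else 0) =
      g a b * (altSum l (fun c l' => if p c then ((b :: l').map (g c)).prod else 0) -
        altSum l fun c l' => if p c then ((a :: l').map (g c)).prod else 0) := by
    rw [sub_eq_add_neg, ← altSum_neg, ← altSum_add]
    refine Eq.trans ?_ (altSum_hom (AddMonoidHom.mulLeft (g a b)) l _)
    refine altSum_congr fun c l' _ => ?_
    rw [AddMonoidHom.coe_mulLeft]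
    by_cases hc : p c
    · rw [if_pos hc, if_pos hc, if_pos hc, List.map_cons, List.map_cons, List.prod_cons,
        List.prod_cons, ← mul_assoc, harn c hc, List.map_cons, List.prod_cons, ← sub_eq_add_neg,
        ← sub_mul, mul_assoc]
    · rw [if_neg hc, if_neg hc, if_neg hc, neg_zero, add_zero, mul_zero]
  rw [arnoldSum, arnoldSum, arnoldSum]
  simp only [altSum]
  rw [e1, if_pos ha, if_pos hb, if_pos ha, if_pos hb, List.map_cons, List.prod_cons, List.map_cons,
    List.prod_cons, hsymm b a]
  noncomm_ring

/-- Factor out g a b. If l contains another letter satisfying p, each of the two remaining sums has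
two such letters and vanishes by induction. Otherwise each sum reduces to its first term, a product
over letters satisfying q, where a and b give the same value. -/
theorem arnoldSum_eq_zero {p q : α → Prop} {g : α → α → R} (hpq : ∀ a, q a → ¬ p a)
    (h : ∀ a b c, g a b * g a c = -(g a c * g a b)) (hsymm : ∀ a b, g a b = g b a)
    (hq : ∀ a b c, p a → p b → q c → g a c = g b c)
    (harn : ∀ a b c, p a → p b → p c → g c a * g c b = g a b * (g c b - g c a)) (n : ℕ) :
    ∀ (a b : α) (l : List α), l.length = n → p a → p b → (∀ c ∈ l, p c ∨ q c) →
      arnoldSum p g (a :: b :: l) = 0 := by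
  classical
  induction n using Nat.strong_induction_on with
  | _ n ih =>
  intro a b l hn ha hb hl
  rw [arnoldSum_cons_cons ha hb l hsymm fun c hc => harn a b c ha hb hc]
  by_cases hc : ∃ c ∈ l, p c
  · obtain ⟨c, hcl, hc⟩ := hc
    have hp := List.perm_cons_erase hcl
    have hlt : (l.erase c).length < n := by
      rw [← hn, hp.length_eq, List.length_cons]
      exact Nat.lt_succ_self _
    have key : ∀ a, p a → arnoldSum p g (a :: l) = 0 := fun a ha =>
      (isAlt_arnoldSum h).perm_eq_zero (hp.cons a) (ih _ hlt a c _ rfl ha hc fun x hx =>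
        hl x (List.mem_of_mem_erase hx))
    rw [key a ha, key b hb, sub_zero, mul_zero]
  · have hl' : ∀ c ∈ l, q c := fun c hcl => (hl c hcl).resolve_left fun h' => hc ⟨c, hcl, h'⟩
    have key : ∀ a, p a → arnoldSum p g (a :: l) = (l.map (g a)).prod := fun a ha => by
      rw [arnoldSum, altSum, if_pos ha, altSum_eq_zero, sub_zero]
      exact fun c l' hp => if_neg (hpq c (hl' c (hp.subset List.mem_cons_self)))
    rw [key a ha, key b hb, List.map_congr_left fun c hcl => hq a b c ha hb (hl' c hcl), sub_self,
      mul_zero]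

end Arnold

namespace OS

variable {L : GeomLat.{u}}

open scoped Classical in
/-- The generator `e_x` if `x` is an atom, and `0` otherwise. -/
noncomputable def gen (x : L) : OS L := if h : IsAtom x then e ⟨x, h⟩ else 0

theorem gen_of_isAtom {x : L} (h : IsAtom x) : gen x = e ⟨x, h⟩ := dif_pos h

theorem gen_of_not_isAtom {x : L} (h : ¬ IsAtom x) : gen x = 0 := dif_neg h

theorem gen_mul_self (x : L) : gen x * gen x = 0 := by
  by_cases h : IsAtom x
  · rw [gen_of_isAtom h, e_mul_self]
  · rw [gen_of_not_isAtom h, zero_mul]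

theorem gen_mul_gen (x y : L) : gen x * gen y = -(gen y * gen x) := by
  by_cases hx : IsAtom x
  · by_cases hy : IsAtom y
    · rw [gen_of_isAtom hx, gen_of_isAtom hy, e_mul_e]
    · rw [gen_of_not_isAtom hy, zero_mul, mul_zero, neg_zero]
  · rw [gen_of_not_isAtom hx, zero_mul, mul_zero, neg_zero]

/-- Three atoms in a flat of rank at most 2 form a dependent word, and the identity is δ (e_x e_y
e_z) = 0. -/
theorem gen_arnold {x y z w : L} (hx : IsAtom x) (hy : IsAtom y) (hz : IsAtom z) (hxw : x ≤ w)
    (hyw : y ≤ w) (hzw : z ≤ w) (hw : rk w ≤ 2) :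
    gen y * gen z = gen x * (gen z - gen y) := by
  have h := (dependent (l := [⟨x, hx⟩, ⟨y, hy⟩, ⟨z, hz⟩]) (by
    have h1 : lsup [⟨x, hx⟩, ⟨y, hy⟩, ⟨z, hz⟩] ≤ w := lsup_le_iff.2 (by
      intro a ha
      simp only [List.mem_cons, List.not_mem_nil, or_false] at ha
      rcases ha with rfl | rfl | rfl
      · exact hxw
      · exact hyw
      · exact hzw)
    have h2 := rk_mono h1
    simp only [List.length_cons, List.length_nil]
    omega)).2
  simp only [bd_cons, monomial_cons, monomial_nil, mul_one] at h
  have h0 : bd ([] : List (At L)) = 0 := rfl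
  rw [h0, mul_zero, sub_zero, mul_one] at h
  rw [gen_of_isAtom hx, gen_of_isAtom hy, gen_of_isAtom hz]
  exact sub_eq_zero.1 h

end OS

namespace Diag

variable {L M : GeomLat.{u}}

open scoped Classical in
/-- The product of the elements `e_{ι⁻¹(H)}` over the letters `H` of a word if `F_ι = ⊤`, and `0`
otherwise. -/
noncomputable def integrand (Γ : Diag L) (l : List Γ.E) : OS L :=
  if Γ.top = ⊤ then (l.map fun H => OS.gen (Γ.trace H)).prod else 0

theorem integrand_of_top (Γ : Diag L) (h : Γ.top = ⊤) (l : List Γ.E) :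
    Γ.integrand l = (l.map fun H => OS.gen (Γ.trace H)).prod := if_pos h

theorem integrand_of_ne_top (Γ : Diag L) (h : Γ.top ≠ ⊤) (l : List Γ.E) : Γ.integrand l = 0 :=
  if_neg h

theorem integrand_map_ι (Γ : Diag L) (h : Γ.top = ⊤) (l : List (OS.At L)) :
    Γ.integrand (l.map fun a => Γ.ι a.1) = OS.monomial l := by
  rw [integrand_of_top Γ h, List.map_map]
  refine congrArg List.prod (List.map_congr_left fun a _ => ?_)
  rw [Function.comp_apply, trace_ι, OS.gen_of_isAtom a.2]

theorem isAlt_integrand (Γ : Diag L) : IsAlt Γ.integrand := by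
  intro l₁ l₂ a b
  by_cases h : Γ.top = ⊤
  · rw [integrand_of_top Γ h, integrand_of_top Γ h]
    exact OS.isAlt_prod (fun H K => OS.gen_mul_gen _ _) l₁ l₂ a b
  · rw [integrand_of_ne_top Γ h, integrand_of_ne_top Γ h, neg_zero]

/-- When F_ι = ⊤ the hypotheses of the last three relations are contradictory, so only alternation
and embeddings require an argument. -/
theorem isInvariant_integrand : IsInvariant fun Γ : Diag L => Γ.integrand Γ.J where
  swap Γ := isAlt_onWords Γ.isAlt_integrand fun _ _ => rfl
  embedding Γ Γ' φ hφ htop hι hJ := by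
    have ht : Γ'.top = ⊤ ↔ Γ.top = ⊤ := by rw [map_top hι, ← htop, hφ.injective.eq_iff]
    by_cases h : Γ.top = ⊤
    · rw [integrand_of_top Γ h, integrand_of_top Γ' (ht.2 h), hJ, List.map_map]
      refine congrArg List.prod (List.map_congr_left fun H _ => ?_)
      rw [Function.comp_apply, trace_map hφ hι]
    · rw [integrand_of_ne_top Γ h, integrand_of_ne_top Γ' fun h' => h (ht.1 h')]
  not_spanning Γ X hX htop _ := Γ.integrand_of_ne_top (fun h => hX.not_ge (h ▸ htop)) _
  product Γ a b h _ hb htop := Γ.integrand_of_ne_top (fun e => hb (by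
    have ha : a = ⊤ := top_le_iff.1 (e ▸ htop)
    have h1 := h.left ⊥ b bot_le le_rfl
    rw [ha, inf_top_eq, bot_sup_eq] at h1
    exact le_bot_iff.1 h1)) _
  two_outside Γ F A _ _ _ htop hA _ _ _ :=
    Γ.integrand_of_ne_top (fun e => hA (le_top.trans (e ▸ htop))) _

theorem exists_word (Γ : Diag L) (h : Γ.top = ⊤) :
    ∃ l : List (OS.At L), Γ.J = l.map fun a => Γ.ι a.1 := by
  have h1 : Γ.J ∈ Set.range (List.map fun a : OS.At L => Γ.ι a.1) := by
    rw [Set.range_list_map]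
    intro H hH
    have e : Γ.ι (Γ.trace H) = H := Γ.ι_trace_of_le (h ▸ le_top)
    exact ⟨⟨Γ.trace H, Γ.emb.isAtom_iff.1 (e.symm ▸ Γ.atoms H hH)⟩, e⟩
  obtain ⟨l, hl⟩ := h1
  exact ⟨l, hl.symm⟩

theorem integrand_of_not_atom (Γ : Diag L) {l : List Γ.E} {H : Γ.E} (h : H ∈ l)
    (hH : ¬ IsAtom H) : Γ.integrand l = 0 := by
  by_cases ht : Γ.top = ⊤
  · rw [integrand_of_top Γ ht]
    refine List.prod_eq_zero (List.mem_map.2 ⟨H, h, OS.gen_of_not_isAtom fun h' => hH ?_⟩)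
    have e : Γ.ι (Γ.trace H) = H := Γ.ι_trace_of_le (ht ▸ le_top)
    exact e ▸ Γ.emb.map_atom _ h'
  · exact Γ.integrand_of_ne_top ht l

end Diag

namespace MD

open Diag

variable {L M : GeomLat.{u}}

/-- The map `MD L → OS L` sending `(E, ι, J)` to `e_{ι⁻¹(J)}` if `ι` is an isomorphism, and to `0`
otherwise. -/
noncomputable def integral (L : GeomLat.{u}) : MD L →ₗ[ℚ] OS L := lift _ isInvariant_integrand

theorem integral_mk (Γ : Diag L) : integral L (mk Γ) = Γ.integrand Γ.J := lift_mk _ _ _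

theorem integral_mk_of_top (Γ : Diag L) (h : Γ.top = ⊤) {l : List (OS.At L)}
    (hl : Γ.J = l.map fun a => Γ.ι a.1) : integral L (mk Γ) = OS.monomial l := by
  rw [integral_mk, hl, integrand_map_ι Γ h]

theorem integral_mk_of_ne_top (Γ : Diag L) (h : Γ.top ≠ ⊤) : integral L (mk Γ) = 0 :=
  (integral_mk Γ).trans (Γ.integrand_of_ne_top h _)

theorem integral_wd (Γ : Diag L) (l : List Γ.E) : integral L (Γ.wd l) = Γ.integrand l := by
  by_cases h : ∀ H ∈ l, IsAtom H
  · rw [wd_of_atoms Γ h, integral_mk]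
    rfl
  · push Not at h
    obtain ⟨H, hl, hH⟩ := h
    rw [wd_of_not_atom Γ hl hH, map_zero, Γ.integrand_of_not_atom hl hH]

theorem integral_one : integral L 1 = 1 := by
  rw [one_def]
  exact integral_mk_of_top (ofWord []) rfl (l := []) rfl

theorem integral_mul (x y : MD L) : integral L (x * y) = integral L x * integral L y := by
  induction x using MD.induction with
  | h0 => rw [zero_mul, map_zero, zero_mul]
  | hadd x x' h h' => rw [add_mul, map_add, h, h', map_add, add_mul]
  | hsmul c x h => rw [smul_mul_assoc, map_smul, h, map_smul, smul_mul_assoc]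
  | hmk Γ₁ =>
    induction y using MD.induction with
    | h0 => rw [mul_zero, map_zero, mul_zero]
    | hadd y y' h h' => rw [mul_add, map_add, h, h', map_add, mul_add]
    | hsmul c y h => rw [mul_smul_comm, map_smul, h, map_smul, mul_smul_comm]
    | hmk Γ₂ =>
      have ht : (push Γ₁ Γ₂).top = ⊤ ↔ Γ₁.top = ⊤ ∧ Γ₂.top = ⊤ :=
        ⟨fun h => ⟨congrArg (fun x : PushCarrier Γ₁ Γ₂ => x.1.1) h,
          congrArg (fun x : PushCarrier Γ₁ Γ₂ => x.1.2) h⟩,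
          fun h => PushCarrier.ext h.1 h.2⟩
      rw [mk_mul_mk]
      by_cases h : Γ₁.top = ⊤ ∧ Γ₂.top = ⊤
      · obtain ⟨l₁, hl₁⟩ := Γ₁.exists_word h.1
        obtain ⟨l₂, hl₂⟩ := Γ₂.exists_word h.2
        rw [integral_mk_of_top Γ₁ h.1 hl₁, integral_mk_of_top Γ₂ h.2 hl₂, ← OS.monomial_append]
        refine integral_mk_of_top (push Γ₁ Γ₂) (ht.2 h) ?_
        rw [List.map_append]
        change Γ₁.J.map (PushCarrier.inl Γ₁ Γ₂) ++ Γ₂.J.map (PushCarrier.inr Γ₁ Γ₂) = _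
        rw [hl₁, hl₂, List.map_map, List.map_map]
        refine congrArg₂ (fun l l' => l ++ l') (List.map_congr_left fun K _ => ?_)
          (List.map_congr_left fun K _ => ?_)
        · exact PushCarrier.ext rfl (congrArg Γ₂.ι (Γ₁.trace_ι K.1))
        · exact PushCarrier.ext (congrArg Γ₁.ι (Γ₂.trace_ι K.1)) rfl
      · rw [integral_mk_of_ne_top (push Γ₁ Γ₂) fun h' => h (ht.1 h')]
        by_cases h1 : Γ₁.top = ⊤
        · rw [integral_mk_of_ne_top Γ₂ fun h2 => h ⟨h1, h2⟩, mul_zero]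
        · rw [integral_mk_of_ne_top Γ₁ h1, zero_mul]

theorem integral_mem {n : ℤ} {x : MD L} (hx : x ∈ gr L n) : integral L x ∈ OS.gr L n := by
  refine gr_induction (p := fun x => integral L x ∈ OS.gr L n) ?_ ?_ ?_ ?_ hx
  · rw [map_zero]; exact zero_mem _
  · intro x y hx hy; rw [map_add]; exact add_mem hx hy
  · intro c x hx; rw [map_smul]; exact Submodule.smul_mem _ _ hx
  · rintro Γ rfl
    by_cases h : Γ.top = ⊤
    · obtain ⟨l, hl⟩ := Γ.exists_word h
      rw [integral_mk_of_top Γ h hl]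
      have e : Γ.deg' = l.length := by
        change (Γ.J.length : ℤ) - 2 * (rk (⊤ : Γ.E) - rk (⊤ : L)) = _
        rw [← Γ.rk_top, h, hl, List.length_map, sub_self, mul_zero, sub_zero]
      exact e ▸ OS.monomial_mem l
    · rw [integral_mk_of_ne_top Γ h]
      exact zero_mem _

theorem integral_map (φ : L ≃o M) (x : MD M) :
    integral L (map φ x) = OS.map φ (integral M x) := by
  suffices h : integral L ∘ₗ map φ = OS.map φ ∘ₗ integral M from LinearMap.congr_fun h x
  refine hom_ext fun Γ => ?_
  rw [LinearMap.comp_apply, LinearMap.comp_apply, map_mk]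
  by_cases h : Γ.top = ⊤
  · obtain ⟨l, hl⟩ := Γ.exists_word h
    rw [integral_mk_of_top Γ h hl, OS.map_monomial]
    refine integral_mk_of_top (Γ.comp φ) ((comp_top Γ φ).trans h) (hl.trans ?_)
    rw [List.map_map]
    exact List.map_congr_left fun a _ => congrArg Γ.ι (φ.apply_symm_apply a.1).symm
  · rw [integral_mk_of_ne_top Γ h, map_zero]
    exact integral_mk_of_ne_top (Γ.comp φ) fun h' => h ((comp_top Γ φ).symm.trans h')

end MD

/-! ### Vanishing of the integral on boundaries. -/

namespace Diag

variable {L : GeomLat.{u}}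

theorem integral_contr (Γ : Diag L) {H : Γ.E} {l : List Γ.E} (h : Γ.Contractible H l)
    (ht : H ⊔ Γ.top = ⊤) :
    MD.integral L (Γ.contr H l) = (l.map fun K => OS.gen (Γ.trace (H ⊔ K))).prod := by
  have h0 := Γ.trace_of_not_le h.1 h.2.1
  rw [Γ.contr_of_pos h h0, MD.integral_wd]
  have ht' : (Γ.quot H h0).top = ⊤ := Subtype.ext ht
  rw [integrand_of_top _ ht']
  refine congrArg List.prod ?_
  refine (List.map_map (f := up H)).trans (List.map_congr_left fun K _ => ?_)
  exact congrArg OS.gen (Γ.trace_quot (h := h0) (up H K))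

theorem integral_contr_of_ne (Γ : Diag L) {H : Γ.E} {l : List Γ.E} (ht : H ⊔ Γ.top ≠ ⊤) :
    MD.integral L (Γ.contr H l) = 0 := by
  by_cases h : Γ.Contractible H l
  · have h0 := Γ.trace_of_not_le h.1 h.2.1
    rw [Γ.contr_of_pos h h0, MD.integral_wd]
    exact integrand_of_ne_top _ (fun e => ht (congrArg Subtype.val e)) _
  · rw [Γ.contr_of_neg h, map_zero]

theorem sup_top_eq (Γ : Diag L) {x : Γ.E} (h : ¬ x ≤ Γ.top) (ht : Γ.top ⋖ ⊤) : x ⊔ Γ.top = ⊤ :=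
  (ht.eq_or_eq le_sup_right le_top).resolve_left fun e => h (sup_eq_right.1 e)

theorem rk_trace_of_not_le (Γ : Diag L) {x : Γ.E} (h : ¬ x ≤ Γ.top) (ht : Γ.top ⋖ ⊤) :
    rk (Γ.trace x) = rk x - 1 := by
  have h1 := Γ.rk_sub_rk_trace x
  rw [Γ.sup_top_eq h ht, rk_covBy ht] at h1
  omega

end Diag

theorem GeomLat.isAtom_of_rk_eq_one {L : GeomLat.{u}} {x : L} (h : rk x = 1) : IsAtom x := by
  refine ⟨fun e => ?_, fun y hy => ?_⟩
  · rw [e, rk_bot] at h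
    exact absurd h (by decide)
  · have h1 := rk_lt hy
    have h2 := rk_nonneg y
    exact (eq_of_le_of_rk_le bot_le (by rw [rk_bot]; omega)).symm

namespace Diag

variable {L : GeomLat.{u}}

/-- The line a ∨ b is not contained in the modular hyperplane F_ι, hence meets it in a flat of rank
1. -/
theorem isAtom_trace_sup (Γ : Diag L) (ht : Γ.top ⋖ ⊤) {a b : Γ.E} (ha : IsAtom a) (hb : IsAtom b)
    (ha' : ¬ a ≤ Γ.top) (hab : a ≠ b) : IsAtom (Γ.trace (a ⊔ b)) := by
  refine isAtom_of_rk_eq_one ?_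
  have h1 : ¬ b ≤ a := fun h => hab ((ha.le_iff.1 h).resolve_left hb.1).symm
  rw [Γ.rk_trace_of_not_le (fun h => ha' (le_sup_left.trans h)) ht, rk_covBy (covBy_sup_atom hb h1),
    rk_atom ha]
  rfl

theorem gen_trace_self (Γ : Diag L) {a : Γ.E} (ha : IsAtom a) (ha' : ¬ a ≤ Γ.top) :
    OS.gen (Γ.trace (a ⊔ a)) = 0 := by
  rw [sup_idem, Γ.trace_of_not_le ha ha']
  exact OS.gen_of_not_isAtom fun h => h.1 rfl

/-- For distinct letters the three traces are atoms below the trace of a ∨ b ∨ c, whose rank is at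
most 2 because F_ι is a modular hyperplane. If letters coincide, the convention that `OS.gen` is 0
at ⊥ and the vanishing of squares give the identity. -/
theorem gen_trace_arnold (Γ : Diag L) (ht : Γ.top ⋖ ⊤) {a b c : Γ.E} (ha : IsAtom a)
    (hb : IsAtom b) (hc : IsAtom c) (ha' : ¬ a ≤ Γ.top) (hb' : ¬ b ≤ Γ.top) (hc' : ¬ c ≤ Γ.top) :
    OS.gen (Γ.trace (c ⊔ a)) * OS.gen (Γ.trace (c ⊔ b)) =
      OS.gen (Γ.trace (a ⊔ b)) * (OS.gen (Γ.trace (c ⊔ b)) - OS.gen (Γ.trace (c ⊔ a))) := by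
  by_cases hca : c = a
  · subst hca
    rw [Γ.gen_trace_self hc hc', zero_mul, sub_zero, OS.gen_mul_self]
  by_cases hcb : c = b
  · subst hcb
    rw [Γ.gen_trace_self hc hc', mul_zero, zero_sub, mul_neg, sup_comm a c, OS.gen_mul_self,
      neg_zero]
  by_cases hab : a = b
  · subst hab
    rw [Γ.gen_trace_self ha ha', zero_mul, OS.gen_mul_self]
  refine OS.gen_arnold (w := Γ.trace (a ⊔ b ⊔ c)) (Γ.isAtom_trace_sup ht ha hb ha' hab)
    (Γ.isAtom_trace_sup ht hc ha hc' hca) (Γ.isAtom_trace_sup ht hc hb hc' hcb)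
    (Γ.trace_mono le_sup_left) (Γ.trace_mono (sup_le le_sup_right (le_sup_left.trans le_sup_left)))
    (Γ.trace_mono (sup_le le_sup_right (le_sup_right.trans le_sup_left))) ?_
  rw [Γ.rk_trace_of_not_le (fun h => hc' (le_sup_right.trans h)) ht]
  have h1 := rk_sup_atom_le (a ⊔ b) hc
  have h2 := rk_sup_atom_le a hb
  have h3 := rk_atom ha
  omega

theorem contractible_iff_exists (Γ : Diag L) (ht : Γ.top ⋖ ⊤) {H : Γ.E} (hH : IsAtom H)
    (hH' : ¬ H ≤ Γ.top) (l : List Γ.E) : Γ.Contractible H l ↔ ∃ K ∈ l, ¬ K ≤ Γ.top := by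
  refine ⟨fun h => ?_, fun ⟨K, hK, hK'⟩ => ⟨hH, hH', fun F hF hl => ?_⟩⟩
  · by_contra hc
    push Not at hc
    exact hH' (h.2.2 _ le_rfl hc)
  · rcases ht.eq_or_eq hF le_top with e | e
    · exact absurd (e ▸ hl K hK) hK'
    · exact e ▸ le_top

/-- A contraction can have F_ι = ⊤ only if F_ι is a hyperplane. Then a letter H outside F_ι is
contractible exactly when another outer letter remains, and its contraction integrates to the
product of the generators at the traces of H ∨ K. For outer K these satisfy the Arnold relations,
and for K ≤ F_ι the trace of H ∨ K does not depend on H, so `arnoldSum_eq_zero` applies. With at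
most one outer letter nothing is contractible. -/
theorem integral_altSum_contr (Γ : Diag L) :
    MD.integral L (altSum Γ.J Γ.contr) = 0 := by
  classical
  refine (altSum_hom (MD.integral L).toAddMonoidHom Γ.J Γ.contr).symm.trans ?_
  by_cases ht : Γ.top ⋖ ⊤
  swap
  · refine altSum_eq_zero fun H l hp => ?_
    change MD.integral L _ = 0
    have hH := Γ.atoms H (hp.subset List.mem_cons_self)
    by_cases hH' : H ≤ Γ.top
    · rw [Γ.contr_of_neg fun h => h.2.1 hH', map_zero]
    · refine Γ.integral_contr_of_ne fun e => ht ?_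
      rw [← e, sup_comm]
      exact covBy_sup_atom hH hH'
  by_cases h2 : ∃ a b l, Γ.J.Perm (a :: b :: l) ∧ ¬ a ≤ Γ.top ∧ ¬ b ≤ Γ.top
  · obtain ⟨a, b, l, hp, ha, hb⟩ := h2
    have e : altSum Γ.J (fun H l => (MD.integral L).toAddMonoidHom (Γ.contr H l)) =
        arnoldSum (fun H => IsAtom H ∧ ¬ H ≤ Γ.top) (fun H K => OS.gen (Γ.trace (H ⊔ K))) Γ.J := by
      refine altSum_congr fun H l' hp' => ?_
      change MD.integral L _ = _
      have hH := Γ.atoms H (hp'.subset List.mem_cons_self)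
      by_cases hH' : H ≤ Γ.top
      · rw [Γ.contr_of_neg fun h => h.2.1 hH', map_zero, if_neg fun h => h.2 hH']
      · rw [if_pos ⟨hH, hH'⟩]
        refine Γ.integral_contr ((Γ.contractible_iff_exists ht hH hH' l').2 ?_)
          (Γ.sup_top_eq hH' ht)
        by_contra hc
        push Not at hc
        have hp'' := hp'.trans hp
        by_cases haH : a = H
        · subst haH
          exact hb (hc b ((List.perm_cons a).1 hp'' |>.symm.subset List.mem_cons_self))
        · exact ha (hc a ((List.mem_cons.1 (hp''.symm.subset List.mem_cons_self)).resolve_left haH))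
    have hat : ∀ c ∈ a :: b :: l, IsAtom c := fun c hc => Γ.atoms c (hp.symm.subset hc)
    rw [e]
    refine (isAlt_arnoldSum fun x y z => OS.gen_mul_gen _ _).perm_eq_zero hp ?_
    refine arnoldSum_eq_zero (p := fun H => IsAtom H ∧ ¬ H ≤ Γ.top) (q := fun H => H ≤ Γ.top)
      (g := fun H K => OS.gen (Γ.trace (H ⊔ K))) (fun x hx h => h.2 hx)
      (fun x y z => OS.gen_mul_gen _ _) (fun x y => by rw [sup_comm]) (fun x y z hx hy hz => ?_)
      (fun x y z hx hy hz => Γ.gen_trace_arnold ht hx.1 hy.1 hz.1 hx.2 hy.2 hz.2) _ a b l rfl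
      ⟨hat a List.mem_cons_self, ha⟩ ⟨hat b (List.mem_cons_of_mem _ List.mem_cons_self), hb⟩
      fun c hc => ?_
    · have key : ∀ x : Γ.E, IsAtom x → ¬ x ≤ Γ.top → Γ.trace (x ⊔ z) = Γ.trace z := by
        intro x hx hx'
        rw [← Γ.ι_trace_of_le hz, trace_sup_ι, Γ.trace_of_not_le hx hx', bot_sup_eq, trace_ι]
      rw [key x hx.1 hx.2, key y hy.1 hy.2]
    · by_cases hc' : c ≤ Γ.top
      · exact Or.inr hc'
      · exact Or.inl ⟨hat c (List.mem_cons_of_mem _ (List.mem_cons_of_mem _ hc)), hc'⟩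
  · refine altSum_eq_zero fun H l hp => ?_
    refine (congrArg (MD.integral L) (Γ.contr_of_neg fun h => ?_)).trans (map_zero _)
    obtain ⟨K, hK, hK'⟩ := (Γ.contractible_iff_exists ht h.1 h.2.1 l).1 h
    exact h2 ⟨H, K, l.erase K, hp.symm.trans ((List.perm_cons_erase hK).cons H), h.2.1, hK'⟩

end Diag

/-! ### The morphism of cooperads. -/

namespace MD

open Diag

variable {L : GeomLat.{u}}

theorem integral_d (x : MD L) : integral L (d x) = 0 := by
  suffices h : integral L ∘ₗ d = 0 from LinearMap.congr_fun h x
  refine hom_ext fun Γ => ?_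
  rw [LinearMap.comp_apply, d_mk, Γ.integral_altSum_contr]
  rfl

/-- The map `MD L → OS L`, as a morphism of cdgas. -/
noncomputable def integralHom (L : GeomLat.{u}) : CDGA.Hom (cdga L) (OS.cdga L) where
  toAlgHom := AlgHom.ofLinearMap (integral L) integral_one integral_mul
  map_gr _ _ h := integral_mem h
  map_d x := integral_d x

/-- The tensor product of two integrals. -/
noncomputable def integralTensor (A B : GeomLat.{u}) : T A B →ₗ[ℚ] OS A ⊗[ℚ] OS B :=
  TensorProduct.map (integral A) (integral B)

theorem integralTensor_tm {A B : GeomLat.{u}} (a : MD A) (b : MD B) :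
    integralTensor A B (tm A B a b) = integral A a ⊗ₜ[ℚ] integral B b := rfl

/-- A factor survives integration only if its embedding is an isomorphism. The lower factor forces
F' = ι F, and then the upper one forces F_ι = ⊤; the single remaining term is the coproduct of the
corresponding monomial of L. -/
theorem integral_coprod_mk {F : L} (hF : Proper F) (Γ : Diag L) :
    OS.coprod hF (integral L (mk Γ)) = integralTensor _ _ (coprod hF (mk Γ)) := by
  have h0 : ∀ x : Γ.Fiber F, Γ.top ≠ ⊤ ∨ x.1 ≠ Γ.ι F →
      integralTensor _ _ (Γ.coterm hF x Γ.J) = 0 := by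
    intro x hx
    rw [coterm_J, map_zsmul, integralTensor_tm]
    refine (congrArg (fun y => _ • y) ?_).trans (smul_zero _)
    by_cases hb : x.1 = Γ.ι F
    · have h : (Γ.above hF.2 x.1 x.2).top ≠ ⊤ := by
        intro e
        have e' : x.1 ⊔ Γ.top = ⊤ := congrArg Subtype.val e
        rw [hb, sup_eq_right.2 (Γ.ι_le_top F)] at e'
        exact hx.elim (fun h => h e') fun h => h hb
      rw [integral_mk_of_ne_top _ h]
      exact TensorProduct.tmul_zero _ _
    · have h : (Γ.below hF.1 x.1 x.2).top ≠ ⊤ := fun e => hb (congrArg Subtype.val e).symm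
      rw [integral_mk_of_ne_top _ h]
      exact TensorProduct.zero_tmul _ _
  rw [coprod_mk, map_sum]
  by_cases h : Γ.top = ⊤
  · have hx := Γ.trace_ι F
    obtain ⟨l, hl⟩ := Γ.exists_word h
    rw [Fintype.sum_eq_single (⟨Γ.ι F, hx⟩ : Γ.Fiber F) fun x hne =>
      h0 x (Or.inr fun e => hne (Subtype.ext e)), integral_mk_of_top Γ h hl, OS.coprod_monomial,
      coterm_J, map_zsmul, integralTensor_tm]
    have e1 : integral _ (mk (Γ.below hF.1 (Γ.ι F) hx)) =
        OS.monomial (l.filterMap (OS.toLower hF.1)) := by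
      refine integral_mk_of_top _ rfl ?_
      change Γ.J.filterMap (toLower (Γ.ι F)) = _
      rw [hl, List.filterMap_map, List.map_filterMap]
      refine List.filterMap_congr fun a _ => ?_
      rw [Function.comp_apply]
      by_cases ha : a.1 ≤ F
      · rw [toLower_of_le (Γ.emb.monotone ha), OS.toLower_of_le _ ha]
        rfl
      · rw [toLower_of_not_le fun h' => ha (Γ.emb.le_iff.1 h'), OS.toLower_of_not_le _ ha]
        rfl
    have e2 : integral _ (mk (Γ.above hF.2 (Γ.ι F) hx)) =
        OS.monomial (l.filterMap (OS.toUpper hF.2)) := by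
      refine integral_mk_of_top _ (Subtype.ext (sup_eq_right.2 (Γ.ι_le_top F) |>.trans h)) ?_
      change Γ.J.filterMap (toUpper (Γ.ι F)) = _
      rw [hl, List.filterMap_map, List.map_filterMap]
      refine List.filterMap_congr fun a _ => ?_
      rw [Function.comp_apply]
      by_cases ha : a.1 ≤ F
      · rw [toUpper_of_le (Γ.emb.monotone ha), OS.toUpper_of_le _ ha]
        rfl
      · rw [toUpper_of_not_le fun h' => ha (Γ.emb.le_iff.1 h'), OS.toUpper_of_not_le _ ha]
        refine congrArg some (Subtype.ext ?_)
        change Γ.ι F ⊔ Γ.ι a.1 = Γ.ι F ⊔ Γ.ι (F ⊔ a.1)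
        rw [Γ.emb.map_sup, ← sup_assoc, sup_idem]
    have e3 : shuffleSign (· ≤ Γ.ι F) Γ.J = shuffleSign (fun a => a.1 ≤ F) l := by
      rw [hl, shuffleSign_map]
      exact shuffleSign_congr fun a _ => Γ.emb.le_iff
    rw [← e1, ← e2, ← e3]
  · rw [integral_mk_of_ne_top Γ h, map_zero]
    exact (Finset.sum_eq_zero fun x _ => h0 x (Or.inl h)).symm

/-- The morphism of cooperads from the modular diagrams to the Orlik--Solomon algebras. -/
noncomputable def integralCooperadHom : GLCooperad.Hom cooperad.{u} OS.cooperad.{u} where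
  app := integralHom
  app_map φ x := integral_map φ x
  app_Δ L F hF x := by
    have e : (OS.coprodHom hF).lin ∘ₗ (integralHom L).lin =
        CDGA.tmap (integralHom (L.lower F hF.1)).lin (integralHom (L.upper F hF.2)).lin ∘ₗ
          (coprodHom hF).lin := hom_ext fun Γ => integral_coprod_mk hF Γ
    exact LinearMap.congr_fun e x

theorem isDiagramIntegral : IsDiagramIntegral (C := cooperad.{u}) (D := OS.cooperad.{u})
    (fun _ => LinearEquiv.refl ℚ _) (fun _ => AlgEquiv.refl) integralCooperadHom.app where
  of_top _ Γ _ h hl := integral_mk_of_top Γ h hl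
  of_ne_top _ Γ h := integral_mk_of_ne_top Γ h

end MD


theorem mainTheorem5 :
    ∃ (MDc : GLCooperad.{u, u + 1}) (eMD : ∀ L : GeomLat.{u}, MD L ≃ₗ[ℚ] MDc.obj L)
      (OSc : GLCooperad.{u, u}) (eOS : ∀ L : GeomLat.{u}, OS L ≃ₐ[ℚ] OSc.obj L)
      (I : GLCooperad.Hom MDc OSc),
      IsMDCooperad MDc eMD ∧ IsOSCooperad OSc eOS ∧ IsDiagramIntegral eMD eOS I.app :=
  ⟨MD.cooperad, fun _ => LinearEquiv.refl ℚ _, OS.cooperad, fun _ => AlgEquiv.refl,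
    MD.integralCooperadHom, MD.isMDCooperad, OS.isOSCooperad, MD.isDiagramIntegral⟩
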